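/- Let $X$ be a reduced scheme of finite type over $\mathbb{C}$ and let $L$ be a line bundle on $X$. **Notation.** For a scheme $Y$ over $\mathbb{C}$ and an $\mathcal{O}_Y$-module $M$, let $\mathcal{P}^1_Y(M)$ be the sheaf of one-jets (principal parts) of $M$, i.e. the sheaf associated with $U\mapsto (\mathcal{O}_Y(U)\otimes_{\mathbb{C}}M(U))/I_U^2(\mathcal{O}_Y(U)\otimes_{\mathbb{C}}M(U))$, where $I_U$ is the kernel of the multiplication $\mathcal{O}_Y(U)\otimes_{\mathbb{C}}\mathcal{O}_Y(U)\to\mathcal{O}_Y(U)$; it is an $\mathcal{O}_Y$-module through the left factor, and $p_1\colon M\to\mathcal{P}^1_Y(M)$, $m\mapsto 1\otimes m$, is the one-jet map. For a local Artinian $\mathbb{C}$-algebra $A$ with residue field $\mathbb{C}$, a deformation of $(X,L)$ over $A$ is a flat morphism $\mathcal{X}\to\operatorname{Spec}A$ and a line bundle $\mathcal{L}$ on $\mathcal{X}$, together with an identification of $X$ with the closed fibre of $\mathcal{X}$ and an isomorphism $\mathcal{L}|_X\cong L$. An isomorphism of deformations is an isomorphism of the pairs $(\mathcal{X},\mathcal{L})$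 over $\operatorname{Spec}A$ compatible with these identifications. The functor $\mathrm{Def}_{(X,L)}$ sends $A$ to the set of isomorphism classes of deformations of $(X,L)$ over $A$, and a homomorphism $A\to B$ of $\mathbb{C}$-algebras to base change. Its tangent space is $T=\mathrm{Def}_{(X,L)}(\mathbb{C}[\varepsilon])$, $\varepsilon^2=0$. $\mathrm{Ext}^1_{\mathcal{O}_X}$ is computed in the category of $\mathcal{O}_X$-modules. **Theorem.** 1. For every deformation $(\mathcal{X},\mathcal{L})$ of $(X,L)$ over $\mathbb{C}[\varepsilon]$ the sequence of $\mathcal{O}_X$-modules $$0\to L\xrightarrow{\,j\,}\mathcal{P}^1_{\mathcal{X}}(\mathcal{L})|_X\xrightarrow{\,r\,}\mathcal{P}^1_X(L)\to 0 \qquad(\ast)$$ is exact, where $j(t|_X)=p_1(\varepsilon t)|_X$ and $r(p_1(t)|_X)=p_1(t|_X)$ for local sections $t$ of $\mathcal{L}$, and $\mathcal{P}^1_{\mathcal{X}}(\mathcal{L})$ is formed for $\mathcal{X}$ as a scheme over $\mathbb{C}$. Sending $(\mathcal{X},\mathcal{L})$ to the class of $(\ast)$ defines a bijection $$\Phi\colon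 T\longrightarrow \mathrm{Ext}^1_{\mathcal{O}_X}(\mathcal{P}^1_X(L),L).$$ It is $\mathbb{C}$-linear for the standard vector space structure on the tangent space: multiplication by $c\in\mathbb{C}$ on $T$ is induced by $\varepsilon\mapsto c\varepsilon$; the two projections $\mathbb{C}[\varepsilon_1,\varepsilon_2]/(\varepsilon_1,\varepsilon_2)^2\to\mathbb{C}[\varepsilon]$ induce a bijection $\mathrm{Def}_{(X,L)}(\mathbb{C}[\varepsilon_1,\varepsilon_2]/(\varepsilon_1,\varepsilon_2)^2)\to T\times T$, and addition on $T$ is given by this bijection and the homomorphism $\varepsilon_1,\varepsilon_2\mapsto\varepsilon$. 2. There is a $\mathbb{C}$-linear map $$p\colon \mathrm{Ext}^1_{\mathcal{O}_X}(\mathcal{P}^1_X(L),L)\otimes_{\mathbb{C}}H^0(X,L)\longrightarrow H^1(X,L)$$ such that, for every extension $0\to L\to\mathcal{E}\to\mathcal{P}^1_X(L)\to0$ of $\mathcal{O}_X$-modules with class $\xi$ and every $s\in H^0(X,L)$, one has $p(\xi\otimes s)=\delta(p_1(s))$, where $\delta\colon H^0(X,\mathcal{P}^1_X(L))\to H^1(X,L)$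 is the connecting homomorphism of the extension. For every deformation $(\mathcal{X},\mathcal{L})$ of $(X,L)$ over $\mathbb{C}[\varepsilon]$, with $\xi=\Phi(\mathcal{X},\mathcal{L})$, a section $s\in H^0(X,L)$ is the restriction to $X$ of a global section of $\mathcal{L}$ if and only if $p(\xi\otimes s)=0$. -/

import Mathlib

open CategoryTheory Limits AlgebraicGeometry TopologicalSpace Opposite TensorProduct
noncomputable section
namespace DefPair

/-! ### First-order jets over a ring -/

section Algebra

variable (k S M : Type) [CommRing k] [CommRing S] [Algebra k S] [AddCommGroup M] [Module k M]
  [Module S M] [IsScalarTower k S M]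

/-- The left `S`-submodule `I² · (S ⊗ M)` of `S ⊗[k] M`, where `I` is the kernel of the
multiplication `S ⊗[k] S → S`.  As a left ideal `I` is generated by the elements
`1 ⊗ a - a ⊗ 1`, and the generators below are `(1 ⊗ a - a ⊗ 1) (1 ⊗ b - b ⊗ 1) (1 ⊗ m)`. -/
def jetRel : Submodule S (S ⊗[k] M) :=
  Submodule.span S {x | ∃ (a b : S) (m : M),
    x = (1 : S) ⊗ₜ[k] ((a * b) • m) - a ⊗ₜ[k] (b • m) - b ⊗ₜ[k] (a • m) + (a * b) ⊗ₜ[k] m}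

/-- The module of one-jets `(S ⊗[k] S / I²) ⊗[S] M = (S ⊗[k] M) / I² (S ⊗[k] M)`, with its left
`S`-module structure. -/
abbrev Jet : Type := (S ⊗[k] M) ⧸ jetRel k S M

variable {k S M}

/-- The one-jet of an element. -/
def Jet.p (m : M) : Jet k S M := (jetRel k S M).mkQ ((1 : S) ⊗ₜ[k] m)

/-- First-order differential operators over `k`, for additive maps between modules over
`k`-algebras which are semilinear with respect to a ring homomorphism `ρ`. -/
structure IsDiffOp {T N : Type} [CommRing T] [AddCommGroup N] [Module T N] (k : Type) [CommRing k]
    {S : Type} [CommRing S] [Algebra k S] {M : Type} [AddCommGroup M] [Module S M]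
    (ρ : S →+* T) (D : M →+ N) : Prop where
  const : ∀ (c : k) (m : M), D (algebraMap k S c • m) = ρ (algebraMap k S c) • D m
  leibniz : ∀ (a b : S) (m : M),
    D ((a * b) • m) + ρ (a * b) • D m = ρ a • D (b • m) + ρ b • D (a • m)

variable {T N : Type} [CommRing T] [AddCommGroup N] [Module T N]

/-- The map on one-jets induced by a first-order differential operator. -/
def Jet.lift (ρ : S →+* T) (D : M →+ N) (hD : IsDiffOp k ρ D) : Jet k S M →ₛₗ[ρ] N := by
  letI : Module S N := Module.compHom N ρ
  letI : Module k N := Module.compHom N (algebraMap k S)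
  haveI : IsScalarTower k S N := ⟨fun c s n => by
    rw [Algebra.smul_def, mul_smul]; rfl⟩
  let D' : M →ₗ[k] N := { D with
    map_smul' := fun c m => by
      have := hD.const c m
      rw [algebraMap_smul] at this
      exact this }
  let e : S ⊗[k] M →ₗ[S] N := TensorProduct.AlgebraTensorModule.lift
    ((LinearMap.toSpanSingleton S (M →ₗ[k] N) D'))
  let q : Jet k S M →ₗ[S] N := (jetRel k S M).liftQ e (by
    rw [jetRel, Submodule.span_le]
    rintro _ ⟨a, b, m, rfl⟩
    have h := hD.leibniz a b m
    change e _ = 0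
    rw [map_add, map_sub, map_sub]
    change (1 : S) • D _ - ρ a • D _ - ρ b • D _ + ρ (a * b) • D m = 0
    rw [one_smul, sub_sub, ← h]; abel)
  exact { toFun := q, map_add' := map_add q, map_smul' := fun s x => map_smul q s x }

lemma Jet.lift_p (ρ : S →+* T) (D : M →+ N) (hD : IsDiffOp k ρ D) (m : M) :
    Jet.lift ρ D hD (Jet.p m) = D m := by
  change ρ (1 : S) • D m = D m
  rw [map_one, one_smul]

lemma Jet.addHom_ext {P : Type} [AddCommGroup P] {f g : Jet k S M →+ P}
    (h : ∀ (s : S) (m : M), f (s • Jet.p m) = g (s • Jet.p m)) : f = g := by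
  refine AddMonoidHom.ext fun y => ?_
  obtain ⟨x, rfl⟩ := (jetRel k S M).mkQ_surjective y
  induction x with
  | zero => simp
  | add x y hx hy => rw [map_add, map_add, map_add, hx, hy]
  | tmul s m =>
    have : (jetRel k S M).mkQ (s ⊗ₜ[k] m) = s • Jet.p m := by
      rw [Jet.p, ← map_smul, TensorProduct.smul_tmul', smul_eq_mul, mul_one]
    rw [this, h]

/-- The one-jet map is additive. -/
def Jet.pHom : M →+ Jet k S M where
  toFun := Jet.p
  map_zero' := by simp [Jet.p]
  map_add' x y := by simp [Jet.p, TensorProduct.tmul_add]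

lemma Jet.isDiffOp_pHom : IsDiffOp k (RingHom.id S) (Jet.pHom : M →+ Jet k S M) where
  const c m := by
    change (jetRel k S M).mkQ _ = _ • (jetRel k S M).mkQ _
    rw [RingHom.id_apply, ← map_smul, TensorProduct.smul_tmul', algebraMap_smul,
      TensorProduct.tmul_smul, TensorProduct.smul_tmul', Algebra.smul_def, smul_eq_mul]
  leibniz a b m := by
    change (jetRel k S M).mkQ _ + _ • (jetRel k S M).mkQ _ =
      _ • (jetRel k S M).mkQ _ + _ • (jetRel k S M).mkQ _
    simp only [RingHom.id_apply, ← map_smul, ← map_add, TensorProduct.smul_tmul', smul_eq_mul,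
      mul_one]
    rw [← sub_eq_zero, ← map_sub]
    refine (Submodule.Quotient.mk_eq_zero _).2 (Submodule.subset_span ⟨a, b, m, ?_⟩)
    abel

end Algebra

/-! ### Complex scalars on sections -/

/-- The base point `Spec ℂ`. -/
abbrev SpecC : Scheme.{0} := Spec (CommRingCat.of ℂ)

/-- The ring homomorphism `R → Γ(X, U)` given by a morphism `X ⟶ Spec R`. -/
def structHom {X : Scheme.{0}} {R : CommRingCat.{0}} (f : X ⟶ Spec R) (U : X.Opens) :
    R →+* Γ(X, U) :=
  ((Scheme.ΓSpecIso R).inv ≫ f.appTop ≫ X.presheaf.map (homOfLE (le_top : U ≤ ⊤)).op).hom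

lemma map_structHom {X : Scheme.{0}} {R : CommRingCat.{0}} (f : X ⟶ Spec R) {U V : X.Opens}
    (i : V ⟶ U) (c : R) : X.presheaf.map i.op (structHom f U c) = structHom f V c := by
  have : ((Scheme.ΓSpecIso R).inv ≫ f.appTop ≫ X.presheaf.map (homOfLE (le_top : U ≤ ⊤)).op) ≫
      X.presheaf.map i.op =
      (Scheme.ΓSpecIso R).inv ≫ f.appTop ≫ X.presheaf.map (homOfLE (le_top : V ≤ ⊤)).op := by
    simp only [Category.assoc, ← Functor.map_comp]
    rfl
  exact congr($this c)

lemma app_structHom {X Y : Scheme.{0}} {R : CommRingCat.{0}} (g : Y ⟶ X) (f : X ⟶ Spec R)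
    (U : X.Opens) (c : R) : g.app U (structHom f U c) = structHom (g ≫ f) (g ⁻¹ᵁ U) c := by
  have : ((Scheme.ΓSpecIso R).inv ≫ f.appTop ≫ X.presheaf.map (homOfLE (le_top : U ≤ ⊤)).op) ≫
      g.app U = (Scheme.ΓSpecIso R).inv ≫ (g ≫ f).appTop ≫
        Y.presheaf.map (homOfLE (le_top : g ⁻¹ᵁ U ≤ ⊤)).op := by
    simp only [Category.assoc, Scheme.Hom.comp_appTop, Scheme.Hom.naturality]
    rfl
  exact congr($this c)

lemma structHom_comp_specMap {X : Scheme.{0}} {R S : CommRingCat.{0}} (f : X ⟶ Spec S)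
    (φ : R ⟶ S) (U : X.Opens) (c : R) :
    structHom (f ≫ Spec.map φ) U c = structHom f U (φ c) := by
  have : (Scheme.ΓSpecIso R).inv ≫ (f ≫ Spec.map φ).appTop ≫
      X.presheaf.map (homOfLE (le_top : U ≤ ⊤)).op = φ ≫ (Scheme.ΓSpecIso S).inv ≫ f.appTop ≫
      X.presheaf.map (homOfLE (le_top : U ≤ ⊤)).op := by
    rw [Scheme.Hom.comp_appTop, Scheme.ΓSpecIso_inv_naturality_assoc, Category.assoc]
  exact congr($this c)

section Scalars

variable {X : Scheme.{0}} [X.Over SpecC]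

/-- Sections of the structure sheaf of a scheme over `ℂ` form a `ℂ`-algebra. -/
instance algebraSections (U : X.Opens) : Algebra ℂ Γ(X, U) :=
  (structHom (X ↘ SpecC) U).toAlgebra

lemma map_algebraMap {U V : X.Opens} (i : V ⟶ U) (c : ℂ) :
    X.presheaf.map i.op (algebraMap ℂ Γ(X, U) c) = algebraMap ℂ Γ(X, V) c :=
  map_structHom (X ↘ SpecC) i c

/-- Sections of a sheaf of modules over a scheme over `ℂ` form a complex vector space. -/
instance moduleSections (M : X.Modules) (U : X.Opens) : Module ℂ Γ(M, U) :=
  Module.compHom _ (algebraMap ℂ Γ(X, U))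

instance (M : X.Modules) (U : X.Opens) : IsScalarTower ℂ Γ(X, U) Γ(M, U) :=
  ⟨fun c s m => by rw [Algebra.smul_def, mul_smul]; rfl⟩

/-- A morphism of sheaves of modules from a morphism of abelian sheaves that is linear on
sections. -/
def mkHom {X : Scheme.{0}} {M N : X.Modules} (φ : M.presheaf ⟶ N.presheaf)
    (h : ∀ (U : X.Opens) (r : Γ(X, U)) (x : Γ(M, U)),
      φ.app (op U) (r • x) = r • φ.app (op U) x) : M ⟶ N :=
  ⟨PresheafOfModules.homMk φ fun U => h U.unop⟩

@[simp] lemma mkHom_app {X : Scheme.{0}} {M N : X.Modules} (φ : M.presheaf ⟶ N.presheaf)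
    (h) (U : X.Opens) (x : Γ(M, U)) : (mkHom φ h).app U x = φ.app (op U) x := rfl

/-- The additive map on sections over `U` given by a morphism of abelian presheaves. -/
abbrev secHom {X : Scheme.{0}} {M N : X.Modules} (D : M.presheaf ⟶ N.presheaf) (U : X.Opens) :
    Γ(M, U) →+ Γ(N, U) := (D.app (op U)).hom

/-- A complex number as an endomorphism of a sheaf of modules. -/
def scal (M : X.Modules) : ℂ →+* End M where
  toFun c := mkHom
    { app := fun U => AddCommGrpCat.ofHom (DistribSMul.toAddMonoidHom Γ(M, U.unop) c)
      naturality := fun U V i => by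
        ext x
        refine Eq.trans ?_ (M.map_smul i.unop (algebraMap ℂ Γ(X, U.unop) c) x).symm
        rw [map_algebraMap i.unop]
        rfl }
    (fun U r x => smul_comm c r x)
  map_one' := by
    refine Scheme.Modules.hom_ext (M := M) (N := M) _ _ fun U => ?_
    ext x
    exact one_smul ℂ x
  map_zero' := by
    refine Scheme.Modules.hom_ext (M := M) (N := M) _ _ fun U => ?_
    ext x
    exact zero_smul ℂ x
  map_mul' a b := by
    refine Scheme.Modules.hom_ext (M := M) (N := M) _ _ fun U => ?_
    ext x
    exact mul_smul a b x
  map_add' a b := by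
    refine Scheme.Modules.hom_ext (M := M) (N := M) _ _ fun U => ?_
    ext x
    exact add_smul a b x

lemma scal_app (M : X.Modules) (c : ℂ) (U : X.Opens) (x : Γ(M, U)) :
    Scheme.Modules.Hom.app (M := M) (N := M) (scal M c) U x = c • x := rfl

lemma app_smul_complex {M N : X.Modules} (f : M ⟶ N) (c : ℂ) (U : X.Opens) (x : Γ(M, U)) :
    f.app U (c • x) = c • f.app U x :=
  f.app_smul (algebraMap ℂ Γ(X, U) c) x

lemma scal_comm {M N : X.Modules} (f : M ⟶ N) (c : ℂ) :
    (show M ⟶ M from scal M c) ≫ f = f ≫ (show N ⟶ N from scal N c) := by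
  ext U x
  exact app_smul_complex f c U x

instance moduleHom (M N : X.Modules) : Module ℂ (M ⟶ N) :=
  Module.compHom _ (scal N)

lemma smul_hom_def {M N : X.Modules} (c : ℂ) (f : M ⟶ N) :
    c • f = f ≫ (show N ⟶ N from scal N c) := rfl

/-- Sheaves of modules on a scheme over `ℂ` form a `ℂ`-linear category. -/
instance linearModules : Linear ℂ X.Modules where
  smul_comp M N K c f g := by
    rw [smul_hom_def, smul_hom_def, Category.assoc, Category.assoc, scal_comm]
  comp_smul M N K f c g := by
    rw [smul_hom_def, smul_hom_def, Category.assoc]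

end Scalars

/-! ### The sheaf of one-jets -/

section Jets

variable {X : Scheme.{0}} [X.Over SpecC]

/-- Restriction of one-jets to a smaller open subset. -/
def jetRes (M : X.Modules) {U V : X.Opens} (i : V ⟶ U) :
    Jet ℂ Γ(X, U) Γ(M, U) →ₛₗ[(X.presheaf.map i.op).hom] Jet ℂ Γ(X, V) Γ(M, V) :=
  Jet.lift _ (Jet.pHom.comp (M.presheaf.map i.op).hom)
    { const := fun c m => by
        have h := (Jet.isDiffOp_pHom (k := ℂ) (S := Γ(X, V)) (M := Γ(M, V))).const c
          (M.presheaf.map i.op m)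
        rw [← map_algebraMap i] at h
        refine (congrArg _ (M.map_smul i _ m)).trans h
      leibniz := fun a b m => by
        have h := (Jet.isDiffOp_pHom (k := ℂ) (S := Γ(X, V)) (M := Γ(M, V))).leibniz
          (X.presheaf.map i.op a) (X.presheaf.map i.op b) (M.presheaf.map i.op m)
        have e : ∀ (r : Γ(X, U)), Jet.pHom.comp (M.presheaf.map i.op).hom (r • m) =
          (Jet.pHom (k := ℂ) (S := Γ(X, V)) (M := Γ(M, V)))
            (X.presheaf.map i.op r • M.presheaf.map i.op m) :=
          fun r => congrArg (Jet.pHom (k := ℂ) (S := Γ(X, V)) (M := Γ(M, V))) (M.map_smul i r m)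
        rw [e, e, e, map_mul]
        exact h }

lemma jetRes_p (M : X.Modules) {U V : X.Opens} (i : V ⟶ U) (m : Γ(M, U)) :
    jetRes M i (Jet.p m) = Jet.p (M.presheaf.map i.op m) :=
  Jet.lift_p _ _ _ m

/-- The abelian presheaf `U ↦ (Γ(X, U) ⊗ Γ(M, U)) / I² (Γ(X, U) ⊗ Γ(M, U))`. -/
def jetsAbPresheaf (M : X.Modules) : X.Opensᵒᵖ ⥤ Ab.{0} where
  obj U := AddCommGrpCat.of (Jet ℂ Γ(X, U.unop) Γ(M, U.unop))
  map i := AddCommGrpCat.ofHom (jetRes M i.unop).toAddMonoidHom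
  map_id U := by
    refine AddCommGrpCat.hom_ext (Jet.addHom_ext fun s m => ?_)
    refine (map_smulₛₗ (jetRes M (𝟙 U.unop)) s _).trans ?_
    rw [jetRes_p]
    have h1 : (X.presheaf.map (𝟙 U.unop).op).hom s = s := congr($(X.presheaf.map_id U) s)
    have h2 : M.presheaf.map (𝟙 U.unop).op m = m := congr($(M.presheaf.map_id U) m)
    rw [h1, h2]
    rfl
  map_comp {U V W} i j := by
    refine AddCommGrpCat.hom_ext (Jet.addHom_ext fun s m => ?_)
    refine (map_smulₛₗ (jetRes M (j.unop ≫ i.unop)) s _).trans ?_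
    change _ = jetRes M j.unop (jetRes M i.unop (s • Jet.p m))
    rw [map_smulₛₗ, map_smulₛₗ, jetRes_p, jetRes_p, jetRes_p]
    have h1 : (X.presheaf.map (j.unop ≫ i.unop).op).hom s =
      (X.presheaf.map j.unop.op).hom ((X.presheaf.map i.unop.op).hom s) :=
        congr($(X.presheaf.map_comp i j) s)
    have h2 : M.presheaf.map (j.unop ≫ i.unop).op m =
      M.presheaf.map j.unop.op (M.presheaf.map i.unop.op m) :=
        congr($(M.presheaf.map_comp i j) m)
    rw [h1, h2]

/-- The presheaf of modules `U ↦ (Γ(X, U) ⊗ Γ(M, U)) / I² (Γ(X, U) ⊗ Γ(M, U))`. -/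
def jetsPresheaf (M : X.Modules) : X.PresheafOfModules :=
  letI : ∀ U : X.Opensᵒᵖ, Module (X.ringCatSheaf.obj.obj U) ((jetsAbPresheaf M).obj U) := fun U =>
    inferInstanceAs (Module Γ(X, U.unop) (Jet ℂ Γ(X, U.unop) Γ(M, U.unop)))
  PresheafOfModules.ofPresheaf (R := X.ringCatSheaf.obj) (jetsAbPresheaf M)
    (fun _ _ i r x => map_smulₛₗ (jetRes M i.unop) r x)

/-- The sheaf of one-jets (principal parts) of a sheaf of modules on a scheme over `ℂ`: the
sheaf associated with `U ↦ (Γ(X, U) ⊗ Γ(M, U)) / I² (Γ(X, U) ⊗ Γ(M, U))`, with its left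
module structure. -/
def jets (M : X.Modules) : X.Modules :=
  (PresheafOfModules.sheafification (𝟙 X.ringCatSheaf.obj)).obj (jetsPresheaf M)

/-- The map from the presheaf of one-jets to its associated sheaf. -/
def jetsUnit (M : X.Modules) (U : X.Opens) :
    Jet ℂ Γ(X, U) Γ(M, U) →ₗ[Γ(X, U)] Γ(jets M, U) :=
  letI u := (PresheafOfModules.sheafificationHomEquiv (𝟙 X.ringCatSheaf.obj)
    (P := jetsPresheaf M) (F := jets M)) (𝟙 (jets M))
  { toFun := fun x => u.app (op U) x
    map_add' := fun x y => map_add (u.app (op U)).hom x y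
    map_smul' := fun r x => (u.app (op U)).hom.map_smul r x }

lemma jetsUnit_res (M : X.Modules) {U V : X.Opens} (i : V ⟶ U) (x : Jet ℂ Γ(X, U) Γ(M, U)) :
    (jets M).presheaf.map i.op (jetsUnit M U x) = jetsUnit M V (jetRes M i x) :=
  (PresheafOfModules.naturality_apply
    ((PresheafOfModules.sheafificationHomEquiv (𝟙 X.ringCatSheaf.obj)
      (P := jetsPresheaf M) (F := jets M)) (𝟙 (jets M))) i.op x).symm

/-- The one-jet `p₁(s)` of a section `s` over `U`. -/
def p₁Hom (M : X.Modules) (U : X.Opens) : Γ(M, U) →+ Γ(jets M, U) :=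
  (jetsUnit M U).toAddMonoidHom.comp Jet.pHom

/-- The one-jet map as a morphism of abelian sheaves. -/
def p₁ (M : X.Modules) : M.presheaf ⟶ (jets M).presheaf where
  app U := AddCommGrpCat.ofHom (p₁Hom M U.unop)
  naturality U V i := by
    refine AddCommGrpCat.hom_ext (AddMonoidHom.ext fun (m : Γ(M, U.unop)) => ?_)
    refine Eq.trans ?_ (jetsUnit_res M i.unop (Jet.p m)).symm
    rw [jetRes_p]
    rfl

/-- First-order differential operators between sheaves of modules. -/
def IsDiffOpSheaf {M N : X.Modules} (D : M.presheaf ⟶ N.presheaf) : Prop :=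
  ∀ U : X.Opens, IsDiffOp ℂ (RingHom.id Γ(X, U)) (secHom D U)

lemma isDiffOp_p₁ (M : X.Modules) : IsDiffOpSheaf (p₁ M) := fun U =>
  { const := fun c m => by
      refine (congrArg (jetsUnit M U) (Jet.isDiffOp_pHom.const c m)).trans ?_
      exact map_smul (jetsUnit M U) _ _
    leibniz := fun a b m => by
      have h := congrArg (jetsUnit M U) (Jet.isDiffOp_pHom (k := ℂ).leibniz a b m)
      simp only [map_add, map_smul, RingHom.id_apply] at h
      exact h }

/-- The morphism out of the sheaf of one-jets given by a first-order differential operator. -/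
def jetsDesc {M N : X.Modules} (D : M.presheaf ⟶ N.presheaf) (hD : IsDiffOpSheaf D) :
    jets M ⟶ N :=
  (PresheafOfModules.sheafificationHomEquiv (𝟙 X.ringCatSheaf.obj) (P := jetsPresheaf M)
    (F := N)).symm (PresheafOfModules.homMk
      { app := fun U => AddCommGrpCat.ofHom (Jet.lift _ (secHom D U.unop) (hD _)).toAddMonoidHom
        naturality := fun U V i => by
          refine AddCommGrpCat.hom_ext (Jet.addHom_ext fun s m => ?_)
          change Jet.lift _ (secHom D V.unop) (hD _) (jetRes M i.unop (s • Jet.p m)) =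
            N.presheaf.map i (Jet.lift _ (secHom D U.unop) (hD _) (s • Jet.p m))
          rw [map_smulₛₗ, map_smulₛₗ, map_smulₛₗ, jetRes_p, Jet.lift_p, Jet.lift_p]
          refine Eq.trans ?_ (N.map_smul i.unop s _).symm
          exact congrArg (fun n : Γ(N, V.unop) => (X.presheaf.map i.unop.op).hom s • n)
            (congr($(D.naturality i) m)) }
      (fun U r x => map_smulₛₗ (Jet.lift _ (secHom D U.unop) (hD _)) r x))

lemma jetsDesc_p₁ {M N : X.Modules} (D : M.presheaf ⟶ N.presheaf) (hD : IsDiffOpSheaf D)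
    (U : X.Opens) (m : Γ(M, U)) :
    (jetsDesc D hD).app U ((p₁ M).app (op U) m) = D.app (op U) m := by
  have h := PresheafOfModules.toPresheaf_map_sheafificationHomEquiv_def
    (𝟙 X.ringCatSheaf.obj) (jetsDesc D hD)
  rw [jetsDesc, Equiv.apply_symm_apply] at h
  refine Eq.trans ?_ (Jet.lift_p _ (secHom D U) (hD U) m)
  exact congr($(congr_app h.symm (op U)) (Jet.p m))

lemma jets_hom_ext {M N : X.Modules} {f g : jets M ⟶ N}
    (h : ∀ (U : X.Opens) (m : Γ(M, U)),
      f.app U ((p₁ M).app (op U) m) = g.app U ((p₁ M).app (op U) m)) : f = g := by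
  apply (PresheafOfModules.sheafificationHomEquiv (𝟙 X.ringCatSheaf.obj) (P := jetsPresheaf M)
    (F := N)).injective
  apply (PresheafOfModules.toPresheaf _).map_injective
  refine NatTrans.ext (funext fun U => AddCommGrpCat.hom_ext (Jet.addHom_ext fun s m => ?_))
  change f.app U.unop (jetsUnit M U.unop (s • Jet.p m)) =
    g.app U.unop (jetsUnit M U.unop (s • Jet.p m))
  rw [map_smul, Scheme.Modules.Hom.app_smul, Scheme.Modules.Hom.app_smul]
  exact congrArg (s • ·) (h U.unop m)

end Jets

/-! ### Schemes with a sheaf of modules -/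

lemma map_endo {X : Scheme.{0}} (M : X.Modules) {U : X.Opens} (i : U ⟶ U) (x : Γ(M, U)) :
    M.presheaf.map i.op x = x := by
  obtain rfl : i = 𝟙 U := Subsingleton.elim _ _
  exact congr($(M.presheaf.map_id (op U)) x)

/-- A scheme together with a sheaf of modules on it. -/
structure Pair where
  scheme : Scheme.{0}
  sheaf : scheme.Modules

namespace Pair

/-- A morphism `(Y, M) ⟶ (Z, N)`: a morphism `g : Y ⟶ Z` with an `𝒪_Z`-linear map `N ⟶ g_* M`. -/
structure Hom (P Q : Pair) where
  base : P.scheme ⟶ Q.scheme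
  map : Q.sheaf ⟶ (Scheme.Modules.pushforward base).obj P.sheaf

lemma Hom.ext' {P Q : Pair} {f g : Hom P Q} (h : f.base = g.base)
    (h' : f.map ≫ (Scheme.Modules.pushforwardCongr h).hom.app P.sheaf = g.map) : f = g := by
  obtain ⟨f, φ⟩ := f
  obtain ⟨g, ψ⟩ := g
  obtain rfl : f = g := h
  congr 1
  refine Eq.trans ?_ h'
  ext U x
  exact (map_endo P.sheaf (U := f ⁻¹ᵁ U) (𝟙 _) (φ.app U x)).symm

instance : Category Pair where
  Hom := Hom
  id P := ⟨𝟙 _, (Scheme.Modules.pushforwardId P.scheme).inv.app P.sheaf⟩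
  comp {P Q R} f g := ⟨f.base ≫ g.base, g.map ≫ (Scheme.Modules.pushforward g.base).map f.map ≫
    (Scheme.Modules.pushforwardComp f.base g.base).hom.app P.sheaf⟩
  id_comp {P Q} f := by
    refine Hom.ext' (Category.id_comp _) ?_
    ext U x
    exact map_endo P.sheaf (U := f.base ⁻¹ᵁ U) (𝟙 _) (f.map.app U x)
  comp_id {P Q} f := by
    refine Hom.ext' (Category.comp_id _) ?_
    ext U x
    exact map_endo P.sheaf (U := f.base ⁻¹ᵁ U) (𝟙 _) (f.map.app U x)
  assoc {P Q R S} f g h := by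
    refine Hom.ext' (Category.assoc _ _ _) ?_
    ext U x
    exact map_endo P.sheaf (U := f.base ⁻¹ᵁ g.base ⁻¹ᵁ h.base ⁻¹ᵁ U) (𝟙 _)
      (f.map.app _ (g.map.app _ (h.map.app U x)))

@[simp] lemma id_base (P : Pair) : Hom.base (𝟙 P) = 𝟙 _ := rfl

@[simp] lemma comp_base {P Q R : Pair} (f : P ⟶ Q) (g : Q ⟶ R) :
    (f ≫ g).base = f.base ≫ g.base := rfl

lemma comp_map {P Q R : Pair} (f : P ⟶ Q) (g : Q ⟶ R) :
    (f ≫ g).map = g.map ≫ (Scheme.Modules.pushforward g.base).map f.map ≫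
      (Scheme.Modules.pushforwardComp f.base g.base).hom.app P.sheaf := rfl

/-- A morphism `(Y, M) ⟶ (Z, N)` over `g : Y ⟶ Z` is cartesian if the corresponding morphism
`g^* N ⟶ M` is an isomorphism. -/
def IsCart {P Q : Pair} (f : P ⟶ Q) : Prop :=
  IsIso (((Scheme.Modules.pullbackPushforwardAdjunction f.base).homEquiv _ _).symm f.map)

lemma isCart_iff {P Q : Pair} (f : P ⟶ Q) : IsCart f ↔ ∀ T : P.scheme.Modules,
    Function.Bijective (fun φ : P.sheaf ⟶ T =>
      f.map ≫ (Scheme.Modules.pushforward f.base).map φ) := by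
  rw [IsCart, isIso_iff_coyoneda_map_bijective]
  refine forall_congr' fun T => ?_
  rw [← ((Scheme.Modules.pullbackPushforwardAdjunction f.base).homEquiv _ T).bijective.of_comp_iff']
  refine iff_of_eq (congrArg _ (funext fun φ => ?_))
  simp [Adjunction.homEquiv_naturality_right]

lemma isCart_comp_iff {P Q R : Pair} (f : P ⟶ Q) {g : Q ⟶ R} (hg : IsCart g) :
    IsCart (f ≫ g) ↔ IsCart f := by
  rw [isCart_iff] at hg
  rw [isCart_iff, isCart_iff]
  refine forall_congr' fun T => ?_
  rw [← (hg ((Scheme.Modules.pushforward f.base).obj T)).of_comp_iff']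
  have : Function.Bijective (fun φ : R.sheaf ⟶ (Scheme.Modules.pushforward g.base).obj
      ((Scheme.Modules.pushforward f.base).obj T) =>
      φ ≫ (Scheme.Modules.pushforwardComp f.base g.base).hom.app T) :=
    ((Iso.homToEquiv ((Scheme.Modules.pushforwardComp f.base g.base).app T))).bijective
  rw [← this.of_comp_iff']
  refine iff_of_eq (congrArg _ (funext fun φ => ?_))
  rw [comp_map]
  ext U x
  simp

lemma isCart_id (P : Pair) : IsCart (𝟙 P) := by
  rw [isCart_iff]
  intro T
  have : Function.Bijective (fun φ : P.sheaf ⟶ T =>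
      φ ≫ (Scheme.Modules.pushforwardId P.scheme).inv.app T) :=
    ((Iso.homToEquiv ((Scheme.Modules.pushforwardId P.scheme).symm.app T))).bijective
  refine (iff_of_eq (congrArg _ (funext fun φ => ?_))).1 this
  ext U x
  rfl

lemma exists_lift {P Q R : Pair} {c : P ⟶ Q} (hc : IsCart c) (f : R ⟶ Q)
    (h : R.scheme ⟶ P.scheme) (hh : h ≫ c.base = f.base) :
    ∃ k : R ⟶ P, k.base = h ∧ k ≫ c = f := by
  rw [isCart_iff] at hc
  obtain ⟨φ, hφ⟩ := (hc ((Scheme.Modules.pushforward h).obj R.sheaf)).2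
    (f.map ≫ (Scheme.Modules.pushforwardCongr hh.symm).hom.app _ ≫
      (Scheme.Modules.pushforwardComp h c.base).inv.app _)
  refine ⟨⟨h, φ⟩, rfl, Hom.ext' hh ?_⟩
  rw [comp_map]
  have := congr($hφ ≫ (Scheme.Modules.pushforwardComp h c.base).hom.app R.sheaf ≫
    (Scheme.Modules.pushforwardCongr hh).hom.app R.sheaf)
  simp only [Category.assoc] at this ⊢
  refine this.trans ?_
  ext U x
  simp only [Scheme.Modules.Hom.comp_app]
  refine Eq.trans ?_ (map_endo R.sheaf (U := f.base ⁻¹ᵁ U) (𝟙 _) (f.map.app U x))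
  exact congr($(R.sheaf.presheaf.map_comp (eqToHom (congrArg (· ⁻¹ᵁ U) hh.symm).symm).op
    (eqToHom (congrArg (· ⁻¹ᵁ U) hh).symm).op) (f.map.app U x)).symm

lemma lift_unique {P Q R : Pair} {c : P ⟶ Q} (hc : IsCart c) {k k' : R ⟶ P}
    (hb : k.base = k'.base) (h : k ≫ c = k' ≫ c) : k = k' := by
  rw [isCart_iff] at hc
  obtain ⟨k, φ⟩ := k
  obtain ⟨k', φ'⟩ := k'
  obtain rfl : k = k' := hb
  congr 1
  apply (hc _).1
  have h2 : c.map ≫ (Scheme.Modules.pushforward c.base).map φ ≫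
      (Scheme.Modules.pushforwardComp k c.base).hom.app R.sheaf =
      c.map ≫ (Scheme.Modules.pushforward c.base).map φ' ≫
      (Scheme.Modules.pushforwardComp k c.base).hom.app R.sheaf := by
    change Hom.mk _ _ = Hom.mk _ _ at h
    injection h
  have := congr($h2 ≫ (Scheme.Modules.pushforwardComp k c.base).inv.app R.sheaf)
  simpa using this

/-- The pull-back of a sheaf of modules, with its cartesian morphism to the given pair. -/
def pull {Y : Scheme.{0}} (Q : Pair) (g : Y ⟶ Q.scheme) : Pair :=
  ⟨Y, (Scheme.Modules.pullback g).obj Q.sheaf⟩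

def pullHom {Y : Scheme.{0}} (Q : Pair) (g : Y ⟶ Q.scheme) : Q.pull g ⟶ Q :=
  Hom.mk (P := Q.pull g) g ((Scheme.Modules.pullbackPushforwardAdjunction g).unit.app Q.sheaf)

lemma isCart_pullHom {Y : Scheme.{0}} (Q : Pair) (g : Y ⟶ Q.scheme) : IsCart (Q.pullHom g) := by
  have : ((Scheme.Modules.pullbackPushforwardAdjunction g).homEquiv Q.sheaf _).symm
      ((Scheme.Modules.pullbackPushforwardAdjunction g).unit.app Q.sheaf) = 𝟙 _ := by
    rw [Equiv.symm_apply_eq, Adjunction.homEquiv_id]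
  rw [IsCart]
  exact this ▸ (inferInstance : IsIso (𝟙 ((Scheme.Modules.pullback g).obj Q.sheaf)))

/-- A morphism of pairs over the identity of the underlying scheme. -/
def vert {P : Pair} {T : P.scheme.Modules} (φ : P.sheaf ⟶ T) : Pair.mk P.scheme T ⟶ P :=
  Hom.mk (P := Pair.mk P.scheme T) (𝟙 P.scheme)
    (φ ≫ (Scheme.Modules.pushforwardId P.scheme).inv.app T)

lemma vert_comp {P Q : Pair} {T : P.scheme.Modules} (φ : P.sheaf ⟶ T) (c : P ⟶ Q) :
    vert φ ≫ c = Hom.mk (P := Pair.mk P.scheme T) c.base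
      (c.map ≫ (Scheme.Modules.pushforward c.base).map φ) := by
  refine Hom.ext' (Category.id_comp _) ?_
  ext U x
  exact map_endo T (U := c.base ⁻¹ᵁ U) (𝟙 _) (φ.app _ (c.map.app U x))

lemma vert_injective {P : Pair} {T : P.scheme.Modules} {φ ψ : P.sheaf ⟶ T}
    (h : vert φ = vert ψ) : φ = ψ := by
  have : φ ≫ (Scheme.Modules.pushforwardId P.scheme).inv.app T =
      ψ ≫ (Scheme.Modules.pushforwardId P.scheme).inv.app T := by
    change Hom.mk _ _ = Hom.mk _ _ at h
    injection h
  rwa [cancel_mono] at this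

lemma exists_vert {P : Pair} {T : P.scheme.Modules} (k : Pair.mk P.scheme T ⟶ P)
    (hk : k.base = 𝟙 P.scheme) : ∃ φ : P.sheaf ⟶ T, vert φ = k := by
  obtain ⟨b, m⟩ := k
  obtain rfl : b = 𝟙 P.scheme := hk
  refine ⟨m ≫ (Scheme.Modules.pushforwardId P.scheme).hom.app T, ?_⟩
  refine Hom.ext' rfl ?_
  ext U x
  exact map_endo T (U := U) (𝟙 _) (m.app U x)

lemma isCart_of_isIso {P Q : Pair} (e : P ≅ Q) : IsCart e.hom := by
  rw [isCart_iff]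
  refine fun T => ⟨fun φ ψ h => vert_injective ?_, fun ψ => ?_⟩
  · rw [← cancel_mono e.hom, vert_comp, vert_comp]
    exact congrArg (Hom.mk (P := Pair.mk P.scheme T) e.hom.base) h
  · let f : Pair.mk P.scheme T ⟶ Q := Hom.mk (P := Pair.mk P.scheme T) e.hom.base ψ
    obtain ⟨φ, hφ⟩ := exists_vert (f ≫ e.inv) (congrArg Hom.base e.hom_inv_id)
    refine ⟨φ, ?_⟩
    have h : vert φ ≫ e.hom = f := by rw [hφ, Category.assoc, e.inv_hom_id, Category.comp_id]
    rw [vert_comp] at h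
    change Hom.mk _ _ = Hom.mk _ _ at h
    injection h

end Pair

/-! ### Line bundles -/

/-- The structure sheaf as a sheaf of modules over itself. -/
def structSheaf (X : Scheme.{0}) : X.Modules := SheafOfModules.unit X.ringCatSheaf

/-- A line bundle: a sheaf of modules that is locally isomorphic to the structure sheaf. -/
def IsLineBundle {X : Scheme.{0}} (M : X.Modules) : Prop :=
  ∀ x : X, ∃ U : X.Opens, x ∈ U ∧
    Nonempty (M.restrict U.ι ≅ structSheaf U)

instance {X Y : Scheme.{0}} (g : Y ⟶ X) : (Opens.map g.base).Final where
  out U := by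
    let T : StructuredArrow U (Opens.map g.base) :=
      StructuredArrow.mk (Y := ⊤) (homOfLE le_top)
    have : Nonempty (StructuredArrow U (Opens.map g.base)) := ⟨T⟩
    refine zigzag_isConnected fun j₁ j₂ => ?_
    have e : ∀ j : StructuredArrow U (Opens.map g.base), Nonempty (j ⟶ T) := fun j =>
      ⟨StructuredArrow.homMk (homOfLE le_top) (Subsingleton.elim _ _)⟩
    exact (Zigzag.of_hom (e j₁).some).trans (Zigzag.of_inv (e j₂).some)

lemma isIso_unit {X Y : Scheme.{0}} (g : Y ⟶ X) :
    IsIso (((Scheme.Modules.pullbackPushforwardAdjunction g).homEquiv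
      (structSheaf X) (structSheaf Y)).symm
      (SheafOfModules.unitToPushforwardObjUnit g.toRingCatSheafHom)) := by
  rw [isIso_iff_coyoneda_map_bijective]
  intro M
  rw [← ((Scheme.Modules.pullbackPushforwardAdjunction g).homEquiv _ _).bijective.of_comp_iff']
  refine ((SheafOfModules.unitHomEquiv
    ((SheafOfModules.pushforward g.toRingCatSheafHom).obj M)).bijective.of_comp_iff' _).1 ?_
  refine (iff_of_eq (congrArg _ (funext fun φ => ?_))).1
    ((SheafOfModules.bijective_pushforwardSections g.toRingCatSheafHom M).comp
      (SheafOfModules.unitHomEquiv M).bijective)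
  refine (SheafOfModules.pushforwardSections_unitHomEquiv g.toRingCatSheafHom φ).trans ?_
  refine congrArg (SheafOfModules.unitHomEquiv _) ?_
  refine Eq.trans ?_ ((Scheme.Modules.pullbackPushforwardAdjunction g).homEquiv_naturality_right
    _ _).symm
  exact congrArg (· ≫ (Scheme.Modules.pushforward g).map φ)
    (Equiv.apply_symm_apply ((Scheme.Modules.pullbackPushforwardAdjunction g).homEquiv
      (structSheaf X) (structSheaf Y)) _).symm

/-- The pull-back of the structure sheaf is the structure sheaf. -/
def pullbackUnit {X Y : Scheme.{0}} (g : Y ⟶ X) :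
    (Scheme.Modules.pullback g).obj (structSheaf X) ≅ structSheaf Y :=
  haveI := isIso_unit g
  asIso (((Scheme.Modules.pullbackPushforwardAdjunction g).homEquiv
      (structSheaf X) (structSheaf Y)).symm
      (SheafOfModules.unitToPushforwardObjUnit g.toRingCatSheafHom))

lemma IsLineBundle.pullback {X Y : Scheme.{0}} (g : Y ⟶ X) {M : X.Modules}
    (hM : IsLineBundle M) : IsLineBundle ((Scheme.Modules.pullback g).obj M) := by
  intro y
  obtain ⟨U, hU, ⟨e⟩⟩ := hM (g y)
  refine ⟨g ⁻¹ᵁ U, hU, ⟨?_⟩⟩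
  refine (Scheme.Modules.restrictFunctorIsoPullback (g ⁻¹ᵁ U).ι).app _ ≪≫
    (Scheme.Modules.pullbackComp (g ⁻¹ᵁ U).ι g).app M ≪≫
    (Scheme.Modules.pullbackCongr (morphismRestrict_ι g U).symm).app M ≪≫
    (Scheme.Modules.pullbackComp (g ∣_ U) U.ι).symm.app M ≪≫
    (Scheme.Modules.pullback (g ∣_ U)).mapIso
      (((Scheme.Modules.restrictFunctorIsoPullback U.ι).app M).symm ≪≫ e) ≪≫
    pullbackUnit (g ∣_ U)

/-! ### Artinian algebras -/

/-- Local Artinian `ℂ`-algebras with residue field `ℂ`. -/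
structure ArtAlg where
  carrier : Type
  [commRing : CommRing carrier]
  [algebra : Algebra ℂ carrier]
  [isLocalRing : IsLocalRing carrier]
  [isArtinianRing : IsArtinianRing carrier]
  residue_bijective :
    Function.Bijective (algebraMap ℂ (IsLocalRing.ResidueField carrier))

namespace ArtAlg

attribute [instance] commRing algebra isLocalRing isArtinianRing

instance : Category ArtAlg where
  Hom A B := A.carrier →ₐ[ℂ] B.carrier
  id A := AlgHom.id ℂ A.carrier
  comp f g := AlgHom.comp g f

/-- The underlying commutative ring. -/
abbrev ring (A : ArtAlg) : CommRingCat.{0} := CommRingCat.of A.carrier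

/-- The ring homomorphism underlying a homomorphism of algebras. -/
def ringMap {A B : ArtAlg} (φ : A ⟶ B) : A.ring ⟶ B.ring :=
  CommRingCat.ofHom (AlgHom.toRingHom φ)

/-- The spectrum of a local Artinian algebra. -/
abbrev spec (A : ArtAlg) : Scheme.{0} := Spec A.ring

/-- The morphism of spectra induced by a homomorphism of algebras. -/
def specMap {A B : ArtAlg} (φ : A ⟶ B) : B.spec ⟶ A.spec := Spec.map (ringMap φ)

/-- The structure morphism `Spec A ⟶ Spec ℂ`. -/
def toSpecC (A : ArtAlg) : A.spec ⟶ SpecC :=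
  Spec.map (CommRingCat.ofHom (algebraMap ℂ A.carrier))

/-- The reduction map `A → ℂ` to the residue field. -/
def aug (A : ArtAlg) : A.carrier →ₐ[ℂ] ℂ :=
  (AlgEquiv.ofBijective (Algebra.ofId ℂ (IsLocalRing.ResidueField A.carrier))
    A.residue_bijective).symm.toAlgHom.comp
    (IsScalarTower.toAlgHom ℂ A.carrier (IsLocalRing.ResidueField A.carrier))

/-- The closed point `Spec ℂ ⟶ Spec A`. -/
def point (A : ArtAlg) : SpecC ⟶ A.spec :=
  Spec.map (CommRingCat.ofHom A.aug.toRingHom)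

lemma aug_unique (A : ArtAlg) (ψ : A.carrier →ₐ[ℂ] ℂ) : ψ = A.aug := by
  have key : ∀ (χ : A.carrier →ₐ[ℂ] ℂ) (x : A.carrier), ¬ IsUnit x → χ x = 0 := by
    intro χ x hx
    by_contra h
    have h1 : IsUnit (algebraMap ℂ A.carrier (χ x)) := (IsUnit.mk0 _ h).map _
    have h2 : ¬ IsUnit (algebraMap ℂ A.carrier (χ x) - x) := fun h3 => by
      have := h3.map χ
      simp at this
    have := (IsLocalRing.maximalIdeal A.carrier).add_mem
      ((IsLocalRing.mem_maximalIdeal _).2 h2) ((IsLocalRing.mem_maximalIdeal _).2 hx)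
    rw [sub_add_cancel, IsLocalRing.mem_maximalIdeal] at this
    exact this h1
  ext x
  have hx : ¬ IsUnit (x - algebraMap ℂ A.carrier (A.aug x)) := fun h => by
    have := h.map A.aug
    simp at this
  have := key ψ _ hx
  rw [map_sub, AlgHom.commutes, sub_eq_zero] at this
  exact this

@[simp] lemma specMap_id (A : ArtAlg) : specMap (𝟙 A) = 𝟙 _ := Spec.map_id _

@[simp] lemma specMap_comp {A B C : ArtAlg} (φ : A ⟶ B) (ψ : B ⟶ C) :
    specMap (φ ≫ ψ) = specMap ψ ≫ specMap φ :=
  Spec.map_comp (ringMap φ) (ringMap ψ)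

@[simp] lemma point_specMap {A B : ArtAlg} (φ : A ⟶ B) : B.point ≫ specMap φ = A.point := by
  have h : B.aug.comp φ = A.aug := A.aug_unique _
  have h2 : ringMap φ ≫ CommRingCat.ofHom B.aug.toRingHom = CommRingCat.ofHom A.aug.toRingHom :=
    congrArg (fun x : A.carrier →ₐ[ℂ] ℂ => CommRingCat.ofHom x.toRingHom) h
  exact (Spec.map_comp _ _).symm.trans (congrArg Spec.map h2)

@[simp] lemma point_toSpecC (A : ArtAlg) : A.point ≫ A.toSpecC = 𝟙 _ := by
  have h2 : CommRingCat.ofHom (algebraMap ℂ A.carrier) ≫ CommRingCat.ofHom A.aug.toRingHom =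
      𝟙 (CommRingCat.of ℂ) := by
    ext x
    exact A.aug.commutes x
  exact (Spec.map_comp _ _).symm.trans ((congrArg Spec.map h2).trans (Spec.map_id _))

end ArtAlg

/-! ### Deformations of a pair -/

section Deformations

variable (X : Scheme.{0}) [X.Over SpecC] (L : X.Modules)

/-- A flat deformation `(𝒳, ℒ)` of the pair `(X, L)` over a local Artinian algebra `A`: a flat
morphism `𝒳 ⟶ Spec A` and a line bundle `ℒ` on `𝒳`, with identifications of `X` with the closed
fibre and of `L` with the restriction of `ℒ` to the closed fibre. -/
structure Deformation (A : ArtAlg) where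
  total : Pair
  proj : total.scheme ⟶ A.spec
  flat : Flat proj
  isLineBundle : IsLineBundle total.sheaf
  incl : Pair.mk X L ⟶ total
  isPullback : IsPullback (show X ⟶ total.scheme from incl.base) (X ↘ SpecC) proj A.point
  isCart : Pair.IsCart incl

variable {X L}

namespace Deformation

/-- Isomorphism of deformations: an isomorphism of the pairs over `Spec A` which is compatible
with the identifications of the closed fibres. -/
def Isomorphic {A : ArtAlg} (E D : Deformation X L A) : Prop :=
  ∃ e : E.total ≅ D.total, e.hom.base ≫ D.proj = E.proj ∧ E.incl ≫ e.hom = D.incl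

lemma Isomorphic.refl {A : ArtAlg} (D : Deformation X L A) : D.Isomorphic D :=
  ⟨Iso.refl _, Category.id_comp _, Category.comp_id _⟩

lemma Isomorphic.symm {A : ArtAlg} {E D : Deformation X L A} (h : E.Isomorphic D) :
    D.Isomorphic E := by
  obtain ⟨e, h1, h2⟩ := h
  refine ⟨e.symm, ?_, ?_⟩
  · rw [← h1, ← Category.assoc]
    exact (congrArg (· ≫ D.proj) (congrArg Pair.Hom.base e.inv_hom_id)).trans (Category.id_comp _)
  · rw [← h2, Category.assoc, Iso.symm_hom, e.hom_inv_id, Category.comp_id]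

lemma Isomorphic.trans {A : ArtAlg} {E D F : Deformation X L A} (h : E.Isomorphic D)
    (h' : D.Isomorphic F) : E.Isomorphic F := by
  obtain ⟨e, h1, h2⟩ := h
  obtain ⟨e', h1', h2'⟩ := h'
  refine ⟨e ≪≫ e', ?_, ?_⟩
  · rw [← h1, ← h1', Iso.trans_hom, Pair.comp_base, Category.assoc]
  · rw [← h2', ← h2, Iso.trans_hom, Category.assoc]

/-- Isomorphism of deformations as an equivalence relation. -/
instance setoid (A : ArtAlg) : Setoid (Deformation X L A) where
  r := Isomorphic
  iseqv := ⟨Isomorphic.refl, Isomorphic.symm, Isomorphic.trans⟩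

/-- `E` is a base change of `D` along a homomorphism `A → B`. -/
def IsBaseChange {A B : ArtAlg} (φ : A ⟶ B) (E : Deformation X L B) (D : Deformation X L A) :
    Prop :=
  ∃ g : E.total ⟶ D.total, Pair.IsCart g ∧
    IsPullback g.base E.proj D.proj (ArtAlg.specMap φ) ∧ E.incl ≫ g = D.incl

lemma IsBaseChange.refl {A : ArtAlg} (D : Deformation X L A) : IsBaseChange (𝟙 A) D D :=
  ⟨𝟙 _, Pair.isCart_id _, by
    rw [ArtAlg.specMap_id, Pair.id_base]
    exact IsPullback.of_horiz_isIso ⟨by simp⟩, Category.comp_id _⟩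

lemma IsBaseChange.trans {A B C : ArtAlg} {φ : A ⟶ B} {ψ : B ⟶ C} {F : Deformation X L C}
    {E : Deformation X L B} {D : Deformation X L A} (h : IsBaseChange ψ F E)
    (h' : IsBaseChange φ E D) : IsBaseChange (φ ≫ ψ) F D := by
  obtain ⟨g, h1, h2, h3⟩ := h
  obtain ⟨g', h1', h2', h3'⟩ := h'
  refine ⟨g ≫ g', (Pair.isCart_comp_iff g h1').2 h1, ?_, ?_⟩
  · rw [ArtAlg.specMap_comp]
    exact h2.paste_horiz h2'
  · rw [← h3', ← h3, Category.assoc]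

lemma IsBaseChange.congr {A B : ArtAlg} {φ : A ⟶ B} {E : Deformation X L B}
    {D D' : Deformation X L A} (h : IsBaseChange φ E D) (h' : D.Isomorphic D') :
    IsBaseChange φ E D' := by
  obtain ⟨g, h1, h2, h3⟩ := h
  obtain ⟨e, h1', h2'⟩ := h'
  refine ⟨g ≫ e.hom, (Pair.isCart_comp_iff g (Pair.isCart_of_isIso e)).2 h1, ?_, ?_⟩
  · have hi : IsIso e.hom.base :=
      ⟨e.inv.base, congrArg Pair.Hom.base e.hom_inv_id, congrArg Pair.Hom.base e.inv_hom_id⟩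
    have := h2.paste_horiz (IsPullback.of_horiz_isIso (fst := e.hom.base) (snd := D.proj)
      (f := D'.proj) (g := 𝟙 _) ⟨by rw [h1', Category.comp_id]⟩)
    rwa [Category.comp_id] at this
  · rw [← h2', ← h3, Category.assoc]

lemma IsBaseChange.exists_hom {A B : ArtAlg} {φ : A ⟶ B} {E E' : Deformation X L B}
    {D : Deformation X L A} {g : E.total ⟶ D.total} {g' : E'.total ⟶ D.total}
    (hg : IsPullback g.base E.proj D.proj (ArtAlg.specMap φ) ∧ E.incl ≫ g = D.incl)
    (hg' : Pair.IsCart g' ∧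
      IsPullback g'.base E'.proj D.proj (ArtAlg.specMap φ) ∧ E'.incl ≫ g' = D.incl) :
    ∃ k : E.total ⟶ E'.total, k ≫ g' = g ∧ k.base ≫ E'.proj = E.proj ∧ E.incl ≫ k = E'.incl := by
  obtain ⟨h2, h3⟩ := hg
  obtain ⟨h1', h2', h3'⟩ := hg'
  obtain ⟨k, hk1, hk2⟩ := Pair.exists_lift h1' g (h2'.lift g.base E.proj h2.w)
    (h2'.lift_fst _ _ _)
  refine ⟨k, hk2, by rw [hk1, h2'.lift_snd], ?_⟩
  refine Pair.lift_unique h1' (h2'.hom_ext ?_ ?_) ?_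
  · exact congrArg Pair.Hom.base (show (E.incl ≫ k) ≫ g' = E'.incl ≫ g' by
      rw [Category.assoc, hk2, h3, h3'])
  · rw [Pair.comp_base, Category.assoc, hk1, h2'.lift_snd]
    exact E.isPullback.w.trans E'.isPullback.w.symm
  · rw [Category.assoc, hk2, h3, h3']

lemma IsBaseChange.unique {A B : ArtAlg} {φ : A ⟶ B} {E E' : Deformation X L B}
    {D : Deformation X L A} (h : IsBaseChange φ E D) (h' : IsBaseChange φ E' D) :
    E.Isomorphic E' := by
  obtain ⟨g, h1, h2, h3⟩ := h
  obtain ⟨g', h1', h2', h3'⟩ := h'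
  obtain ⟨k, a1, a2, a3⟩ := exists_hom ⟨h2, h3⟩ ⟨h1', h2', h3'⟩
  obtain ⟨k', b1, b2, b3⟩ := exists_hom ⟨h2', h3'⟩ ⟨h1, h2, h3⟩
  refine ⟨⟨k, k', ?_, ?_⟩, a2, a3⟩
  · have e : (k ≫ k') ≫ g = 𝟙 _ ≫ g := by rw [Category.assoc, b1, a1, Category.id_comp]
    refine Pair.lift_unique h1 (h2.hom_ext (congrArg Pair.Hom.base e) ?_) e
    rw [Pair.comp_base, Category.assoc, b2, a2]
    exact (Category.id_comp _).symm
  · have e : (k' ≫ k) ≫ g' = 𝟙 _ ≫ g' := by rw [Category.assoc, a1, b1, Category.id_comp]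
    refine Pair.lift_unique h1' (h2'.hom_ext (congrArg Pair.Hom.base e) ?_) e
    rw [Pair.comp_base, Category.assoc, a2, b2]
    exact (Category.id_comp _).symm

lemma flat_snd {Y Z S : Scheme.{0}} {f : Y ⟶ S} {g : Z ⟶ S} (hf : Flat f) :
    Flat (pullback.snd f g) := inferInstance

lemma exists_incl {A B : ArtAlg} (φ : A ⟶ B) (D : Deformation X L A) :
    ∃ k : Pair.mk X L ⟶ D.total.pull (pullback.fst D.proj (ArtAlg.specMap φ)),
      (show X ⟶ pullback D.proj (ArtAlg.specMap φ) from k.base) ≫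
        pullback.snd D.proj (ArtAlg.specMap φ) = (X ↘ SpecC) ≫ B.point ∧
      k ≫ D.total.pullHom (pullback.fst D.proj (ArtAlg.specMap φ)) = D.incl := by
  have hw : (show X ⟶ D.total.scheme from D.incl.base) ≫ D.proj =
      ((X ↘ SpecC) ≫ B.point) ≫ ArtAlg.specMap φ := by
    rw [Category.assoc, ArtAlg.point_specMap]
    exact D.isPullback.w
  obtain ⟨k, hk1, hk2⟩ := Pair.exists_lift
    (D.total.isCart_pullHom (pullback.fst D.proj (ArtAlg.specMap φ)))
    D.incl (pullback.lift D.incl.base ((X ↘ SpecC) ≫ B.point) hw) (pullback.lift_fst _ _ _)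
  refine ⟨k, ?_, hk2⟩
  rw [hk1]
  exact pullback.lift_snd _ _ _

/-- The base change `(𝒳 ×_{Spec A} Spec B, pr₁^* ℒ)` of a deformation. -/
def baseChange {A B : ArtAlg} (φ : A ⟶ B) (D : Deformation X L A) : Deformation X L B where
  total := D.total.pull (pullback.fst D.proj (ArtAlg.specMap φ))
  proj := pullback.snd D.proj (ArtAlg.specMap φ)
  flat := flat_snd D.flat
  isLineBundle := D.isLineBundle.pullback _
  incl := (D.exists_incl φ).choose
  isPullback := by
    refine IsPullback.of_right (h₁₂ := pullback.fst D.proj (ArtAlg.specMap φ))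
      (h₂₂ := ArtAlg.specMap φ) (v₁₃ := D.proj) ?_ (D.exists_incl φ).choose_spec.1
      (IsPullback.of_hasPullback _ _)
    rw [ArtAlg.point_specMap]
    have h : (show X ⟶ pullback D.proj (ArtAlg.specMap φ) from
        (D.exists_incl φ).choose.base) ≫ pullback.fst D.proj (ArtAlg.specMap φ) =
        D.incl.base := congrArg Pair.Hom.base (D.exists_incl φ).choose_spec.2
    rw [h]
    exact D.isPullback
  isCart := by
    rw [← Pair.isCart_comp_iff _ (D.total.isCart_pullHom _), (D.exists_incl φ).choose_spec.2]
    exact D.isCart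

lemma isBaseChange_baseChange {A B : ArtAlg} (φ : A ⟶ B) (D : Deformation X L A) :
    IsBaseChange φ (D.baseChange φ) D :=
  ⟨D.total.pullHom _, D.total.isCart_pullHom _, IsPullback.of_hasPullback _ _,
    (D.exists_incl φ).choose_spec.2⟩

end Deformation

variable (X L)

/-- The functor of Artin rings `Def_(X, L)`: it sends `A` to the set of isomorphism classes of
flat deformations of `(X, L)` over `A`, and a homomorphism to the base change along it. -/
def defFunctor : ArtAlg ⥤ Type 1 where
  obj A := Quotient (Deformation.setoid (X := X) (L := L) A)
  map φ := ↾(Quotient.map (Deformation.baseChange φ) fun D D' h =>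
    (D.isBaseChange_baseChange φ).congr h |>.unique (D'.isBaseChange_baseChange φ))
  map_id A := by
    ext x
    induction x using Quotient.inductionOn with | _ D =>
    exact Quotient.sound ((D.isBaseChange_baseChange _).unique (.refl D))
  map_comp φ ψ := by
    ext x
    induction x using Quotient.inductionOn with | _ D =>
    exact Quotient.sound ((D.isBaseChange_baseChange _).unique
      (((D.baseChange φ).isBaseChange_baseChange ψ).trans (D.isBaseChange_baseChange φ)))

end Deformations

/-! ### Infinitesimal algebras -/

section Infinitesimal

variable (V : Type) [AddCommGroup V] [Module ℂ V] [Module ℂᵐᵒᵖ V] [IsCentralScalar ℂ V]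

instance : IsLocalRing (TrivSqZeroExt ℂ V) :=
  IsLocalRing.of_nonunits_add fun a b ha hb => by
    simp only [mem_nonunits_iff, TrivSqZeroExt.isUnit_iff_isUnit_fst, isUnit_iff_ne_zero,
      not_not, TrivSqZeroExt.fst_add] at *
    rw [ha, hb, add_zero]

instance [FiniteDimensional ℂ V] : IsArtinianRing (TrivSqZeroExt ℂ V) :=
  haveI : Module.Finite ℂ (TrivSqZeroExt ℂ V) := inferInstanceAs (Module.Finite ℂ (ℂ × V))
  IsArtinianRing.of_finite ℂ _

/-- The algebra `ℂ[V] = ℂ ⊕ V` with `V² = 0`, for a finite-dimensional vector space `V`. -/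
def infAlg [FiniteDimensional ℂ V] : ArtAlg where
  carrier := TrivSqZeroExt ℂ V
  residue_bijective := by
    refine ⟨RingHom.injective _, fun y => ?_⟩
    obtain ⟨x, rfl⟩ := IsLocalRing.residue_surjective y
    refine ⟨x.fst, ?_⟩
    rw [IsScalarTower.algebraMap_apply ℂ (TrivSqZeroExt ℂ V), ← sub_eq_zero]
    refine (map_sub (IsLocalRing.residue (TrivSqZeroExt ℂ V)) _ x).symm.trans ?_
    rw [IsLocalRing.residue_eq_zero_iff, IsLocalRing.mem_maximalIdeal, mem_nonunits_iff,
      TrivSqZeroExt.isUnit_iff_isUnit_fst, isUnit_iff_ne_zero, not_not]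
    exact sub_self x.fst

end Infinitesimal

/-- The homomorphism `ℂ[V] → ℂ[W]` induced by a linear map `V → W`. -/
def infMap {V W : Type} [AddCommGroup V] [Module ℂ V] [Module ℂᵐᵒᵖ V] [IsCentralScalar ℂ V]
    [FiniteDimensional ℂ V] [AddCommGroup W] [Module ℂ W] [Module ℂᵐᵒᵖ W] [IsCentralScalar ℂ W]
    [FiniteDimensional ℂ W] (f : V →ₗ[ℂ] W) : infAlg V ⟶ infAlg W :=
  (TrivSqZeroExt.map f : TrivSqZeroExt ℂ V →ₐ[ℂ] TrivSqZeroExt ℂ W)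

/-- The dual numbers `ℂ[ε]`. -/
abbrev dualNumbers : ArtAlg := infAlg ℂ

/-- The element `ε` of `ℂ[ε]`. -/
def eps : dualNumbers.carrier := (DualNumber.eps : DualNumber ℂ)

lemma aug_eps : dualNumbers.aug eps = 0 := by
  have h : (eps : dualNumbers.carrier) * eps = 0 := DualNumber.eps_mul_eps
  have := congrArg dualNumbers.aug h
  rw [map_mul, map_zero] at this
  exact mul_self_eq_zero.1 this

/-- The tangent space `F(ℂ[ε])` of a functor of Artin rings. -/
abbrev tangentSpace (F : ArtAlg ⥤ Type 1) : Type 1 := F.obj dualNumbers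

/-! ### The extension of one-jets attached to a first-order deformation -/

namespace Deformation

variable {X : Scheme.{0}} [X.Over SpecC] {L : X.Modules}

/-- The inclusion `X ⟶ 𝒳` of the closed fibre. -/
def i {A : ArtAlg} (D : Deformation X L A) : X ⟶ D.total.scheme := D.incl.base

/-- The restriction `ℒ ⟶ i_* L` of sections of `ℒ` to the closed fibre. -/
def res {A : ArtAlg} (D : Deformation X L A) :
    D.total.sheaf ⟶ (Scheme.Modules.pushforward D.i).obj L := D.incl.map

/-- The total space of a deformation is a scheme over `ℂ`. -/
instance {A : ArtAlg} (D : Deformation X L A) : D.total.scheme.Over SpecC :=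
  ⟨D.proj ≫ A.toSpecC⟩

lemma i_proj {A : ArtAlg} (D : Deformation X L A) : D.i ≫ D.proj = (X ↘ SpecC) ≫ A.point :=
  D.isPullback.w

lemma i_over {A : ArtAlg} (D : Deformation X L A) :
    D.i ≫ (D.total.scheme ↘ SpecC) = X ↘ SpecC := by
  change D.i ≫ D.proj ≫ A.toSpecC = _
  rw [← Category.assoc, i_proj, Category.assoc, ArtAlg.point_toSpecC, Category.comp_id]

lemma i_app_algebraMap {A : ArtAlg} (D : Deformation X L A) (U : D.total.scheme.Opens) (c : ℂ) :
    D.i.app U (algebraMap ℂ Γ(D.total.scheme, U) c) = algebraMap ℂ Γ(X, D.i ⁻¹ᵁ U) c := by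
  refine (app_structHom D.i (D.total.scheme ↘ SpecC) U c).trans ?_
  rw [i_over]
  rfl

/-- The restriction of sections of `ℒ` to `X` followed by the one-jet of sections of `L`. -/
def resJet {A : ArtAlg} (D : Deformation X L A) : D.total.sheaf.presheaf ⟶
    ((Scheme.Modules.pushforward D.i).obj (jets L)).presheaf :=
  D.res.mapPresheaf ≫ Functor.whiskerLeft (Opens.map D.i.base).op (p₁ L)

lemma resJet_apply {A : ArtAlg} (D : Deformation X L A) (U : D.total.scheme.Opens)
    (m : Γ(D.total.sheaf, U)) :
    secHom D.resJet U m = p₁Hom L (D.i ⁻¹ᵁ U) (D.res.app U m) := rfl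

lemma res_smul {A : ArtAlg} (D : Deformation X L A) (U : D.total.scheme.Opens)
    (r : Γ(D.total.scheme, U)) (m : Γ(D.total.sheaf, U)) :
    (show Γ(L, D.i ⁻¹ᵁ U) from D.res.app U (r • m)) =
      D.i.app U r • (show Γ(L, D.i ⁻¹ᵁ U) from D.res.app U m) :=
  D.res.app_smul r m

lemma isDiffOp_resJet {A : ArtAlg} (D : Deformation X L A) : IsDiffOpSheaf D.resJet := fun U =>
  { const := fun c m => by
      have h := (isDiffOp_p₁ L (D.i ⁻¹ᵁ U)).const c (D.res.app U m)
      rw [← i_app_algebraMap] at h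
      refine Eq.trans ?_ h
      exact congrArg (p₁Hom L (D.i ⁻¹ᵁ U)) (D.res_smul U _ m)
    leibniz := fun a b m => by
      have h := (isDiffOp_p₁ L (D.i ⁻¹ᵁ U)).leibniz (D.i.app U a) (D.i.app U b) (D.res.app U m)
      have e : ∀ r, secHom D.resJet U (r • m) =
          p₁Hom L (D.i ⁻¹ᵁ U) (D.i.app U r • (show Γ(L, D.i ⁻¹ᵁ U) from D.res.app U m)) :=
        fun r => congrArg (p₁Hom L (D.i ⁻¹ᵁ U)) (D.res_smul U r m)
      rw [e, e, e]
      rw [← map_mul] at h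
      exact h }

/-- The restriction map `r : 𝒫¹(ℒ)|_X ⟶ 𝒫¹(L)`. -/
def jetRestr {A : ArtAlg} (D : Deformation X L A) :
    (Scheme.Modules.pullback D.i).obj (jets D.total.sheaf) ⟶ jets L :=
  ((Scheme.Modules.pullbackPushforwardAdjunction D.i).homEquiv _ _).symm
    (jetsDesc D.resJet D.isDiffOp_resJet)

/-- The restriction to `X` of the one-jet of a section of `ℒ`. -/
def jetAt {A : ArtAlg} (D : Deformation X L A) (U : D.total.scheme.Opens) :
    Γ(D.total.sheaf, U) →+
      Γ((Scheme.Modules.pullback D.i).obj (jets D.total.sheaf), D.i ⁻¹ᵁ U) :=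
  AddMonoidHom.comp (((Scheme.Modules.pullbackPushforwardAdjunction D.i).unit.app
    (jets D.total.sheaf)).app U).hom (p₁Hom D.total.sheaf U)

lemma jetAt_leibniz {A : ArtAlg} (D : Deformation X L A) (U : D.total.scheme.Opens)
    (a b : Γ(D.total.scheme, U)) (m : Γ(D.total.sheaf, U)) :
    D.jetAt U ((a * b) • m) + D.i.app U (a * b) • D.jetAt U m =
      D.i.app U a • D.jetAt U (b • m) + D.i.app U b • D.jetAt U (a • m) := by
  have h := congrArg (((Scheme.Modules.pullbackPushforwardAdjunction D.i).unit.app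
    (jets D.total.sheaf)).app U) ((isDiffOp_p₁ D.total.sheaf U).leibniz a b m)
  rw [map_add, map_add] at h
  refine Eq.trans (congrArg _ ?_) (h.trans (congrArg₂ _ ?_ ?_))
  · exact (((Scheme.Modules.pullbackPushforwardAdjunction D.i).unit.app
      (jets D.total.sheaf)).app_smul (a * b) (p₁Hom D.total.sheaf U m)).symm
  · exact ((Scheme.Modules.pullbackPushforwardAdjunction D.i).unit.app
      (jets D.total.sheaf)).app_smul a (p₁Hom D.total.sheaf U (b • m))
  · exact ((Scheme.Modules.pullbackPushforwardAdjunction D.i).unit.app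
      (jets D.total.sheaf)).app_smul b (p₁Hom D.total.sheaf U (a • m))

/-- The function `ε` on an open subset of the total space of a first-order deformation. -/
def epsFun (D : Deformation X L dualNumbers) (U : D.total.scheme.Opens) :
    Γ(D.total.scheme, U) :=
  structHom D.proj U (show dualNumbers.ring from eps)

lemma i_app_epsFun (D : Deformation X L dualNumbers) (U : D.total.scheme.Opens) :
    D.i.app U (D.epsFun U) = 0 := by
  refine (app_structHom D.i D.proj U _).trans ?_
  rw [i_proj]
  refine (structHom_comp_specMap (X ↘ SpecC)
    (CommRingCat.ofHom dualNumbers.aug.toRingHom) _ _).trans ?_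
  exact (congrArg (structHom (X ↘ SpecC) (D.i ⁻¹ᵁ U)) aug_eps).trans (map_zero _)

lemma map_epsFun (D : Deformation X L dualNumbers) {U V : D.total.scheme.Opens} (k : V ⟶ U) :
    D.total.scheme.presheaf.map k.op (D.epsFun U) = D.epsFun V :=
  map_structHom D.proj k _

/-- The `𝒪`-linear map `ℒ ⟶ i_* (𝒫¹(ℒ)|_X)`, `t ↦ p₁(ε t)|_X`. -/
def epsJet (D : Deformation X L dualNumbers) : D.total.sheaf ⟶
    (Scheme.Modules.pushforward D.i).obj
      ((Scheme.Modules.pullback D.i).obj (jets D.total.sheaf)) :=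
  mkHom
    { app := fun U => AddCommGrpCat.ofHom ((D.jetAt U.unop).comp
        (DistribSMul.toAddMonoidHom Γ(D.total.sheaf, U.unop) (D.epsFun U.unop)))
      naturality := fun U V k => by
        refine AddCommGrpCat.hom_ext (AddMonoidHom.ext fun (m : Γ(D.total.sheaf, U.unop)) => ?_)
        have h1 : D.epsFun V.unop • (show Γ(D.total.sheaf, V.unop) from
            D.total.sheaf.presheaf.map k m) =
            D.total.sheaf.presheaf.map k (D.epsFun U.unop • m) := by
          rw [← D.map_epsFun k.unop]
          exact (D.total.sheaf.map_smul k.unop _ m).symm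
        have h2 := congr($((p₁ D.total.sheaf ≫
          ((Scheme.Modules.pullbackPushforwardAdjunction D.i).unit.app
            (jets D.total.sheaf)).mapPresheaf).naturality k) (D.epsFun U.unop • m))
        refine Eq.trans ?_ h2
        exact congrArg (D.jetAt V.unop) h1 }
    (fun U r m => by
      have h := D.jetAt_leibniz U (D.epsFun U) r m
      rw [map_mul, i_app_epsFun, zero_mul, zero_smul, zero_smul, add_zero, zero_add] at h
      refine Eq.trans ?_ h
      exact congrArg (D.jetAt U) (mul_smul _ _ _).symm)

/-- The identification `ℒ|_X ≅ L`. -/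
def resIso {A : ArtAlg} (D : Deformation X L A) :
    (Scheme.Modules.pullback D.i).obj D.total.sheaf ≅ L :=
  haveI : IsIso (((Scheme.Modules.pullbackPushforwardAdjunction D.i).homEquiv _ _).symm D.res) :=
    D.isCart
  asIso (((Scheme.Modules.pullbackPushforwardAdjunction D.i).homEquiv _ _).symm D.res)

/-- The map `j : L ⟶ 𝒫¹(ℒ)|_X`, `t|_X ↦ p₁(ε t)|_X`. -/
def jetIncl (D : Deformation X L dualNumbers) :
    L ⟶ (Scheme.Modules.pullback D.i).obj (jets D.total.sheaf) :=
  D.resIso.inv ≫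
    ((Scheme.Modules.pullbackPushforwardAdjunction D.i).homEquiv _ _).symm D.epsJet

lemma jetIncl_jetRestr (D : Deformation X L dualNumbers) : D.jetIncl ≫ D.jetRestr = 0 := by
  have h : D.epsJet ≫ (Scheme.Modules.pushforward D.i).map D.jetRestr = 0 := by
    ext U m
    have h1 : (Scheme.Modules.pullbackPushforwardAdjunction D.i).unit.app (jets D.total.sheaf) ≫
        (Scheme.Modules.pushforward D.i).map D.jetRestr = jetsDesc D.resJet D.isDiffOp_resJet := by
      refine ((Scheme.Modules.pullbackPushforwardAdjunction D.i).homEquiv_unit _ _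
        D.jetRestr).symm.trans ?_
      rw [jetRestr, Equiv.apply_symm_apply]
    have h2 := congr(($h1).app U (p₁Hom D.total.sheaf U (D.epsFun U • m)))
    refine h2.trans ((jetsDesc_p₁ D.resJet D.isDiffOp_resJet U _).trans ?_)
    refine (congrArg (p₁Hom L (D.i ⁻¹ᵁ U)) (D.res_smul U (D.epsFun U) m)).trans ?_
    rw [i_app_epsFun, zero_smul, map_zero]
    rfl
  rw [jetIncl, Category.assoc, ← Adjunction.homEquiv_naturality_right_symm, h]
  simp [Adjunction.homEquiv_counit]

/-- The sequence `0 ⟶ L ⟶ 𝒫¹(ℒ)|_X ⟶ 𝒫¹(L) ⟶ 0` attached to a first-order deformation. -/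
def jetSequence (D : Deformation X L dualNumbers) : ShortComplex X.Modules :=
  ShortComplex.mk D.jetIncl D.jetRestr D.jetIncl_jetRestr

end Deformation

/-! ### Extensions and cohomology -/

section Cohomology

variable {X : Scheme.{0}}

instance hasExtModules : HasExt.{1} X.Modules := HasExt.standard _

/-- If `L ⊣ R` is a reflection and `L ⋙ G` preserves colimits, then so does `G`. -/
lemma preservesColimit_of_reflection {C D E : Type*} [Category* C] [Category* D] [Category* E]
    {F : C ⥤ D} {R : D ⥤ C} (adj : F ⊣ R) [R.Full] [R.Faithful] (G : D ⥤ E) {J : Type*}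
    [Category* J] (K : J ⥤ D) [HasColimitsOfShape J C] [PreservesColimitsOfShape J (F ⋙ G)] :
    PreservesColimit K G := by
  have := adj.leftAdjoint_preservesColimits
  have h1 : PreservesColimit ((K ⋙ R) ⋙ F) G := by
    refine preservesColimit_of_preserves_colimit_cocone
      (isColimitOfPreserves F (colimit.isColimit (K ⋙ R))) ?_
    exact isColimitOfPreserves (F ⋙ G) (colimit.isColimit (K ⋙ R))
  have e : (K ⋙ R) ⋙ F ≅ K := Functor.associator _ _ _ ≪≫
    Functor.isoWhiskerLeft K (asIso adj.counit) ≪≫ K.rightUnitor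
  exact preservesColimit_of_iso_diagram G e

/-- The underlying abelian sheaf of a sheaf of modules. -/
def abSheaf (X : Scheme.{0}) :
    X.Modules ⥤ Sheaf (Opens.grothendieckTopology X) AddCommGrpCat.{0} :=
  SheafOfModules.toSheaf.{0} X.ringCatSheaf

instance : (abSheaf X).Additive :=
  inferInstanceAs (SheafOfModules.toSheaf.{0} X.ringCatSheaf).Additive

instance : PreservesFiniteLimits (abSheaf X) :=
  inferInstanceAs (PreservesFiniteLimits (SheafOfModules.toSheaf.{0} X.ringCatSheaf))

instance : PreservesFiniteColimits (SheafOfModules.toSheaf.{0} X.ringCatSheaf) where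
  preservesFiniteColimits J _ _ := by
    constructor
    intro K
    have : PreservesColimitsOfShape J
      (PresheafOfModules.sheafification (𝟙 X.ringCatSheaf.obj) ⋙
        SheafOfModules.toSheaf.{0} X.ringCatSheaf) :=
      inferInstanceAs (PreservesColimitsOfShape J
        (PresheafOfModules.toPresheaf X.ringCatSheaf.obj ⋙
          presheafToSheaf (Opens.grothendieckTopology X) AddCommGrpCat.{0}))
    exact preservesColimit_of_reflection
      (PresheafOfModules.sheafificationAdjunction (𝟙 X.ringCatSheaf.obj)) _ K

instance : PreservesFiniteColimits (abSheaf X) :=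
  inferInstanceAs (PreservesFiniteColimits (SheafOfModules.toSheaf.{0} X.ringCatSheaf))

/-- Multiplication by a complex number on a sheaf of modules. -/
abbrev scalHom [X.Over SpecC] (M : X.Modules) (c : ℂ) : M ⟶ M := scal M c

/-- The sheaf cohomology `Hⁿ(X, M)` of a sheaf of modules. -/
def H (M : X.Modules) (n : ℕ) : Type := Sheaf.H ((abSheaf X).obj M) n

instance (M : X.Modules) (n : ℕ) : AddCommGroup (H M n) :=
  inferInstanceAs (AddCommGroup (Sheaf.H ((abSheaf X).obj M) n))

/-- The map on cohomology induced by a morphism of sheaves of modules. -/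
def H.map {M N : X.Modules} (f : M ⟶ N) (n : ℕ) : H M n →+ H N n :=
  Sheaf.H.map ((abSheaf X).map f) n

lemma H.map_id {M : X.Modules} {n : ℕ} (x : H M n) : H.map (𝟙 M) n x = x :=
  (congrArg (fun f => Sheaf.H.map f n x) ((abSheaf X).map_id M)).trans
    (Sheaf.H.map_id_apply (F := (abSheaf X).obj M) x)

lemma H.map_comp {M N K : X.Modules} (f : M ⟶ N) (g : N ⟶ K) {n : ℕ} (x : H M n) :
    H.map (f ≫ g) n x = H.map g n (H.map f n x) :=
  (congrArg (fun f => Sheaf.H.map f n x) ((abSheaf X).map_comp f g)).trans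
    (Sheaf.H.map_comp_apply ((abSheaf X).map f) ((abSheaf X).map g) x)

lemma H.map_add {M N : X.Modules} (f g : M ⟶ N) {n : ℕ} (x : H M n) :
    H.map (f + g) n x = H.map f n x + H.map g n x :=
  (congrArg (fun f => Sheaf.H.map f n x) ((abSheaf X).map_add (f := f) (g := g))).trans
    (Sheaf.H.map_add_apply ((abSheaf X).map f) ((abSheaf X).map g) x)

section Scalars

variable [X.Over SpecC] (M : X.Modules)

/-- On a scheme over `ℂ`, a complex number `c` acts on cohomology by the map induced by
multiplication by `c`. -/
instance smulH (n : ℕ) : SMul ℂ (H M n) := ⟨fun c x => H.map (scalHom M c) n x⟩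

lemma smulH_def {n : ℕ} (c : ℂ) (x : H M n) : c • x = H.map (scalHom M c) n x := rfl

lemma scalHom_add (a b : ℂ) : scalHom M (a + b) = scalHom M a + scalHom M b :=
  (scal M).map_add a b

lemma scalHom_mul (a b : ℂ) : scalHom M (a * b) = scalHom M b ≫ scalHom M a :=
  (scal M).map_mul a b

lemma scalHom_one : scalHom M 1 = 𝟙 M := (scal M).map_one

/-- On a scheme over `ℂ`, cohomology is a complex vector space. -/
instance moduleH (n : ℕ) : Module ℂ (H M n) :=
  Module.ofMinimalAxioms
    (fun c x y => _root_.map_add (H.map (scalHom M c) n) x y)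
    (fun a b x => by
      rw [smulH_def, smulH_def, smulH_def, scalHom_add, H.map_add])
    (fun a b x => by
      rw [smulH_def, smulH_def, smulH_def, scalHom_mul, H.map_comp])
    (fun x => by
      rw [smulH_def, scalHom_one, H.map_id])

end Scalars

/-- A global section as a cohomology class of degree `0`. -/
def toH0 {M : X.Modules} (s : Γ(M, ⊤)) : Sheaf.H ((abSheaf X).obj M) 0 :=
  (Sheaf.H.equiv₀ ((abSheaf X).obj M) (Preorder.isTerminalTop X.Opens)).symm s

/-- The connecting homomorphism `δ : H⁰(X, S₃) → H¹(X, S₁)` of a short exact sequence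
`0 ⟶ S₁ ⟶ S₂ ⟶ S₃ ⟶ 0` of sheaves of modules. -/
def connecting {S : ShortComplex X.Modules} (hS : S.ShortExact) (s : Γ(S.X₃, ⊤)) : H S.X₁ 1 :=
  (toH0 s).comp (hS.map_of_exact (abSheaf X)).extClass (zero_add 1)

end Cohomology

end DefPair

end

open DefPair CategoryTheory AlgebraicGeometry Opposite TensorProduct

open CategoryTheory Limits AlgebraicGeometry TopologicalSpace Opposite TensorProduct
noncomputable section
namespace DefPair

/-! The one-jet map is the universal first-order differential operator, so the theorem can be read
as a statement about first-order operators on `ℒ` with values in sheaves on `X`. It is proved over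
`ℂ[V] = ℂ ⊕ V`, `V² = 0`, for finite-dimensional `V`, because the addition on the tangent space
involves `V = ℂ × ℂ`. The link between a deformation and an extension `0 → L ⊗ V → E → 𝒫¹(L) → 0` is
a `Comparison`: a first-order operator `d : ℒ → E` which lifts `t ↦ p₁(t|_X)` and satisfies `d(v t)
= v ⊗ t|_X`. The sequence (∗) carries one, namely `t ↦ p₁(t)|_X`.

An extension with a comparison is universal (`Comparison.exists_hom`). An operator `Δ : ℒ → N` is
linear on `V ℒ`, where it gives a map `L ⊗ V → N`. Push `E` out along this map: the difference of
`d` and `Δ` now kills `V ℒ`, hence descends to an operator on `L`, hence to a map on `𝒫¹(L)`, and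
this map splits the push-out. So the deformation determines its extension, and base change along `V
→ W` becomes push-out along `L ⊗ V → L ⊗ W` (`Comparison.extClass_comp`). Linearity of `Φ` follows,
since the class group is additive and `ℂ`-linear in the kernel.

In the exactness of (∗) only the injectivity of `j` is not formal, and it uses that `X` is reduced
and of finite type (`mono_of_jetAt_vFun`). A nonzero function on `X` is nonzero at some point `η`
whose local ring is a field. This field is formally smooth over `ℂ`, so the local ring of the
deformation splits over it, and the coefficients of `V` become derivations, that is, first-order
operators. They detect the kernel of `j`.

Conversely `d` recovers the deformation. A section `t` is the pair `(d(t), t|_X)`, so that `ℒ = E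
×_{𝒫¹(L)} L`; a function `a` is the pair `(a|_X, [d, a])`, where the commutator `[d, a]` is a linear
map `L → E` lifting `[p₁, a|_X]`. Such pairs make sense for every extension: they form a sheaf of
rings (`CommLift`) with kernel `𝒪_X ⊗ V` over `𝒪_X`, and a module over it (`jetLift`). Finite type
makes functions lift over small affine neighbourhoods, so this ringed space is a scheme; it is flat
over `ℂ[V]`, and together they are the `realisation` of the extension. For a deformation with a
comparison, the two formulas define a morphism from the realisation, and a morphism of deformations
over `ℂ[V]` is an isomorphism by a five-lemma argument (`isomorphic_of_hom`). Hence isomorphism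
classes of deformations and extension classes correspond (`bijective_defClass`).

The pairing is `p(ξ ⊗ s) = δ(p₁(s))`: the connecting map is the product with the class, and `p₁` is
`ℂ`-linear although not `𝒪`-linear. Since `ℒ` is the fibre product of `E` and `L`, a section `s`
lifts to `ℒ` exactly when `p₁(s)` lifts to `E`, that is, when `δ(p₁(s)) = 0`. -/

/-! ### Extensions in an abelian category -/

section AbelianExtensions

universe w v u

variable {C : Type u} [Category.{v} C] [Abelian C]

open DerivedCategory Pretriangulated in
/-- A distinguished triangle with first two morphisms in the heart comes from a short exact
sequence, and its third morphism is the class of the sequence. -/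
lemma shortExact_of_distTriang [HasDerivedCategory.{w} C] (S : ShortComplex C)
    (h : (singleFunctor C 0).obj S.X₃ ⟶ ((singleFunctor C 0).obj S.X₁)⟦(1 : ℤ)⟧)
    (hT : Triangle.mk ((singleFunctor C 0).map S.f) ((singleFunctor C 0).map S.g) h ∈
      distTriang (DerivedCategory C)) : ∃ hS : S.ShortExact, hS.singleδ = h := by
  have hz : ∀ (Y : C) (n : ℤ), n ≠ 0 →
      IsZero ((homologyFunctor C n).obj ((singleFunctor C 0).obj Y)) := by
    intro Y n hn
    rcases lt_or_gt_of_ne hn with h | h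
    · exact isZero_of_isGE _ 0 _ h
    · exact isZero_of_isLE _ 0 _ h
  have hm : Mono ((homologyFunctor C 0).map ((singleFunctor C 0).map S.f)) :=
    (HomologySequence.mono_homologyMap_mor₁_iff _ hT (-1) 0).2 ((hz S.X₃ _ (by lia)).eq_of_src _ _)
  have he : Epi ((homologyFunctor C 0).map ((singleFunctor C 0).map S.g)) :=
    (HomologySequence.epi_homologyMap_mor₂_iff _ hT 0 1).2 ((hz S.X₁ _ (by lia)).eq_of_tgt _ _)
  have hx := HomologySequence.exact₂ _ hT 0
  have hS : S.ShortExact := by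
    let e := singleFunctorCompHomologyFunctorIso C 0
    refine (ShortComplex.shortExact_iff_of_iso (S₁ := ShortComplex.mk
      ((homologyFunctor C 0).map ((singleFunctor C 0).map S.f))
      ((homologyFunctor C 0).map ((singleFunctor C 0).map S.g)) (by
        simp only [← Functor.map_comp, S.zero, Functor.map_zero])) (S₂ := S) ?_).1 ⟨hx⟩
    exact ShortComplex.isoMk (e.app _) (e.app _) (e.app _) (e.hom.naturality S.f).symm
      (e.hom.naturality S.g).symm
  refine ⟨hS, ?_⟩
  -- The triangle of the short exact sequence and the given one share their first two morphisms. A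
  -- comparison `c` of third terms comes from an endomorphism of `S.X₃` fixing the epimorphism
  -- `S.g`, so it is the identity and the third morphisms agree.
  obtain ⟨c, h1, h2⟩ := complete_distinguished_triangle_morphism _ _
    hS.singleTriangle_distinguished hT (𝟙 _) (𝟙 _)
    ((Category.comp_id _).trans (Category.id_comp _).symm)
  replace h1 : (singleFunctor C 0).map S.g ≫ c = 𝟙 _ ≫ (singleFunctor C 0).map S.g := h1
  replace h2 : hS.singleδ ≫ (shiftFunctor (DerivedCategory C) (1 : ℤ)).map (𝟙 _) = c ≫ h := h2
  change (singleFunctor C 0).obj S.X₃ ⟶ (singleFunctor C 0).obj S.X₃ at c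
  obtain ⟨c, rfl⟩ := (singleFunctor C 0).map_surjective c
  have hc : c = 𝟙 _ := by
    have := hS.epi_g
    rw [← cancel_epi S.g]
    apply (singleFunctor C 0).map_injective
    rw [Functor.map_comp, Category.comp_id]
    exact h1.trans (Category.id_comp _)
  subst hc
  rw [CategoryTheory.Functor.map_id, CategoryTheory.Functor.map_id, Category.comp_id] at h2
  exact h2.trans (Category.id_comp _)

open DerivedCategory Pretriangulated in
/-- Every class of degree one is the class of an extension. -/
lemma exists_extClass_eq [HasExt.{w} C] {P M : C} (ξ : Abelian.Ext P M 1) :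
    ∃ (E : C) (j : M ⟶ E) (r : E ⟶ P) (w : j ≫ r = 0)
      (hS : (ShortComplex.mk j r w).ShortExact), hS.extClass = ξ := by
  let := HasDerivedCategory.standard C
  -- The class is a morphism `P ⟶ M[1]`, which is completed to a triangle `M ⟶ K ⟶ P ⟶ M[1]`. The
  -- homology of `K` lies between that of `M` and `P`, hence in degree `0`, and so `K` is an object
  -- `E` of the heart.
  obtain ⟨K, f, g, hT⟩ := distinguished_cocone_triangle₂
    (Z := (singleFunctor C 0).obj P) (X := (singleFunctor C 0).obj M) ξ.hom
  have hz : ∀ (n : ℤ), n ≠ 0 → IsZero ((homologyFunctor C n).obj K) := by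
    intro n hn
    have hz : ∀ (Y : C), IsZero ((homologyFunctor C n).obj ((singleFunctor C 0).obj Y)) := by
      intro Y
      rcases lt_or_gt_of_ne hn with h | h
      · exact isZero_of_isGE _ 0 _ h
      · exact isZero_of_isLE _ 0 _ h
    exact (HomologySequence.exact₂ _ hT n).isZero_of_both_zeros
      ((hz M).eq_of_src _ _) ((hz P).eq_of_tgt _ _)
  have : K.IsGE 0 := (isGE_iff _ _).2 fun i hi => hz i hi.ne
  have : K.IsLE 0 := (isLE_iff _ _).2 fun i hi => hz i hi.ne'
  obtain ⟨E, ⟨e⟩⟩ := exists_iso_singleFunctor_obj_of_isGE_of_isLE K 0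
  obtain ⟨j, hj⟩ := (singleFunctor C 0).map_surjective (f ≫ e.hom)
  obtain ⟨r, hr⟩ := (singleFunctor C 0).map_surjective (e.inv ≫ g)
  have w : j ≫ r = 0 := by
    apply (singleFunctor C 0).map_injective
    rw [Functor.map_comp, hj, hr, Functor.map_zero]
    rw [Category.assoc, e.hom_inv_id_assoc]
    exact comp_distTriang_mor_zero₁₂ _ hT
  obtain ⟨hS, h⟩ := shortExact_of_distTriang (ShortComplex.mk j r w) ξ.hom
    (isomorphic_distinguished _ hT _ (Triangle.isoMk _ _ (Iso.refl _) e.symm (Iso.refl _)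
      (((congrArg (· ≫ e.inv) hj).trans (by simp)).trans (Category.id_comp _).symm)
      ((Category.comp_id _).trans hr)
      ((congrArg (ξ.hom ≫ ·) (CategoryTheory.Functor.map_id _ _)).trans
        ((Category.comp_id _).trans (Category.id_comp _).symm))))
  refine ⟨E, j, r, w, hS, ?_⟩
  ext
  rw [hS.extClass_hom, h]

/-- Extensions with the same class are related by a morphism of extensions. -/
lemma exists_hom_of_extClass_eq [HasExt.{w} C] {P M E E' : C} {j : M ⟶ E} {r : E ⟶ P}
    {w : j ≫ r = 0} {j' : M ⟶ E'} {r' : E' ⟶ P} {w' : j' ≫ r' = 0}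
    (hS : (ShortComplex.mk j r w).ShortExact) (hS' : (ShortComplex.mk j' r' w').ShortExact)
    (h : hS.extClass = hS'.extClass) : ∃ f : E ⟶ E', j ≫ f = j' ∧ f ≫ r' = r := by
  -- The class of an extension dies in its own middle term; as the classes agree, `j'` is the
  -- restriction to `M` of a map `f` on `E`.
  have h0 : hS.extClass.comp (Abelian.Ext.mk₀ j') (add_zero 1) = 0 := by
    rw [h]
    exact hS'.extClass_comp
  obtain ⟨x, hx⟩ := Abelian.Ext.contravariant_sequence_exact₁ hS _ (Abelian.Ext.mk₀ j') rfl h0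
  obtain ⟨f, rfl⟩ : ∃ f, Abelian.Ext.mk₀ f = x := ⟨_, Abelian.Ext.mk₀_homEquiv₀_apply x⟩
  have hf : j ≫ f = j' := by
    rw [Abelian.Ext.mk₀_comp_mk₀] at hx
    exact Abelian.Ext.homEquiv₀.symm.injective hx
  have := hS.epi_g
  let t : E ⟶ P := f ≫ r'
  have ht : j ≫ t = 0 := by simp only [t, reassoc_of% hf, w']
  let u : P ⟶ P := hS.exact.desc t ht
  have hu : r ≫ u = f ≫ r' := hS.exact.g_desc t ht
  let φ : ShortComplex.mk j r w ⟶ ShortComplex.mk j' r' w' :=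
    { τ₁ := 𝟙 _, τ₂ := f, τ₃ := u, comm₁₂ := by simp [hf], comm₂₃ := hu.symm }
  have hn := ShortComplex.ShortExact.extClass_naturality hS hS' φ
  -- The map `u` induced by `f` on `P` pulls the common class back to itself, so `u - 1` pulls it
  -- back to zero and lifts to `d : P ⟶ E'`. Subtracting `r ≫ d` from `f` turns `u` into the
  -- identity and changes nothing on `M`.
  have hn' : (Abelian.Ext.mk₀ (u - 𝟙 P)).comp hS'.extClass (zero_add 1) = 0 := by
    have h1 : hS.extClass.comp (Abelian.Ext.mk₀ (𝟙 M)) (add_zero 1) =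
        (Abelian.Ext.mk₀ u).comp hS'.extClass (zero_add 1) := hn
    rw [Abelian.Ext.comp_mk₀_id, h] at h1
    rw [sub_eq_add_neg, Abelian.Ext.mk₀_add, Abelian.Ext.mk₀_neg, Abelian.Ext.add_comp,
      Abelian.Ext.neg_comp, Abelian.Ext.mk₀_id_comp, ← h1, add_neg_cancel]
  obtain ⟨y, hy⟩ := Abelian.Ext.covariant_sequence_exact₃ P hS' (Abelian.Ext.mk₀ (u - 𝟙 P)) rfl hn'
  obtain ⟨d, rfl⟩ : ∃ f, Abelian.Ext.mk₀ f = y := ⟨_, Abelian.Ext.mk₀_homEquiv₀_apply y⟩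
  have hd : d ≫ r' = u - 𝟙 P := by
    rw [Abelian.Ext.mk₀_comp_mk₀] at hy
    exact Abelian.Ext.homEquiv₀.symm.injective hy
  refine ⟨f - r ≫ d, ?_, ?_⟩
  · rw [Preadditive.comp_sub, hf, reassoc_of% w, zero_comp, sub_zero]
  · rw [Preadditive.sub_comp, Category.assoc, hd, Preadditive.comp_sub, hu, Category.comp_id]
    abel

/-- The push-out of an extension is an extension. -/
lemma shortExact_pushout {P M E N : C} {j : M ⟶ E} {r : E ⟶ P} {w : j ≫ r = 0}
    (hS : (ShortComplex.mk j r w).ShortExact) (κ : M ⟶ N) :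
    (ShortComplex.mk (pushout.inr j κ) (pushout.desc r 0 (w.trans comp_zero.symm))
      (pushout.inr_desc r 0 _)).ShortExact := by
  have := hS.mono_f
  have := hS.epi_g
  dsimp at *
  have h : Epi (pushout.desc r 0 (w.trans comp_zero.symm) : pushout j κ ⟶ P) :=
    epi_of_epi_fac (pushout.inl_desc r 0 (w.trans comp_zero.symm))
  -- A map on the push-out that kills `N` is a map on `E` that kills `M`, that is, a map on `P`.
  refine ⟨ShortComplex.exact_of_g_is_cokernel _ (CokernelCofork.IsColimit.ofπ' _ _ fun k hk => ?_)⟩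
  dsimp at hk
  have hk' : j ≫ pushout.inl j κ ≫ k = 0 := by
    rw [pushout.condition_assoc, hk, comp_zero]
  refine ⟨hS.exact.desc (pushout.inl j κ ≫ k) hk', ?_⟩
  refine pushout.hom_ext ?_ ?_
  · rw [pushout.inl_desc_assoc]
    exact hS.exact.g_desc _ _
  · rw [pushout.inr_desc_assoc, zero_comp, hk]

end AbelianExtensions

/-! ### Gluing sections -/

section Gluing

universe v u

variable {C : Type u} [Category.{v} C] {FC : C → C → Type*} {CC : C → Type 0}
  [∀ X Y, FunLike (FC X Y) (CC X) (CC Y)] [ConcreteCategory.{0} C FC]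

lemma presheaf_map_map {X : TopCat.{0}} (F : X.Presheaf C) {U V W : Opens X} (h : W ≤ V)
    (h' : V ≤ U) (s : ToType (F.obj (op U))) :
    F.map (homOfLE h).op (F.map (homOfLE h').op s) = F.map (homOfLE (h.trans h')).op s := by
  rw [← ConcreteCategory.comp_apply, ← F.map_comp]
  rfl

variable [HasLimitsOfSize.{0, 0} C] [(CategoryTheory.forget C).ReflectsIsomorphisms]
  [PreservesLimitsOfSize.{0, 0} (CategoryTheory.forget C)]

/-- Two sections of a sheaf which agree locally are equal. -/
lemma section_ext {X : TopCat.{0}} {F : X.Presheaf C} (hF : F.IsSheaf) {U : Opens X}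
    {s t : ToType (F.obj (op U))} (h : ∀ x ∈ U, ∃ V, ∃ hV : V ≤ U, x ∈ V ∧
      F.map (homOfLE hV).op s = F.map (homOfLE hV).op t) : s = t := by
  choose V hV hx hst using h
  refine TopCat.Sheaf.eq_of_locally_eq' ⟨F, hF⟩ (fun x : U => V x.1 x.2) U
    (fun x => homOfLE (hV x.1 x.2)) (fun x hxU => ?_) s t fun x => hst x.1 x.2
  exact Opens.mem_iSup.2 ⟨⟨x, hxU⟩, hx x hxU⟩

/-- A property of sections of a sheaf which is satisfied by at most one section, and locally by
some section, is locally satisfied by a section. -/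
lemma exists_section {X : TopCat.{0}} {F : X.Presheaf C} (hF : F.IsSheaf) {U : Opens X}
    (P : ∀ V : Opens X, V ≤ U → ToType (F.obj (op V)) → Prop)
    (hres : ∀ (V W : Opens X) (hV : V ≤ U) (h : W ≤ V) (s : ToType (F.obj (op V))), P V hV s →
      P W (h.trans hV) (F.map (homOfLE h).op s))
    (huniq : ∀ (V : Opens X) (hV : V ≤ U) (s t : ToType (F.obj (op V))), P V hV s → P V hV t →
      s = t)
    (hex : ∀ x ∈ U, ∃ V, ∃ hV : V ≤ U, x ∈ V ∧ ∃ s, P V hV s) :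
    ∃ s : ToType (F.obj (op U)), ∀ x ∈ U, ∃ V, ∃ hV : V ≤ U, x ∈ V ∧
      P V hV (F.map (homOfLE hV).op s) := by
  choose V hV hx s hs using hex
  obtain ⟨t, ht, -⟩ := TopCat.Sheaf.existsUnique_gluing' ⟨F, hF⟩ (fun x : U => V x.1 x.2) U
    (fun x => homOfLE (hV x.1 x.2)) (fun x hxU => Opens.mem_iSup.2 ⟨⟨x, hxU⟩, hx x hxU⟩)
    (fun x => s x.1 x.2) (fun x y => huniq _ (inf_le_left.trans (hV x.1 x.2)) _ _
      (hres _ _ _ inf_le_left _ (hs _ _)) (hres _ _ _ inf_le_right _ (hs _ _)))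
  refine ⟨t, fun x hxU => ⟨V x hxU, hV x hxU, hx x hxU, ?_⟩⟩
  have := ht ⟨x, hxU⟩
  exact this ▸ hs x hxU

end Gluing

/-! ### Sections of sheaves of modules -/

section Sections

variable {X : Scheme.{0}} {M N : X.Modules}

/-- Restriction of sections of a sheaf of modules. -/
def rs (M : X.Modules) {U V : X.Opens} (h : V ≤ U) : Γ(M, U) →+ Γ(M, V) :=
  (M.presheaf.map (homOfLE h).op).hom

/-- Restriction of functions. -/
def ro {U V : X.Opens} (h : V ≤ U) : Γ(X, U) →+* Γ(X, V) := (X.presheaf.map (homOfLE h).op).hom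

@[simp] lemma rs_rs {U V W : X.Opens} (h : W ≤ V) (h' : V ≤ U) (x : Γ(M, U)) :
    rs M h (rs M h' x) = rs M (h.trans h') x :=
  presheaf_map_map M.presheaf h h' x

@[simp] lemma ro_ro {U V W : X.Opens} (h : W ≤ V) (h' : V ≤ U) (x : Γ(X, U)) :
    ro h (ro h' x) = ro (h.trans h') x :=
  presheaf_map_map X.presheaf h h' x

@[simp] lemma rs_self {U : X.Opens} (h : U ≤ U) (x : Γ(M, U)) : rs M h x = x :=
  map_endo M _ x

@[simp] lemma ro_self {U : X.Opens} (h : U ≤ U) (x : Γ(X, U)) : ro h x = x :=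
  congr($(X.presheaf.map_id (op U)) x)

@[simp] lemma rs_smul {U V : X.Opens} (h : V ≤ U) (a : Γ(X, U)) (x : Γ(M, U)) :
    rs M h (a • x) = ro h a • rs M h x :=
  M.map_smul (homOfLE h) a x

lemma app_rs (f : M ⟶ N) {U V : X.Opens} (h : V ≤ U) (x : Γ(M, U)) :
    f.app V (rs M h x) = rs N h (f.app U x) :=
  congr($(f.mapPresheaf.naturality (homOfLE h).op) x)

lemma secHom_rs (D : M.presheaf ⟶ N.presheaf) {U V : X.Opens} (h : V ≤ U) (x : Γ(M, U)) :
    secHom D V (rs M h x) = rs N h (secHom D U x) :=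
  congr($(D.naturality (homOfLE h).op) x)

lemma rs_ext {U : X.Opens} {s t : Γ(M, U)}
    (h : ∀ x ∈ U, ∃ V, ∃ hV : V ≤ U, x ∈ V ∧ rs M hV s = rs M hV t) : s = t :=
  section_ext M.isSheaf h

lemma ro_ext {U : X.Opens} {s t : Γ(X, U)}
    (h : ∀ x ∈ U, ∃ V, ∃ hV : V ≤ U, x ∈ V ∧ ro hV s = ro hV t) : s = t :=
  section_ext X.IsSheaf h

lemma exists_rs {U : X.Opens} (P : ∀ V : X.Opens, V ≤ U → Γ(M, V) → Prop)
    (hres : ∀ (V W : X.Opens) (hV : V ≤ U) (h : W ≤ V) (s : Γ(M, V)), P V hV s →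
      P W (h.trans hV) (rs M h s))
    (huniq : ∀ (V : X.Opens) (hV : V ≤ U) (s t : Γ(M, V)), P V hV s → P V hV t → s = t)
    (hex : ∀ x ∈ U, ∃ V, ∃ hV : V ≤ U, x ∈ V ∧ ∃ s, P V hV s) :
    ∃ s : Γ(M, U), ∀ x ∈ U, ∃ V, ∃ hV : V ≤ U, x ∈ V ∧ P V hV (rs M hV s) :=
  exists_section M.isSheaf P hres huniq hex

lemma exists_ro {U : X.Opens} (P : ∀ V : X.Opens, V ≤ U → Γ(X, V) → Prop)
    (hres : ∀ (V W : X.Opens) (hV : V ≤ U) (h : W ≤ V) (s : Γ(X, V)), P V hV s →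
      P W (h.trans hV) (ro h s))
    (huniq : ∀ (V : X.Opens) (hV : V ≤ U) (s t : Γ(X, V)), P V hV s → P V hV t → s = t)
    (hex : ∀ x ∈ U, ∃ V, ∃ hV : V ≤ U, x ∈ V ∧ ∃ s, P V hV s) :
    ∃ s : Γ(X, U), ∀ x ∈ U, ∃ V, ∃ hV : V ≤ U, x ∈ V ∧ P V hV (ro hV s) :=
  exists_section X.IsSheaf P hres huniq hex

lemma modules_hom_ext {f g : M ⟶ N} (h : ∀ (U : X.Opens) (x : Γ(M, U)), f.app U x = g.app U x) :
    f = g :=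
  Scheme.Modules.hom_ext f g fun U => by ext x; exact h U x

lemma add_app_apply (f g : M ⟶ N) (U : X.Opens) (x : Γ(M, U)) :
    (f + g).app U x = f.app U x + g.app U x := rfl

lemma comp_app_apply {K : X.Modules} (f : M ⟶ N) (g : N ⟶ K) (U : X.Opens) (x : Γ(M, U)) :
    (f ≫ g).app U x = g.app U (f.app U x) := rfl

lemma sum_app_apply {ι : Type*} (s : Finset ι) (f : ι → (M ⟶ N)) (U : X.Opens) (x : Γ(M, U)) :
    (∑ k ∈ s, f k).app U x = ∑ k ∈ s, (f k).app U x := by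
  classical
  induction s using Finset.induction_on with
  | empty => simp only [Finset.sum_empty]; rfl
  | insert a s ha ih => rw [Finset.sum_insert ha, Finset.sum_insert ha, add_app_apply, ih]

/-- An epimorphism of sheaves of modules is surjective on sections locally. -/
lemma exists_app_eq_of_epi (f : M ⟶ N) [Epi f] {U : X.Opens} (n : Γ(N, U)) {x : X} (hx : x ∈ U) :
    ∃ V, ∃ hV : V ≤ U, x ∈ V ∧ ∃ m : Γ(M, V), f.app V m = rs N hV n := by
  have : Epi ((abSheaf X).map f) := inferInstance
  have h := (TopCat.Sheaf.isLocallySurjective_iff_epi (X := X.carrier)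
    (φ := (abSheaf X).map f)).2 this
  obtain ⟨V, i, ⟨m, hm⟩, hxV⟩ := (TopCat.Presheaf.isLocallySurjective_iff _).1 h U n x hx
  exact ⟨V, i, hxV, m, hm⟩

lemma epi_of_exists_app_eq (f : M ⟶ N)
    (h : ∀ (U : X.Opens) (n : Γ(N, U)), ∀ x ∈ U, ∃ V, ∃ hV : V ≤ U, x ∈ V ∧
      ∃ m : Γ(M, V), f.app V m = rs N hV n) : Epi f := by
  refine ⟨fun _ _ hg => modules_hom_ext fun U n => rs_ext fun x hx => ?_⟩
  obtain ⟨V, hV, hxV, m, hm⟩ := h U n x hx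
  refine ⟨V, hV, hxV, ?_⟩
  rw [← app_rs, ← app_rs, ← hm]
  exact congr(($hg).app V m)

/-- The functor of sections over an open subset. -/
def sectionsFunctor (U : X.Opens) : X.Modules ⥤ Ab.{0} :=
  Scheme.Modules.toPresheaf X ⋙ (evaluation X.Opensᵒᵖ Ab.{0}).obj (op U)

instance (U : X.Opens) : PreservesFiniteLimits (sectionsFunctor U) := by
  have : PreservesLimits (Scheme.Modules.toPresheaf X) := inferInstance
  have h1 : PreservesFiniteLimits (Scheme.Modules.toPresheaf X) :=
    PreservesLimits.preservesFiniteLimits _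
  have h2 : PreservesFiniteLimits ((evaluation X.Opensᵒᵖ Ab.{0}).obj (op U)) := inferInstance
  exact @comp_preservesFiniteLimits _ _ _ _ _ _ _ _ h1 h2

instance (U : X.Opens) : (sectionsFunctor U).PreservesZeroMorphisms := ⟨fun _ _ => rfl⟩

lemma app_injective_of_mono (f : M ⟶ N) [Mono f] (U : X.Opens) : Function.Injective (f.app U) := by
  have h1 : Mono ((sectionsFunctor U).map f) := inferInstance
  exact (AddCommGrpCat.mono_iff_injective _).1 h1

lemma mono_of_app_injective (f : M ⟶ N) (h : ∀ U : X.Opens, Function.Injective (f.app U)) :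
    Mono f :=
  ⟨fun _ _ hg => modules_hom_ext fun U n => h U congr(($hg).app U n)⟩

/-- Sections of the middle term of a left exact sequence. -/
lemma exists_app_eq_of_exact {S : ShortComplex X.Modules} (hS : S.ShortExact) (U : X.Opens)
    (e : Γ(S.X₂, U)) (he : S.g.app U e = 0) : ∃ m : Γ(S.X₁, U), S.f.app U m = e := by
  have := hS.mono_f
  have h1 := hS.exact.map_of_mono_of_preservesKernel
    (sectionsFunctor U) inferInstance inferInstance
  exact (ShortComplex.ab_exact_iff _).1 h1 e he

end Sections

/-! ### Local generators of line bundles -/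

section Generators

variable {X : Scheme.{0}} {M : X.Modules}

/-- A section over `U` which freely generates a sheaf of modules over `U`. -/
def IsGen (M : X.Modules) {U : X.Opens} (m : Γ(M, U)) : Prop :=
  ∀ (V : X.Opens) (h : V ≤ U), Function.Bijective (fun a : Γ(X, V) => a • rs M h m)

lemma IsGen.restrict {U V : X.Opens} {m : Γ(M, U)} (hm : IsGen M m) (h : V ≤ U) :
    IsGen M (rs M h m) := fun W hW => by
  simpa using hm W (hW.trans h)

/-- The morphism from the structure sheaf given by a global section. -/
def ofSection (M : X.Modules) (m : Γ(M, ⊤)) : structSheaf X ⟶ M :=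
  mkHom
    { app := fun U => AddCommGrpCat.ofHom
        ((LinearMap.toSpanSingleton Γ(X, U.unop) Γ(M, U.unop) (rs M le_top m)).toAddMonoidHom)
      naturality := fun U V i => by
        refine AddCommGrpCat.hom_ext (AddMonoidHom.ext fun (a : Γ(X, U.unop)) => ?_)
        change ro (leOfHom i.unop) a • rs M le_top m = rs M (leOfHom i.unop) (a • rs M le_top m)
        rw [rs_smul, rs_rs] }
    (fun U r x => mul_smul (α := Γ(X, U)) r x (rs M le_top m))

lemma isIso_of_app_bijective {M N : X.Modules} (f : M ⟶ N)
    (h : ∀ U, Function.Bijective (f.app U)) : IsIso f := by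
  rw [Scheme.Modules.Hom.isIso_iff_isIso_app]
  intro U
  exact (ConcreteCategory.isIso_iff_bijective _).2 (h U)

lemma app_bijective {M N : X.Modules} (f : M ⟶ N) [IsIso f] (U : X.Opens) :
    Function.Bijective (f.app U) :=
  (ConcreteCategory.isIso_iff_bijective _).1 inferInstance

/-- A generator gives a trivialization. -/
lemma IsGen.exists_iso {U : X.Opens} {m : Γ(M, U)}
    (hm : IsGen M m) : ∃ e : M.restrict U.ι ≅ structSheaf U,
      ∀ (W : U.toScheme.Opens) (h : U.ι ''ᵁ W ≤ U), (show Γ(U, W) from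
        e.hom.app W (show Γ(M, U.ι ''ᵁ W) from rs M h m)) = 1 := by
  have hle : U.ι ''ᵁ ⊤ ≤ U := by simp
  let f := ofSection (M.restrict U.ι) (show Γ(M, U.ι ''ᵁ ⊤) from rs M hle m)
  have : IsIso f := by
    refine isIso_of_app_bijective _ fun V => ?_
    have hV : U.ι ''ᵁ V ≤ U := by
      rintro _ ⟨y, -, rfl⟩; exact y.2
    have key : ∀ a : Γ(X, U.ι ''ᵁ V), (show Γ(M, U.ι ''ᵁ V) from f.app V a) = a • rs M hV m := by
      intro a
      have hVt : U.ι ''ᵁ V ≤ U.ι ''ᵁ ⊤ := U.ι.image_mono le_top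
      change (show Γ(X, U.ι ''ᵁ V) from (U.ι.appIso V).inv a) • rs M hVt (rs M hle m) = _
      rw [Scheme.Opens.ι_appIso, rs_rs]
      rfl
    exact (congrArg Function.Bijective (funext key)).mpr (hm _ hV)
  refine ⟨(asIso f).symm, fun W h => ?_⟩
  have h1 : f.app W (1 : Γ(U, W)) = rs M h m := by
    refine (one_smul Γ(U, W) _).trans ?_
    exact rs_rs (M := M) (U.ι.image_mono le_top : U.ι ''ᵁ W ≤ U.ι ''ᵁ ⊤) hle m
  have h2 := congr(($((asIso f).hom_inv_id)).app W (1 : Γ(U, W)))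
  exact (congrArg _ h1.symm).trans h2

lemma isLineBundle_of_isGen (h : ∀ x : X, ∃ U : X.Opens, x ∈ U ∧ ∃ m : Γ(M, U), IsGen M m) :
    IsLineBundle M := by
  intro x
  obtain ⟨U, hx, m, hm⟩ := h x
  obtain ⟨e, -⟩ := hm.exists_iso
  exact ⟨U, hx, ⟨e⟩⟩

lemma IsLineBundle.exists_isGen (hM : IsLineBundle M) (x : X) :
    ∃ U : X.Opens, x ∈ U ∧ ∃ m : Γ(M, U), IsGen M m := by
  obtain ⟨U, hx, ⟨e⟩⟩ := hM x
  have hle : U ≤ U.ι ''ᵁ ⊤ := by simp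
  let m : Γ(M, U.ι ''ᵁ ⊤) := e.inv.app ⊤ (1 : Γ(U, ⊤))
  refine ⟨U, hx, rs M hle m, fun V hV => ?_⟩
  obtain ⟨V, rfl⟩ : ∃ W : U.toScheme.Opens, V = U.ι ''ᵁ W := by
    refine ⟨U.ι ⁻¹ᵁ V, ?_⟩
    rw [Scheme.Hom.image_preimage_eq_opensRange_inf]
    simpa using hV
  have key : ∀ a : Γ(X, U.ι ''ᵁ V), a • rs M hV (rs M hle m) =
      (show Γ(M, U.ι ''ᵁ V) from e.inv.app V a) := by
    intro a
    have hVt : U.ι ''ᵁ V ≤ U.ι ''ᵁ ⊤ := U.ι.image_mono le_top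
    have h3 : (show Γ(M, U.ι ''ᵁ V) from e.inv.app V (show Γ(structSheaf U, V) from
        (show Γ(U, V) from a) • (show Γ(structSheaf U, V) from (1 : Γ(U, V))))) =
        (show Γ(X, U.ι ''ᵁ V) from (U.ι.appIso V).inv a) • (show Γ(M, U.ι ''ᵁ V) from
          e.inv.app V (1 : Γ(U, V))) := e.inv.app_smul (U := V) a (1 : Γ(U, V))
    have h4 : (show Γ(M, U.ι ''ᵁ V) from e.inv.app V (1 : Γ(U, V))) = rs M hVt m := by
      refine Eq.trans ?_ (app_rs e.inv (le_top : V ≤ ⊤) (1 : Γ(U, ⊤)))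
      exact congrArg (e.inv.app V) (map_one (U.toScheme.presheaf.map (homOfLE le_top).op).hom).symm
    have h5 : (show Γ(structSheaf U, V) from
      (show Γ(U, V) from a) • (show Γ(structSheaf U, V) from (1 : Γ(U, V)))) = a :=
        mul_one (M := Γ(U, V)) a
    rw [h5, h4, Scheme.Opens.ι_appIso] at h3
    rw [rs_rs]
    exact h3.symm
  exact (congrArg Function.Bijective (funext key)).mpr (app_bijective e.inv V)

end Generators

/-! ### Cartesian morphisms of pairs and generators -/

section CartGenerators

/-- For an open immersion, restriction is left adjoint to push-forward just as the pull-back is.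
Being cartesian can thus be tested with the restriction, whose sections are known explicitly. -/
lemma isCart_iff_isIso_restrict {P Q : Pair} (f : P ⟶ Q) [IsOpenImmersion f.base] :
    Pair.IsCart f ↔
      IsIso (((Scheme.Modules.restrictAdjunction f.base).homEquiv _ _).symm f.map) := by
  rw [Pair.isCart_iff, isIso_iff_coyoneda_map_bijective]
  refine forall_congr' fun T => ?_
  rw [← ((Scheme.Modules.restrictAdjunction f.base).homEquiv _ T).bijective.of_comp_iff']
  refine iff_of_eq (congrArg _ (funext fun φ => ?_))
  simp [Adjunction.homEquiv_naturality_right]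

lemma restrict_homEquiv_symm_app {Y Z : Scheme.{0}} (j : Y ⟶ Z) [IsOpenImmersion j]
    {M : Z.Modules} {N : Y.Modules} (φ : M ⟶ (Scheme.Modules.pushforward j).obj N) (W : Y.Opens)
    (x : Γ(M, j ''ᵁ W)) :
    (((Scheme.Modules.restrictAdjunction j).homEquiv _ _).symm φ).app W x =
      rs N (j.preimage_image_eq W).ge (φ.app (j ''ᵁ W) x) := by
  rw [Adjunction.homEquiv_counit]
  rfl

lemma app_bijective_of_isCart {P Q : Pair} (f : P ⟶ Q) [IsOpenImmersion f.base]
    (hf : Pair.IsCart f) {V : Q.scheme.Opens} (hV : V ≤ f.base.opensRange) :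
    Function.Bijective (f.map.app V) := by
  obtain ⟨W, rfl⟩ : ∃ W : P.scheme.Opens, V = f.base ''ᵁ W := by
    refine ⟨f.base ⁻¹ᵁ V, ?_⟩
    rw [Scheme.Hom.image_preimage_eq_opensRange_inf]
    simpa using hV
  rw [isCart_iff_isIso_restrict] at hf
  have h := app_bijective (((Scheme.Modules.restrictAdjunction f.base).homEquiv _ _).symm f.map) W
  have h2 : Function.Bijective (rs P.sheaf (f.base.preimage_image_eq W).ge) := by
    refine Function.bijective_iff_has_inverse.2 ⟨rs P.sheaf (f.base.preimage_image_eq W).le,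
      fun x => ?_, fun x => ?_⟩ <;> simp
  refine (Function.Bijective.of_comp_iff' h2 _).1 ?_
  exact (congrArg Function.Bijective (funext fun x =>
    restrict_homEquiv_symm_app f.base f.map W x)).mp h

/-- The structure sheaves form a cartesian morphism. -/
lemma isCart_unit {Y Z : Scheme.{0}} (g : Y ⟶ Z) :
    Pair.IsCart (Pair.Hom.mk (P := ⟨Y, structSheaf Y⟩) (Q := ⟨Z, structSheaf Z⟩) g
      (SheafOfModules.unitToPushforwardObjUnit g.toRingCatSheafHom) :
      Pair.mk Y (structSheaf Y) ⟶ Pair.mk Z (structSheaf Z)) :=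
  isIso_unit g

/-- Cartesian morphisms preserve generators. -/
lemma IsGen.of_isCart {P Q : Pair} {f : P ⟶ Q} (hf : Pair.IsCart f) {U : Q.scheme.Opens}
    {m : Γ(Q.sheaf, U)} (hm : IsGen Q.sheaf m) :
    IsGen P.sheaf (U := f.base ⁻¹ᵁ U) (f.map.app U m) := by
  obtain ⟨e, he⟩ := hm.exists_iso
  -- The trivialization given by `m` is a cartesian morphism `c₁` from `(U, 𝒪)`, and `c₂` is
  -- cartesian because structure sheaves pull back to structure sheaves. Their composite factors
  -- through `f` by a morphism `k` over the open immersion of `f⁻¹(U)`. Then `k` is cartesian, hence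
  -- bijective on sections, and it takes the pulled-back section to `1`.
  let c₁ : Pair.mk U (structSheaf U) ⟶ Q := Pair.Hom.mk (P := ⟨U, structSheaf U⟩) U.ι
    ((Scheme.Modules.restrictAdjunction U.ι).homEquiv _ _ e.hom)
  have i₁ : IsOpenImmersion c₁.base := inferInstanceAs (IsOpenImmersion U.ι)
  have hc₁ : Pair.IsCart c₁ := by
    rw [isCart_iff_isIso_restrict]
    change IsIso (((Scheme.Modules.restrictAdjunction U.ι).homEquiv _ _).symm
      ((Scheme.Modules.restrictAdjunction U.ι).homEquiv _ _ e.hom))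
    rw [Equiv.symm_apply_apply]
    infer_instance
  let Z := f.base ⁻¹ᵁ U
  let c₂ : Pair.mk Z (structSheaf Z) ⟶ Pair.mk U (structSheaf U) :=
    Pair.Hom.mk (P := ⟨Z, structSheaf Z⟩) (Q := ⟨U, structSheaf U⟩) (f.base ∣_ U)
      (SheafOfModules.unitToPushforwardObjUnit (f.base ∣_ U).toRingCatSheafHom)
  have hc₂ : Pair.IsCart c₂ := isCart_unit _
  obtain ⟨k, hk, hkf⟩ := Pair.exists_lift hf (c₂ ≫ c₁) Z.ι (morphismRestrict_ι f.base U).symm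
  have i₂ : IsOpenImmersion k.base := by rw [hk]; infer_instance
  have hkc : Pair.IsCart k := by
    rw [← Pair.isCart_comp_iff k hf, hkf, Pair.isCart_comp_iff _ hc₁]
    exact hc₂
  -- Stated for every `g` equal to the composite, so that it applies to `k ≫ f`, whose sections live
  -- over a different expression for the same open set.
  have h1 : ∀ (g : Pair.mk Z (structSheaf Z) ⟶ Q), g = c₂ ≫ c₁ →
      (show Γ(Z, g.base ⁻¹ᵁ U) from g.map.app U m) = 1 := by
    rintro _ rfl
    have hle : U.ι ''ᵁ (U.ι ⁻¹ᵁ U) ≤ U := U.ι.image_preimage_le U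
    have h2 : (show Γ(U, U.ι ⁻¹ᵁ U) from c₁.map.app U m) = 1 := by
      refine Eq.trans (b := (show Γ(U, U.ι ⁻¹ᵁ U) from
        e.hom.app (U.ι ⁻¹ᵁ U) (show Γ(Q.sheaf, U.ι ''ᵁ U.ι ⁻¹ᵁ U) from rs Q.sheaf hle m))) ?_ ?_
      · change ((Scheme.Modules.restrictAdjunction U.ι).homEquiv _ _ e.hom).app U m = _
        rw [Adjunction.homEquiv_unit]
        rfl
      · exact he _ hle
    exact (congrArg (c₂.map.app (U.ι ⁻¹ᵁ U)) h2).trans (map_one ((f.base ∣_ U).app _).hom)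
  intro V hV
  have hV' : V ≤ k.base.opensRange := by
    rw [show k.base.opensRange = Z by simp [hk]]
    exact hV
  have hb := app_bijective_of_isCart k hkc hV'
  have hb2 : Function.Bijective (k.base.app V) := by
    have := k.base.isIso_app V hV'
    exact (ConcreteCategory.isIso_iff_bijective _).1 this
  refine (Function.Bijective.of_comp_iff' hb _).1 ?_
  refine (congrArg Function.Bijective (funext fun a => ?_)).mp hb2
  have h2 : (show Γ(Z, k.base ⁻¹ᵁ f.base ⁻¹ᵁ U) from k.map.app _ (f.map.app U m)) = 1 :=
    h1 _ hkf
  have h3 : k.map.app V (rs P.sheaf hV (f.map.app U m)) = (1 : Γ(Z, k.base ⁻¹ᵁ V)) := by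
    refine (app_rs k.map hV _).trans ?_
    refine (congrArg (rs ((Scheme.Modules.pushforward k.base).obj (structSheaf Z)) hV) h2).trans ?_
    exact map_one (ro (X := Z) (U := k.base ⁻¹ᵁ f.base ⁻¹ᵁ U) (V := k.base ⁻¹ᵁ V)
      (k.base.preimage_mono hV))
  have h4 := k.map.app_smul (U := V) a (rs P.sheaf hV (f.map.app U m))
  refine Eq.trans ?_ h4.symm
  refine Eq.trans ?_ (congrArg (fun y : Γ(Z, k.base ⁻¹ᵁ V) => k.base.app V a * y) h3.symm)
  exact (mul_one (M := Γ(Z, k.base ⁻¹ᵁ V)) _).symm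

end CartGenerators

/-! ### Local structure of a deformation -/

section StructHom

lemma structHom_ext {Y : Scheme.{0}} {R : CommRingCat.{0}} {f g : Y ⟶ Spec R}
    (h : ∀ c : R, structHom f ⊤ c = structHom g ⊤ c) : f = g := by
  have key : ∀ f : Y ⟶ Spec R, ∀ c : R, structHom f ⊤ c =
      f.appTop ((Scheme.ΓSpecIso R).inv c) := by
    intro f c
    exact ro_self (le_refl (⊤ : Y.Opens)) _
  refine ext_of_isAffine ?_
  rw [← cancel_epi (Scheme.ΓSpecIso R).inv]
  ext c
  exact (key f c).symm.trans ((h c).trans (key g c))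

lemma ro_structHom {Y : Scheme.{0}} {R : CommRingCat.{0}} (f : Y ⟶ Spec R) {U V : Y.Opens}
    (h : V ≤ U) (c : R) : ro h (structHom f U c) = structHom f V c :=
  map_structHom f (homOfLE h) c

lemma app_ro {Y Z : Scheme.{0}} (f : Y ⟶ Z) {U V : Z.Opens} (h : V ≤ U) (a : Γ(Z, U)) :
    f.app V (ro h a) = ro (f.preimage_mono h) (f.app U a) :=
  congr($(f.naturality (homOfLE h).op) a)

end StructHom

section InfAlg

variable {V : Type} [AddCommGroup V] [Module ℂ V] [Module ℂᵐᵒᵖ V] [IsCentralScalar ℂ V]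
  [FiniteDimensional ℂ V]

lemma aug_infAlg (x : TrivSqZeroExt ℂ V) : (infAlg V).aug x = x.fst := by
  have := (infAlg V).aug_unique (TrivSqZeroExt.fstHom ℂ ℂ V)
  rw [← this]
  rfl

lemma surjective_aug (A : ArtAlg) : Function.Surjective A.aug := fun c =>
  ⟨algebraMap ℂ A.carrier c, A.aug.commutes c⟩

lemma surjective_point (A : ArtAlg) : Surjective A.point := by
  refine ⟨fun y => ⟨IsLocalRing.closedPoint ℂ, ?_⟩⟩
  have : Subsingleton (PrimeSpectrum A.carrier) := inferInstance
  exact Subsingleton.elim (α := PrimeSpectrum A.carrier) _ _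

end InfAlg

namespace Deformation

variable {X : Scheme.{0}} [X.Over SpecC] {L : X.Modules}

section General

variable {A : ArtAlg} (D : Deformation X L A)

instance isClosedImmersion_i : IsClosedImmersion D.i :=
  MorphismProperty.of_isPullback D.isPullback.flip
    (IsClosedImmersion.spec_of_surjective _ (surjective_aug A))

instance surjective_i : Surjective D.i :=
  MorphismProperty.of_isPullback D.isPullback.flip (surjective_point A)

/-- `Spec A` has a single point, so the closed immersion `i` is surjective. Open subsets of `X` are
therefore the preimages of open subsets of the total space. -/
lemma isHomeomorph_i : IsHomeomorph D.i := by
  have h := (isClosedImmersion_i D).isClosedEmbedding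
  exact (isHomeomorph_iff_isEmbedding_surjective).2 ⟨h.isEmbedding, D.i.surjective⟩

lemma exists_preimage_eq (W : X.Opens) : ∃ U : D.total.scheme.Opens, D.i ⁻¹ᵁ U = W := by
  have h := (isClosedImmersion_i D).isClosedEmbedding.isInducing
  obtain ⟨s, hs, h2⟩ := h.isOpen_iff.1 W.2
  exact ⟨⟨s, hs⟩, Opens.ext h2⟩

lemma preimage_le_iff {U U' : D.total.scheme.Opens} : D.i ⁻¹ᵁ U ≤ D.i ⁻¹ᵁ U' ↔ U ≤ U' := by
  refine ⟨fun h x hx => ?_, fun h => D.i.preimage_mono h⟩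
  obtain ⟨y, rfl⟩ := D.i.surjective x
  exact h hx

end General

section Inf

variable {V : Type} [AddCommGroup V] [Module ℂ V] [Module ℂᵐᵒᵖ V] [IsCentralScalar ℂ V]
  [FiniteDimensional ℂ V] (D : Deformation X L (infAlg V))

/-- The function on an open subset of the total space given by an infinitesimal element. -/
def vFun (U : D.total.scheme.Opens) (v : V) : Γ(D.total.scheme, U) :=
  structHom D.proj U (show TrivSqZeroExt ℂ V from TrivSqZeroExt.inr v)

lemma vFun_zero (U : D.total.scheme.Opens) : D.vFun U 0 = 0 :=
  (congrArg (structHom D.proj U) (TrivSqZeroExt.inr_zero ℂ)).trans (map_zero _)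

lemma vFun_add (U : D.total.scheme.Opens) (v w : V) :
    D.vFun U (v + w) = D.vFun U v + D.vFun U w :=
  (congrArg (structHom D.proj U) (TrivSqZeroExt.inr_add ℂ v w)).trans (map_add _ _ _)

lemma vFun_smul (U : D.total.scheme.Opens) (c : ℂ) (v : V) :
    D.vFun U (c • v) = algebraMap ℂ Γ(D.total.scheme, U) c * D.vFun U v := by
  have h1 : (TrivSqZeroExt.inr (c • v) : TrivSqZeroExt ℂ V) =
      TrivSqZeroExt.inl c * TrivSqZeroExt.inr v := by
    ext <;> simp
  refine (congrArg (structHom D.proj U) h1).trans ((map_mul _ _ _).trans ?_)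
  refine congrArg (· * D.vFun U v) ?_
  exact (structHom_comp_specMap D.proj
    (CommRingCat.ofHom (algebraMap ℂ (infAlg V).carrier)) U c).symm

lemma vFun_mul_vFun (U : D.total.scheme.Opens) (v w : V) : D.vFun U v * D.vFun U w = 0 :=
  (map_mul (structHom D.proj U) _ _).symm.trans
    ((congrArg (structHom D.proj U) (TrivSqZeroExt.inr_mul_inr ℂ v w)).trans (map_zero _))

lemma ro_vFun {U U' : D.total.scheme.Opens} (h : U' ≤ U) (v : V) :
    ro h (D.vFun U v) = D.vFun U' v :=
  ro_structHom D.proj h _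

lemma i_app_structHom (U : D.total.scheme.Opens) (x : TrivSqZeroExt ℂ V) :
    D.i.app U (structHom D.proj U x) = algebraMap ℂ Γ(X, D.i ⁻¹ᵁ U) x.fst := by
  refine (app_structHom D.i D.proj U _).trans ?_
  rw [i_proj]
  refine (structHom_comp_specMap (X ↘ SpecC)
    (CommRingCat.ofHom (infAlg V).aug.toRingHom) _ _).trans ?_
  exact congrArg (structHom (X ↘ SpecC) (D.i ⁻¹ᵁ U)) (aug_infAlg x)

lemma i_app_vFun (U : D.total.scheme.Opens) (v : V) : D.i.app U (D.vFun U v) = 0 :=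
  (D.i_app_structHom U _).trans (map_zero _)

variable {ι : Type} [Fintype ι] (b : Module.Basis ι ℂ V)

lemma vFun_eq_sum (U : D.total.scheme.Opens) (v : V) :
    D.vFun U v = ∑ k, algebraMap ℂ Γ(D.total.scheme, U) (b.repr v k) * D.vFun U (b k) := by
  let f : V →+ Γ(D.total.scheme, U) := ⟨⟨D.vFun U, D.vFun_zero U⟩, D.vFun_add U⟩
  calc D.vFun U v = f (∑ k, b.repr v k • b k) := by rw [b.sum_repr]; rfl
    _ = _ := by
      rw [map_sum]
      exact Finset.sum_congr rfl fun k _ => D.vFun_smul U _ _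

/-- The kernel of the restriction of functions to the closed fibre, on affine open subsets. -/
lemma exists_sum_eq_of_isAffineOpen {U : D.total.scheme.Opens} (hU : IsAffineOpen U)
    {a : Γ(D.total.scheme, U)} (ha : D.i.app U a = 0) :
    ∃ c : ι → Γ(D.total.scheme, U), a = ∑ k, D.vFun U (b k) * c k := by
  -- On the closed subscheme of `U` defined by `J` all elements of `V` vanish, so it lies over the
  -- closed point and, by the cartesian square, maps to `X`. A function that vanishes on `X`
  -- vanishes on this subscheme and so belongs to `J`.
  let J : Ideal Γ(D.total.scheme, U) := Ideal.span (Set.range fun k => D.vFun U (b k))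
  let q : Γ(D.total.scheme, U) ⟶ CommRingCat.of (Γ(D.total.scheme, U) ⧸ J) :=
    CommRingCat.ofHom (Ideal.Quotient.mk J)
  let h : Spec (CommRingCat.of (Γ(D.total.scheme, U) ⧸ J)) ⟶ D.total.scheme :=
    Spec.map q ≫ hU.fromSpec
  have hU' : h ⁻¹ᵁ U = ⊤ := by
    rw [Scheme.Hom.comp_preimage, hU.fromSpec_preimage_self, Scheme.Hom.preimage_top]
  have happ : ∀ x, h.app U x = 0 ↔ x ∈ J := by
    intro x
    have h0 : h.app U = q ≫ (Scheme.ΓSpecIso _).inv ≫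
        (Spec (CommRingCat.of (Γ(D.total.scheme, U) ⧸ J))).presheaf.map (eqToHom hU').op := by
      rw [Scheme.Hom.comp_app, hU.fromSpec_app_self, Category.assoc, Scheme.Hom.naturality,
        Scheme.ΓSpecIso_inv_naturality_assoc]
      rfl
    have hinj : Function.Injective ((Scheme.ΓSpecIso _).inv ≫
        (Spec (CommRingCat.of (Γ(D.total.scheme, U) ⧸ J))).presheaf.map (eqToHom hU').op) :=
      ((ConcreteCategory.isIso_iff_bijective _).1 inferInstance).1
    rw [h0]
    refine Iff.trans ?_ (Ideal.Quotient.eq_zero_iff_mem (I := J) (a := x))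
    exact map_eq_zero_iff (CommRingCat.Hom.hom ((Scheme.ΓSpecIso _).inv ≫
        (Spec (CommRingCat.of (Γ(D.total.scheme, U) ⧸ J))).presheaf.map (eqToHom hU').op)) hinj
  have hv : ∀ v, h.app U (D.vFun U v) = 0 := by
    intro v
    rw [happ, D.vFun_eq_sum b]
    exact J.sum_mem fun k _ => J.mul_mem_left _ (Ideal.subset_span ⟨k, rfl⟩)
  have hw : h ≫ D.proj = (h ≫ D.proj ≫ (infAlg V).toSpecC) ≫ (infAlg V).point := by
    have hv' : ∀ v, structHom (h ≫ D.proj) ⊤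
        (show TrivSqZeroExt ℂ V from TrivSqZeroExt.inr v) = 0 := fun v => by
      refine (ro_structHom (h ≫ D.proj) hU'.ge _).symm.trans ?_
      refine (congrArg (ro hU'.ge) (app_structHom h D.proj U _)).symm.trans ?_
      exact (congrArg (ro hU'.ge) (hv v)).trans (map_zero _)
    refine structHom_ext fun (c : TrivSqZeroExt ℂ V) => ?_
    have h1 : structHom ((h ≫ D.proj ≫ (infAlg V).toSpecC) ≫ (infAlg V).point) ⊤ c =
        structHom (h ≫ D.proj) ⊤ (TrivSqZeroExt.inl c.fst : TrivSqZeroExt ℂ V) := by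
      refine (structHom_comp_specMap _ _ _ _).trans ?_
      rw [← Category.assoc]
      refine (structHom_comp_specMap _ _ _ _).trans ?_
      exact congrArg (fun z : ℂ => structHom (h ≫ D.proj) ⊤
        (TrivSqZeroExt.inl z : TrivSqZeroExt ℂ V)) (aug_infAlg c)
    rw [h1]
    conv_lhs => rw [← TrivSqZeroExt.inl_fst_add_inr_snd_eq c]
    refine (map_add (structHom (h ≫ D.proj) ⊤) (TrivSqZeroExt.inl c.fst : TrivSqZeroExt ℂ V)
      (TrivSqZeroExt.inr c.snd : TrivSqZeroExt ℂ V)).trans ?_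
    exact (congrArg (_ + ·) (hv' c.snd)).trans (add_zero _)
  let l := D.isPullback.lift h (h ≫ D.proj ≫ (infAlg V).toSpecC) hw
  have hl : l ≫ D.i = h := D.isPullback.lift_fst _ _ _
  have haJ : a ∈ J := by
    rw [← happ, ← hl, Scheme.Hom.comp_app]
    exact (congrArg (l.app _) ha).trans (map_zero (l.app _).hom)
  obtain ⟨c, hc⟩ := (Ideal.mem_span_range_iff_exists_fun).1 haJ
  exact ⟨c, by simp_rw [mul_comm _ (c _), hc]⟩

/-- Here flatness is used, through the equational criterion: a relation `∑ v_k c_k = 0` comes from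
relations `∑ v_k a_kj = 0` in `ℂ[V]`. As the `v_k` are linearly independent and `V² = 0`, the `a_kj`
have zero constant term, and `c_k = ∑ a_kj y_j` vanishes on `X`. -/
lemma app_eq_zero_of_isAffineOpen {U : D.total.scheme.Opens} (hU : IsAffineOpen U)
    {c : ι → Γ(D.total.scheme, U)} (hc : ∑ k, D.vFun U (b k) * c k = 0) (k : ι) :
    D.i.app U (c k) = 0 := by
  have := D.flat
  have hf : (structHom D.proj U).Flat := by
    have h1 := D.proj.flat_appLE (isAffineOpen_top _) hU le_top
    have h2 : ((Scheme.ΓSpecIso (infAlg V).ring).inv).hom.Flat :=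
      RingHom.Flat.of_bijective ((ConcreteCategory.isIso_iff_bijective _).1 inferInstance)
    exact h2.comp h1
  let φ : TrivSqZeroExt ℂ V →+* Γ(D.total.scheme, U) := structHom D.proj U
  let := φ.toAlgebra
  have : Module.Flat (TrivSqZeroExt ℂ V) Γ(D.total.scheme, U) := hf
  obtain ⟨l, a, y, h1, h2⟩ := Module.Flat.isTrivialRelation_of_sum_smul_eq_zero
    (R := TrivSqZeroExt ℂ V) (f := fun k => TrivSqZeroExt.inr (b k)) (x := c) hc
  have h3 : ∀ j i, (a i j).fst = 0 := by
    intro j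
    refine Fintype.linearIndependent_iff.1 b.linearIndependent (fun i => (a i j).fst) ?_
    have := congrArg (TrivSqZeroExt.sndHom ℂ V) (h2 j)
    rw [map_sum] at this
    simpa using this
  rw [h1 k, map_sum]
  refine Finset.sum_eq_zero fun j _ => ?_
  have h4 := D.i_app_structHom U (a k j)
  rw [h3, map_zero] at h4
  refine (map_mul (D.i.app U).hom _ _).trans ?_
  exact (congrArg (· * D.i.app U (y j)) h4).trans (zero_mul _)

end Inf
end Deformation

namespace Deformation

/-! ### Restriction of sections to the closed fibre -/

variable {X : Scheme.{0}} [X.Over SpecC] {L : X.Modules}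

section General

variable {A : ArtAlg} (D : Deformation X L A)

/-- Restriction of functions to the closed fibre. -/
def io (U : D.total.scheme.Opens) : Γ(D.total.scheme, U) →+* Γ(X, D.i ⁻¹ᵁ U) := (D.i.app U).hom

/-- Restriction of sections of the line bundle to the closed fibre. -/
def rl (U : D.total.scheme.Opens) : Γ(D.total.sheaf, U) →+ Γ(L, D.i ⁻¹ᵁ U) := (D.res.app U).hom

lemma io_ro {U V : D.total.scheme.Opens} (h : V ≤ U) (a : Γ(D.total.scheme, U)) :
    D.io V (ro h a) = ro (D.i.preimage_mono h) (D.io U a) :=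
  app_ro D.i h a

lemma rl_rs {U V : D.total.scheme.Opens} (h : V ≤ U) (t : Γ(D.total.sheaf, U)) :
    D.rl V (rs _ h t) = rs L (D.i.preimage_mono h) (D.rl U t) :=
  app_rs D.res h t

lemma rl_smul (U : D.total.scheme.Opens) (a : Γ(D.total.scheme, U)) (t : Γ(D.total.sheaf, U)) :
    D.rl U (a • t) = D.io U a • D.rl U t :=
  D.res_smul U a t

/-- Functions on the closed fibre lift locally. -/
lemma exists_io_eq {W : X.Opens} (f : Γ(X, W)) {x : X} (hx : x ∈ W) :
    ∃ (U : D.total.scheme.Opens) (h : D.i ⁻¹ᵁ U ≤ W), x ∈ D.i ⁻¹ᵁ U ∧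
      ∃ a : Γ(D.total.scheme, U), D.io U a = ro h f := by
  obtain ⟨U₀, rfl⟩ := D.exists_preimage_eq W
  obtain ⟨U, hU, hxU, hle⟩ := Opens.isBasis_iff_nbhd.1 D.total.scheme.isBasis_affineOpens
    (U := U₀) (x := D.i x) hx
  obtain ⟨a, ha⟩ := D.i.app_surjective U hU (ro (D.i.preimage_mono hle) f)
  exact ⟨U, D.i.preimage_mono hle, hxU, a, ha⟩

lemma exists_isGen (x : X) : ∃ (U : D.total.scheme.Opens), x ∈ D.i ⁻¹ᵁ U ∧
    ∃ m : Γ(D.total.sheaf, U), IsGen D.total.sheaf m ∧ IsGen L (D.rl U m) := by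
  obtain ⟨U, hx, m, hm⟩ := D.isLineBundle.exists_isGen (D.i x)
  exact ⟨U, hx, m, hm, hm.of_isCart D.isCart⟩

/-- Sections of the line bundle on the closed fibre lift locally. -/
lemma exists_rl_eq {W : X.Opens} (l : Γ(L, W)) {x : X} (hx : x ∈ W) :
    ∃ (U : D.total.scheme.Opens) (h : D.i ⁻¹ᵁ U ≤ W), x ∈ D.i ⁻¹ᵁ U ∧
      ∃ t : Γ(D.total.sheaf, U), D.rl U t = rs L h l := by
  obtain ⟨U₀, hxU₀, m, -, hm⟩ := D.exists_isGen x
  obtain ⟨f, hf⟩ := (hm (D.i ⁻¹ᵁ U₀ ⊓ W) inf_le_left).2 (rs L inf_le_right l)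
  obtain ⟨U, hU, hxU, a, ha⟩ := D.exists_io_eq f ⟨hxU₀, hx⟩
  have hle : U ≤ U₀ := D.preimage_le_iff.1 (hU.trans inf_le_left)
  refine ⟨U, hU.trans inf_le_right, hxU, a • rs _ hle m, ?_⟩
  rw [rl_smul, rl_rs, ha]
  have := congrArg (rs L hU) hf
  simpa using this

end General

section Inf

variable {V : Type} [AddCommGroup V] [Module ℂ V] [Module ℂᵐᵒᵖ V] [IsCentralScalar ℂ V]
  [FiniteDimensional ℂ V] (D : Deformation X L (infAlg V))

lemma io_vFun (U : D.total.scheme.Opens) (v : V) : D.io U (D.vFun U v) = 0 := D.i_app_vFun U v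

lemma rl_vFun_smul (U : D.total.scheme.Opens) (v : V) (t : Γ(D.total.sheaf, U)) :
    D.rl U (D.vFun U v • t) = 0 := by
  rw [rl_smul, io_vFun, zero_smul]

lemma rs_vFun_smul {U U' : D.total.scheme.Opens} (h : U' ≤ U) (v : V) (t : Γ(D.total.sheaf, U)) :
    rs _ h (D.vFun U v • t) = D.vFun U' v • rs _ h t := by
  rw [rs_smul, ro_vFun]

variable {ι : Type} [Fintype ι] (b : Module.Basis ι ℂ V)

lemma exists_sum_eq_of_io_eq_zero {U : D.total.scheme.Opens} {a : Γ(D.total.scheme, U)}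
    (ha : D.io U a = 0) {x : D.total.scheme} (hx : x ∈ U) :
    ∃ (U' : D.total.scheme.Opens) (h : U' ≤ U), x ∈ U' ∧
      ∃ c : ι → Γ(D.total.scheme, U'), ro h a = ∑ k, D.vFun U' (b k) * c k := by
  obtain ⟨U', hU, hxU, hle⟩ := Opens.isBasis_iff_nbhd.1 D.total.scheme.isBasis_affineOpens hx
  refine ⟨U', hle, hxU, D.exists_sum_eq_of_isAffineOpen b hU ?_⟩
  exact (D.io_ro hle a).trans ((congrArg _ ha).trans (map_zero _))

lemma io_eq_zero_of_sum_eq_zero {U : D.total.scheme.Opens}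
    {c : ι → Γ(D.total.scheme, U)} (hc : ∑ k, D.vFun U (b k) * c k = 0) (k : ι) :
    D.io U (c k) = 0 := by
  refine ro_ext fun x hx => ?_
  obtain ⟨U', hU, hxU, hle⟩ := Opens.isBasis_iff_nbhd.1 D.total.scheme.isBasis_affineOpens
    (U := U) (x := D.i x) hx
  refine ⟨D.i ⁻¹ᵁ U', D.i.preimage_mono hle, hxU, ?_⟩
  rw [← io_ro, map_zero]
  refine D.app_eq_zero_of_isAffineOpen b hU (c := fun k => ro hle (c k)) ?_ k
  have := congrArg (ro hle) hc
  simpa [ro_vFun] using this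

/-- A generator of `ℒ` restricts to a generator of `L`, so the coefficient of `t` vanishes on `X` as
soon as `t` does; the kernel on functions is known. -/
lemma exists_sum_eq_of_rl_eq_zero {U : D.total.scheme.Opens} {t : Γ(D.total.sheaf, U)}
    (ht : D.rl U t = 0) {x : X} (hx : x ∈ D.i ⁻¹ᵁ U) :
    ∃ (U' : D.total.scheme.Opens) (h : U' ≤ U), x ∈ D.i ⁻¹ᵁ U' ∧
      ∃ c : ι → Γ(D.total.sheaf, U'), rs _ h t = ∑ k, D.vFun U' (b k) • c k := by
  obtain ⟨U₀, hxU₀, m, hm, hm'⟩ := D.exists_isGen x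
  obtain ⟨a, ha⟩ := (hm (U₀ ⊓ U) inf_le_left).2 (rs _ inf_le_right t)
  have ha0 : D.io _ a = 0 := by
    refine (hm' _ (D.i.preimage_mono inf_le_left)).1 ?_
    have h := congrArg (D.rl _) ha
    dsimp only at h ⊢
    rw [rl_smul, rl_rs, rl_rs, ht, map_zero] at h
    rw [h, zero_smul]
  obtain ⟨U', h', hxU', c, hc⟩ := D.exists_sum_eq_of_io_eq_zero b ha0 (x := D.i x) ⟨hxU₀, hx⟩
  refine ⟨U', h'.trans inf_le_right, hxU', fun k => c k • rs _ (h'.trans inf_le_left) m, ?_⟩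
  have := congrArg (rs _ h') ha
  simp only [rs_smul, rs_rs, hc, Finset.sum_smul, mul_smul] at this
  exact this.symm

lemma rl_eq_zero_of_sum_eq_zero {U : D.total.scheme.Opens}
    {c : ι → Γ(D.total.sheaf, U)} (hc : ∑ k, D.vFun U (b k) • c k = 0) (k : ι) :
    D.rl U (c k) = 0 := by
  refine rs_ext fun x hx => ?_
  obtain ⟨U₀, hxU₀, m, hm, hm'⟩ := D.exists_isGen x
  have hle : U₀ ⊓ U ≤ U := inf_le_right
  refine ⟨D.i ⁻¹ᵁ (U₀ ⊓ U), D.i.preimage_mono hle, ⟨hxU₀, hx⟩, ?_⟩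
  rw [← D.rl_rs hle, map_zero]
  choose a ha using fun k => (hm (U₀ ⊓ U) inf_le_left).2 (rs _ inf_le_right (c k))
  dsimp only at ha
  have h1 : ∑ k, D.vFun (U₀ ⊓ U) (b k) * a k = 0 := by
    refine (hm (U₀ ⊓ U) inf_le_left).1 ?_
    dsimp only
    have := congrArg (rs _ hle) hc
    simp only [map_sum, rs_vFun_smul, map_zero] at this
    simpa only [Finset.sum_smul, mul_smul, ha, zero_smul] using this
  rw [← ha, rl_smul, D.io_eq_zero_of_sum_eq_zero b h1, zero_smul]

/-! ### Factoring through the restriction to the closed fibre -/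

variable {N : X.Modules}

lemma secHom_eq_zero_of_rl_eq_zero
    {Δ : D.total.sheaf.presheaf ⟶ ((Scheme.Modules.pushforward D.i).obj N).presheaf}
    (hΔ : ∀ U v t, secHom Δ U (D.vFun U v • t) = 0) {U : D.total.scheme.Opens}
    {t : Γ(D.total.sheaf, U)} (ht : D.rl U t = 0) :
    (show Γ(N, D.i ⁻¹ᵁ U) from secHom Δ U t) = 0 := by
  refine rs_ext fun x hx => ?_
  obtain ⟨U', h, hxU, c, hc⟩ := D.exists_sum_eq_of_rl_eq_zero (Module.finBasis ℂ V) ht hx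
  refine ⟨_, D.i.preimage_mono h, hxU, ?_⟩
  refine (secHom_rs Δ h t).symm.trans ?_
  rw [hc, map_sum, map_zero]
  exact Finset.sum_eq_zero fun k _ => hΔ _ _ _

/-- An additive map on `ℒ` which kills `V ℒ` factors through the restriction to the closed
fibre. -/
lemma exists_factor
    (Δ : D.total.sheaf.presheaf ⟶ ((Scheme.Modules.pushforward D.i).obj N).presheaf)
    (hΔ : ∀ U v t, secHom Δ U (D.vFun U v • t) = 0) :
    ∃ g : L.presheaf ⟶ N.presheaf, ∀ (U : D.total.scheme.Opens) (t : Γ(D.total.sheaf, U)),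
      secHom g (D.i ⁻¹ᵁ U) (D.rl U t) = secHom Δ U t := by
  -- `P W l n` says that `n` is the value of `Δ` on every local lift of `l`. There is at most one
  -- such `n`, because lifts exist locally, and there is one locally, because two lifts differ by a
  -- section of `V ℒ`, which `Δ` kills.
  let P : ∀ (W : X.Opens), Γ(L, W) → Γ(N, W) → Prop := fun W l n =>
    ∀ (U : D.total.scheme.Opens) (h : D.i ⁻¹ᵁ U ≤ W) (t : Γ(D.total.sheaf, U)),
      D.rl U t = rs L h l → secHom Δ U t = rs N h n
  have hP : ∀ (W : X.Opens) (l : Γ(L, W)), ∃! n, P W l n := by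
    intro W l
    have huniq : ∀ (Z : X.Opens) (hZ : Z ≤ W) (s t : Γ(N, Z)), P Z (rs L hZ l) s →
        P Z (rs L hZ l) t → s = t := by
      intro Z hZ s t hs ht
      refine rs_ext fun x hx => ?_
      obtain ⟨U, hU, hxU, t', ht'⟩ := D.exists_rl_eq (rs L hZ l) hx
      exact ⟨_, hU, hxU, (hs U hU t' ht').symm.trans (ht U hU t' ht')⟩
    obtain ⟨n, hn⟩ := exists_rs (M := N) (U := W) (fun Z hZ n => P Z (rs L hZ l) n)
      (fun Z Z' hZ h s hs U hU t ht => by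
        rw [rs_rs] at ht
        rw [rs_rs]
        exact hs U (hU.trans h) t (by rw [ht, rs_rs])) huniq
      (fun x hx => by
        obtain ⟨U, hU, hxU, t, ht⟩ := D.exists_rl_eq l hx
        refine ⟨_, hU, hxU, secHom Δ U t, fun U' hU' t' ht' => ?_⟩
        have h1 : D.rl U' (t' - rs _ (D.preimage_le_iff.1 hU') t) = 0 := by
          rw [map_sub, rl_rs, ht, ht', sub_self]
        have h2 := D.secHom_eq_zero_of_rl_eq_zero hΔ h1
        have h3 : secHom Δ U' t' - secHom Δ U' (rs _ (D.preimage_le_iff.1 hU') t) = 0 :=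
          (map_sub (secHom Δ U') _ _).symm.trans h2
        exact (sub_eq_zero.1 h3).trans (secHom_rs Δ _ t))
    refine ⟨n, fun U h t ht => ?_, fun n' hn' => ?_⟩
    · refine rs_ext (M := N) (s := secHom Δ U t) fun x hx => ?_
      obtain ⟨Z, hZ, hxZ, hPZ⟩ := hn x (h hx)
      obtain ⟨Z, rfl⟩ := D.exists_preimage_eq Z
      have h1 : Z ⊓ U ≤ U := inf_le_right
      have h2 : D.i ⁻¹ᵁ (Z ⊓ U) ≤ D.i ⁻¹ᵁ Z := D.i.preimage_mono inf_le_left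
      refine ⟨_, D.i.preimage_mono h1, ⟨hxZ, hx⟩, ?_⟩
      refine (secHom_rs Δ h1 t).symm.trans ((hPZ _ h2 (rs _ h1 t) ?_).trans ?_)
      · rw [rl_rs, ht, rs_rs, rs_rs]
      · rw [rs_rs, rs_rs]
    · refine rs_ext fun x hx => ?_
      obtain ⟨U, hU, hxU, t, ht⟩ := D.exists_rl_eq l hx
      obtain ⟨Z, hZ, hxZ, hPZ⟩ := hn x hx
      obtain ⟨Z, rfl⟩ := D.exists_preimage_eq Z
      have h1 : Z ⊓ U ≤ U := inf_le_right
      have h2 : D.i ⁻¹ᵁ (Z ⊓ U) ≤ D.i ⁻¹ᵁ Z := D.i.preimage_mono inf_le_left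
      have h3 : D.rl _ (rs _ h1 t) = rs L (h2.trans hZ) l := by
        rw [rl_rs, ht, rs_rs]
      refine ⟨_, h2.trans hZ, ⟨hxZ, hxU⟩, ?_⟩
      rw [← hn' _ (h2.trans hZ) _ h3, hPZ _ h2 _ (by rw [h3, rs_rs]), rs_rs]
  choose g hg hg' using hP
  -- To identify a value of `g`, one lift near each point suffices.
  have hloc : ∀ (W : X.Opens) (l : Γ(L, W)) (n : Γ(N, W)), (∀ x ∈ W,
      ∃ (U : D.total.scheme.Opens) (h : D.i ⁻¹ᵁ U ≤ W), x ∈ D.i ⁻¹ᵁ U ∧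
        ∃ t : Γ(D.total.sheaf, U), D.rl U t = rs L h l ∧ secHom Δ U t = rs N h n) →
      g W l = n := fun W l n h => by
    refine rs_ext fun x hx => ?_
    obtain ⟨U, hU, hxU, t, ht, hn⟩ := h x hx
    exact ⟨_, hU, hxU, (hg W l U hU t ht).symm.trans hn⟩
  have hadd : ∀ W l l', g W (l + l') = g W l + g W l' := fun W l l' => by
    refine hloc _ _ _ fun x hx => ?_
    obtain ⟨U, hU, hxU, t, ht⟩ := D.exists_rl_eq l hx
    obtain ⟨U', hU', hxU', t', ht'⟩ := D.exists_rl_eq l' hx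
    have h1 : U ⊓ U' ≤ U := inf_le_left
    have h2 : U ⊓ U' ≤ U' := inf_le_right
    have hle := (D.i.preimage_mono h1).trans hU
    have h3 : D.rl _ (rs _ h1 t) = rs L hle l := by rw [rl_rs, ht, rs_rs]
    have h4 : D.rl _ (rs _ h2 t') = rs L hle l' := by rw [rl_rs, ht', rs_rs]
    refine ⟨U ⊓ U', hle, ⟨hxU, hxU'⟩, rs _ h1 t + rs _ h2 t', ?_, ?_⟩
    · rw [map_add, map_add, h3, h4]
    · rw [map_add, map_add, ← hg _ _ _ hle _ h3, ← hg _ _ _ hle _ h4]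
      rfl
  refine ⟨{ app := fun W => AddCommGrpCat.ofHom (AddMonoidHom.mk' (g W.unop) (hadd W.unop))
            naturality := fun W W' f => ?_ }, fun U t => ?_⟩
  · refine AddCommGrpCat.hom_ext (AddMonoidHom.ext fun (l : Γ(L, W.unop)) => ?_)
    change g W'.unop (rs L (leOfHom f.unop) l) = rs N (leOfHom f.unop) (g W.unop l)
    refine hloc _ _ _ fun x hx => ?_
    obtain ⟨U, hU, hxU, t, ht⟩ := D.exists_rl_eq (rs L (leOfHom f.unop) l) hx
    refine ⟨U, hU, hxU, t, ht, ?_⟩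
    rw [rs_rs]
    exact hg _ _ U _ t (by rw [ht, rs_rs])
  · refine ((hg _ (D.rl U t) U le_rfl t ?_).trans ?_).symm
    · rw [rs_self]
    · rw [rs_self]; rfl

/-- Both identities may be checked locally, where sections of `L` and functions on `X` lift to the
total space and the identities of `Δ` apply. -/
lemma isDiffOpSheaf_of_factor
    {Δ : D.total.sheaf.presheaf ⟶ ((Scheme.Modules.pushforward D.i).obj N).presheaf}
    (hΔ : IsDiffOpSheaf Δ) {g : L.presheaf ⟶ N.presheaf}
    (h : ∀ (U : D.total.scheme.Opens) (t : Γ(D.total.sheaf, U)),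
      secHom g (D.i ⁻¹ᵁ U) (D.rl U t) = secHom Δ U t) : IsDiffOpSheaf g := fun W =>
  { const := fun c l => by
      refine rs_ext fun x hx => ?_
      obtain ⟨U, hU, hxU, t, ht⟩ := D.exists_rl_eq l hx
      refine ⟨_, hU, hxU, ?_⟩
      have h1 := (hΔ U).const c t
      have h2 : D.io U (algebraMap ℂ _ c) = algebraMap ℂ _ c := D.i_app_algebraMap U c
      have h3 : ro hU (algebraMap ℂ Γ(X, W) c) = algebraMap ℂ _ c := map_algebraMap (homOfLE hU) c
      rw [RingHom.id_apply, ← secHom_rs, rs_smul, rs_smul, ← secHom_rs, ← ht, h, h3]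
      have h4 := h U (algebraMap ℂ Γ(D.total.scheme, U) c • t)
      rw [rl_smul, h2] at h4
      refine h4.trans (h1.trans ?_)
      exact congrArg (fun a : Γ(X, D.i ⁻¹ᵁ U) => a • (show Γ(N, D.i ⁻¹ᵁ U) from secHom Δ U t)) h2
    leibniz := fun a a' l => by
      refine rs_ext fun x hx => ?_
      obtain ⟨U, hU, hxU, t, ht⟩ := D.exists_rl_eq l hx
      obtain ⟨U', hU', hxU', c, hc⟩ := D.exists_io_eq (ro hU a) hxU
      obtain ⟨U'', hU'', hxU'', c', hc'⟩ := D.exists_io_eq (ro (hU'.trans hU) a') hxU'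
      have e1 : U' ≤ U := D.preimage_le_iff.1 hU'
      have e2 : U'' ≤ U' := D.preimage_le_iff.1 hU''
      have hle := hU''.trans (hU'.trans hU)
      refine ⟨_, hle, hxU'', ?_⟩
      have h1 := (hΔ U'').leibniz (ro e2 c) c' (rs _ (e2.trans e1) t)
      have h2 : ro hle a = D.io U'' (ro e2 c) := by rw [io_ro, hc, ro_ro, ro_ro]
      have h3 : ro hle a' = D.io U'' c' := by rw [hc', ro_ro]
      have h4 : rs L hle l = D.rl U'' (rs _ (e2.trans e1) t) := by rw [rl_rs, ht, rs_rs]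
      simp only [RingHom.id_apply, map_add, rs_smul, ← secHom_rs, map_mul, h2, h3, h4]
      rw [← map_mul, ← rl_smul, ← rl_smul, ← rl_smul, h, h, h, h]
      exact h1 }

/-- A morphism `ℒ ⟶ i_* N` factors through the restriction to the closed fibre. -/
lemma exists_hom_of_linear (Δ : D.total.sheaf ⟶ (Scheme.Modules.pushforward D.i).obj N) :
    ∃ g : L ⟶ N, ∀ (U : D.total.scheme.Opens) (t : Γ(D.total.sheaf, U)),
      g.app (D.i ⁻¹ᵁ U) (D.rl U t) = Δ.app U t := by
  obtain ⟨g, hg⟩ := ((Pair.isCart_iff _).1 D.isCart N).2 Δ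
  exact ⟨g, fun U t => congr(($hg).app U t)⟩

end Inf
end Deformation

/-! ### Tensor products with a vector space -/

/-- A presentation of a sheaf of modules `M` as the tensor product `L ⊗ V` with a vector space `V`
with basis `b`. -/
structure Frame {X : Scheme.{0}} [X.Over SpecC] (L M : X.Modules) {V : Type} [AddCommGroup V]
    [Module ℂ V] {ι : Type} [Fintype ι] (b : Module.Basis ι ℂ V) where
  τ : V →ₗ[ℂ] (L ⟶ M)
  π : ι → (M ⟶ L)
  τ_π : ∀ k, τ (b k) ≫ π k = 𝟙 L
  τ_π_of_ne : ∀ k l, k ≠ l → τ (b k) ≫ π l = 0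
  sum_π_τ : ∑ k, π k ≫ τ (b k) = 𝟙 M

namespace Frame

variable {X : Scheme.{0}} [X.Over SpecC] {L M : X.Modules} {V : Type} [AddCommGroup V]
  [Module ℂ V] {ι : Type} [Fintype ι] {b : Module.Basis ι ℂ V} (F : Frame L M b)

lemma hom_ext {N : X.Modules} {f g : M ⟶ N} (h : ∀ k, F.τ (b k) ≫ f = F.τ (b k) ≫ g) : f = g := by
  rw [← Category.id_comp f, ← Category.id_comp g, ← F.sum_π_τ, Preadditive.sum_comp,
    Preadditive.sum_comp]
  exact Finset.sum_congr rfl fun k _ => by rw [Category.assoc, h, Category.assoc]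

/-- The morphism `L ⊗ V ⟶ N` given by a family of morphisms `L ⟶ N`. -/
def desc {N : X.Modules} (κ : ι → (L ⟶ N)) : M ⟶ N := ∑ k, F.π k ≫ κ k

lemma τ_desc {N : X.Modules} (κ : ι → (L ⟶ N)) (k : ι) : F.τ (b k) ≫ F.desc κ = κ k := by
  rw [desc, Preadditive.comp_sum, Finset.sum_eq_single k]
  · rw [← Category.assoc, F.τ_π, Category.id_comp]
  · intro l _ hl
    rw [← Category.assoc, F.τ_π_of_ne _ _ hl.symm, zero_comp]
  · simp

lemma τ_comp_desc {N : X.Modules} (κ : V →ₗ[ℂ] (L ⟶ N)) (v : V) :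
    F.τ v ≫ F.desc (fun k => κ (b k)) = κ v := by
  have h : (Linear.rightComp ℂ L (F.desc (fun k => κ (b k)))).comp F.τ = κ :=
    b.ext fun k => F.τ_desc _ k
  exact congr($h v)

end Frame

namespace Deformation

variable {X : Scheme.{0}} [X.Over SpecC] {L : X.Modules}

/-- First-order differential operators from the line bundle of a deformation to a sheaf of modules
on the closed fibre. -/
structure DOp {A : ArtAlg} (D : Deformation X L A) (N : X.Modules) where
  app (U : D.total.scheme.Opens) : Γ(D.total.sheaf, U) →+ Γ(N, D.i ⁻¹ᵁ U)
  app_rs {U U' : D.total.scheme.Opens} (h : U' ≤ U) (t : Γ(D.total.sheaf, U)) :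
    app U' (rs _ h t) = rs N (D.i.preimage_mono h) (app U t)
  isDiffOp (U : D.total.scheme.Opens) : IsDiffOp ℂ (D.io U) (app U)

section General

variable {A : ArtAlg} (D : Deformation X L A)

lemma hom_ext {N : X.Modules} {f g : L ⟶ N} (h : ∀ U t,
    f.app (D.i ⁻¹ᵁ U) (D.rl U t) = g.app (D.i ⁻¹ᵁ U) (D.rl U t)) : f = g := by
  refine ((Pair.isCart_iff _).1 D.isCart N).1 ?_
  exact modules_hom_ext fun U t => h U t

lemma jets_hom_ext {N : X.Modules} {f g : jets L ⟶ N} (h : ∀ U t,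
    f.app (D.i ⁻¹ᵁ U) (p₁Hom L _ (D.rl U t)) = g.app (D.i ⁻¹ᵁ U) (p₁Hom L _ (D.rl U t))) :
    f = g := by
  refine DefPair.jets_hom_ext fun W l => rs_ext fun x hx => ?_
  obtain ⟨U, hU, hxU, t, ht⟩ := D.exists_rl_eq l hx
  refine ⟨_, hU, hxU, ?_⟩
  rw [← app_rs, ← app_rs]
  have h1 : rs (jets L) hU ((p₁ L).app (op W) l) = p₁Hom L _ (D.rl U t) := by
    rw [ht]
    exact (secHom_rs (p₁ L) hU l).symm
  rw [h1]
  exact h U t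

namespace DOp

variable {D} {N : X.Modules} (Δ : D.DOp N)

/-- A differential operator as a morphism of presheaves. -/
def toPresheafHom : D.total.sheaf.presheaf ⟶ ((Scheme.Modules.pushforward D.i).obj N).presheaf where
  app U := AddCommGrpCat.ofHom (Δ.app U.unop)
  naturality U V i := by
    refine AddCommGrpCat.hom_ext (AddMonoidHom.ext fun (t : Γ(D.total.sheaf, U.unop)) => ?_)
    exact Δ.app_rs (leOfHom i.unop) t

lemma isDiffOpSheaf : IsDiffOpSheaf Δ.toPresheafHom := fun U =>
  ⟨(Δ.isDiffOp U).const, (Δ.isDiffOp U).leibniz⟩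

/-- The composition of a differential operator with a linear map. -/
def comp {N' : X.Modules} (f : N ⟶ N') : D.DOp N' where
  app U := (f.app (D.i ⁻¹ᵁ U)).hom.comp (Δ.app U)
  app_rs h t := (congrArg _ (Δ.app_rs h t)).trans (DefPair.app_rs f _ _)
  isDiffOp U :=
    { const := fun c t => (congrArg _ ((Δ.isDiffOp U).const c t)).trans (f.app_smul _ _)
      leibniz := fun a a' t => by
        have h := congrArg (f.app (D.i ⁻¹ᵁ U)) ((Δ.isDiffOp U).leibniz a a' t)
        rw [map_add, map_add, f.app_smul, f.app_smul, f.app_smul] at h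
        exact h }

lemma comp_app {N' : X.Modules} (f : N ⟶ N') (U : D.total.scheme.Opens) (t : Γ(D.total.sheaf, U)) :
    (Δ.comp f).app U t = f.app _ (Δ.app U t) := rfl

/-- The difference of two differential operators. -/
def sub (Δ' : D.DOp N) : D.DOp N where
  app U := Δ.app U - Δ'.app U
  app_rs h t := by
    rw [AddMonoidHom.sub_apply, AddMonoidHom.sub_apply, Δ.app_rs, Δ'.app_rs, map_sub]
  isDiffOp U :=
    { const := fun c t => by
        rw [AddMonoidHom.sub_apply, AddMonoidHom.sub_apply, (Δ.isDiffOp U).const,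
          (Δ'.isDiffOp U).const, smul_sub]
      leibniz := fun a a' t => by
        have h := congrArg₂ (· - ·) ((Δ.isDiffOp U).leibniz a a' t)
          ((Δ'.isDiffOp U).leibniz a a' t)
        simp only [AddMonoidHom.sub_apply, smul_sub]
        rw [sub_add_sub_comm, h, sub_add_sub_comm] }

end DOp

end General

section Inf

variable {V : Type} [AddCommGroup V] [Module ℂ V] [Module ℂᵐᵒᵖ V] [IsCentralScalar ℂ V]
  [FiniteDimensional ℂ V] {D : Deformation X L (infAlg V)} {N : X.Modules}

namespace DOp

variable (Δ : D.DOp N)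

lemma app_vFun_add (U : D.total.scheme.Opens) (v w : V) (t : Γ(D.total.sheaf, U)) :
    Δ.app U (D.vFun U (v + w) • t) = Δ.app U (D.vFun U v • t) + Δ.app U (D.vFun U w • t) := by
  rw [vFun_add, add_smul, map_add]

lemma app_vFun_smul (U : D.total.scheme.Opens) (c : ℂ) (v : V) (t : Γ(D.total.sheaf, U)) :
    Δ.app U (D.vFun U (c • v) • t) = c • Δ.app U (D.vFun U v • t) := by
  rw [vFun_smul, mul_smul, (Δ.isDiffOp U).const]
  exact congrArg (· • Δ.app U (D.vFun U v • t)) (D.i_app_algebraMap U c)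

/-- In the Leibniz identity for the product `v a`, the terms with a coefficient `v|_X = 0` drop out.
So a first-order operator with values on `X` is linear on `V ℒ`. -/
lemma app_vFun_linear (U : D.total.scheme.Opens) (v : V) (a : Γ(D.total.scheme, U))
    (t : Γ(D.total.sheaf, U)) :
    Δ.app U (D.vFun U v • a • t) = D.io U a • Δ.app U (D.vFun U v • t) := by
  have h := (Δ.isDiffOp U).leibniz (D.vFun U v) a t
  rwa [map_mul, io_vFun, zero_mul, zero_smul, zero_smul, add_zero, zero_add, mul_smul] at h

/-- The linear map `t ↦ Δ (v t)`. -/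
def vPart (v : V) : D.total.sheaf ⟶ (Scheme.Modules.pushforward D.i).obj N :=
  mkHom
    { app := fun U => AddCommGrpCat.ofHom ((Δ.app U.unop).comp
        (DistribSMul.toAddMonoidHom Γ(D.total.sheaf, U.unop) (D.vFun U.unop v)))
      naturality := fun U U' i => by
        refine AddCommGrpCat.hom_ext (AddMonoidHom.ext fun (t : Γ(D.total.sheaf, U.unop)) => ?_)
        change Δ.app U'.unop (D.vFun U'.unop v • rs _ (leOfHom i.unop) t) =
          rs N (D.i.preimage_mono (leOfHom i.unop)) (Δ.app U.unop (D.vFun U.unop v • t))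
        rw [← app_rs, rs_vFun_smul] }
    (fun U a t => Δ.app_vFun_linear U v a t)

/-- The linear map `L ⟶ N` induced by `t ↦ Δ (v t)`. -/
lemma exists_symbol : ∃ κ : V →ₗ[ℂ] (L ⟶ N), ∀ v (U : D.total.scheme.Opens) t,
    (κ v).app (D.i ⁻¹ᵁ U) (D.rl U t) = Δ.app U (D.vFun U v • t) := by
  choose κ hκ using fun v => D.exists_hom_of_linear (Δ.vPart v)
  replace hκ : ∀ v (U : D.total.scheme.Opens) t, (κ v).app (D.i ⁻¹ᵁ U) (D.rl U t) =
    Δ.app U (D.vFun U v • t) := hκ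
  refine ⟨{ toFun := κ, map_add' := fun v w => D.hom_ext fun U t => ?_,
            map_smul' := fun c v => D.hom_ext fun U t => ?_ }, hκ⟩
  · rw [hκ, app_vFun_add, add_app_apply, hκ, hκ]
  · rw [hκ, app_vFun_smul, ← hκ]
    rfl

end DOp

variable {ι : Type} [Fintype ι] {b : Module.Basis ι ℂ V} {M E : X.Modules}

/-- A differential operator identifying an extension `M ⟶ E ⟶ 𝒫¹(L)`, where `M = L ⊗ V`, as the
extension attached to a deformation. -/
structure Comparison (D : Deformation X L (infAlg V)) (F : Frame L M b) (j : M ⟶ E)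
    (r : E ⟶ jets L) where
  d : D.DOp E
  r_d (U : D.total.scheme.Opens) (t : Γ(D.total.sheaf, U)) :
    r.app _ (d.app U t) = p₁Hom L _ (D.rl U t)
  d_vFun (U : D.total.scheme.Opens) (v : V) (t : Γ(D.total.sheaf, U)) :
    d.app U (D.vFun U v • t) = j.app _ ((F.τ v).app _ (D.rl U t))

namespace Comparison

variable {F : Frame L M b} {j : M ⟶ E} {r : E ⟶ jets L} (C : D.Comparison F j r)

/-- A map on `E` is determined by its values on `d(ℒ)`: the values at `d(v t)` determine it on `M`,
and modulo `M` the sections `d(t)` become the one-jets `p₁(t|_X)`, which generate `𝒫¹(L)`. -/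
lemma hom_ext {w : j ≫ r = 0} (hS : (ShortComplex.mk j r w).ShortExact) {f g : E ⟶ N}
    (h : ∀ (U : D.total.scheme.Opens) t, f.app _ (C.d.app U t) = g.app _ (C.d.app U t)) :
    f = g := by
  rw [← sub_eq_zero]
  have h0 : ∀ (U : D.total.scheme.Opens) t, (f - g).app _ (C.d.app U t) = 0 := fun U t =>
    sub_eq_zero.2 (h U t)
  generalize f - g = k at h0
  have h1 : j ≫ k = 0 := F.hom_ext fun l => D.hom_ext fun U t => by
    rw [comp_zero]
    have := h0 U (D.vFun U (b l) • t)
    rw [C.d_vFun] at this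
    exact this
  have := hS.epi_g
  have h2 : r ≫ hS.exact.desc k h1 = k := hS.exact.g_desc k h1
  have h3 : hS.exact.desc k h1 = 0 := D.jets_hom_ext fun U t => by
    rw [← C.r_d]
    refine Eq.trans ?_ (h0 U t)
    exact congr(($h2).app _ (C.d.app U t))
  rw [← h2, h3, comp_zero]

/-- An extension with a comparison is universal for differential operators. -/
lemma exists_hom {w : j ≫ r = 0} (hS : (ShortComplex.mk j r w).ShortExact) (Δ : D.DOp N) :
    ∃ g : E ⟶ N, ∀ (U : D.total.scheme.Opens) t, g.app _ (C.d.app U t) = Δ.app U t := by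
  obtain ⟨κ, hκ⟩ := Δ.exists_symbol
  -- The map sought has to restrict to `k` on `M`, since `d(v t)` must go to `Δ(v t)`. In the
  -- push-out along `k` the operators `d` and `Δ` agree on `V ℒ`, so their difference `Δ'` descends
  -- to `L` and gives a map `s` on `𝒫¹(L)`.
  let k : M ⟶ N := F.desc fun l => κ (b l)
  have hQ := shortExact_pushout hS k
  let rQ : pushout j k ⟶ jets L := pushout.desc r 0 (w.trans comp_zero.symm)
  have := hQ.mono_f
  let Δ' : D.DOp (pushout j k) := (C.d.comp (pushout.inl j k)).sub (Δ.comp (pushout.inr j k))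
  have hΔ' : ∀ U t, Δ'.app U t = (pushout.inl j k).app _ (C.d.app U t) -
    (pushout.inr j k).app _ (Δ.app U t) := fun U t => rfl
  have hv : ∀ U v t, Δ'.app U (D.vFun U v • t) = 0 := fun U v t => by
    rw [hΔ', C.d_vFun, ← hκ, ← F.τ_comp_desc κ, sub_eq_zero]
    exact congr(((F.τ v) ≫ $(pushout.condition (f := j) (g := k))).app _ (D.rl U t))
  obtain ⟨s₀, hs₀⟩ := D.exists_factor Δ'.toPresheafHom hv
  have hs₀' := D.isDiffOpSheaf_of_factor Δ'.isDiffOpSheaf hs₀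
  let s : jets L ⟶ pushout j k := jetsDesc s₀ hs₀'
  have hs : ∀ (U : D.total.scheme.Opens) t,
      s.app _ (p₁Hom L _ (D.rl U t)) = Δ'.app U t := fun U t =>
    (jetsDesc_p₁ s₀ hs₀' _ _).trans (hs₀ U t)
  -- So `s` splits the push-out extension, and `inl - r ≫ s` takes values in `N`; this is the
  -- required map.
  have hsr : s ≫ rQ = 𝟙 _ := D.jets_hom_ext fun U t => by
    rw [comp_app_apply, hs, hΔ', map_sub]
    have h1 : rQ.app _ ((pushout.inl j k).app _ (C.d.app U t)) = r.app _ (C.d.app U t) :=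
      congr(($(pushout.inl_desc (f := j) (g := k) r 0 (w.trans comp_zero.symm))).app _
        (C.d.app U t))
    have h2 : rQ.app _ ((pushout.inr j k).app _ (Δ.app U t)) = 0 :=
      congr(($(pushout.inr_desc (f := j) (g := k) r 0 (w.trans comp_zero.symm))).app _
        (Δ.app U t))
    rw [h1, h2, sub_zero, C.r_d]
    rfl
  have hz : (pushout.inl j k - r ≫ s) ≫ rQ = 0 := by
    rw [Preadditive.sub_comp, Category.assoc, hsr, Category.comp_id, pushout.inl_desc, sub_self]
  refine ⟨hQ.exact.lift _ hz, fun U t => ?_⟩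
  have h3 : hQ.exact.lift _ hz ≫ pushout.inr j k = pushout.inl j k - r ≫ s :=
    hQ.exact.lift_f _ hz
  refine app_injective_of_mono (pushout.inr j k) _ ?_
  refine (congr(($h3).app _ (C.d.app U t))).trans ?_
  change (pushout.inl j k).app _ (C.d.app U t) - s.app _ (r.app _ (C.d.app U t)) = _
  rw [C.r_d, hs, hΔ', sub_sub_cancel]

end Comparison

end Inf
end Deformation

/-! ### Naturality of the extension attached to a deformation -/

lemma Pair.map_app_congr {P Q : Pair} {f g : P ⟶ Q} (h : f = g) (U : Q.scheme.Opens)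
    (hU : f.base ⁻¹ᵁ U ≤ g.base ⁻¹ᵁ U) (t : Γ(Q.sheaf, U)) :
    rs P.sheaf hU (g.map.app U t) = f.map.app U t := by
  subst h
  exact rs_self _ _

lemma app_congr {Y Z : Scheme.{0}} {f g : Y ⟶ Z} (h : f = g) (U : Z.Opens)
    (hU : f ⁻¹ᵁ U ≤ g ⁻¹ᵁ U) (a : Γ(Z, U)) : ro hU (g.app U a) = f.app U a := by
  subst h
  exact ro_self _ _

namespace Deformation

variable {X : Scheme.{0}} [X.Over SpecC] {L : X.Modules}

section General

variable {A B : ArtAlg} {φ : A ⟶ B} {D' : Deformation X L B} {D : Deformation X L A}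
  (g : D'.total ⟶ D.total)

/-- Pull-back of functions along a morphism of deformations. -/
def pullFun (U : D.total.scheme.Opens) :
    Γ(D.total.scheme, U) →+* Γ(D'.total.scheme, g.base ⁻¹ᵁ U) :=
  (g.base.app U).hom

/-- Pull-back of sections along a morphism of deformations. -/
def pullSec (U : D.total.scheme.Opens) :
    Γ(D.total.sheaf, U) →+ Γ(D'.total.sheaf, g.base ⁻¹ᵁ U) :=
  (g.map.app U).hom

lemma pullSec_smul (U : D.total.scheme.Opens) (a : Γ(D.total.scheme, U))
    (t : Γ(D.total.sheaf, U)) : pullSec g U (a • t) = pullFun g U a • pullSec g U t :=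
  g.map.app_smul a t

lemma pullSec_rs {U U' : D.total.scheme.Opens} (h : U' ≤ U) (t : Γ(D.total.sheaf, U)) :
    pullSec g U' (rs _ h t) = rs _ (g.base.preimage_mono h) (pullSec g U t) :=
  app_rs g.map h t

variable {g} (hg : D'.incl ≫ g = D.incl)

lemma preimage_preimage_eq (hg : D'.incl ≫ g = D.incl) (U : D.total.scheme.Opens) :
    D.i ⁻¹ᵁ U = D'.i ⁻¹ᵁ (g.base ⁻¹ᵁ U) := by
  have h : D.i = D'.i ≫ g.base := (congrArg Pair.Hom.base hg).symm
  rw [h]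
  rfl

lemma rl_eq_rs_rl_pullSec (U : D.total.scheme.Opens) (t : Γ(D.total.sheaf, U)) :
    D.rl U t = rs L (preimage_preimage_eq hg U).le (D'.rl _ (pullSec g U t)) :=
  (Pair.map_app_congr hg.symm U (preimage_preimage_eq hg U).le t).symm

lemma io_eq_ro_io_pullFun (U : D.total.scheme.Opens) (a : Γ(D.total.scheme, U)) :
    D.io U a = ro (preimage_preimage_eq hg U).le (D'.io _ (pullFun g U a)) := by
  have h : D.i = D'.i ≫ g.base := (congrArg Pair.Hom.base hg).symm
  exact (app_congr h U (preimage_preimage_eq hg U).le a).symm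

/-- The pull-back of a differential operator along a morphism of deformations. -/
def DOp.pull {N : X.Modules} (Δ : D'.DOp N)
    (hC : g.base ≫ (D.total.scheme ↘ SpecC) = D'.total.scheme ↘ SpecC) : D.DOp N where
  app U := (rs N (preimage_preimage_eq hg U).le).comp ((Δ.app (g.base ⁻¹ᵁ U)).comp (pullSec g U))
  app_rs h t := by
    simp only [AddMonoidHom.comp_apply, pullSec_rs, Δ.app_rs, rs_rs]
  isDiffOp U :=
    { const := fun c t => by
        have h1 : pullFun g U (algebraMap ℂ _ c) = algebraMap ℂ _ c :=
          (app_structHom g.base (D.total.scheme ↘ SpecC) U c).trans (by rw [hC]; rfl)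
        simp only [AddMonoidHom.comp_apply, pullSec_smul, h1, (Δ.isDiffOp _).const, rs_smul]
        rw [io_eq_ro_io_pullFun hg, h1]
      leibniz := fun a a' t => by
        have h := congrArg (rs N (preimage_preimage_eq hg U).le)
          ((Δ.isDiffOp (g.base ⁻¹ᵁ U)).leibniz (pullFun g U a) (pullFun g U a') (pullSec g U t))
        simp only [AddMonoidHom.comp_apply, pullSec_smul, io_eq_ro_io_pullFun hg, map_mul]
        simpa only [map_add, rs_smul, map_mul] using h }

lemma DOp.pull_app {N : X.Modules} (Δ : D'.DOp N)
    (hC : g.base ≫ (D.total.scheme ↘ SpecC) = D'.total.scheme ↘ SpecC)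
    (U : D.total.scheme.Opens) (t : Γ(D.total.sheaf, U)) :
    (Δ.pull hg hC).app U t = rs N (preimage_preimage_eq hg U).le (Δ.app _ (pullSec g U t)) := rfl

lemma comp_over (h : g.base ≫ D.proj = D'.proj ≫ ArtAlg.specMap φ) :
    g.base ≫ (D.total.scheme ↘ SpecC) = D'.total.scheme ↘ SpecC := by
  change g.base ≫ D.proj ≫ A.toSpecC = D'.proj ≫ B.toSpecC
  rw [← Category.assoc, h, Category.assoc]
  congr 1
  refine (Spec.map_comp _ _).symm.trans (congrArg Spec.map ?_)
  ext c
  exact AlgHom.commutes (show A.carrier →ₐ[ℂ] B.carrier from φ) c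

end General

section Inf

variable {V : Type} [AddCommGroup V] [Module ℂ V] [Module ℂᵐᵒᵖ V] [IsCentralScalar ℂ V]
  [FiniteDimensional ℂ V] {W : Type} [AddCommGroup W] [Module ℂ W] [Module ℂᵐᵒᵖ W]
  [IsCentralScalar ℂ W] [FiniteDimensional ℂ W] {f : V →ₗ[ℂ] W}
  {D : Deformation X L (infAlg V)} {D' : Deformation X L (infAlg W)} {g : D'.total ⟶ D.total}

lemma pullFun_vFun (h : g.base ≫ D.proj = D'.proj ≫ ArtAlg.specMap (infMap f))
    (U : D.total.scheme.Opens) (v : V) :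
    pullFun g U (D.vFun U v) = D'.vFun _ (f v) := by
  refine (app_structHom g.base D.proj U _).trans ?_
  rw [h]
  refine (structHom_comp_specMap _ _ _ _).trans ?_
  exact congrArg (structHom D'.proj (g.base ⁻¹ᵁ U)) (TrivSqZeroExt.map_inr f v)

variable {ι ι' : Type} [Fintype ι] [Fintype ι'] {b : Module.Basis ι ℂ V} {b' : Module.Basis ι' ℂ W}
  {M E M' E' : X.Modules} {F : Frame L M b} {j : M ⟶ E} {r : E ⟶ jets L} {F' : Frame L M' b'}
  {j' : M' ⟶ E'} {r' : E' ⟶ jets L}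

/-- The extension attached to a base change is the push-out extension. -/
lemma Comparison.exists_hom_of_isBaseChange (C : D.Comparison F j r) (C' : D'.Comparison F' j' r')
    {w : j ≫ r = 0} (hS : (ShortComplex.mk j r w).ShortExact)
    (h : g.base ≫ D.proj = D'.proj ≫ ArtAlg.specMap (infMap f)) (hg : D'.incl ≫ g = D.incl) :
    ∃ e : E ⟶ E', j ≫ e = F.desc (fun k => F'.τ (f (b k))) ≫ j' ∧ e ≫ r' = r := by
  have hC := comp_over h
  -- Pulling a section back to `D'` and applying the operator of `D'` is a first-order operator on
  -- `D`, to which the universality of `E` applies.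
  obtain ⟨e, he⟩ := C.exists_hom hS (C'.d.pull hg hC)
  refine ⟨e, ?_, ?_⟩
  · refine F.hom_ext fun k => D.hom_ext fun U t => ?_
    rw [← Category.assoc, ← Category.assoc, F.τ_desc]
    have h1 := he U (D.vFun U (b k) • t)
    rw [C.d_vFun, DOp.pull_app, pullSec_smul, pullFun_vFun h, C'.d_vFun, ← app_rs, ← app_rs,
      ← rl_eq_rs_rl_pullSec hg] at h1
    exact h1
  · refine C.hom_ext hS fun U t => ?_
    have h1 : r'.app _ (e.app _ (C.d.app U t)) = p₁Hom L _ (D.rl U t) := by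
      rw [he, DOp.pull_app, app_rs, C'.r_d, rl_eq_rs_rl_pullSec hg]
      exact (secHom_rs (p₁ L) _ _).symm
    exact h1.trans (C.r_d U t).symm

/-- The morphism of extensions given by universality is the identity on `𝒫¹(L)` and is induced by
`f` on the kernels. The formula is then the naturality of extension classes. With `f` the identity
it shows that the class depends only on the deformation. -/
lemma Comparison.extClass_comp (C : D.Comparison F j r) (C' : D'.Comparison F' j' r')
    {w : j ≫ r = 0} (hS : (ShortComplex.mk j r w).ShortExact)
    {w' : j' ≫ r' = 0} (hS' : (ShortComplex.mk j' r' w').ShortExact)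
    (h : g.base ≫ D.proj = D'.proj ≫ ArtAlg.specMap (infMap f)) (hg : D'.incl ≫ g = D.incl) :
    hS.extClass.comp (Abelian.Ext.mk₀ (F.desc fun k => F'.τ (f (b k)))) (add_zero 1) =
      hS'.extClass := by
  obtain ⟨e, h1, h2⟩ := C.exists_hom_of_isBaseChange C' hS h hg
  let φ : ShortComplex.mk j r w ⟶ ShortComplex.mk j' r' w' :=
    { τ₁ := F.desc fun k => F'.τ (f (b k)), τ₂ := e, τ₃ := 𝟙 _, comm₁₂ := h1.symm
      comm₂₃ := h2.trans (Category.comp_id _).symm }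
  refine (ShortComplex.ShortExact.extClass_naturality hS hS' φ).trans ?_
  exact Abelian.Ext.mk₀_id_comp _

/-- Isomorphic deformations have the same extension class. -/
lemma Comparison.extClass_eq_of_isomorphic {D D' : Deformation X L (infAlg V)}
    {E' : X.Modules} {j' : M ⟶ E'} {r' : E' ⟶ jets L}
    (C : D.Comparison F j r) (C' : D'.Comparison F j' r')
    {w : j ≫ r = 0} (hS : (ShortComplex.mk j r w).ShortExact)
    {w' : j' ≫ r' = 0} (hS' : (ShortComplex.mk j' r' w').ShortExact) (h : D.Isomorphic D') :
    hS.extClass = hS'.extClass := by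
  obtain ⟨e, h1, h2⟩ := h.symm
  have hid : infMap (LinearMap.id : V →ₗ[ℂ] V) = 𝟙 (infAlg V) := by
    exact TrivSqZeroExt.map_id
  have h3 := C.extClass_comp C' hS hS' (g := e.hom) (f := LinearMap.id)
    (by rw [h1, hid, ArtAlg.specMap_id]; exact (Category.comp_id _).symm) h2
  rw [← h3]
  have h4 : (F.desc fun k => F.τ ((LinearMap.id : V →ₗ[ℂ] V) (b k))) = 𝟙 M :=
    F.hom_ext fun k => by rw [F.τ_desc, Category.comp_id]; rfl
  rw [h4, Abelian.Ext.comp_mk₀_id]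

end Inf
end Deformation

/-! ### Derivations at generic points -/

/-- Coefficients of square-zero elements with respect to a smooth quotient are derivations. -/
lemma exists_derivation_of_formallySmooth {A K ι : Type} [CommRing A] [CommRing K] [Algebra ℂ A]
    [Algebra ℂ K] [Algebra.FormallySmooth ℂ K] [Fintype ι] (s : A →ₐ[ℂ] K)
    (hs : Function.Surjective s) (v : ι → A) (hvv : ∀ k l, v k * v l = 0)
    (hker : ∀ a, s a = 0 → ∃ c : ι → A, a = ∑ k, v k * c k) (hv : ∀ k, s (v k) = 0)
    (hrel : ∀ c : ι → A, ∑ k, v k * c k = 0 → ∀ k, s (c k) = 0) (k : ι) :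
    ∃ d : A →+ K, (∀ a b, d (a * b) = s a * d b + s b * d a) ∧ (∀ c, d (algebraMap ℂ A c) = 0) ∧
      ∀ c : ι → A, d (∑ l, v l * c l) = s (c k) := by
  -- The kernel is generated by the `v k`, whose products vanish, so its square is zero.
  have hnil : IsNilpotent (RingHom.ker (s : A →+* K)) := by
    refine ⟨2, ?_⟩
    rw [pow_two, Ideal.zero_eq_bot, eq_bot_iff, Ideal.mul_le]
    intro a ha a' ha'
    obtain ⟨c, rfl⟩ := hker a ha
    obtain ⟨c', rfl⟩ := hker a' ha'
    rw [Ideal.mem_bot, Finset.sum_mul_sum]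
    exact Finset.sum_eq_zero fun l _ => Finset.sum_eq_zero fun l' _ => by
      rw [mul_mul_mul_comm, hvv, zero_mul]
  -- Formal smoothness gives a section `σ` of `s` by an algebra homomorphism. The coordinates of `a
  -- - σ(s a)` with respect to the `v l` are well defined after applying `s`, by `hrel`, and the
  -- `k`-th one is the derivation.
  let σ := Algebra.FormallySmooth.liftOfSurjective (AlgHom.id ℂ K) s hs hnil
  have hσ : ∀ x, s (σ x) = x := fun x =>
    Algebra.FormallySmooth.liftOfSurjective_apply (AlgHom.id ℂ K) s hs hnil x
  choose c hc using fun a => hker (a - σ (s a)) (by rw [map_sub, hσ, sub_self])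
  have huniq : ∀ a (e : ι → A), a - σ (s a) = ∑ l, v l * e l → s (c a k) = s (e k) := by
    intro a e he
    rw [← sub_eq_zero, ← map_sub]
    refine hrel (fun l => c a l - e l) ?_ k
    simp only [mul_sub, Finset.sum_sub_distrib]
    rw [← hc, he, sub_self]
  refine ⟨AddMonoidHom.mk' (fun a => s (c a k)) fun a a' => ?_, fun a a' => ?_, fun z => ?_,
    fun e => ?_⟩
  · rw [← map_add]
    refine huniq _ (fun l => c a l + c a' l) ?_
    simp only [mul_add, Finset.sum_add_distrib]
    rw [← hc, ← hc, map_add, map_add]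
    ring
  · change s (c (a * a') k) = s a * s (c a' k) + s a' * s (c a k)
    rw [huniq (a * a') (fun l => c a l * a' + σ (s a) * c a' l), map_add, map_mul, map_mul, hσ]
    · ring
    · have h : ∑ l, v l * (c a l * a' + σ (s a) * c a' l) =
          (∑ l, v l * c a l) * a' + σ (s a) * ∑ l, v l * c a' l := by
        rw [Finset.sum_mul, Finset.mul_sum, ← Finset.sum_add_distrib]
        exact Finset.sum_congr rfl fun l _ => by ring
      rw [h, ← hc, ← hc, map_mul, map_mul]
      ring
  · change s (c (algebraMap ℂ A z) k) = 0
    rw [huniq _ (fun _ => 0), map_zero]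
    simp
  · change s (c (∑ l, v l * e l) k) = s (e k)
    refine huniq _ _ ?_
    simp [hv]

/-- A nonzero function on a reduced scheme is nonzero at a generic point. -/
lemma exists_isField_stalk {X : Scheme.{0}} [IsReduced X] {W : X.Opens} {f : Γ(X, W)}
    (hf : f ≠ 0) : ∃ (η : X) (hη : η ∈ W), IsField (X.presheaf.stalk η) ∧
      X.presheaf.germ W η hη f ≠ 0 := by
  obtain ⟨U, hU, hUW, hfU⟩ : ∃ (U : X.Opens) (_ : IsAffineOpen U) (h : U ≤ W), ro h f ≠ 0 := by
    by_contra! h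
    refine hf (ro_ext fun x hx => ?_)
    obtain ⟨U, hU, hxU, hle⟩ := Opens.isBasis_iff_nbhd.1 X.isBasis_affineOpens hx
    exact ⟨U, hle, hxU, (h U hU hle).trans (map_zero _).symm⟩
  -- In a reduced ring the minimal primes intersect in zero.
  obtain ⟨p, hp, hfp⟩ : ∃ p ∈ minimalPrimes Γ(X, U), ro hUW f ∉ p := by
    by_contra! h
    refine hfU ?_
    have h1 : ro hUW f ∈ sInf (minimalPrimes Γ(X, U)) := by
      exact Submodule.mem_sInf.2 fun p hp => h p hp
    rw [show sInf (minimalPrimes Γ(X, U)) = _ from Ideal.sInf_minimalPrimes,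
      show (⊥ : Ideal Γ(X, U)).radical = _ from nilradical_eq_zero _] at h1
    exact h1
  have hpp : p.IsPrime := Ideal.IsMinimalPrime.isPrime hp
  let η : X := hU.fromSpec ⟨p, hpp⟩
  have hη : η ∈ U := hU.range_fromSpec.le ⟨_, rfl⟩
  have hid : (hU.primeIdealOf ⟨η, hη⟩).asIdeal = p := by
    have h : hU.primeIdealOf ⟨η, hη⟩ = ⟨p, hpp⟩ :=
      hU.fromSpec.isOpenEmbedding.injective (hU.fromSpec_primeIdealOf ⟨η, hη⟩)
    rw [h]
  let := TopCat.Presheaf.algebra_section_stalk X.presheaf (U := U) ⟨η, hη⟩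
  have hloc : IsLocalization.AtPrime (X.presheaf.stalk η) (hU.primeIdealOf ⟨η, hη⟩).asIdeal :=
    hU.isLocalization_stalk ⟨η, hη⟩
  simp only [hid] at hloc
  refine ⟨η, hUW hη, ?_, fun h => hfp ?_⟩
  -- The localization at a minimal prime has one prime ideal, and a reduced local ring with this
  -- property is a field.
  · have h1 := IsLocalization.subsingleton_primeSpectrum_of_mem_minimalPrimes
      (S := X.presheaf.stalk η) _ hp
    exact (PrimeSpectrum.subsingleton_iff_isField_of_isReduced).1 h1
  · have h2 : algebraMap Γ(X, U) (X.presheaf.stalk η) (ro hUW f) = 0 := by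
      refine Eq.trans ?_ h
      exact X.presheaf.germ_res_apply (homOfLE hUW) η hη f
    obtain ⟨m, hm⟩ := (IsLocalization.map_eq_zero_iff p.primeCompl _ _).1 h2
    exact (hpp.mem_or_mem (hm ▸ p.zero_mem : (m : Γ(X, U)) * ro hUW f ∈ p)).resolve_left m.2


section Stalks

variable {X : Scheme.{0}} [X.Over SpecC]

/-- The stalks of a scheme over `ℂ` are `ℂ`-algebras. -/
instance algebraStalk (x : X) : Algebra ℂ (X.presheaf.stalk x) :=
  ((X.presheaf.germ ⊤ x trivial).hom.comp (algebraMap ℂ Γ(X, ⊤))).toAlgebra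

lemma germ_algebraMap {U : X.Opens} {x : X} (hx : x ∈ U) (c : ℂ) :
    X.presheaf.germ U x hx (algebraMap ℂ Γ(X, U) c) = algebraMap ℂ (X.presheaf.stalk x) c := by
  rw [← map_algebraMap (homOfLE (le_top : U ≤ ⊤)) c]
  exact X.presheaf.germ_res_apply (homOfLE le_top) x hx _

lemma finiteType_sections [LocallyOfFiniteType (X ↘ SpecC)] {U : X.Opens} (hU : IsAffineOpen U) :
    Algebra.FiniteType ℂ Γ(X, U) := by
  have h1 := (X ↘ SpecC).finiteType_appLE (isAffineOpen_top _) hU le_top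
  have h2 : ((Scheme.ΓSpecIso (CommRingCat.of ℂ)).inv).hom.FiniteType :=
    RingHom.FiniteType.of_surjective _
      ((ConcreteCategory.isIso_iff_bijective _).1 inferInstance).2
  exact h1.comp h2

lemma essFiniteType_stalk [LocallyOfFiniteType (X ↘ SpecC)] (x : X) :
    Algebra.EssFiniteType ℂ (X.presheaf.stalk x) := by
  obtain ⟨U, hU, hxU, -⟩ := Opens.isBasis_iff_nbhd.1 X.isBasis_affineOpens
    (U := ⊤) (x := x) trivial
  let := TopCat.Presheaf.algebra_section_stalk X.presheaf (U := U) ⟨x, hxU⟩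
  have hloc : IsLocalization.AtPrime (X.presheaf.stalk x) (hU.primeIdealOf ⟨x, hxU⟩).asIdeal :=
    hU.isLocalization_stalk ⟨x, hxU⟩
  have : Algebra.EssFiniteType Γ(X, U) (X.presheaf.stalk x) :=
    Algebra.EssFiniteType.of_isLocalization _ (hU.primeIdealOf ⟨x, hxU⟩).asIdeal.primeCompl
  have : Algebra.FiniteType ℂ Γ(X, U) := finiteType_sections hU
  have : IsScalarTower ℂ Γ(X, U) (X.presheaf.stalk x) :=
    .of_algebraMap_eq fun c => (germ_algebraMap hxU c).symm
  exact .comp ℂ Γ(X, U) _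

/-- The stalk is a field essentially of finite type over `ℂ`, and `ℂ` is perfect. -/
lemma formallySmooth_stalk [LocallyOfFiniteType (X ↘ SpecC)] {x : X}
    (hx : IsField (X.presheaf.stalk x)) : Algebra.FormallySmooth ℂ (X.presheaf.stalk x) := by
  have := essFiniteType_stalk x
  let := hx.toField
  exact .of_perfectField

end Stalks

namespace Deformation

variable {X : Scheme.{0}} [X.Over SpecC] {L : X.Modules}
  {V : Type} [AddCommGroup V] [Module ℂ V] [Module ℂᵐᵒᵖ V] [IsCentralScalar ℂ V]
  [FiniteDimensional ℂ V] (D : Deformation X L (infAlg V))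
  {ι : Type} [Fintype ι] (b : Module.Basis ι ℂ V)

/-- Restriction of germs of functions to the closed fibre. -/
def stalkRes (x : X) :
    D.total.scheme.presheaf.stalk (D.i x) →ₐ[ℂ] X.presheaf.stalk x where
  __ := (D.i.stalkMap x).hom
  commutes' c := by
    rw [← germ_algebraMap (U := ⊤) trivial c]
    refine (Scheme.Hom.germ_stalkMap_apply D.i ⊤ x trivial _).trans ?_
    rw [i_app_algebraMap]
    exact germ_algebraMap (U := ⊤) trivial c

lemma stalkRes_germ {U : D.total.scheme.Opens} {x : X} (hx : D.i x ∈ U)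
    (a : Γ(D.total.scheme, U)) :
    D.stalkRes x (D.total.scheme.presheaf.germ U (D.i x) hx a) =
      X.presheaf.germ (D.i ⁻¹ᵁ U) x hx (D.io U a) :=
  Scheme.Hom.germ_stalkMap_apply D.i U x hx a

lemma germ_ro {Y : Scheme.{0}} {U W : Y.Opens} (h : W ≤ U) {x : Y} (hx : x ∈ W) (a : Γ(Y, U)) :
    Y.presheaf.germ W x hx (ro h a) = Y.presheaf.germ U x (h hx) a :=
  Y.presheaf.germ_res_apply (homOfLE h) x hx a

lemma exists_germ_family {Y : Scheme.{0}} {ι : Type} [Finite ι] {x : Y}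
    (c : ι → Y.presheaf.stalk x) {U : Y.Opens} (hU : x ∈ U) : ∃ (W : Y.Opens) (_ : W ≤ U)
      (hx : x ∈ W) (c' : ι → Γ(Y, W)), ∀ k, Y.presheaf.germ W x hx (c' k) = c k := by
  choose W hW c' hc' using fun k => Y.presheaf.exists_germ_eq (c k)
  let Z : Y.Opens := ⟨U ∩ ⋂ k, (W k : Set Y), U.2.inter (isOpen_iInter_of_finite fun k => (W k).2)⟩
  have hZ : ∀ k, Z ≤ W k := fun k y hy => Set.mem_iInter.1 hy.2 k
  have hxZ : x ∈ Z := ⟨hU, Set.mem_iInter.2 hW⟩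
  exact ⟨Z, fun y hy => hy.1, hxZ, fun k => ro (hZ k) (c' k), fun k =>
    (germ_ro (hZ k) hxZ _).trans (hc' k)⟩

/-- The stalk of the total space is a square-zero extension of the field `𝒪_{X,x}`, and
`exists_derivation_of_formallySmooth` applies to it. Its hypotheses on germs follow from the
statements about sections by spreading out to a neighbourhood. -/
lemma exists_derivation_stalk [LocallyOfFiniteType (X ↘ SpecC)] {x : X}
    (hx : IsField (X.presheaf.stalk x)) (k : ι) :
    ∃ d : D.total.scheme.presheaf.stalk (D.i x) →+ X.presheaf.stalk x,
      (∀ a a', d (a * a') = D.stalkRes x a * d a' + D.stalkRes x a' * d a) ∧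
      (∀ c, d (algebraMap ℂ _ c) = 0) ∧
      ∀ (U : D.total.scheme.Opens) (hxU : D.i x ∈ U) (c : ι → Γ(D.total.scheme, U)),
        d (D.total.scheme.presheaf.germ U (D.i x) hxU (∑ l, D.vFun U (b l) * c l)) =
          X.presheaf.germ _ x hxU (D.io U (c k)) := by
  have := formallySmooth_stalk hx
  let v : ι → D.total.scheme.presheaf.stalk (D.i x) := fun l =>
    D.total.scheme.presheaf.germ ⊤ (D.i x) trivial (D.vFun ⊤ (b l))
  have hv : ∀ (U : D.total.scheme.Opens) (hxU : D.i x ∈ U) l,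
      D.total.scheme.presheaf.germ U (D.i x) hxU (D.vFun U (b l)) = v l := fun U hxU l => by
    rw [← D.ro_vFun (le_top : U ≤ ⊤), germ_ro]
  have hsum : ∀ (U : D.total.scheme.Opens) (hxU : D.i x ∈ U) (c : ι → Γ(D.total.scheme, U)),
      D.total.scheme.presheaf.germ U (D.i x) hxU (∑ l, D.vFun U (b l) * c l) =
      ∑ l, v l * D.total.scheme.presheaf.germ U (D.i x) hxU (c l) := fun U hxU c => by
    rw [map_sum]
    exact Finset.sum_congr rfl fun l _ => by rw [map_mul, hv]
  obtain ⟨d, h1, h2, h3⟩ := exists_derivation_of_formallySmooth (D.stalkRes x)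
    (fun y => by
      obtain ⟨W, hxW, f, rfl⟩ := X.presheaf.exists_germ_eq y
      obtain ⟨U, hU, hxU, a, ha⟩ := D.exists_io_eq f hxW
      refine ⟨D.total.scheme.presheaf.germ U (D.i x) hxU a, (D.stalkRes_germ hxU a).trans ?_⟩
      rw [ha]
      exact germ_ro hU hxU f) v
    (fun l l' => by
      rw [← map_mul, vFun_mul_vFun, map_zero])
    (fun a ha => by
      obtain ⟨W, hxW, a, rfl⟩ := D.total.scheme.presheaf.exists_germ_eq a
      rw [D.stalkRes_germ hxW, ← map_zero (X.presheaf.germ (D.i ⁻¹ᵁ W) x hxW).hom] at ha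
      obtain ⟨Z, hxZ, i₁, i₂, h⟩ :=
        X.presheaf.germ_eq (U := D.i ⁻¹ᵁ W) (V := D.i ⁻¹ᵁ W) x hxW hxW _ _ ha
      obtain ⟨Z, rfl⟩ := D.exists_preimage_eq Z
      have hle : Z ≤ W := D.preimage_le_iff.1 (leOfHom i₁)
      have h0 : D.io Z (ro hle a) = 0 := by
        rw [io_ro]
        exact h.trans (map_zero _)
      obtain ⟨U, hU, hxU, c, hc⟩ := D.exists_sum_eq_of_io_eq_zero b h0 (x := D.i x) hxZ
      refine ⟨fun l => D.total.scheme.presheaf.germ U (D.i x) hxU (c l), ?_⟩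
      rw [← hsum, ← hc, germ_ro, germ_ro])
    (fun l => by
      rw [D.stalkRes_germ (U := ⊤) trivial, io_vFun, map_zero])
    (fun c hc l => by
      obtain ⟨W, -, hxW, c, hc'⟩ := exists_germ_family c (U := ⊤) (x := D.i x) trivial
      obtain rfl : _ = _ := funext hc'
      rw [← hsum W hxW, ← map_zero (D.total.scheme.presheaf.germ W _ hxW).hom] at hc
      obtain ⟨Z, hxZ, i₁, i₂, h⟩ := D.total.scheme.presheaf.germ_eq _ hxW hxW _ _ hc
      have hle : Z ≤ W := leOfHom i₁
      have h0 : ∑ l, D.vFun Z (b l) * ro hle (c l) = 0 := by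
        have h' : ro hle (∑ l, D.vFun W (b l) * c l) = 0 := h.trans (map_zero _)
        simpa [ro_vFun] using h'
      have h4 := D.io_eq_zero_of_sum_eq_zero b h0 l
      change D.stalkRes x (D.total.scheme.presheaf.germ W (D.i x) hxW (c l)) = 0
      rw [← germ_ro hle hxZ, stalkRes_germ, h4, map_zero]) k
  refine ⟨d, h1, h2, fun U hxU c => ?_⟩
  rw [hsum, h3, stalkRes_germ]

end Deformation

/-! ### Exactness of the sequence of one-jets -/

section GermCoeff

variable {Y : Scheme.{0}} {M : Y.Modules} {U₀ : Y.Opens} {m : Γ(M, U₀)} (hm : IsGen M m)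

/-- The coefficient of a section with respect to a generator. -/
def IsGen.coeff {U : Y.Opens} (h : U ≤ U₀) : Γ(M, U) ≃ₗ[Γ(Y, U)] Γ(Y, U) :=
  (LinearEquiv.ofBijective (LinearMap.toSpanSingleton Γ(Y, U) Γ(M, U) (rs M h m)) (hm U h)).symm

lemma IsGen.coeff_smul_gen {U : Y.Opens} (h : U ≤ U₀) (t : Γ(M, U)) :
    hm.coeff h t • rs M h m = t :=
  (LinearEquiv.ofBijective (LinearMap.toSpanSingleton Γ(Y, U) Γ(M, U) (rs M h m))
    (hm U h)).apply_symm_apply t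

lemma IsGen.coeff_eq {U : Y.Opens} (h : U ≤ U₀) {t : Γ(M, U)} {a : Γ(Y, U)}
    (hat : a • rs M h m = t) : hm.coeff h t = a :=
  (hm U h).1 ((hm.coeff_smul_gen h t).trans hat.symm)

lemma IsGen.coeff_rs {U U' : Y.Opens} (h : U ≤ U₀) (h' : U' ≤ U) (t : Γ(M, U)) :
    hm.coeff (h'.trans h) (rs M h' t) = ro h' (hm.coeff h t) :=
  hm.coeff_eq _ (by rw [← rs_rs h' h, ← rs_smul, hm.coeff_smul_gen])

variable {y : Y} (hy : y ∈ U₀)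

/-- The germ of the coefficient of a section with respect to a generator. -/
def IsGen.germCoeff {U : Y.Opens} (hU : y ∈ U) : Γ(M, U) →+ Y.presheaf.stalk y :=
  ((Y.presheaf.germ (U₀ ⊓ U) y ⟨hy, hU⟩).hom.toAddMonoidHom.comp
    (hm.coeff (inf_le_left : U₀ ⊓ U ≤ U₀)).toLinearMap.toAddMonoidHom).comp
      (rs M (inf_le_right : U₀ ⊓ U ≤ U))

lemma IsGen.germCoeff_apply {U : Y.Opens} (hU : y ∈ U) (t : Γ(M, U)) :
    hm.germCoeff hy hU t = Y.presheaf.germ (U₀ ⊓ U) y ⟨hy, hU⟩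
      (hm.coeff (inf_le_left : U₀ ⊓ U ≤ U₀) (rs M (inf_le_right : U₀ ⊓ U ≤ U) t)) := rfl

lemma IsGen.germCoeff_rs {U U' : Y.Opens} (hU : y ∈ U') (h : U' ≤ U) (t : Γ(M, U)) :
    hm.germCoeff hy hU (rs M h t) = hm.germCoeff hy (h hU) t := by
  have hle : U₀ ⊓ U' ≤ U₀ ⊓ U := inf_le_inf_left _ h
  rw [germCoeff_apply, germCoeff_apply, rs_rs,
    ← rs_rs hle (inf_le_right : U₀ ⊓ U ≤ U), hm.coeff_rs inf_le_left hle]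
  exact Y.presheaf.germ_res_apply (homOfLE hle) y _ _

lemma IsGen.germCoeff_smul {U : Y.Opens} (hU : y ∈ U) (a : Γ(Y, U)) (t : Γ(M, U)) :
    hm.germCoeff hy hU (a • t) = Y.presheaf.germ U y hU a * hm.germCoeff hy hU t := by
  rw [germCoeff_apply, germCoeff_apply, rs_smul, map_smul, smul_eq_mul, map_mul]
  congr 1
  exact Y.presheaf.germ_res_apply (homOfLE inf_le_right) y _ _

lemma IsGen.germCoeff_smul_gen {U : Y.Opens} (hU : y ∈ U) (h : U ≤ U₀) (a : Γ(Y, U)) :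
    hm.germCoeff hy hU (a • rs M h m) = Y.presheaf.germ U y hU a := by
  rw [germCoeff_smul, germCoeff_rs]
  have h1 : hm.germCoeff hy (h hU) m = 1 := by
    rw [germCoeff_apply, hm.coeff_eq inf_le_left (a := 1) (one_smul _ _), map_one]
  rw [h1, mul_one]

end GermCoeff

section StalkSection

variable {X : Scheme.{0}} (η : X)

/-- The structure sheaf of the spectrum of a stalk, as a sheaf of modules on the scheme. -/
abbrev stalkSheaf : X.Modules :=
  (Scheme.Modules.pushforward (X.fromSpecStalk η)).obj (structSheaf (Spec (X.presheaf.stalk η)))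

/-- Elements of a stalk as sections of the structure sheaf of its spectrum. -/
def stalkSection (W : X.Opens) : X.presheaf.stalk η →+ Γ(stalkSheaf η, W) :=
  (structHom (𝟙 (Spec (X.presheaf.stalk η))) (X.fromSpecStalk η ⁻¹ᵁ W)).toAddMonoidHom

lemma rs_stalkSection {W W' : X.Opens} (h : W' ≤ W) (a : X.presheaf.stalk η) :
    rs _ h (stalkSection η W a) = stalkSection η W' a :=
  ro_structHom (𝟙 (Spec (X.presheaf.stalk η))) ((X.fromSpecStalk η).preimage_mono h) a

lemma smul_stalkSection {W : X.Opens} (h : η ∈ W) (f : Γ(X, W)) (a : X.presheaf.stalk η) :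
    f • stalkSection η W a = stalkSection η W (X.presheaf.germ W η h f * a) := by
  have h1 : (X.fromSpecStalk η).app W f =
      structHom (𝟙 (Spec (X.presheaf.stalk η))) (X.fromSpecStalk η ⁻¹ᵁ W)
        (X.presheaf.germ W η h f) := by
    rw [Scheme.fromSpecStalk_app h]
    rfl
  exact (congrArg (· * structHom (𝟙 (Spec (X.presheaf.stalk η))) (X.fromSpecStalk η ⁻¹ᵁ W) a)
    h1).trans (map_mul _ _ _).symm

lemma stalkSection_injective (hη : IsField (X.presheaf.stalk η)) {W : X.Opens} (h : η ∈ W) :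
    Function.Injective (stalkSection η W) := by
  let := hη.toField
  have h1 : Nonempty (X.fromSpecStalk η ⁻¹ᵁ W) :=
    ⟨⟨IsLocalRing.closedPoint (X.presheaf.stalk η), by
      change X.fromSpecStalk η (IsLocalRing.closedPoint (X.presheaf.stalk η)) ∈ W
      rwa [Scheme.fromSpecStalk_closedPoint]⟩⟩
  exact (structHom (𝟙 (Spec (X.presheaf.stalk η))) (X.fromSpecStalk η ⁻¹ᵁ W)).injective

/-- The spectrum of a field is one point, which maps to `η`; its preimage of `W` is therefore empty.
-/
lemma subsingleton_stalkSheaf (hη : IsField (X.presheaf.stalk η)) {W : X.Opens} (h : η ∉ W) :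
    Subsingleton Γ(stalkSheaf η, W) := by
  have h1 : X.fromSpecStalk η ⁻¹ᵁ W = ⊥ := by
    rw [eq_bot_iff]
    intro y hy
    have : Subsingleton (PrimeSpectrum (X.presheaf.stalk η)) :=
      let := hη.toField; inferInstance
    obtain rfl : y = IsLocalRing.closedPoint (X.presheaf.stalk η) :=
      Subsingleton.elim (α := PrimeSpectrum (X.presheaf.stalk η)) _ _
    refine (h ?_).elim
    have h2 : X.fromSpecStalk η (IsLocalRing.closedPoint (X.presheaf.stalk η)) ∈ W := hy
    rwa [Scheme.fromSpecStalk_closedPoint] at h2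
  change Subsingleton Γ(Spec (X.presheaf.stalk η), X.fromSpecStalk η ⁻¹ᵁ W)
  rw [h1]
  infer_instance

end StalkSection

namespace Deformation

variable {X : Scheme.{0}} [X.Over SpecC] {L : X.Modules}
  {V : Type} [AddCommGroup V] [Module ℂ V] [Module ℂᵐᵒᵖ V] [IsCentralScalar ℂ V]
  [FiniteDimensional ℂ V] (D : Deformation X L (infAlg V))
  {ι : Type} [Fintype ι] (b : Module.Basis ι ℂ V)

open Classical in
/-- A differential operator with prescribed values on infinitesimal sections at a generic
point. -/
lemma exists_dop_stalk [LocallyOfFiniteType (X ↘ SpecC)] {η : X}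
    (hη : IsField (X.presheaf.stalk η)) {U₀ : D.total.scheme.Opens} (hU₀ : D.i η ∈ U₀)
    {m : Γ(D.total.sheaf, U₀)} (hm : IsGen D.total.sheaf m) (k : ι) :
    ∃ Δ : D.DOp (stalkSheaf η), ∀ (U : D.total.scheme.Opens) (hU : D.i η ∈ U) (h : U ≤ U₀)
      (c : ι → Γ(D.total.scheme, U)), Δ.app U ((∑ l, D.vFun U (b l) * c l) • rs _ h m) =
        stalkSection η (D.i ⁻¹ᵁ U) (X.presheaf.germ (D.i ⁻¹ᵁ U) η hU (D.io U (c k))) := by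
  obtain ⟨d, h1, h2, h3⟩ := D.exists_derivation_stalk b hη k
  -- The derivation is applied to the germ at `η` of the coefficient with respect to `m`. Over open
  -- sets missing `η` the target is zero, so the default value `0` is the only one.
  let φ : ∀ U : D.total.scheme.Opens, Γ(D.total.sheaf, U) →+ Γ(stalkSheaf η, D.i ⁻¹ᵁ U) :=
    fun U => if h : D.i η ∈ U then (stalkSection η (D.i ⁻¹ᵁ U)).comp (d.comp (hm.germCoeff hU₀ h))
      else 0
  have hφ : ∀ (U : D.total.scheme.Opens) (h : D.i η ∈ U) t,
      φ U t = stalkSection η (D.i ⁻¹ᵁ U) (d (hm.germCoeff hU₀ h t)) := fun U h t => by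
    simp only [φ, dif_pos h]
    rfl
  have hsub : ∀ U : D.total.scheme.Opens, D.i η ∉ U →
      Subsingleton Γ(stalkSheaf η, D.i ⁻¹ᵁ U) := fun U h => subsingleton_stalkSheaf η hη h
  have hgerm : ∀ (U : D.total.scheme.Opens) (h : D.i η ∈ U) (a : Γ(D.total.scheme, U)) y,
      D.io U a • stalkSection η (D.i ⁻¹ᵁ U) y = stalkSection η (D.i ⁻¹ᵁ U)
        (D.stalkRes η (D.total.scheme.presheaf.germ U _ h a) * y) := fun U h a y => by
    rw [D.stalkRes_germ]
    exact smul_stalkSection η (W := D.i ⁻¹ᵁ U) h _ _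
  refine ⟨⟨φ, fun {U U'} h t => ?_, fun U => ⟨fun c t => ?_, fun a a' t => ?_⟩⟩,
    fun U hU h c => ?_⟩
  · by_cases hU' : D.i η ∈ U'
    · rw [hφ U' hU', hφ U (h hU'), hm.germCoeff_rs hU₀ hU' h]
      exact (rs_stalkSection η (D.i.preimage_mono h) _).symm
    · have := hsub U' hU'
      exact Subsingleton.elim _ _
  · by_cases hU : D.i η ∈ U
    · rw [hφ U hU, hφ U hU, hm.germCoeff_smul, h1, germ_algebraMap, h2, mul_zero, add_zero,
        hgerm U hU,
        germ_algebraMap]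
    · have := hsub U hU
      exact Subsingleton.elim _ _
  · by_cases hU : D.i η ∈ U
    · rw [hφ U hU, hφ U hU, hφ U hU, hφ U hU, hgerm _ hU, hgerm _ hU, hgerm _ hU, ← map_add,
        ← map_add]
      congr 1
      simp only [hm.germCoeff_smul, map_mul, h1]
      ring
    · have := hsub U hU
      exact Subsingleton.elim _ _
  · exact (hφ U hU _).trans (congrArg (stalkSection η (D.i ⁻¹ᵁ U))
      ((congrArg d (hm.germCoeff_smul_gen hU₀ hU h _)).trans (h3 U hU c)))

end Deformation

namespace Deformation

variable {X : Scheme.{0}} [X.Over SpecC] {L : X.Modules}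

section General

variable {A : ArtAlg} (D : Deformation X L A)

lemma exists_rl_family {ι : Type} [Finite ι] {W : X.Opens} (l : ι → Γ(L, W)) {x : X}
    (hx : x ∈ W) : ∃ (U : D.total.scheme.Opens) (h : D.i ⁻¹ᵁ U ≤ W), x ∈ D.i ⁻¹ᵁ U ∧
      ∃ t : ι → Γ(D.total.sheaf, U), ∀ k, D.rl U (t k) = rs L h (l k) := by
  choose U hU hxU t ht using fun k => D.exists_rl_eq (l k) hx
  obtain ⟨W, rfl⟩ := D.exists_preimage_eq W
  let Z : D.total.scheme.Opens :=
    ⟨W ∩ ⋂ k, (U k : Set D.total.scheme), W.2.inter (isOpen_iInter_of_finite fun k => (U k).2)⟩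
  have hZ : ∀ k, Z ≤ U k := fun k y hy => Set.mem_iInter.1 hy.2 k
  have hZW : Z ≤ W := fun y hy => hy.1
  refine ⟨Z, D.i.preimage_mono hZW, ⟨hx, Set.mem_iInter.2 hxU⟩, fun k => rs _ (hZ k) (t k),
    fun k => ?_⟩
  rw [rl_rs, ht, rs_rs]

/-- The universal differential operator `t ↦ p₁(t)|_X`. -/
def jetOp : D.DOp ((Scheme.Modules.pullback D.i).obj (jets D.total.sheaf)) where
  app U := D.jetAt U
  app_rs h t := secHom_rs (p₁ D.total.sheaf ≫
    ((Scheme.Modules.pullbackPushforwardAdjunction D.i).unit.app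
      (jets D.total.sheaf)).mapPresheaf) h t
  isDiffOp U :=
    { const := fun c t => by
        have h := congrArg (((Scheme.Modules.pullbackPushforwardAdjunction D.i).unit.app
          (jets D.total.sheaf)).app U) ((isDiffOp_p₁ D.total.sheaf U).const c t)
        refine h.trans ?_
        exact ((Scheme.Modules.pullbackPushforwardAdjunction D.i).unit.app
          (jets D.total.sheaf)).app_smul _ _
      leibniz := D.jetAt_leibniz U }

lemma homEquiv_symm_app_jetAt {N : X.Modules}
    (f : jets D.total.sheaf ⟶ (Scheme.Modules.pushforward D.i).obj N)
    (U : D.total.scheme.Opens) (t : Γ(D.total.sheaf, U)) :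
    (((Scheme.Modules.pullbackPushforwardAdjunction D.i).homEquiv _ _).symm f).app (D.i ⁻¹ᵁ U)
      (D.jetAt U t) = f.app U (p₁Hom D.total.sheaf U t) := by
  have h := ((Scheme.Modules.pullbackPushforwardAdjunction D.i).homEquiv_unit _ _
    (((Scheme.Modules.pullbackPushforwardAdjunction D.i).homEquiv _ _).symm f)).symm
  rw [Equiv.apply_symm_apply] at h
  exact congr(($h).app U (p₁Hom D.total.sheaf U t))

lemma jetRestr_jetAt (U : D.total.scheme.Opens) (t : Γ(D.total.sheaf, U)) :
    D.jetRestr.app (D.i ⁻¹ᵁ U) (D.jetAt U t) = p₁Hom L _ (D.rl U t) :=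
  (D.homEquiv_symm_app_jetAt _ U t).trans (jetsDesc_p₁ D.resJet D.isDiffOp_resJet U t)

lemma exists_hom_jetAt {N : X.Modules} (Δ : D.DOp N) :
    ∃ g : (Scheme.Modules.pullback D.i).obj (jets D.total.sheaf) ⟶ N,
      ∀ (U : D.total.scheme.Opens) t, g.app (D.i ⁻¹ᵁ U) (D.jetAt U t) = Δ.app U t :=
  ⟨((Scheme.Modules.pullbackPushforwardAdjunction D.i).homEquiv _ _).symm
    (jetsDesc Δ.toPresheafHom Δ.isDiffOpSheaf), fun U t =>
      (D.homEquiv_symm_app_jetAt _ U t).trans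
        (jetsDesc_p₁ Δ.toPresheafHom Δ.isDiffOpSheaf U t)⟩

lemma hom_ext_jetAt {N : X.Modules}
    {f g : (Scheme.Modules.pullback D.i).obj (jets D.total.sheaf) ⟶ N}
    (h : ∀ (U : D.total.scheme.Opens) t,
      f.app (D.i ⁻¹ᵁ U) (D.jetAt U t) = g.app (D.i ⁻¹ᵁ U) (D.jetAt U t)) : f = g := by
  apply ((Scheme.Modules.pullbackPushforwardAdjunction D.i).homEquiv _ _).injective
  refine DefPair.jets_hom_ext fun U t => ?_
  rw [Adjunction.homEquiv_unit, Adjunction.homEquiv_unit]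
  exact h U t

end General

section Inf

variable {V : Type} [AddCommGroup V] [Module ℂ V] [Module ℂᵐᵒᵖ V] [IsCentralScalar ℂ V]
  [FiniteDimensional ℂ V] {D : Deformation X L (infAlg V)}
  {ι : Type} [Fintype ι] {b : Module.Basis ι ℂ V} {M : X.Modules} {F : Frame L M b}
  {j : M ⟶ (Scheme.Modules.pullback D.i).obj (jets D.total.sheaf)}

/-- The one-jets of a deformation, compared with the one-jets of the closed fibre. -/
def jetComparison (hj : ∀ U v t, D.jetAt U (D.vFun U v • t) =
    j.app (D.i ⁻¹ᵁ U) ((F.τ v).app _ (D.rl U t))) : D.Comparison F j D.jetRestr where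
  d := D.jetOp
  r_d := D.jetRestr_jetAt
  d_vFun := hj

/-- The map `j` is the symbol of the universal operator `t ↦ p₁(t)|_X`, that is, its restriction to
`V ℒ`. -/
lemma exists_jetAt_vFun (D : Deformation X L (infAlg V)) (F : Frame L M b) :
    ∃ j : M ⟶ (Scheme.Modules.pullback D.i).obj (jets D.total.sheaf),
      ∀ U v t, D.jetAt U (D.vFun U v • t) = j.app (D.i ⁻¹ᵁ U) ((F.τ v).app _ (D.rl U t)) := by
  obtain ⟨κ, hκ⟩ := D.jetOp.exists_symbol
  refine ⟨F.desc fun k => κ (b k), fun U v t => (hκ v U t).symm.trans ?_⟩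
  exact congr(($(F.τ_comp_desc κ v)).app _ (D.rl U t)).symm

/-- This is where reducedness enters. Locally an element of `M` is `∑ v_k ⊗ c_k m₀|_X`, and its
image under `j` is the restricted one-jet of `∑ v_k c_k m₀`. If this image is zero, every
first-order operator with values on `X` kills `∑ v_k c_k m₀`. But if some `c_k|_X` is nonzero, it is
nonzero at a point whose stalk is a field, and the operator of `exists_dop_stalk` takes there the
value `c_k|_X`. -/
lemma mono_of_jetAt_vFun [IsReduced X] [LocallyOfFiniteType (X ↘ SpecC)]
    (hj : ∀ U v t, D.jetAt U (D.vFun U v • t) =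
      j.app (D.i ⁻¹ᵁ U) ((F.τ v).app _ (D.rl U t))) : Mono j := by
  refine mono_of_app_injective j fun W => (injective_iff_map_eq_zero (j.app W).hom).2
    fun m hm => ?_
  have hsum : ∀ (Z : X.Opens) (n : Γ(M, Z)),
      n = ∑ k, (F.τ (b k)).app Z ((F.π k).app Z n) := fun Z n => by
    have h := congr(($(F.sum_π_τ)).app Z n)
    rw [sum_app_apply] at h
    exact h.symm
  refine rs_ext fun x hx => ?_
  obtain ⟨U₁, hU₁, hxU₁, t, ht⟩ := D.exists_rl_family (fun k => (F.π k).app W m) hx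
  obtain ⟨U₀, hxU₀, m₀, hm₀, -⟩ := D.exists_isGen x
  let U := U₀ ⊓ U₁
  have h₀ : U ≤ U₀ := inf_le_left
  have h₁ : U ≤ U₁ := inf_le_right
  have hle : D.i ⁻¹ᵁ U ≤ W := (D.i.preimage_mono h₁).trans hU₁
  refine ⟨D.i ⁻¹ᵁ U, hle, ⟨hxU₀, hxU₁⟩, ?_⟩
  let c : ι → Γ(D.total.scheme, U) := fun k => hm₀.coeff h₀ (rs _ h₁ (t k))
  have hc : ∀ k, D.rl U (c k • rs _ h₀ m₀) = rs L hle ((F.π k).app W m) := fun k => by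
    rw [hm₀.coeff_smul_gen, rl_rs, ht, rs_rs]
  have hz : D.jetAt U ((∑ k, D.vFun U (b k) * c k) • rs _ h₀ m₀) = 0 := by
    simp only [Finset.sum_smul, mul_smul, map_sum, hj, hc]
    rw [← map_sum]
    simp only [app_rs]
    rw [← map_sum, ← hsum, app_rs]
    exact (congrArg _ hm).trans (map_zero _)
  have hc0 : ∀ k, D.io U (c k) = 0 := by
    intro k
    by_contra hne
    obtain ⟨η, hη, hK, hg⟩ := exists_isField_stalk hne
    obtain ⟨Δ, hΔ⟩ := D.exists_dop_stalk b hK (h₀ hη) hm₀ k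
    obtain ⟨g, hg'⟩ := D.exists_hom_jetAt Δ
    have h1 := (hΔ U hη h₀ c).symm.trans ((hg' _ _).symm.trans (congrArg _ hz))
    rw [map_zero] at h1
    exact hg (stalkSection_injective η hK hη (h1.trans (map_zero _).symm))
  rw [hsum _ (rs M hle m), map_zero]
  refine Finset.sum_eq_zero fun k _ => ?_
  rw [app_rs, ← hc, rl_smul, hc0, zero_smul, map_zero]

/-- The sequence of one-jets attached to an infinitesimal deformation is exact. -/
lemma shortExact_of_jetAt_vFun [IsReduced X] [LocallyOfFiniteType (X ↘ SpecC)]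
    (hj : ∀ U v t, D.jetAt U (D.vFun U v • t) =
      j.app (D.i ⁻¹ᵁ U) ((F.τ v).app _ (D.rl U t))) :
    ∃ w : j ≫ D.jetRestr = 0, (ShortComplex.mk j D.jetRestr w).ShortExact := by
  have w : j ≫ D.jetRestr = 0 := F.hom_ext fun k => D.hom_ext fun U t => by
    have h1 := congrArg (D.jetRestr.app (D.i ⁻¹ᵁ U)) (hj U (b k) t)
    rw [jetRestr_jetAt, rl_vFun_smul, map_zero] at h1
    rw [comp_zero]
    exact h1.symm
  have hm : Mono j := mono_of_jetAt_vFun hj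
  -- A map on `𝒫¹(L)` is determined by its values at one-jets of restrictions of sections of `ℒ`,
  -- and these are in the image.
  have he : Epi D.jetRestr := ⟨fun f g hfg => D.jets_hom_ext fun U t => by
    rw [← jetRestr_jetAt]
    exact congr(($hfg).app _ (D.jetAt U t))⟩
  refine ⟨w, ⟨ShortComplex.exact_of_g_is_cokernel _
    (CokernelCofork.IsColimit.ofπ' _ _ fun {N} k hk => ?_)⟩⟩
  dsimp at hk
  apply Nonempty.some
  apply nonempty_subtype.2
  -- A map on `𝒫¹(ℒ)|_X` that kills `M` is an operator on `ℒ` that kills `V ℒ`; it descends to an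
  -- operator on `L`, which is a map on `𝒫¹(L)`.
  obtain ⟨s, hs⟩ := D.exists_factor (D.jetOp.comp k).toPresheafHom fun U v t => by
    refine (congrArg _ (hj U v t)).trans ?_
    exact congr(($hk).app _ ((F.τ v).app _ (D.rl U t)))
  have hs' := D.isDiffOpSheaf_of_factor (D.jetOp.comp k).isDiffOpSheaf hs
  refine ⟨jetsDesc s hs', D.hom_ext_jetAt fun U t => ?_⟩
  refine Eq.trans ?_ (hs U t)
  refine Eq.trans ?_ (jetsDesc_p₁ s hs' _ _)
  exact congrArg _ (D.jetRestr_jetAt U t)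

/-- Every infinitesimal deformation has an extension of one-jets. -/
lemma exists_comparison [IsReduced X] [LocallyOfFiniteType (X ↘ SpecC)]
    (D : Deformation X L (infAlg V)) (F : Frame L M b) :
    ∃ (E : X.Modules) (j : M ⟶ E) (r : E ⟶ jets L) (w : j ≫ r = 0),
      (ShortComplex.mk j r w).ShortExact ∧ Nonempty (D.Comparison F j r) := by
  obtain ⟨j, hj⟩ := D.exists_jetAt_vFun F
  obtain ⟨w, hS⟩ := shortExact_of_jetAt_vFun hj
  exact ⟨_, j, _, w, hS, ⟨jetComparison hj⟩⟩

end Inf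

/-- The sheaf `L` itself as a tensor product with the vector space `ℂ`. -/
def lineFrame (L : X.Modules) : Frame L L (Module.Basis.singleton Unit ℂ) where
  τ := LinearMap.toSpanSingleton ℂ (L ⟶ L) (𝟙 L)
  π _ := 𝟙 L
  τ_π k := by simp
  τ_π_of_ne k l h := (h rfl).elim
  sum_π_τ := by simp

/-- The explicit map `j` of the sequence (∗) is the symbol of `t ↦ p₁(t)|_X`. Hence the general
results on infinitesimal deformations apply to (∗) itself. -/
lemma jetAt_vFun_eq_jetIncl (D : Deformation X L dualNumbers) (U : D.total.scheme.Opens) (v : ℂ)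
    (t : Γ(D.total.sheaf, U)) : D.jetAt U (D.vFun U v • t) =
      D.jetIncl.app (D.i ⁻¹ᵁ U) (((lineFrame L).τ v).app _ (D.rl U t)) := by
  have h1 : ∀ t, D.jetIncl.app (D.i ⁻¹ᵁ U) (D.rl U t) = D.jetAt U (D.vFun U 1 • t) := by
    intro t
    have h2 : D.res ≫ (Scheme.Modules.pushforward D.i).map D.jetIncl = D.epsJet := by
      have h3 : D.res = (Scheme.Modules.pullbackPushforwardAdjunction D.i).unit.app _ ≫
          (Scheme.Modules.pushforward D.i).map D.resIso.hom := by
        refine Eq.trans ?_ ((Scheme.Modules.pullbackPushforwardAdjunction D.i).homEquiv_unit _ _ _)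
        exact (Equiv.apply_symm_apply _ _).symm
      rw [h3, Category.assoc, ← Functor.map_comp, jetIncl, Iso.hom_inv_id_assoc]
      refine ((Scheme.Modules.pullbackPushforwardAdjunction D.i).homEquiv_unit _ _ _).symm.trans ?_
      exact Equiv.apply_symm_apply _ _
    exact congr(($h2).app U t)
  have h2 : v = v • (1 : ℂ) := by simp
  rw [h2]
  refine (D.jetOp.app_vFun_smul U v 1 t).trans ?_
  refine (congrArg (v • ·) (h1 t).symm).trans ?_
  rw [← app_smul_complex]
  congr 1
  rw [map_smul]
  have h3 : (lineFrame L).τ 1 = 𝟙 L := LinearMap.toSpanSingleton_apply_one _ _ _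
  rw [h3]
  rfl

end Deformation

namespace Deformation

variable {X : Scheme.{0}} [X.Over SpecC] {L : X.Modules}
  {V : Type} [AddCommGroup V] [Module ℂ V] [Module ℂᵐᵒᵖ V] [IsCentralScalar ℂ V]
  [FiniteDimensional ℂ V]

/-! ### Sections of the line bundle of a deformation -/

section Sections

variable (D : Deformation X L (infAlg V))

/-- Locally `t` lies in `V ℒ`, and `V² = 0`. Thus `v t` depends only on `t|_X`. -/
lemma vFun_smul_eq_zero {U : D.total.scheme.Opens} {t : Γ(D.total.sheaf, U)} (ht : D.rl U t = 0)
    (v : V) : D.vFun U v • t = 0 := by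
  refine rs_ext fun y hy => ?_
  obtain ⟨x, rfl⟩ := D.i.surjective y
  obtain ⟨U', h, hxU, c, hc⟩ := D.exists_sum_eq_of_rl_eq_zero (Module.finBasis ℂ V) ht hy
  refine ⟨U', h, hxU, ?_⟩
  rw [rs_vFun_smul, hc, Finset.smul_sum, map_zero]
  exact Finset.sum_eq_zero fun k _ => by rw [smul_smul, vFun_mul_vFun, zero_smul]

lemma vFun_smul_eq {U : D.total.scheme.Opens}
    {t t' : Γ(D.total.sheaf, U)}
    (ht : D.rl U t = D.rl U t') (v : V) : D.vFun U v • t = D.vFun U v • t' := by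
  rw [← sub_eq_zero, ← smul_sub]
  exact D.vFun_smul_eq_zero (by rw [map_sub, ht, sub_self]) v

lemma vFun_mul_eq {U : D.total.scheme.Opens} {a a' : Γ(D.total.scheme, U)}
    (ha : D.io U a = D.io U a') (v : V) : D.vFun U v * a = D.vFun U v * a' := by
  rw [← sub_eq_zero, ← mul_sub]
  have h0 : D.io U (a - a') = 0 := by rw [map_sub, ha, sub_self]
  refine ro_ext fun y hy => ?_
  obtain ⟨U', h, hxU, c, hc⟩ := D.exists_sum_eq_of_io_eq_zero (Module.finBasis ℂ V) h0 hy
  refine ⟨U', h, hxU, ?_⟩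
  rw [map_mul, ro_vFun, hc, Finset.mul_sum, map_zero]
  exact Finset.sum_eq_zero fun k _ => by rw [← mul_assoc, vFun_mul_vFun, zero_mul]

end Sections

namespace Comparison

variable {D : Deformation X L (infAlg V)} {ι : Type} [Fintype ι] {b : Module.Basis ι ℂ V}
  {M E : X.Modules} {F : Frame L M b} {j : M ⟶ E} {r : E ⟶ jets L} (C : D.Comparison F j r)
  {w : j ≫ r = 0}

/-- If `t|_X = 0` then locally `t = ∑ v_k c_k`, and `d(t)` is the image under the monomorphism `j`
of `∑ v_k ⊗ c_k|_X`. So all `c_k|_X` vanish, and with them `v_k c_k`. This makes `ℒ → E ×_{𝒫¹(L)} L`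
injective, which also allows lifts to be glued. -/
lemma eq_zero (hS : (ShortComplex.mk j r w).ShortExact) {U : D.total.scheme.Opens}
    {t : Γ(D.total.sheaf, U)} (h : C.d.app U t = 0)
    (h' : D.rl U t = 0) : t = 0 := by
  refine rs_ext fun y hy => ?_
  obtain ⟨x, rfl⟩ := D.i.surjective y
  obtain ⟨U', hU, hxU, c, hc⟩ := D.exists_sum_eq_of_rl_eq_zero b h' hy
  refine ⟨U', hU, hxU, ?_⟩
  have h1 := C.d.app_rs hU t
  rw [h, hc, map_zero, map_sum] at h1
  simp only [C.d_vFun] at h1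
  rw [← map_sum] at h1
  have := hS.mono_f
  have h2 := app_injective_of_mono j _ (h1.trans (map_zero _).symm)
  have h3 : ∀ k, D.rl U' (c k) = 0 := fun k => by
    have h4 := congrArg ((F.π k).app _) h2
    rw [map_zero, map_sum, Finset.sum_eq_single k] at h4
    · have h5 := congr(($(F.τ_π k)).app _ (D.rl U' (c k)))
      exact h5.symm.trans h4
    · intro l _ hl
      exact congr(($(F.τ_π_of_ne l k hl)).app _ (D.rl U' (c l)))
    · simp
  rw [hc, map_zero]
  exact Finset.sum_eq_zero fun k _ => D.vFun_smul_eq_zero (h3 k) _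

lemma eq_of_eq (hS : (ShortComplex.mk j r w).ShortExact) {U : D.total.scheme.Opens}
    {t t' : Γ(D.total.sheaf, U)}
    (h : C.d.app U t = C.d.app U t') (h' : D.rl U t = D.rl U t') : t = t' := by
  rw [← sub_eq_zero]
  exact C.eq_zero hS (by rw [map_sub, h, sub_self]) (by rw [map_sub, h', sub_self])

/-- The sections of the line bundle of a deformation, in terms of the extension. -/
lemma exists_section (hS : (ShortComplex.mk j r w).ShortExact) {U : D.total.scheme.Opens}
    (e : Γ(E, D.i ⁻¹ᵁ U)) (l : Γ(L, D.i ⁻¹ᵁ U))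
    (h : r.app _ e = p₁Hom L _ l) : ∃ t : Γ(D.total.sheaf, U), C.d.app U t = e ∧ D.rl U t = l := by
  obtain ⟨t, ht⟩ := exists_rs (M := D.total.sheaf) (U := U)
    (fun Z hZ t => C.d.app Z t = rs E (D.i.preimage_mono hZ) e ∧
      D.rl Z t = rs L (D.i.preimage_mono hZ) l)
    (fun Z Z' hZ h t ht => by
      rw [C.d.app_rs, rl_rs, ht.1, ht.2, rs_rs, rs_rs]
      exact ⟨rfl, rfl⟩)
    (fun Z hZ s t hs ht => C.eq_of_eq hS (hs.1.trans ht.1.symm) (hs.2.trans ht.2.symm))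
    (fun y hy => by
      obtain ⟨x, rfl⟩ := D.i.surjective y
      obtain ⟨U₁, hU₁, hxU₁, t, ht⟩ := D.exists_rl_eq l hy
      have hU₁' : U₁ ≤ U := D.preimage_le_iff.1 hU₁
      -- A local lift `t` of `l` has the right value under `d` up to a section `m` of `M`. Adding
      -- `v_k` times lifts of the coordinates of `m` corrects this without changing `t|_X`.
      obtain ⟨m, hm⟩ := exists_app_eq_of_exact hS (D.i ⁻¹ᵁ U₁)
        (rs E hU₁ e - C.d.app U₁ t) (by
          dsimp only
          rw [map_sub, C.r_d, ht, app_rs, h, sub_eq_zero]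
          exact (secHom_rs (p₁ L) _ _).symm)
      have hm : j.app _ m = _ := hm
      obtain ⟨U₂, hU₂, hxU₂, c, hc⟩ := D.exists_rl_family (fun k => (F.π k).app _ m) hxU₁
      have hU₂' : U₂ ≤ U₁ := D.preimage_le_iff.1 hU₂
      refine ⟨U₂, hU₂'.trans hU₁', hxU₂, rs _ hU₂' t + ∑ k, D.vFun U₂ (b k) • c k, ?_, ?_⟩
      · rw [map_add, map_sum]
        simp only [C.d_vFun, hc]
        rw [← map_sum]
        have h1 : ∑ k, (F.τ (b k)).app _ (rs L hU₂ ((F.π k).app _ m)) = rs M hU₂ m := by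
          have h2 := congr(($(F.sum_π_τ)).app _ (rs M hU₂ m))
          rw [sum_app_apply] at h2
          simp only [← app_rs]
          exact h2
        rw [h1, app_rs, hm, C.d.app_rs, map_sub, rs_rs, add_sub_cancel]
      · rw [map_add, rl_rs, ht, map_sum, rs_rs]
        simp only [rl_vFun_smul, Finset.sum_const_zero, add_zero])
  refine ⟨t, rs_ext fun x hx => ?_, rs_ext fun x hx => ?_⟩
  · obtain ⟨Z, hZ, hxZ, h1, -⟩ := ht (D.i x) hx
    exact ⟨_, D.i.preimage_mono hZ, hxZ, by rw [← C.d.app_rs hZ, h1]⟩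
  · obtain ⟨Z, hZ, hxZ, -, h1⟩ := ht (D.i x) hx
    exact ⟨_, D.i.preimage_mono hZ, hxZ, by rw [← D.rl_rs hZ, h1]⟩

end Comparison

end Deformation

/-! ### Morphisms of deformations over `ℂ[V]` -/

lemma isIso_of_isHomeomorph {Y Z : Scheme.{0}} (f : Y ⟶ Z) (hf : IsHomeomorph f)
    (h : ∀ U, Function.Bijective (f.app U)) : IsIso f := by
  let F := Scheme.forgetToLocallyRingedSpace ⋙ LocallyRingedSpace.forgetToSheafedSpace ⋙
    SheafedSpace.forgetToPresheafedSpace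
  have h1 : IsIso f.base := TopCat.isIso_iff_isHomeomorph _ |>.2 hf
  have hb : IsIso (F.map f).base := h1
  have hc : IsIso (F.map f).c := by
    rw [NatTrans.isIso_iff_isIso_app]
    exact fun U => (ConcreteCategory.isIso_iff_bijective _).2 (h U.unop)
  have : IsIso (F.map f) := PresheafedSpace.isIso_of_components _
  exact isIso_of_reflects_iso f F

/-- A morphism of pairs which is an isomorphism on spaces and sections. -/
lemma Pair.isIso_of_bijective {P Q : Pair} (g : P ⟶ Q) [IsIso g.base]
    (h : ∀ U, Function.Bijective (g.map.app U)) : IsIso g := by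
  have h1 : IsIso g.map := isIso_of_app_bijective _ h
  have hc : Pair.IsCart g := by
    rw [Pair.isCart_iff]
    intro T
    have hF : Function.Bijective (fun φ : P.sheaf ⟶ T =>
        (Scheme.Modules.pushforward g.base).map φ) :=
      ⟨Functor.map_injective _, Functor.map_surjective _⟩
    exact ((asIso g.map).homFromEquiv.symm.bijective).comp hF
  obtain ⟨k, hk1, hk2⟩ := Pair.exists_lift hc (𝟙 Q) (inv g.base) (by simp)
  refine ⟨k, Pair.lift_unique hc ?_ ?_, hk2⟩
  · rw [Pair.comp_base, hk1]
    exact IsIso.hom_inv_id _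
  · rw [Category.assoc, hk2, Category.comp_id, Category.id_comp]

namespace Deformation

variable {X : Scheme.{0}} [X.Over SpecC] {L : X.Modules}
  {V : Type} [AddCommGroup V] [Module ℂ V] [Module ℂᵐᵒᵖ V] [IsCentralScalar ℂ V]
  [FiniteDimensional ℂ V]

lemma exists_io_family {A : ArtAlg} (D : Deformation X L A) {ι : Type} [Finite ι] {W : X.Opens}
    (f : ι → Γ(X, W)) {x : X} (hx : x ∈ W) :
    ∃ (U : D.total.scheme.Opens) (h : D.i ⁻¹ᵁ U ≤ W), x ∈ D.i ⁻¹ᵁ U ∧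
      ∃ a : ι → Γ(D.total.scheme, U), ∀ k, D.io U (a k) = ro h (f k) := by
  choose U hU hxU t ht using fun k => D.exists_io_eq (f k) hx
  obtain ⟨W, rfl⟩ := D.exists_preimage_eq W
  let Z : D.total.scheme.Opens :=
    ⟨W ∩ ⋂ k, (U k : Set D.total.scheme), W.2.inter (isOpen_iInter_of_finite fun k => (U k).2)⟩
  have hZ : ∀ k, Z ≤ U k := fun k y hy => Set.mem_iInter.1 hy.2 k
  have hZW : Z ≤ W := fun y hy => hy.1
  refine ⟨Z, D.i.preimage_mono hZW, ⟨hx, Set.mem_iInter.2 hxU⟩, fun k => ro (hZ k) (t k),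
    fun k => ?_⟩
  rw [io_ro, ht, ro_ro]

section Morphism

variable {D D' : Deformation X L (infAlg V)} {g : D'.total ⟶ D.total}

lemma pullFun_ro {U U' : D.total.scheme.Opens} (h : U' ≤ U) (a : Γ(D.total.scheme, U)) :
    pullFun g U' (ro h a) = ro (g.base.preimage_mono h) (pullFun g U a) :=
  app_ro g.base h a

lemma pullFun_vFun_of_comp (hp : g.base ≫ D.proj = D'.proj) (U : D.total.scheme.Opens) (v : V) :
    pullFun g U (D.vFun U v) = D'.vFun _ v := by
  refine (app_structHom g.base D.proj U _).trans ?_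
  rw [hp]
  rfl

lemma io_pullFun (hg : D'.incl ≫ g = D.incl) (U : D.total.scheme.Opens)
    (a : Γ(D.total.scheme, U)) :
    D'.io _ (pullFun g U a) = ro (preimage_preimage_eq hg U).ge (D.io U a) := by
  rw [io_eq_ro_io_pullFun hg, ro_ro, ro_self]

lemma rl_pullSec (hg : D'.incl ≫ g = D.incl) (U : D.total.scheme.Opens)
    (t : Γ(D.total.sheaf, U)) :
    D'.rl _ (pullSec g U t) = rs L (preimage_preimage_eq hg U).ge (D.rl U t) := by
  rw [rl_eq_rs_rl_pullSec hg, rs_rs, rs_self]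

lemma isHomeomorph_base (hg : D'.incl ≫ g = D.incl) : IsHomeomorph g.base := by
  have h : D.i = D'.i ≫ g.base := (congrArg Pair.Hom.base hg).symm
  let e := D'.isHomeomorph_i.homeomorph
  have h2 : (g.base : D'.total.scheme → D.total.scheme) = D.i ∘ e.symm := by
    funext y
    obtain ⟨x, rfl⟩ := e.surjective y
    rw [Function.comp_apply, e.symm_apply_apply, h]
    rfl
  rw [h2]
  exact D.isHomeomorph_i.comp e.symm.isHomeomorph

/-- The injectivity half of the five lemma. An element of the kernel vanishes on `X`, so it is
locally `∑ v_k c_k`; its pull-back is the corresponding sum on `D'`, and as this is zero, flatness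
of `D'` gives `c_k|_X = 0`, whence `v_k c_k = 0`. -/
lemma pullFun_injective (hp : g.base ≫ D.proj = D'.proj) (hg : D'.incl ≫ g = D.incl)
    (U : D.total.scheme.Opens) : Function.Injective (pullFun g U) := by
  rw [injective_iff_map_eq_zero]
  intro a ha
  refine ro_ext fun y hy => ?_
  have h0 : D.io U a = 0 := by rw [io_eq_ro_io_pullFun hg, ha, map_zero, map_zero]
  obtain ⟨U', h, hyU, c, hc⟩ := D.exists_sum_eq_of_io_eq_zero (Module.finBasis ℂ V) h0 hy
  refine ⟨U', h, hyU, ?_⟩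
  have h1 := congrArg (pullFun g U') hc
  rw [pullFun_ro, ha, map_zero, map_sum] at h1
  simp only [map_mul, pullFun_vFun_of_comp hp] at h1
  rw [hc, map_zero]
  refine Finset.sum_eq_zero fun k _ => ?_
  rw [D.vFun_mul_eq (a' := 0), mul_zero]
  rw [io_eq_ro_io_pullFun hg, D'.io_eq_zero_of_sum_eq_zero _ h1.symm k, map_zero, map_zero]

lemma pullSec_injective (hp : g.base ≫ D.proj = D'.proj) (hg : D'.incl ≫ g = D.incl)
    (U : D.total.scheme.Opens) : Function.Injective (pullSec g U) := by
  rw [injective_iff_map_eq_zero]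
  intro t ht
  refine rs_ext fun y hy => ?_
  have h0 : D.rl U t = 0 := by rw [rl_eq_rs_rl_pullSec hg, ht, map_zero, map_zero]
  obtain ⟨x, rfl⟩ := D.i.surjective y
  obtain ⟨U', h, hyU, c, hc⟩ := D.exists_sum_eq_of_rl_eq_zero (Module.finBasis ℂ V) h0 hy
  refine ⟨U', h, hyU, ?_⟩
  have h1 := congrArg (pullSec g U') hc
  rw [pullSec_rs, ht, map_zero, map_sum] at h1
  simp only [pullSec_smul, pullFun_vFun_of_comp hp] at h1
  rw [hc, map_zero]
  refine Finset.sum_eq_zero fun k _ => D.vFun_smul_eq_zero ?_ _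
  rw [rl_eq_rs_rl_pullSec hg, D'.rl_eq_zero_of_sum_eq_zero _ h1.symm k, map_zero]

/-- The surjectivity half. Lift the restriction of `s` to `X` to a function on `D`; the error is `∑
v_k c_k` on `D'`, and any lifts to `D` of the `c_k|_X` correct it, because only their restrictions
to `X` matter after multiplication by `v_k`. Injectivity makes the local solutions glue. -/
lemma pullFun_surjective (hp : g.base ≫ D.proj = D'.proj) (hg : D'.incl ≫ g = D.incl)
    (U : D.total.scheme.Opens) : Function.Surjective (pullFun g U) := by
  intro s
  obtain ⟨t, ht⟩ := exists_ro (X := D.total.scheme) (U := U)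
    (fun Z hZ t => pullFun g Z t = ro (g.base.preimage_mono hZ) s)
    (fun Z Z' hZ h t ht => by rw [pullFun_ro, ht, ro_ro])
    (fun Z hZ s t hs ht => pullFun_injective hp hg Z (hs.trans ht.symm))
    (fun y hy => by
      obtain ⟨x, rfl⟩ := D.i.surjective y
      have hxU : x ∈ D'.i ⁻¹ᵁ (g.base ⁻¹ᵁ U) := (preimage_preimage_eq hg U).le hy
      obtain ⟨U₁, hU₁, hxU₁, t, ht⟩ := D.exists_io_eq (D'.io _ s) hxU
      have hU₁' : U₁ ≤ U := by
        rw [← preimage_preimage_eq hg] at hU₁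
        exact D.preimage_le_iff.1 hU₁
      have h0 : D'.io _ (ro (g.base.preimage_mono hU₁') s - pullFun g U₁ t) = 0 := by
        rw [map_sub, io_ro, io_pullFun hg, ht, ro_ro, sub_self]
      have hxg : D'.i x ∈ g.base ⁻¹ᵁ U₁ := (preimage_preimage_eq hg U₁).le hxU₁
      obtain ⟨U'', h'', hxU'', c, hc⟩ :=
        D'.exists_sum_eq_of_io_eq_zero (Module.finBasis ℂ V) h0 hxg
      obtain ⟨U₂, hU₂, hxU₂, e, he⟩ := D.exists_io_family (fun k => D'.io _ (c k)) (x := x) hxU''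
      have hU₂' : g.base ⁻¹ᵁ U₂ ≤ U'' := by
        rw [preimage_preimage_eq hg] at hU₂
        exact D'.preimage_le_iff.1 hU₂
      have hU₂₁ : U₂ ≤ U₁ := by
        refine D.preimage_le_iff.1 (hU₂.trans ?_)
        rw [preimage_preimage_eq hg]
        exact D'.i.preimage_mono h''
      refine ⟨U₂, hU₂₁.trans hU₁', hxU₂,
        ro hU₂₁ t + ∑ k, D.vFun U₂ (Module.finBasis ℂ V k) * e k, ?_⟩
      have h1 := congrArg (ro hU₂') hc
      rw [map_sub, map_sub, map_sum, ro_ro, ro_ro, ro_ro, sub_eq_iff_eq_add'] at h1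
      rw [map_add, map_sum, pullFun_ro, h1]
      congr 1
      refine Finset.sum_congr rfl fun k _ => ?_
      rw [map_mul, map_mul, pullFun_vFun_of_comp hp, ro_vFun]
      refine D'.vFun_mul_eq ?_ _
      rw [io_pullFun hg, he, io_ro, ro_ro])
  refine ⟨t, ro_ext fun y hy => ?_⟩
  obtain ⟨Z, hZ, hyZ, h⟩ := ht (g.base y) hy
  exact ⟨g.base ⁻¹ᵁ Z, g.base.preimage_mono hZ, hyZ, by rw [← pullFun_ro hZ, h]⟩

lemma pullSec_surjective (hp : g.base ≫ D.proj = D'.proj) (hg : D'.incl ≫ g = D.incl)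
    (U : D.total.scheme.Opens) : Function.Surjective (pullSec g U) := by
  intro s
  obtain ⟨t, ht⟩ := exists_rs (M := D.total.sheaf) (U := U)
    (fun Z hZ t => pullSec g Z t = rs _ (g.base.preimage_mono hZ) s)
    (fun Z Z' hZ h t ht => by rw [pullSec_rs, ht, rs_rs])
    (fun Z hZ s t hs ht => pullSec_injective hp hg Z (hs.trans ht.symm))
    (fun y hy => by
      obtain ⟨x, rfl⟩ := D.i.surjective y
      have hxU : x ∈ D'.i ⁻¹ᵁ (g.base ⁻¹ᵁ U) := (preimage_preimage_eq hg U).le hy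
      obtain ⟨U₁, hU₁, hxU₁, t, ht⟩ := D.exists_rl_eq (D'.rl _ s) hxU
      have hU₁' : U₁ ≤ U := by
        rw [← preimage_preimage_eq hg] at hU₁
        exact D.preimage_le_iff.1 hU₁
      have h0 : D'.rl _ (rs _ (g.base.preimage_mono hU₁') s - pullSec g U₁ t) = 0 := by
        rw [map_sub, rl_rs, rl_pullSec hg, ht, rs_rs, sub_self]
      have hxg : x ∈ D'.i ⁻¹ᵁ (g.base ⁻¹ᵁ U₁) := (preimage_preimage_eq hg U₁).le hxU₁
      obtain ⟨U'', h'', hxU'', c, hc⟩ :=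
        D'.exists_sum_eq_of_rl_eq_zero (Module.finBasis ℂ V) h0 hxg
      obtain ⟨U₂, hU₂, hxU₂, e, he⟩ := D.exists_rl_family (fun k => D'.rl _ (c k)) (x := x) hxU''
      have hU₂' : g.base ⁻¹ᵁ U₂ ≤ U'' := by
        rw [preimage_preimage_eq hg] at hU₂
        exact D'.preimage_le_iff.1 hU₂
      have hU₂₁ : U₂ ≤ U₁ := by
        refine D.preimage_le_iff.1 (hU₂.trans ?_)
        rw [preimage_preimage_eq hg]
        exact D'.i.preimage_mono h''
      refine ⟨U₂, hU₂₁.trans hU₁', hxU₂,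
        rs _ hU₂₁ t + ∑ k, D.vFun U₂ (Module.finBasis ℂ V k) • e k, ?_⟩
      have h1 := congrArg (rs _ hU₂') hc
      rw [map_sub, map_sub, map_sum, rs_rs, rs_rs, rs_rs, sub_eq_iff_eq_add'] at h1
      rw [map_add, map_sum, pullSec_rs, h1]
      congr 1
      refine Finset.sum_congr rfl fun k _ => ?_
      rw [rs_smul, pullSec_smul, pullFun_vFun_of_comp hp, ro_vFun]
      refine D'.vFun_smul_eq ?_ _
      rw [rl_pullSec hg, he, rl_rs, rs_rs])
  refine ⟨t, rs_ext fun y hy => ?_⟩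
  obtain ⟨Z, hZ, hyZ, h⟩ := ht (g.base y) hy
  exact ⟨g.base ⁻¹ᵁ Z, g.base.preimage_mono hZ, hyZ, (pullSec_rs (g := g) hZ t).symm.trans h⟩

/-- Morphisms of first-order deformations are isomorphisms. -/
theorem isomorphic_of_hom (hp : g.base ≫ D.proj = D'.proj) (hg : D'.incl ≫ g = D.incl) :
    D'.Isomorphic D := by
  have : IsIso g.base := isIso_of_isHomeomorph _ (isHomeomorph_base hg)
    fun U => ⟨pullFun_injective hp hg U, pullFun_surjective hp hg U⟩
  have : IsIso g := Pair.isIso_of_bijective g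
    fun U => ⟨pullSec_injective hp hg U, pullSec_surjective hp hg U⟩
  exact ⟨asIso g, hp, hg⟩

end Morphism

end Deformation

/-! ### Square-zero thickenings of a scheme -/

/-- A locally ringed space is affine if its map to the spectrum of its global sections is a
homeomorphism and the sections over basic open subsets are localizations. -/
lemma isIso_toΓSpec_of_isLocalization (Y : LocallyRingedSpace.{0})
    (h : IsHomeomorph Y.toΓSpecFun)
    (hY : ∀ r : LocallyRingedSpace.Γ.obj (op Y), Function.Bijective (Y.toΓSpecCApp r)) :
    IsIso Y.toΓSpec := by
  have hb : IsIso Y.toΓSpecSheafedSpace.hom.base := TopCat.isIso_iff_isHomeomorph _ |>.2 h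
  have hc : IsIso Y.toΓSpecSheafedSpace.hom.c := by
    let φ : (Spec.structureSheaf (LocallyRingedSpace.Γ.obj (op Y))) ⟶
      (TopCat.Sheaf.pushforward _ Y.toΓSpecBase).obj Y.𝒪 := ⟨Y.toΓSpecSheafedSpace.hom.c⟩
    have hφ : IsIso φ := by
      refine TopCat.Sheaf.isIso_iff_isIso_basis PrimeSpectrum.isBasis_basic_opens fun r => ?_
      refine (ConcreteCategory.isIso_iff_bijective _).2 ?_
      change Function.Bijective (Y.toΓSpecSheafedSpace.hom.c.app (op (PrimeSpectrum.basicOpen r)))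
      rw [Y.toΓSpecSheafedSpace_app_eq]
      exact hY r
    obtain ⟨ψ, h1, h2⟩ := hφ
    exact ⟨ψ.hom, congrArg (fun f => f.hom) h1, congrArg (fun f => f.hom) h2⟩
  have h1 : IsIso Y.toΓSpecSheafedSpace.hom := PresheafedSpace.isIso_of_components _
  have h1' : IsIso ((SheafedSpace.forgetToPresheafedSpace (C := CommRingCat.{0})).map
      Y.toΓSpecSheafedSpace) := h1
  have h2 : IsIso Y.toΓSpecSheafedSpace :=
    isIso_of_reflects_iso _ (SheafedSpace.forgetToPresheafedSpace (C := CommRingCat.{0}))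
  have h3 : IsIso (LocallyRingedSpace.forgetToSheafedSpace.map Y.toΓSpec) := h2
  exact isIso_of_reflects_iso _ LocallyRingedSpace.forgetToSheafedSpace

/-- A sheaf of rings `𝒜` on a scheme `X` with a surjection `𝒜 → 𝒪_X` whose kernel is a free
`𝒪_X`-module with basis indexed by `ι`. -/
structure Thickening (X : Scheme.{0}) (ι : Type) where
  presheaf : X.toTopCat.Presheaf CommRingCat.{0}
  isSheaf : presheaf.IsSheaf
  proj : presheaf ⟶ X.presheaf
  ker : ∀ W : X.Opens, (ι → Γ(X, W)) →+ presheaf.obj (op W)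
  ker_res : ∀ {W W' : X.Opens} (h : W' ≤ W) (r : ι → Γ(X, W)),
    presheaf.map (homOfLE h).op (ker W r) = ker W' fun k => ro h (r k)
  ker_injective : ∀ W, Function.Injective (ker W)
  proj_eq_zero : ∀ (W : X.Opens) (a : presheaf.obj (op W)),
    proj.app (op W) a = 0 ↔ ∃ r, ker W r = a
  mul_ker : ∀ (W : X.Opens) (a : presheaf.obj (op W)) (r : ι → Γ(X, W)),
    a * ker W r = ker W fun k => proj.app (op W) a * r k
  exists_lift : ∀ {W : X.Opens} (f : Γ(X, W)) {x : X}, x ∈ W → ∃ (W' : X.Opens) (h : W' ≤ W),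
    x ∈ W' ∧ ∃ a, proj.app (op W') a = ro h f

namespace Thickening

variable {X : Scheme.{0}} {ι : Type} (T : Thickening X ι)

/-- Sections of a thickening. -/
abbrev sec (W : X.Opens) : Type := T.presheaf.obj (op W)

/-- The projection to functions on the scheme. -/
def pr (W : X.Opens) : T.sec W →+* Γ(X, W) := (T.proj.app (op W)).hom

/-- Restriction of sections of a thickening. -/
def ra {W W' : X.Opens} (h : W' ≤ W) : T.sec W →+* T.sec W' := (T.presheaf.map (homOfLE h).op).hom

lemma pr_ra {W W' : X.Opens} (h : W' ≤ W) (a : T.sec W) :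
    T.pr W' (T.ra h a) = ro h (T.pr W a) :=
  congr($(T.proj.naturality (homOfLE h).op) a)

lemma ra_ker {W W' : X.Opens} (h : W' ≤ W) (r : ι → Γ(X, W)) :
    T.ra h (T.ker W r) = T.ker W' fun k => ro h (r k) := T.ker_res h r

lemma ker_mul_ker (W : X.Opens) (r s : ι → Γ(X, W)) : T.ker W r * T.ker W s = 0 := by
  rw [T.mul_ker, (T.proj_eq_zero W _).2 ⟨r, rfl⟩]
  simp only [zero_mul]
  exact map_zero _

lemma isNilpotent_of_pr_eq_zero {W : X.Opens} {a : T.sec W} (h : T.pr W a = 0) :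
    IsNilpotent a := by
  obtain ⟨r, rfl⟩ := (T.proj_eq_zero W a).1 h
  exact ⟨2, by rw [pow_two, ker_mul_ker]⟩

/-- The ringed space of a thickening. -/
def toSheafedSpace : SheafedSpace CommRingCat.{0} where
  carrier := X.toTopCat
  presheaf := T.presheaf
  IsSheaf := T.isSheaf

/-- The kernel of the projection consists of nilpotent sections, so a local lift of an inverse on
`X` is an inverse up to a unit. This makes the stalks local and gives the thickening the same basic
open sets as `X`. -/
lemma isUnit_germ_iff {W : X.Opens} (a : T.sec W) {x : X} (hx : x ∈ W) :
    IsUnit (T.presheaf.germ W x hx a) ↔ IsUnit (X.presheaf.germ W x hx (T.pr W a)) := by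
  refine ⟨fun h => ?_, fun h => ?_⟩
  · have h1 := h.map ((TopCat.Presheaf.stalkFunctor CommRingCat.{0} x).map T.proj).hom
    have h2 := TopCat.Presheaf.stalkFunctor_map_germ_apply W x hx T.proj a
    exact h2 ▸ h1
  · obtain ⟨V, i, hxV, hV⟩ :=
      X.toLocallyRingedSpace.toRingedSpace.isUnit_res_of_isUnit_germ W _ x hx h
    obtain ⟨b, hb⟩ := hV.exists_right_inv
    obtain ⟨V', hV', hxV', c, hc⟩ := T.exists_lift b hxV
    have hVW : V ≤ W := i.le
    have hu : IsUnit (T.ra (hV'.trans hVW) a) := by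
      have h1 : T.pr V' (T.ra (hV'.trans hVW) a * c - 1) = 0 := by
        rw [map_sub, map_mul, pr_ra, map_one, sub_eq_zero]
        change _ * T.proj.app (op V') c = 1
        rw [hc, ← ro_ro (X := X) hV' hVW, ← map_mul]
        exact (congrArg (ro hV') hb).trans (map_one _)
      have h2 := (T.isNilpotent_of_pr_eq_zero h1).isUnit_add_one
      rw [sub_add_cancel] at h2
      exact isUnit_of_mul_isUnit_left h2
    have h3 := hu.map (T.presheaf.germ V' x hxV').hom
    exact (TopCat.Presheaf.germ_res_apply T.presheaf (homOfLE (hV'.trans hVW)) x hxV' a) ▸ h3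

lemma isUnit_of_isUnit_pr {W : X.Opens} {a : T.sec W} (h : IsUnit (T.pr W a)) : IsUnit a :=
  RingedSpace.isUnit_of_isUnit_germ T.toSheafedSpace W a fun x hx =>
    (T.isUnit_germ_iff a hx).2 (h.map (X.presheaf.germ W x hx).hom)

/-- The locally ringed space of a thickening. -/
def toLocallyRingedSpace : LocallyRingedSpace.{0} where
  toSheafedSpace := T.toSheafedSpace
  isLocalRing x := by
    let f := ((TopCat.Presheaf.stalkFunctor CommRingCat.{0} x).map T.proj).hom
    have hf : IsLocalHom f := ⟨fun s hs => by
      obtain ⟨W, hx, a, rfl⟩ := TopCat.Presheaf.exists_germ_eq T.presheaf s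
      have h2 := TopCat.Presheaf.stalkFunctor_map_germ_apply W x hx T.proj a
      refine (T.isUnit_germ_iff a hx).2 ?_
      exact h2 ▸ hs⟩
    have : IsLocalRing (((TopCat.Presheaf.stalkFunctor CommRingCat.{0} x).obj X.presheaf)) :=
      X.toLocallyRingedSpace.isLocalRing x
    exact @RingHom.domain_isLocalRing _ _ _ _ this f hf

/-- The restriction of a thickening to an open subset. -/
def restrict (W : X.Opens) : Thickening W.toScheme ι where
  presheaf := W.isOpenEmbedding.isOpenMap.functor.op ⋙ T.presheaf
  isSheaf := TopCat.Presheaf.isSheaf_of_isOpenEmbedding W.isOpenEmbedding T.isSheaf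
  proj := Functor.whiskerLeft W.isOpenEmbedding.isOpenMap.functor.op T.proj
  ker U := T.ker (W.ι ''ᵁ U)
  ker_res h r := T.ker_res (W.ι.image_mono h) r
  ker_injective U := T.ker_injective _
  proj_eq_zero U a := T.proj_eq_zero _ a
  mul_ker U a r := T.mul_ker _ a r
  exists_lift {U} f x hx := by
    obtain ⟨V, hV, hxV, a, ha⟩ := T.exists_lift (W := W.ι ''ᵁ U) f (x := x.1) ⟨x, hx, rfl⟩
    have hVW : W.ι ''ᵁ (W.ι ⁻¹ᵁ V) ≤ V := by
      rintro _ ⟨y, hy, rfl⟩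
      exact hy
    have hVU : W.ι ⁻¹ᵁ V ≤ U := by
      intro y hy
      obtain ⟨z, hz, hzy⟩ := hV hy
      exact Subtype.ext hzy ▸ hz
    refine ⟨W.ι ⁻¹ᵁ V, hVU, hxV, T.ra hVW a, ?_⟩
    refine (T.pr_ra hVW a).trans ?_
    refine (congrArg (ro hVW) ha).trans ?_
    exact ro_ro (X := X) hVW hV f

lemma bijective_of_isLocalization_away {R A B : Type} [CommRing R] [CommRing A] [CommRing B]
    {i : Algebra R A} (r : R) (hA : IsLocalization.Away r A) (g : R →+* B)
    (hg : @IsLocalization.Away R _ r B _ g.toAlgebra) (f : A →+* B)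
    (hf : f.comp (algebraMap R A) = g) : Function.Bijective f := by
  let := g.toAlgebra
  let e := IsLocalization.algEquiv (Submonoid.powers r) A B
  have : f = (e : A →+* B) := by
    refine IsLocalization.ringHom_ext (Submonoid.powers r) (hf.trans ?_)
    ext x
    exact (e.commutes x).symm
  rw [this]
  exact e.bijective

lemma mem_basicOpen_pr_iff (r : T.sec ⊤) (x : X) :
    r ∉ (T.toLocallyRingedSpace.toΓSpecFun x).asIdeal ↔ x ∈ X.basicOpen (T.pr ⊤ r) := by
  refine (T.toLocallyRingedSpace.notMem_prime_iff_unit_in_stalk r x).trans ?_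
  exact (T.isUnit_germ_iff (W := ⊤) r (x := x) trivial).trans
    (X.mem_basicOpen (T.pr ⊤ r) x (U := ⊤) trivial).symm

/-- Both prime ideals consist of the sections that are not units at `x`, and units are detected on
`X`. For affine `X` this exhibits the canonical map to the spectrum as a composite of
homeomorphisms, since `T.pr ⊤` is then surjective, by assumption, with nil kernel. -/
lemma toΓSpecFun_eq (x : X) : T.toLocallyRingedSpace.toΓSpecFun x =
    PrimeSpectrum.comap (T.pr ⊤) (X.toSpecΓ x) := by
  refine PrimeSpectrum.ext (Ideal.ext fun r => ?_)
  rw [← not_iff_not]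
  refine (T.mem_basicOpen_pr_iff r x).trans ?_
  rw [← Scheme.toSpecΓ_preimage_basicOpen]
  rfl

lemma ra_comp_injective {U V : X.Opens} (hVU : V ≤ U) {k : ι → Γ(X, U)}
    (h : T.ra hVU (T.ker U k) = 0) (i : ι) : ro (X := X) hVU (k i) = 0 := by
  rw [ra_ker] at h
  exact congrFun (T.ker_injective V (h.trans (map_zero _).symm)) i

lemma pow_mul_ker {U : X.Opens} (r : T.sec U) (n : ℕ) (k : ι → Γ(X, U)) :
    r ^ n * T.ker U k = T.ker U fun i => T.pr U r ^ n * k i := by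
  rw [T.mul_ker]
  congr 1
  funext i
  exact congrArg (· * k i) (map_pow (T.pr U) r n)

/-- Sections over a basic open subset are a localization. -/
lemma isLocalization_away [Finite ι] {U V : X.Opens} (hU : IsAffineOpen U) (r : T.sec U)
    (hVU : V ≤ U) (hV : V = X.basicOpen (T.pr U r)) (h : Function.Surjective (T.pr U)) :
    @IsLocalization.Away (T.sec U) _ r (T.sec V) _ (T.ra hVU).toAlgebra := by
  let := (T.ra hVU).toAlgebra
  have hr : IsUnit (T.ra hVU r) := by
    refine T.isUnit_of_isUnit_pr ?_
    rw [pr_ra]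
    subst hV
    exact RingedSpace.isUnit_res_basicOpen X.toLocallyRingedSpace.toRingedSpace (T.pr U r)
  let := (ro (X := X) hVU).toAlgebra
  have hloc : IsLocalization.Away (T.pr U r) Γ(X, V) := by
    subst hV
    exact hU.isLocalization_basicOpen (T.pr U r)
  have key (z : Γ(X, V)) : ∃ (n : ℕ) (s : Γ(X, U)), z * ro (X := X) hVU (T.pr U r) ^ n =
      ro (X := X) hVU s := IsLocalization.Away.surj (T.pr U r) z
  have key' (s : Γ(X, U)) (hs : ro (X := X) hVU s = 0) : ∃ n : ℕ, T.pr U r ^ n * s = 0 := by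
    obtain ⟨⟨_, n, rfl⟩, hn⟩ := (IsLocalization.map_eq_zero_iff (Submonoid.powers (T.pr U r))
      Γ(X, V) s).1 hs
    exact ⟨n, hn⟩
  refine IsLocalization.Away.mk r hr (fun y => ?_) (fun a b hab => ?_)
  -- Denominators are cleared in two stages: first for the image in `𝒪_X`, then for the remaining
  -- error, which lies in the kernel and is given by coordinates in `𝒪_X` on which `r` acts through
  -- its image. As there are finitely many coordinates, one exponent `M` serves them all.
  · obtain ⟨n, s, hs⟩ := key (T.pr V y)
    obtain ⟨a, rfl⟩ := h s
    have h0 : T.pr V (y * T.ra hVU r ^ n - T.ra hVU a) = 0 := by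
      rw [map_sub, map_mul, map_pow, pr_ra, pr_ra, hs, sub_self]
    obtain ⟨k, hk⟩ := (T.proj_eq_zero V _).1 h0
    choose m s hs using fun i => key (k i)
    obtain ⟨M, hM⟩ := Finite.exists_le m
    refine ⟨n + M, a * r ^ M + T.ker U fun i => s i * T.pr U r ^ (M - m i), ?_⟩
    have h1 : T.ra hVU r ^ M * T.ker V k =
        T.ra hVU (T.ker U fun i => s i * T.pr U r ^ (M - m i)) := by
      rw [pow_mul_ker, ra_ker, pr_ra]
      congr 1
      funext i
      rw [map_mul, map_pow, ← hs, mul_assoc, ← pow_add, Nat.add_sub_cancel' (hM i), mul_comm]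
    change y * T.ra hVU r ^ (n + M) = T.ra hVU _
    rw [map_add, ← h1, hk, map_mul, map_pow]
    ring
  -- The same two stages: a power of `r` moves `a - b` into the kernel, and a further power kills
  -- its coordinates.
  · have hab' : T.ra hVU (a - b) = 0 := by
      rw [map_sub, sub_eq_zero]
      exact hab
    obtain ⟨n, hn⟩ := key' (T.pr U (a - b)) (by rw [← pr_ra, hab', map_zero])
    have h0 : T.pr U (r ^ n * (a - b)) = 0 := by rw [map_mul, map_pow, hn]
    obtain ⟨k, hk⟩ := (T.proj_eq_zero U _).1 h0
    have h1 : ∀ i, ro (X := X) hVU (k i) = 0 := T.ra_comp_injective hVU (by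
      rw [hk, map_mul, hab', mul_zero])
    choose m hm using fun i => key' (k i) (h1 i)
    obtain ⟨M, hM⟩ := Finite.exists_le m
    refine ⟨M + n, ?_⟩
    rw [← sub_eq_zero, ← mul_sub, pow_add, mul_assoc, ← hk, pow_mul_ker]
    refine Eq.trans (congrArg (T.ker U) (funext fun i => ?_)) (map_zero _)
    rw [← Nat.sub_add_cancel (hM i), pow_add, mul_assoc, hm, mul_zero, Pi.zero_apply]

/-- A thickening of an affine scheme is affine if functions lift. -/
lemma isIso_toΓSpec [Finite ι] [IsAffine X] (h : Function.Surjective (T.pr ⊤)) :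
    IsIso T.toLocallyRingedSpace.toΓSpec := by
  refine isIso_toΓSpec_of_isLocalization _ ?_ fun r => ?_
  · have h1 : T.toLocallyRingedSpace.toΓSpecFun = PrimeSpectrum.comap (T.pr ⊤) ∘ X.toSpecΓ :=
      funext T.toΓSpecFun_eq
    rw [h1]
    refine (PrimeSpectrum.isHomeomorph_comap _ (fun s => ?_) fun a ha => ?_).comp
      X.toSpecΓ.homeomorph.isHomeomorph
    · obtain ⟨a, rfl⟩ := h s
      exact ⟨1, one_pos, a, by simp⟩
    · exact T.isNilpotent_of_pr_eq_zero ha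
  · let Y := T.toLocallyRingedSpace
    have hV : Y.toΓSpecMapBasicOpen r = X.basicOpen (T.pr ⊤ r) :=
      Opens.ext (Set.ext fun x => T.mem_basicOpen_pr_iff r x)
    have h2 := StructureSheaf.IsLocalization.to_basicOpen (LocallyRingedSpace.Γ.obj (op Y)) r
    exact bijective_of_isLocalization_away (R := LocallyRingedSpace.Γ.obj (op Y)) r h2 _
      (T.isLocalization_away (isAffineOpen_top X) r le_top hV h) (Y.toΓSpecCApp r).hom
      (congrArg CommRingCat.Hom.hom (Y.toΓSpecCApp_spec r))

/-- The scheme of a thickening. -/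
def scheme [Finite ι] (hT : ∀ x : X, ∃ W : X.Opens, IsAffineOpen W ∧ x ∈ W ∧
    Function.Surjective (T.pr W)) : Scheme.{0} where
  toLocallyRingedSpace := T.toLocallyRingedSpace
  local_affine x := by
    obtain ⟨W, hW, hx, h⟩ := hT x
    have : IsAffine W := hW
    -- The top open set of `W`, seen in `X`, is only propositionally equal to `W`, so surjectivity
    -- is transported along that equality.
    have h2 : Function.Surjective ((T.restrict W).pr ⊤) := by
      have h3 : ∀ W' : X.Opens, W' = W → Function.Surjective (T.pr W') := by
        rintro _ rfl
        exact h
      exact h3 (W.ι ''ᵁ ⊤) W.ι_image_top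
    exact ⟨⟨W, hx⟩, _, ⟨@asIso _ _ _ _ _ ((T.restrict W).isIso_toΓSpec h2)⟩⟩

end Thickening

/-! ### Flatness over the algebra `ℂ[V]` -/

/-- In fact `A` is free over `ℂ[V]`. Choose a `ℂ`-linear section `s` of `π` and a `ℂ`-basis of `S`:
the lifts `s (B i)` span `A`, because the kernel of `π` is `V · s(S)`. In a relation between them
the constant terms vanish by projection to `S`, and then the `V`-parts vanish by injectivity of `κ`.
-/
lemma flat_of_sqZero {V ι : Type} [AddCommGroup V] [Module ℂ V] [Module ℂᵐᵒᵖ V]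
    [IsCentralScalar ℂ V] [Fintype ι] (b : Module.Basis ι ℂ V) {A S : Type} [CommRing A]
    [CommRing S] [Algebra ℂ S] (σ : TrivSqZeroExt ℂ V →+* A) (π : A →+* S)
    (hπ : Function.Surjective π) (hσ : ∀ a, π (σ a) = algebraMap ℂ S a.fst)
    (κ : (ι → S) →+ A) (hκ : Function.Injective κ) (hker : ∀ a, π a = 0 → ∃ r, κ r = a)
    (hmul : ∀ a r, a * κ r = κ fun k => π a * r k)
    (hinr : ∀ v, σ (TrivSqZeroExt.inr v) = κ fun k => algebraMap ℂ S (b.repr v k)) :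
    σ.Flat := by
  let : Algebra (TrivSqZeroExt ℂ V) A := σ.toAlgebra
  let : Algebra ℂ A := (σ.comp (TrivSqZeroExt.inlHom ℂ V)).toAlgebra
  have hC : ∀ (c : ℂ) (a : A), c • a = (TrivSqZeroExt.inl c : TrivSqZeroExt ℂ V) • a :=
    fun _ _ => rfl
  have hsm : ∀ (x : TrivSqZeroExt ℂ V) (a : A), x • a = σ x * a := fun _ _ => rfl
  let πl : A →ₗ[ℂ] S :=
    { π with
      map_smul' := fun c a => by
        change π (σ (TrivSqZeroExt.inl c) * a) = c • π a
        rw [map_mul, hσ, TrivSqZeroExt.fst_inl, Algebra.smul_def] }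
  obtain ⟨s, hs⟩ := πl.exists_rightInverse_of_surjective (LinearMap.range_eq_top.2 hπ)
  have hs' : ∀ f, π (s f) = f := fun f => LinearMap.congr_fun hs f
  let B := Module.Basis.ofVectorSpace ℂ S
  have hker' : ∀ r : ι → S, κ r = ∑ k, σ (TrivSqZeroExt.inr (b k)) * s (r k) := by
    intro r
    simp only [hinr, b.repr_self, mul_comm _ (s _), hmul, hs']
    rw [← map_sum]
    congr 1
    funext k
    rw [Finset.sum_apply, Finset.sum_eq_single k]
    · simp
    · intro l _ hl
      simp [Finsupp.single_eq_of_ne hl.symm]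
    · simp
  have hinr' : ∀ v a, σ (TrivSqZeroExt.inr v) * a =
      κ fun k => π a * algebraMap ℂ S (b.repr v k) := by
    intro v a
    rw [hinr, mul_comm, hmul]
  have hli : LinearIndependent (TrivSqZeroExt ℂ V) fun i => s (B i) := by
    rw [linearIndependent_iff']
    intro t x hx i hi
    have h1 : ∑ i ∈ t, (x i).fst • B i = 0 := by
      have := congrArg π hx
      rw [map_zero, map_sum] at this
      simpa only [hsm, map_mul, hσ, hs', ← Algebra.smul_def] using this
    have h2 := linearIndependent_iff'.1 B.linearIndependent t _ h1
    have h3 : ∀ i ∈ t, x i = TrivSqZeroExt.inr (x i).snd := fun i hi => by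
      ext
      · simp [h2 i hi]
      · simp
    have h4 : κ (∑ i ∈ t, fun k => B i * algebraMap ℂ S (b.repr (x i).snd k)) = 0 := by
      rw [map_sum, ← hx]
      refine Finset.sum_congr rfl fun i hi => ?_
      rw [h3 i hi, hsm, hinr', hs']
      simp
    have h5 := hκ (h4.trans (map_zero κ).symm)
    have h6 : b.repr (x i).snd = 0 := by
      ext k
      have h7 := congrFun h5 k
      rw [Finset.sum_apply] at h7
      simp only [mul_comm (B _), ← Algebra.smul_def] at h7
      exact linearIndependent_iff'.1 B.linearIndependent t _ h7 i hi
    rw [h3 i hi, b.repr.map_eq_zero_iff.1 h6, TrivSqZeroExt.inr_zero]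
  have hsp : ⊤ ≤ Submodule.span (TrivSqZeroExt ℂ V) (Set.range fun i => s (B i)) := by
    have h1 : ∀ f, s f ∈ Submodule.span (TrivSqZeroExt ℂ V) (Set.range fun i => s (B i)) := by
      intro f
      induction B.mem_span f using Submodule.span_induction with
      | mem f hf =>
        obtain ⟨i, rfl⟩ := hf
        exact Submodule.subset_span ⟨i, rfl⟩
      | zero => rw [map_zero]; exact Submodule.zero_mem _
      | add x y _ _ hx hy => rw [map_add]; exact Submodule.add_mem _ hx hy
      | smul c x _ hx => rw [map_smul, hC]; exact Submodule.smul_mem _ _ hx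
    rintro a -
    obtain ⟨r, hr⟩ := hker (a - s (π a)) (by rw [map_sub, hs', sub_self])
    rw [← sub_add_cancel a (s (π a)), ← hr, hker']
    refine Submodule.add_mem _ (Submodule.sum_mem _ fun k _ => ?_) (h1 _)
    exact Submodule.smul_mem _ (TrivSqZeroExt.inr (b k)) (h1 (r k))
  have := Module.Free.of_basis (Module.Basis.mk hli hsp)
  exact (inferInstance : Module.Flat (TrivSqZeroExt ℂ V) A)

namespace Thickening

variable {X : Scheme.{0}} [X.Over SpecC] {ι V : Type} [AddCommGroup V] [Module ℂ V]
  [Module ℂᵐᵒᵖ V]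

/-- The structure of a sheaf of `ℂ[V]`-algebras on a thickening, such that the kernel is obtained
from `V`. -/
structure Scalars (T : Thickening X ι) (b : Module.Basis ι ℂ V) where
  hom : TrivSqZeroExt ℂ V →+* T.sec ⊤
  pr_hom : ∀ a, T.pr ⊤ (hom a) = algebraMap ℂ Γ(X, ⊤) a.fst
  hom_inr : ∀ v, hom (TrivSqZeroExt.inr v) = T.ker ⊤ fun k => algebraMap ℂ Γ(X, ⊤) (b.repr v k)

variable {T : Thickening X ι} {b : Module.Basis ι ℂ V} (σ : T.Scalars b)

/-- The scalars over an open subset. -/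
def Scalars.homOn (σ : T.Scalars b) (W : X.Opens) : TrivSqZeroExt ℂ V →+* T.sec W :=
  (T.ra le_top).comp σ.hom

lemma Scalars.pr_homOn (W : X.Opens) (a : TrivSqZeroExt ℂ V) :
    T.pr W (σ.homOn W a) = algebraMap ℂ Γ(X, W) a.fst := by
  refine (T.pr_ra _ _).trans ?_
  rw [σ.pr_hom]
  exact map_algebraMap (homOfLE le_top) _

lemma Scalars.homOn_inr (W : X.Opens) (v : V) : σ.homOn W (TrivSqZeroExt.inr v) =
    T.ker W fun k => algebraMap ℂ Γ(X, W) (b.repr v k) := by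
  refine (congrArg (T.ra le_top) (σ.hom_inr v)).trans ?_
  rw [ra_ker]
  congr 1
  funext k
  exact map_algebraMap (homOfLE le_top) _

lemma Scalars.ker_eq_sum [Fintype ι] {W : X.Opens} (r : ι → Γ(X, W)) (c : ι → T.sec W)
    (hc : ∀ k, T.pr W (c k) = r k) :
    T.ker W r = ∑ k, σ.homOn W (TrivSqZeroExt.inr (b k)) * c k := by
  simp only [σ.homOn_inr, b.repr_self, mul_comm _ (c _), T.mul_ker]
  rw [← map_sum]
  congr 1
  funext k
  rw [Finset.sum_apply, Finset.sum_eq_single k]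
  · rw [← hc]
    simp
    rfl
  · intro l _ hl
    simp [Finsupp.single_eq_of_ne hl.symm]
  · simp

/-- Here finite type is used. Finitely many algebra generators of `Γ(X, W)` lift over a common
neighbourhood `Z` of `x`, and the functions on `W` that lift over `Z` form a subalgebra, so all of
them do. Over a basic open set of `W` inside `Z` the fractions lift as well, because a lift of the
denominator is a unit. -/
lemma Scalars.exists_surjective_pr (σ : T.Scalars b) [LocallyOfFiniteType (X ↘ SpecC)] (x : X) :
    ∃ W : X.Opens, IsAffineOpen W ∧ x ∈ W ∧ Function.Surjective (T.pr W) := by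
  obtain ⟨W, hW, hxW, -⟩ := Opens.isBasis_iff_nbhd.1 X.isBasis_affineOpens
    (show x ∈ (⊤ : X.Opens) from trivial)
  have hft : Algebra.FiniteType ℂ Γ(X, W) := finiteType_sections hW
  obtain ⟨s, hs⟩ := hft.out
  choose V hV hxV a ha using fun f : s => T.exists_lift (f : Γ(X, W)) hxW
  let Z : X.Opens :=
    ⟨W ∩ ⋂ k, (V k : Set X), W.2.inter (isOpen_iInter_of_finite fun k => (V k).2)⟩
  have hZ : ∀ k, Z ≤ V k := fun k y hy => Set.mem_iInter.1 hy.2 k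
  have hZW : Z ≤ W := fun y hy => hy.1
  have hxZ : x ∈ Z := ⟨hxW, Set.mem_iInter.2 hxV⟩
  have key : ∀ f : Γ(X, W), ∃ a, T.pr Z a = ro hZW f := by
    intro f
    have hf : f ∈ Algebra.adjoin ℂ (s : Set Γ(X, W)) := hs ▸ Algebra.mem_top
    induction hf using Algebra.adjoin_induction with
    | mem f hf =>
      refine ⟨T.ra (hZ ⟨f, hf⟩) (a ⟨f, hf⟩), ?_⟩
      rw [pr_ra]
      exact (congrArg (ro (hZ ⟨f, hf⟩)) (ha ⟨f, hf⟩)).trans (ro_ro _ _ _)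
    | algebraMap c =>
      exact ⟨σ.homOn Z (TrivSqZeroExt.inl c), (σ.pr_homOn Z _).trans
        (map_algebraMap (homOfLE hZW) _).symm⟩
    | add f g _ _ hf hg =>
      obtain ⟨a, ha⟩ := hf
      obtain ⟨b, hb⟩ := hg
      exact ⟨a + b, by rw [map_add, map_add, ha, hb]⟩
    | mul f g _ _ hf hg =>
      obtain ⟨a, ha⟩ := hf
      obtain ⟨b, hb⟩ := hg
      exact ⟨a * b, by rw [map_mul, map_mul, ha, hb]⟩
  obtain ⟨h, hhZ, hxh⟩ := hW.exists_basicOpen_le ⟨x, hxZ⟩ hxW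
  refine ⟨X.basicOpen h, hW.basicOpen h, hxh, fun z => ?_⟩
  have hle : X.basicOpen h ≤ W := X.basicOpen_le h
  let := (ro (X := X) hle).toAlgebra
  have hloc : IsLocalization.Away h Γ(X, X.basicOpen h) := hW.isLocalization_basicOpen h
  obtain ⟨n, f, hf⟩ := IsLocalization.Away.surj h z
  change z * ro hle h ^ n = ro hle f at hf
  obtain ⟨a, ha⟩ := key f
  obtain ⟨c, hc⟩ := key h
  have h1 : T.pr _ (T.ra hhZ c) = ro hle h := by rw [pr_ra, hc, ro_ro]
  have h2 : IsUnit (ro hle h) :=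
    RingedSpace.isUnit_res_basicOpen X.toLocallyRingedSpace.toRingedSpace h
  have h3 : IsUnit (T.ra hhZ c) := T.isUnit_of_isUnit_pr (h1 ▸ h2)
  obtain ⟨d, hd⟩ := h3.exists_right_inv
  refine ⟨T.ra hhZ a * d ^ n, ?_⟩
  rw [← (h2.pow n).mul_left_inj, hf, ← h1, ← map_pow, ← map_mul, mul_assoc, ← mul_pow,
    mul_comm d, hd, one_pow, mul_one, pr_ra, ha, ro_ro]

end Thickening

lemma structHom_toSpecΓ_comp {Y : Scheme.{0}} {R : CommRingCat.{0}} (φ : R ⟶ Γ(Y, ⊤))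
    (U : Y.Opens) (c : R) : structHom (Y.toSpecΓ ≫ Spec.map φ) U c = ro le_top (φ c) := by
  rw [structHom_comp_specMap]
  have : ((Scheme.ΓSpecIso Γ(Y, ⊤)).inv ≫ Y.toSpecΓ.appTop ≫
      Y.presheaf.map (homOfLE (le_top : U ≤ ⊤)).op) =
      Y.presheaf.map (homOfLE (le_top : U ≤ ⊤)).op := by
    rw [Scheme.toSpecΓ_appTop, Iso.inv_hom_id_assoc]
  exact congr($this (φ c))

namespace Thickening

variable {X : Scheme.{0}} {ι : Type} (T : Thickening X ι)

/-- The inclusion of a scheme in a thickening as a morphism of ringed spaces. -/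
def inclHom : X.toPresheafedSpace ⟶ T.toSheafedSpace.toPresheafedSpace where
  base := 𝟙 X.toTopCat
  c :=
    { app := fun U => T.proj.app U
      naturality := fun _ _ i => T.proj.naturality i }

lemma stalkMap_inclHom_germ {W : X.Opens} {x : X} (hx : x ∈ W) (a : T.sec W) :
    T.inclHom.stalkMap x (T.presheaf.germ W x hx a) = X.presheaf.germ W x hx (T.pr W a) :=
  PresheafedSpace.stalkMap_germ_apply T.inclHom W x hx a

variable [Finite ι]
  (hT : ∀ x : X, ∃ W : X.Opens, IsAffineOpen W ∧ x ∈ W ∧ Function.Surjective (T.pr W))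

/-- The closed immersion of a scheme in a thickening. -/
def incl : X ⟶ T.scheme hT where
  toLRSHom' :=
    { toHom := T.inclHom
      prop := fun x => ⟨fun s hs => by
        obtain ⟨W, hx, a, rfl⟩ := TopCat.Presheaf.exists_germ_eq T.presheaf s
        exact (T.isUnit_germ_iff a hx).2 ((T.stalkMap_inclHom_germ hx a) ▸ hs)⟩ }

instance : IsClosedImmersion (T.incl hT) where
  stalkMap_surjective x := by
    intro s
    obtain ⟨W, hx, f, rfl⟩ := TopCat.Presheaf.exists_germ_eq X.presheaf s
    obtain ⟨V, hV, hxV, a, ha⟩ := T.exists_lift f hx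
    refine ⟨T.presheaf.germ V x hxV a, ?_⟩
    refine (T.stalkMap_inclHom_germ hxV a).trans ?_
    refine Eq.trans (congrArg (X.presheaf.germ V x hxV) ha) ?_
    exact TopCat.Presheaf.germ_res_apply X.presheaf (homOfLE hV) x hxV f
  isClosedEmbedding := Topology.IsClosedEmbedding.id

lemma surjective_pr_of_isAffineOpen {W : X.Opens} (hW : IsAffineOpen (X := T.scheme hT) W) :
    Function.Surjective (T.pr W) :=
  Scheme.Hom.app_surjective (T.incl hT) W hW

variable [X.Over SpecC] {V : Type} [AddCommGroup V] [Module ℂ V]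
  [Module ℂᵐᵒᵖ V] [IsCentralScalar ℂ V] [FiniteDimensional ℂ V] {b : Module.Basis ι ℂ V}
  (σ : T.Scalars b)

/-- The structure morphism of a thickening. -/
def toSpec : T.scheme hT ⟶ (infAlg V).spec :=
  (T.scheme hT).toSpecΓ ≫ Spec.map (CommRingCat.ofHom σ.hom)

lemma structHom_toSpec (W : X.Opens) (a : TrivSqZeroExt ℂ V) :
    structHom (T.toSpec hT σ) W a = σ.homOn W a :=
  structHom_toSpecΓ_comp (Y := T.scheme hT) (CommRingCat.ofHom σ.hom) W a

lemma incl_toSpec : T.incl hT ≫ T.toSpec hT σ = (X ↘ SpecC) ≫ (infAlg V).point := by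
  refine structHom_ext fun a => ?_
  refine (app_structHom (T.incl hT) (T.toSpec hT σ) ⊤ a).symm.trans ?_
  refine (congrArg ((T.incl hT).app ⊤) (T.structHom_toSpec hT σ ⊤ a)).trans ?_
  refine (σ.pr_homOn ⊤ a).trans ?_
  refine Eq.trans ?_ (structHom_comp_specMap (X ↘ SpecC)
    (CommRingCat.ofHom (infAlg V).aug.toRingHom) _ _).symm
  exact congrArg (structHom (X ↘ SpecC) ⊤) (aug_infAlg a).symm

lemma flat_toSpec : Flat (T.toSpec hT σ) := by
  have := Fintype.ofFinite ι
  refine HasRingHomProperty.of_iSup_eq_top (P := @Flat) (fun U : (T.scheme hT).affineOpens => U)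
    (iSup_affineOpens_eq_top _) fun U => ?_
  let W : X.Opens := U.1
  have h1 : (σ.homOn W).Flat :=
    flat_of_sqZero b _ (T.pr W) (T.surjective_pr_of_isAffineOpen hT U.2) (σ.pr_homOn _)
      (T.ker _) (T.ker_injective _) (fun a ha => (T.proj_eq_zero _ a).1 ha) (T.mul_ker _)
      (σ.homOn_inr _)
  have h2 : (T.toSpec hT σ).appLE ⊤ U.1 le_top =
      (Scheme.ΓSpecIso (infAlg V).ring).hom ≫ CommRingCat.ofHom (structHom (T.toSpec hT σ) U.1) :=
    ((Scheme.ΓSpecIso (infAlg V).ring).hom_inv_id_assoc _).symm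
  have h3 : structHom (T.toSpec hT σ) U.1 = σ.homOn W :=
    RingHom.ext (T.structHom_toSpec hT σ W)
  have h4 : ((Scheme.ΓSpecIso (infAlg V).ring).hom).hom.Flat :=
    RingHom.Flat.of_bijective ((ConcreteCategory.isIso_iff_bijective _).1 inferInstance)
  rw [h2, h3]
  exact h4.comp h1

/-- On affine open sets the ideal of `X` is generated by `V`, and a morphism that lies over the
closed point kills `V`. Such a morphism thus factors through the closed immersion of `X`, which is
the closed fibre. -/
lemma ker_incl_le {Z : Scheme.{0}} {f : Z ⟶ T.scheme hT} {g : Z ⟶ SpecC}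
    (h : f ≫ T.toSpec hT σ = g ≫ (infAlg V).point) : (T.incl hT).ker ≤ f.ker := by
  refine Scheme.IdealSheafData.le_ofIdeals_iff.2 fun U a ha => ?_
  have h1 : T.pr U.1 a = 0 := (T.incl hT).ideal_ker_le U ha
  obtain ⟨r, rfl⟩ := (T.proj_eq_zero U.1 a).1 h1
  choose c hc using fun k => T.surjective_pr_of_isAffineOpen hT U.2 (r k)
  have := Fintype.ofFinite ι
  have h2 : ∀ v : V, f.app U.1 (structHom (T.toSpec hT σ) U.1
      (show TrivSqZeroExt ℂ V from TrivSqZeroExt.inr v)) = 0 := fun v => by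
    refine (app_structHom f (T.toSpec hT σ) U.1 _).trans ?_
    rw [h]
    refine (structHom_comp_specMap g
      (CommRingCat.ofHom (infAlg V).aug.toRingHom) _ _).trans ?_
    refine (congrArg (structHom g _) ?_).trans (map_zero _)
    exact aug_infAlg (TrivSqZeroExt.inr v)
  have h3 : T.ker U.1 r = ∑ k, structHom (T.toSpec hT σ) U.1
      (show TrivSqZeroExt ℂ V from TrivSqZeroExt.inr (b k)) * (show Γ(T.scheme hT, U.1) from c k) :=
    (σ.ker_eq_sum r c hc).trans (Finset.sum_congr rfl fun k _ =>
      congrArg (· * (show Γ(T.scheme hT, U.1) from c k)) (T.structHom_toSpec hT σ U.1 _).symm)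
  refine RingHom.mem_ker.2 ((congrArg (f.app U.1) h3).trans ?_)
  refine (map_sum (f.app U.1).hom _ _).trans (Finset.sum_eq_zero fun k _ => ?_)
  refine (map_mul (f.app U.1).hom _ _).trans ?_
  refine (congrArg (· * _) (h2 (b k))).trans (zero_mul _)

lemma isPullback_incl : IsPullback (T.incl hT) (X ↘ SpecC) (T.toSpec hT σ) (infAlg V).point := by
  have hm : IsClosedImmersion (infAlg V).point :=
    IsClosedImmersion.spec_of_surjective _ (surjective_aug _)
  refine ⟨⟨T.incl_toSpec hT σ⟩, ⟨PullbackCone.IsLimit.mk _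
    (fun s => IsClosedImmersion.lift (T.incl hT) s.fst (T.ker_incl_le hT σ s.condition))
    (fun s => ?_) (fun s => ?_)
    (fun s m h1 h2 => ?_)⟩⟩
  · exact IsClosedImmersion.lift_fac _ _ _
  · rw [← cancel_mono (infAlg V).point, Category.assoc, ← T.incl_toSpec hT σ,
      IsClosedImmersion.lift_fac_assoc, s.condition]
  · rw [← cancel_mono (T.incl hT), h1, IsClosedImmersion.lift_fac]

end Thickening

/-! ### Functions on the deformation given by an extension: lifts of commutators -/

variable {X : Scheme.{0}} [X.Over SpecC] {L E : X.Modules}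

lemma p₁Hom_rs {U V : X.Opens} (h : V ≤ U) (l : Γ(L, U)) :
    p₁Hom L V (rs L h l) = rs (jets L) h (p₁Hom L U l) :=
  secHom_rs (p₁ L) h l

lemma p₁Hom_leibniz {U : X.Opens} (f g : Γ(X, U)) (l : Γ(L, U)) :
    p₁Hom L U ((f * g) • l) + (f * g) • p₁Hom L U l =
      f • p₁Hom L U (g • l) + g • p₁Hom L U (f • l) :=
  (isDiffOp_p₁ L U).leibniz f g l

/-- A function `f` over `W` together with a linear lift `L|_W ⟶ E|_W` of the commutator of the
one-jet map with `f`. -/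
@[ext]
structure CommLift (r : E ⟶ jets L) (W : X.Opens) where
  fn : Γ(X, W)
  op : ∀ V : X.Opens, V ≤ W → (Γ(L, V) →+ Γ(E, V))
  op_smul : ∀ V h (a : Γ(X, V)) l, op V h (a • l) = a • op V h l
  op_rs : ∀ V V' h (h' : V' ≤ V) l, op V' (h'.trans h) (rs L h' l) = rs E h' (op V h l)
  r_op : ∀ V h l, r.app V (op V h l) = p₁Hom L V (ro h fn • l) - ro h fn • p₁Hom L V l

namespace CommLift

variable {r : E ⟶ jets L} {W : X.Opens}

lemma ext' {x y : CommLift r W} (h : x.fn = y.fn)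
    (h' : ∀ V hV l, x.op V hV l = y.op V hV l) : x = y :=
  CommLift.ext h (funext fun V => funext fun hV => AddMonoidHom.ext fun l => h' V hV l)

instance : Zero (CommLift r W) where
  zero :=
    { fn := 0
      op := fun _ _ => 0
      op_smul := fun V h a l => by simp
      op_rs := fun V V' h h' l => by simp
      r_op := fun V h l => by simp }

instance : One (CommLift r W) where
  one :=
    { fn := 1
      op := fun _ _ => 0
      op_smul := fun V h a l => by simp
      op_rs := fun V V' h h' l => by simp
      r_op := fun V h l => by simp }

instance : Add (CommLift r W) where
  add x y :=
    { fn := x.fn + y.fn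
      op := fun V h => x.op V h + y.op V h
      op_smul := fun V h a l => by simp [op_smul]
      op_rs := fun V V' h h' l => by simp [x.op_rs _ _ h h', y.op_rs _ _ h h']
      r_op := fun V h l => by simp only [AddMonoidHom.add_apply, map_add, r_op, add_smul]; abel }

instance : Neg (CommLift r W) where
  neg x :=
    { fn := -x.fn
      op := fun V h => -x.op V h
      op_smul := fun V h a l => by simp [op_smul]
      op_rs := fun V V' h h' l => by simp [x.op_rs _ _ h h']
      r_op := fun V h l => by simp only [AddMonoidHom.neg_apply, map_neg, r_op, neg_smul]; abel }

/-- The operator in a pair stands for the commutator `[d, f]` with a first-order operator `d`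
lifting `p₁`, and the product is the rule `[d, f g] = f [d, g] + g [d, f]`. It is compatible with
`r` because `p₁` satisfies the Leibniz identity. Pairs with zero function have product zero. -/
instance : Mul (CommLift r W) where
  mul x y :=
    { fn := x.fn * y.fn
      op := fun V h => (DistribSMul.toAddMonoidHom _ (ro h x.fn)).comp (y.op V h) +
        (DistribSMul.toAddMonoidHom _ (ro h y.fn)).comp (x.op V h)
      op_smul := fun V h a l => by
        simp only [AddMonoidHom.add_apply, AddMonoidHom.comp_apply,
          DistribSMul.toAddMonoidHom_apply, op_smul, smul_add, smul_comm a]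
      op_rs := fun V V' h h' l => by
        simp only [AddMonoidHom.add_apply, AddMonoidHom.comp_apply,
          DistribSMul.toAddMonoidHom_apply, x.op_rs _ _ h h', y.op_rs _ _ h h', map_add, rs_smul,
          ro_ro]
      r_op := fun V h l => by
        simp only [AddMonoidHom.add_apply, AddMonoidHom.comp_apply,
          DistribSMul.toAddMonoidHom_apply, map_add, Scheme.Modules.Hom.app_smul, r_op, map_mul,
          smul_sub, smul_smul]
        have := p₁Hom_leibniz (ro h x.fn) (ro h y.fn) l
        rw [← sub_eq_zero] at this ⊢
        rw [← neg_eq_zero, ← this, mul_comm (ro h y.fn)]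
        abel }

lemma zero_fn : (0 : CommLift r W).fn = 0 := rfl
lemma one_fn : (1 : CommLift r W).fn = 1 := rfl
lemma add_fn (x y : CommLift r W) : (x + y).fn = x.fn + y.fn := rfl
lemma mul_fn (x y : CommLift r W) : (x * y).fn = x.fn * y.fn := rfl

variable {V : X.Opens} (h : V ≤ W) (l : Γ(L, V))

lemma zero_op : (0 : CommLift r W).op V h l = 0 := rfl
lemma one_op : (1 : CommLift r W).op V h l = 0 := rfl
lemma add_op (x y : CommLift r W) : (x + y).op V h l = x.op V h l + y.op V h l := rfl
lemma mul_op (x y : CommLift r W) :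
    (x * y).op V h l = ro h x.fn • y.op V h l + ro h y.fn • x.op V h l := rfl

instance : CommRing (CommLift r W) where
  add_assoc x y z := ext' (add_assoc _ _ _) fun V h l => add_assoc _ _ _
  zero_add x := ext' (zero_add _) fun V h l => zero_add _
  add_zero x := ext' (add_zero _) fun V h l => add_zero _
  nsmul := nsmulRec
  zsmul := zsmulRec
  neg_add_cancel x := ext' (neg_add_cancel _) fun V h l => neg_add_cancel _
  add_comm x y := ext' (add_comm _ _) fun V h l => add_comm _ _
  mul_comm x y := ext' (mul_comm _ _) fun V h l => add_comm _ _
  zero_mul x := ext' (zero_mul _) fun V h l => by simp [mul_op, zero_fn, zero_op]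
  mul_zero x := ext' (mul_zero _) fun V h l => by simp [mul_op, zero_fn, zero_op]
  one_mul x := ext' (one_mul _) fun V h l => by simp [mul_op, one_fn, one_op]
  mul_one x := ext' (mul_one _) fun V h l => by simp [mul_op, one_fn, one_op]
  left_distrib x y z := ext' (mul_add _ _ _) fun V h l => by
    simp only [mul_op, add_op, add_fn, map_add, smul_add, add_smul]
    abel
  right_distrib x y z := ext' (add_mul _ _ _) fun V h l => by
    simp only [mul_op, add_op, add_fn, map_add, smul_add, add_smul]
    abel
  mul_assoc x y z := ext' (mul_assoc _ _ _) fun V h l => by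
    simp only [mul_op, mul_fn, map_mul, smul_add, smul_smul, mul_comm, add_assoc]

/-- Restriction to a smaller open subset. -/
def restrict {W' : X.Opens} (h : W' ≤ W) : CommLift r W →+* CommLift r W' where
  toFun x :=
    { fn := ro h x.fn
      op := fun V hV => x.op V (hV.trans h)
      op_smul := fun V hV => x.op_smul V (hV.trans h)
      op_rs := fun V V' hV => x.op_rs V V' (hV.trans h)
      r_op := fun V hV l => by rw [x.r_op, ro_ro] }
  map_one' := ext' (map_one _) fun _ _ _ => rfl
  map_mul' x y := ext' (map_mul _ _ _) fun V hV l => by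
    simp only [mul_op, ro_ro]
  map_zero' := ext' (map_zero _) fun _ _ _ => rfl
  map_add' x y := ext' (map_add _ _ _) fun _ _ _ => rfl

lemma restrict_op {W' : X.Opens} (h : W' ≤ W) (x : CommLift r W) (hV : V ≤ W') :
    (restrict h x).op V hV l = x.op V (hV.trans h) l := rfl

end CommLift

/-- The presheaf of liftings of commutators. -/
def commLiftPresheaf (r : E ⟶ jets L) : X.toTopCat.Presheaf CommRingCat.{0} where
  obj W := CommRingCat.of (CommLift r W.unop)
  map i := CommRingCat.ofHom (CommLift.restrict (leOfHom i.unop))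
  map_id W := by
    refine CommRingCat.hom_ext (RingHom.ext fun x => CommLift.ext' (ro_self _ _) fun _ _ _ => rfl)
  map_comp i k := by
    refine CommRingCat.hom_ext (RingHom.ext fun x => CommLift.ext' (ro_ro _ _ _).symm
      fun _ _ _ => rfl)

lemma commLiftPresheaf_isSheaf (r : E ⟶ jets L) : (commLiftPresheaf r).IsSheaf := by
  rw [TopCat.Presheaf.isSheaf_iff_isSheafUniqueGluing]
  intro ι U sf hsf
  change ∀ i, CommLift r (U i) at sf
  let W := iSup U
  have hcomp : ∀ i j (V : X.Opens) (hi : V ≤ U i) (hj : V ≤ U j) l,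
      (sf i).op V hi l = (sf j).op V hj l := fun i j V hi hj l =>
    congrArg (fun x : CommLift r (U i ⊓ U j) => x.op V (le_inf hi hj) l) (hsf i j)
  have hcompf : ∀ i j (V : X.Opens) (hi : V ≤ U i) (hj : V ≤ U j),
      ro hi (sf i).fn = ro hj (sf j).fn := fun i j V hi hj => by
    have := congrArg (fun x : CommLift r (U i ⊓ U j) => ro (le_inf hi hj) x.fn) (hsf i j)
    refine Eq.trans ?_ (this.trans ?_)
    · exact (ro_ro (le_inf hi hj) inf_le_left _).symm
    · exact ro_ro (le_inf hi hj) inf_le_right _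
  have hcov : ∀ {V : X.Opens} (_ : V ≤ W) {x : X}, x ∈ V → ∃ i, x ∈ V ⊓ U i := fun hV x hx => by
    obtain ⟨i, hi⟩ := Opens.mem_iSup.1 (hV hx)
    exact ⟨i, hx, hi⟩
  obtain ⟨f, hf⟩ : ∃ f : Γ(X, W), ∀ i, ro (le_iSup U i) f = (sf i).fn := by
    obtain ⟨f, hf, -⟩ := X.sheaf.existsUnique_gluing U (fun i => (sf i).fn)
      (fun i j => hcompf i j _ inf_le_left inf_le_right)
    exact ⟨f, hf⟩
  have hf' : ∀ i (V : X.Opens) (hV : V ≤ W) (hi : V ≤ U i), ro hV f = ro hi (sf i).fn :=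
    fun i V hV hi => by rw [← hf, ro_ro]
  -- The operator is glued value by value. `G V l e` says that `e` restricts to the value at `l` of
  -- each given operator wherever that operator is defined; it determines `e`, and existence follows
  -- from the sheaf property of `E`. Linearity and compatibility with restriction then follow from
  -- uniqueness.
  let G : ∀ V : X.Opens, Γ(L, V) → Γ(E, V) → Prop := fun V l e =>
    ∀ i (V' : X.Opens) (hV : V' ≤ V) (hi : V' ≤ U i), rs E hV e = (sf i).op V' hi (rs L hV l)
  have hG : ∀ {V : X.Opens} (_ : V ≤ W) {l : Γ(L, V)} {e e' : Γ(E, V)}, G V l e → G V l e' →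
      e = e' := fun hV l e e' he he' => rs_ext fun x hx => by
    obtain ⟨i, hi⟩ := hcov hV hx
    exact ⟨_, inf_le_left, hi, (he i _ inf_le_left inf_le_right).trans
      (he' i _ inf_le_left inf_le_right).symm⟩
  have hex : ∀ (V : X.Opens) (_ : V ≤ W) (l : Γ(L, V)), ∃ e, G V l e := by
    intro V hV l
    obtain ⟨e, he⟩ := exists_rs (M := E) (U := V) (fun Z hZ e => G Z (rs L hZ l) e)
      (fun Z Z' hZ h e he i V' hV' hi => by
        rw [rs_rs, he i V' (hV'.trans h) hi, rs_rs, rs_rs])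
      (fun Z hZ e e' he he' => hG (hZ.trans hV) he he')
      (fun x hx => by
        obtain ⟨i, hi⟩ := hcov hV hx
        refine ⟨_, inf_le_left, hi, (sf i).op _ inf_le_right (rs L inf_le_left l), ?_⟩
        intro k V' hV' hk
        rw [← (sf i).op_rs _ _ inf_le_right hV']
        exact hcomp i k V' _ hk _)
    refine ⟨e, fun i V' hV' hi => rs_ext fun x hx => ?_⟩
    obtain ⟨Z, hZ, hxZ, hGZ⟩ := he x (hV' hx)
    have h1 : V' ⊓ Z ≤ V' := inf_le_left
    have h2 : V' ⊓ Z ≤ Z := inf_le_right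
    refine ⟨V' ⊓ Z, h1, ⟨hx, hxZ⟩, ?_⟩
    have h3 := hGZ i _ h2 (h1.trans hi)
    rw [rs_rs, rs_rs] at h3
    rw [rs_rs, h3, ← (sf i).op_rs _ _ hi h1, rs_rs]
  choose! φ hφ using hex
  let s : CommLift r W :=
    { fn := f
      op := fun V hV =>
        { toFun := φ V
          map_zero' := hG hV (hφ V hV 0) fun i V' hV' hi => by simp
          map_add' := fun l l' => hG hV (hφ V hV _) fun i V' hV' hi => by
            simp only [map_add, hφ V hV _ i V' hV' hi] }
      op_smul := fun V hV a l => hG hV (hφ V hV _) fun i V' hV' hi => by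
        change rs E hV' (a • φ V l) = _
        rw [rs_smul, rs_smul, (sf i).op_smul, hφ V hV _ i V' hV' hi]
      op_rs := fun V V' hV h l => hG (h.trans hV) (hφ V' (h.trans hV) _) fun i V'' hV'' hi => by
        change rs E hV'' (rs E h (φ V l)) = _
        rw [rs_rs, rs_rs, hφ V hV _ i V'' _ hi]
      r_op := fun V hV l => rs_ext fun x hx => by
        obtain ⟨i, hi⟩ := hcov hV hx
        have h1 : V ⊓ U i ≤ V := inf_le_left
        have h2 : V ⊓ U i ≤ U i := inf_le_right
        refine ⟨_, h1, hi, ?_⟩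
        change rs _ h1 (r.app V (φ V l)) = _
        rw [← app_rs, hφ V hV _ i _ h1 h2, (sf i).r_op, map_sub, ← p₁Hom_rs, rs_smul, rs_smul,
          ← p₁Hom_rs, ro_ro, hf' i _ _ h2] }
  have hsop : ∀ (V : X.Opens) (hV : V ≤ W) l, s.op V hV l = φ V l := fun _ _ _ => rfl
  refine ⟨s, fun i => CommLift.ext' (hf i) fun V hV l => ?_, fun s' hs' => ?_⟩
  · have := hφ V (hV.trans (le_iSup U i)) l i V le_rfl hV
    rw [rs_self, rs_self] at this
    exact this
  · have hs'' : ∀ i, CommLift.restrict (le_iSup U i) s' = sf i := hs'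
    refine CommLift.ext' (ro_ext fun x hx => ?_) fun V hV l => hG hV ?_ (hφ V hV l)
    · obtain ⟨i, hi⟩ := hcov le_rfl hx
      have hi' : x ∈ U i := hi.2
      refine ⟨U i, le_iSup U i, hi', ?_⟩
      exact (congrArg CommLift.fn (hs'' i)).trans (hf i).symm
    · intro i V' hV' hi
      have h1 := congrArg (fun x : CommLift r (U i) => x.op V' hi (rs L hV' l)) (hs'' i)
      refine Eq.trans ?_ h1
      exact (CommLift.op_rs (W := W) s' V V' hV hV' l).symm

variable {X : Scheme.{0}} [X.Over SpecC] {L M E : X.Modules}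
  {V : Type} [AddCommGroup V] [Module ℂ V] {ι : Type} [Fintype ι] {b : Module.Basis ι ℂ V}

namespace Frame

variable (F : Frame L M b)

lemma π_sum {U : X.Opens} (x : ι → Γ(L, U)) (k : ι) :
    (F.π k).app U (∑ l, (F.τ (b l)).app U (x l)) = x k := by
  rw [map_sum, Finset.sum_eq_single k]
  · exact congr(($(F.τ_π k)).app U (x k))
  · intro l _ hl
    exact congr(($(F.τ_π_of_ne l k hl)).app U (x l))
  · simp

lemma sum_τ_app {U : X.Opens} (m : Γ(M, U)) :
    ∑ k, (F.τ (b k)).app U ((F.π k).app U m) = m := by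
  have h := congr(($(F.sum_π_τ)).app U m)
  rw [sum_app_apply] at h
  exact h

lemma τ_smul_app (c : ℂ) (v : V) {U : X.Opens} (l : Γ(L, U)) :
    (F.τ (c • v)).app U l = c • (F.τ v).app U l := by
  rw [map_smul]
  rfl

lemma τ_add_app (v w : V) {U : X.Opens} (l : Γ(L, U)) :
    (F.τ (v + w)).app U l = (F.τ v).app U l + (F.τ w).app U l := by
  rw [map_add]
  rfl

lemma τ_eq_sum (v : V) {U : X.Opens} (l : Γ(L, U)) : (F.τ v).app U l =
    ∑ k, (F.τ (b k)).app U (algebraMap ℂ Γ(X, U) (b.repr v k) • l) := by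
  have h : F.τ v = ∑ k, b.repr v k • F.τ (b k) := by
    conv_lhs => rw [← b.sum_repr v]
    simp only [map_sum, map_smul]
  rw [h, sum_app_apply]
  refine Finset.sum_congr rfl fun k _ => ?_
  rw [Scheme.Modules.Hom.app_smul]
  rfl

end Frame

variable {r : E ⟶ jets L}

/-- The lifting of a commutator determined by its value on a generator. -/
def CommLift.ofGen {U : X.Opens} {l₀ : Γ(L, U)} (hl : IsGen L l₀) (f : Γ(X, U)) (e : Γ(E, U))
    (he : r.app U e = p₁Hom L U (f • l₀) - f • p₁Hom L U l₀) : CommLift r U where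
  fn := f
  op V h := AddMonoidHom.mk' (fun l : Γ(L, V) => hl.coeff h l • rs E h e)
    (fun l l' => by rw [map_add, add_smul])
  op_smul V h a l := by
    change hl.coeff h (a • l) • rs E h e = a • hl.coeff h l • rs E h e
    rw [map_smul, smul_eq_mul, mul_smul]
  op_rs V V' h h' l := by
    change hl.coeff (h'.trans h) (rs L h' l) • rs E (h'.trans h) e =
      rs E h' (hl.coeff h l • rs E h e)
    rw [hl.coeff_rs h h', rs_smul, rs_rs]
  r_op V h l := by
    change r.app V (hl.coeff h l • rs E h e) = _
    have h1 := hl.coeff_smul_gen h l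
    set c := hl.coeff h l
    rw [← h1, Scheme.Modules.Hom.app_smul, app_rs, he, map_sub, ← p₁Hom_rs, rs_smul, rs_smul,
      ← p₁Hom_rs, smul_sub, smul_smul, smul_smul]
    -- By the Leibniz identity the commutator of `p₁` with `f` is linear, so a lift of its value at
    -- the generator determines a lift everywhere.
    have h2 := p₁Hom_leibniz c (ro h f) (rs L h l₀)
    rw [← sub_eq_zero] at h2 ⊢
    rw [← neg_eq_zero, ← h2, mul_comm (ro h f) c]
    abel

variable {j : M ⟶ E} {w : j ≫ r = 0}

/-- The liftings of the commutator with zero given by functions. -/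
def CommLift.ker (F : Frame L M b) (w : j ≫ r = 0) (W : X.Opens) :
    (ι → Γ(X, W)) →+ CommLift r W where
  toFun ρ :=
    { fn := 0
      op := fun V h => AddMonoidHom.mk'
        (fun l => j.app V (∑ k, (F.τ (b k)).app V (ro h (ρ k) • l)))
        (fun l l' => by simp only [smul_add, map_add, Finset.sum_add_distrib])
      op_smul := fun V h a l => by
        change j.app V (∑ k, (F.τ (b k)).app V (ro h (ρ k) • a • l)) = _
        refine (congrArg (j.app V) ?_).trans (j.app_smul a _)
        rw [Finset.smul_sum]
        refine Finset.sum_congr rfl fun k _ => ?_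
        rw [smul_comm, Scheme.Modules.Hom.app_smul]
      op_rs := fun V V' h h' l => by
        simp only [AddMonoidHom.mk'_apply, ← app_rs, map_sum, rs_smul, ro_ro]
      r_op := fun V h l => by
        rw [map_zero, zero_smul, zero_smul, map_zero, sub_zero]
        exact congr(($w).app V _) }
  map_zero' := CommLift.ext' rfl fun V h l => by
    change j.app V (∑ k, (F.τ (b k)).app V (ro h 0 • l)) = 0
    simp only [map_zero, zero_smul, Finset.sum_const_zero]
  map_add' ρ ρ' := CommLift.ext' (zero_add _).symm fun V h l => by
    change j.app V (∑ k, (F.τ (b k)).app V (ro h (ρ k + ρ' k) • l)) =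
      j.app V (∑ k, (F.τ (b k)).app V (ro h (ρ k) • l)) +
      j.app V (∑ k, (F.τ (b k)).app V (ro h (ρ' k) • l))
    simp only [map_add, add_smul, Finset.sum_add_distrib]

lemma CommLift.ker_op (F : Frame L M b) (w : j ≫ r = 0) {W : X.Opens} (ρ : ι → Γ(X, W))
    {V : X.Opens} (h : V ≤ W) (l : Γ(L, V)) :
    (ker F w W ρ).op V h l = j.app V (∑ k, (F.τ (b k)).app V (ro h (ρ k) • l)) := rfl

/-- When the function is zero, the operator lifts zero and takes values in `M = L ⊗ V`. Each of its
coordinates is a linear map from the line bundle `L` to itself, which is multiplication by a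
function; the function is read off on local generators and glued. -/
lemma CommLift.exists_ker_eq (F : Frame L M b) (hL : IsLineBundle L)
    (hS : (ShortComplex.mk j r w).ShortExact) {W : X.Opens} {x : CommLift r W} (hx : x.fn = 0) :
    ∃ ρ, ker F w W ρ = x := by
  have := hS.mono_f
  have hj : ∀ U, Function.Injective (j.app U) := app_injective_of_mono j
  have hm : ∀ (U : X.Opens) (h : U ≤ W) (l : Γ(L, U)), ∃ m, j.app U m = x.op U h l :=
    fun U h l => exists_app_eq_of_exact hS U (x.op U h l) (by
      change r.app U _ = 0
      rw [x.r_op, hx, map_zero, zero_smul, zero_smul, map_zero, sub_zero])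
  have key : ∀ k, ∃ ρ : Γ(X, W), ∀ (U : X.Opens) (h : U ≤ W) (l : Γ(L, U)) (m : Γ(M, U)),
      j.app U m = x.op U h l → (F.π k).app U m = ro h ρ • l := by
    intro k
    obtain ⟨ρ, hρ⟩ := exists_ro (U := W) (fun Z hZ ρ => ∀ (U : X.Opens) (h : U ≤ Z) (l : Γ(L, U))
        (m : Γ(M, U)), j.app U m = x.op U (h.trans hZ) l → (F.π k).app U m = ro h ρ • l)
      (fun Z Z' hZ h ρ hρ U hU l m hlm => by rw [ro_ro]; exact hρ U (hU.trans h) l m hlm)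
      (fun Z hZ ρ ρ' hρ hρ' => ro_ext fun y hy => by
        obtain ⟨V₀, hyV, l₀, hl₀⟩ := hL.exists_isGen y
        have h1 : Z ⊓ V₀ ≤ Z := inf_le_left
        have h2 : Z ⊓ V₀ ≤ V₀ := inf_le_right
        refine ⟨_, h1, ⟨hy, hyV⟩, (hl₀ _ h2).1 ?_⟩
        obtain ⟨m, hm⟩ := hm _ (h1.trans hZ) (rs L h2 l₀)
        exact (hρ _ h1 _ m hm).symm.trans (hρ' _ h1 _ m hm))
      (fun y hy => by
        obtain ⟨V₀, hyV, l₀, hl₀⟩ := hL.exists_isGen y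
        have h1 : W ⊓ V₀ ≤ W := inf_le_left
        have h2 : W ⊓ V₀ ≤ V₀ := inf_le_right
        obtain ⟨m₀, hm₀⟩ := hm _ h1 (rs L h2 l₀)
        refine ⟨_, h1, ⟨hy, hyV⟩, hl₀.coeff h2 ((F.π k).app _ m₀), fun U hU l m hlm => ?_⟩
        have h3 := hl₀.coeff_smul_gen (hU.trans h2) l
        set c := hl₀.coeff (hU.trans h2) l
        have h4 : m = c • rs M hU m₀ := hj U (by
          rw [hlm, Scheme.Modules.Hom.app_smul, app_rs, hm₀, ← x.op_rs, rs_rs, ← x.op_smul, h3])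
        rw [h4, Scheme.Modules.Hom.app_smul, app_rs, ← h3, smul_smul, mul_comm, ← smul_smul,
          ← rs_rs hU h2, ← rs_smul, hl₀.coeff_smul_gen])
    refine ⟨ρ, fun U h l m hlm => rs_ext fun y hy => ?_⟩
    obtain ⟨Z, hZ, hyZ, hρZ⟩ := hρ y (h hy)
    have h1 : U ⊓ Z ≤ U := inf_le_left
    have h2 : U ⊓ Z ≤ Z := inf_le_right
    refine ⟨_, h1, ⟨hy, hyZ⟩, ?_⟩
    have h3 := hρZ _ h2 (rs L h1 l) (rs M h1 m) (by rw [app_rs, hlm, ← x.op_rs])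
    rw [← app_rs, h3, rs_smul, ro_ro, ro_ro]
  choose ρ hρ using key
  refine ⟨ρ, CommLift.ext' hx.symm fun U h l => ?_⟩
  obtain ⟨m, hm⟩ := hm U h l
  rw [ker_op, ← hm]
  congr 1
  simp only [← hρ _ U h l m hm]
  exact F.sum_τ_app m

lemma CommLift.ker_injective (F : Frame L M b) (hL : IsLineBundle L)
    (hS : (ShortComplex.mk j r w).ShortExact) (W : X.Opens) :
    Function.Injective (ker F w W) := by
  have := hS.mono_f
  rw [injective_iff_map_eq_zero]
  intro ρ hρ
  funext k
  refine ro_ext fun y hy => ?_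
  obtain ⟨V₀, hyV, l₀, hl₀⟩ := hL.exists_isGen y
  have h1 : W ⊓ V₀ ≤ W := inf_le_left
  have h2 : W ⊓ V₀ ≤ V₀ := inf_le_right
  refine ⟨_, h1, ⟨hy, hyV⟩, (hl₀ _ h2).1 ?_⟩
  have h3 := congrArg (fun x : CommLift r W => x.op _ h1 (rs L h2 l₀)) hρ
  have h4 := app_injective_of_mono j _ (h3.trans (map_zero (j.app (W ⊓ V₀)).hom).symm)
  have h5 := congrArg ((F.π k).app _) h4
  refine ((F.π_sum (fun k => ro h1 (ρ k) • rs L h2 l₀) k).symm.trans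
    (h5.trans (map_zero ((F.π k).app (W ⊓ V₀)).hom))).trans ?_
  exact ((congrArg (· • rs L h2 l₀) (map_zero (ro h1))).trans (zero_smul _ _)).symm

/-- The thickening given by an extension of the sheaf of one-jets. -/
def thickening (F : Frame L M b) (hL : IsLineBundle L)
    (hS : (ShortComplex.mk j r w).ShortExact) : Thickening X ι where
  presheaf := commLiftPresheaf r
  isSheaf := commLiftPresheaf_isSheaf r
  proj :=
    { app := fun W => CommRingCat.ofHom
        { toFun := fun x : CommLift r W.unop => x.fn
          map_one' := rfl
          map_mul' := fun _ _ => rfl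
          map_zero' := rfl
          map_add' := fun _ _ => rfl }
      naturality := fun _ _ _ => rfl }
  ker W := CommLift.ker F w W
  ker_res h ρ := CommLift.ext' (map_zero _) fun V hV l => by
    refine (CommLift.restrict_op l h (CommLift.ker F w _ ρ) hV).trans ?_
    change j.app V (∑ k, (F.τ (b k)).app V (ro _ (ρ k) • l)) =
      j.app V (∑ k, (F.τ (b k)).app V (ro hV (ro h (ρ k)) • l))
    simp only [ro_ro]
  ker_injective W := CommLift.ker_injective F hL hS W
  proj_eq_zero W x := ⟨fun h => CommLift.exists_ker_eq F hL hS h, by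
    rintro ⟨ρ, rfl⟩
    rfl⟩
  mul_ker W x ρ := CommLift.ext' (mul_zero _) fun V h l => by
    change ro h (CommLift.fn (W := W) x) • (CommLift.ker F w W ρ).op V h l +
      ro h 0 • CommLift.op (W := W) x V h l =
      j.app V (∑ k, (F.τ (b k)).app V (ro h (CommLift.fn (W := W) x * ρ k) • l))
    rw [map_zero, zero_smul, add_zero, CommLift.ker_op, ← Scheme.Modules.Hom.app_smul,
      Finset.smul_sum]
    congr 1
    refine Finset.sum_congr rfl fun k _ => ?_
    simp only [map_mul, mul_smul, Scheme.Modules.Hom.app_smul]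
  exists_lift {W} f x hx := by
    obtain ⟨V₀, hxV, l₀, hl₀⟩ := hL.exists_isGen x
    have h1 : W ⊓ V₀ ≤ W := inf_le_left
    have h2 : W ⊓ V₀ ≤ V₀ := inf_le_right
    have := hS.epi_g
    -- The commutator of `p₁` with `f` at a generator lifts locally along the epimorphism `r`, and
    -- this one value defines the whole operator.
    obtain ⟨Z, hZ, hxZ, e, he⟩ := exists_app_eq_of_epi r (U := W ⊓ V₀)
      (p₁Hom L _ (ro h1 f • rs L h2 l₀) - ro h1 f • p₁Hom L _ (rs L h2 l₀)) ⟨hx, hxV⟩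
    refine ⟨Z, hZ.trans h1, hxZ, CommLift.ofGen (r := r) (hl₀.restrict (hZ.trans h2))
      (ro (hZ.trans h1) f) e ?_, rfl⟩
    rw [he, map_sub, ← p₁Hom_rs, rs_smul, rs_smul, ← p₁Hom_rs, rs_rs, ro_ro]

/-- In terms of the generators `m` and `φ(m)`, the morphism is the identity on coefficients. -/
lemma isIso_of_isGen {Y : Scheme.{0}} {M N : Y.Modules} (φ : M ⟶ N)
    (h : ∀ x : Y, ∃ U : Y.Opens, x ∈ U ∧ ∃ m : Γ(M, U), IsGen M m ∧ IsGen N (φ.app U m)) :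
    IsIso φ := by
  have : Mono φ := mono_of_app_injective φ fun U => by
    rw [injective_iff_map_eq_zero]
    intro m hm
    refine rs_ext fun x hx => ?_
    obtain ⟨U', hx', m', h1, h2⟩ := h x
    have hU : U ⊓ U' ≤ U := inf_le_left
    have hU' : U ⊓ U' ≤ U' := inf_le_right
    refine ⟨_, hU, ⟨hx, hx'⟩, ?_⟩
    obtain ⟨a, ha⟩ := (h1 _ hU').2 (rs M hU m)
    have ha' : a • rs M hU' m' = rs M hU m := ha
    have h3 : a • rs N hU' (φ.app U' m') = (0 : Γ(Y, U ⊓ U')) • rs N hU' (φ.app U' m') := by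
      rw [← app_rs, ← Scheme.Modules.Hom.app_smul, ha', app_rs, hm, zero_smul, map_zero]
    rw [← ha', (h2 _ hU').1 h3, zero_smul, map_zero]
  have : Epi φ := epi_of_exists_app_eq φ fun U n x hx => by
    obtain ⟨U', hx', m', h1, h2⟩ := h x
    have hU : U ⊓ U' ≤ U := inf_le_left
    have hU' : U ⊓ U' ≤ U' := inf_le_right
    obtain ⟨a, ha⟩ := (h2 _ hU').2 (rs N hU n)
    refine ⟨_, hU, ⟨hx, hx'⟩, a • rs M hU' m', ?_⟩
    rw [Scheme.Modules.Hom.app_smul, app_rs]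
    exact ha
  exact isIso_of_mono_of_epi φ

/-- The pull-back of a generator is a generator, so the comparison map from the pull-back of
`Q.sheaf` to `P.sheaf` carries generators to generators. -/
lemma Pair.isCart_of_isGen {P Q : Pair} (f : P ⟶ Q)
    (h : ∀ x : P.scheme, ∃ U : Q.scheme.Opens, f.base x ∈ U ∧ ∃ m : Γ(Q.sheaf, U),
      IsGen Q.sheaf m ∧ IsGen P.sheaf (U := f.base ⁻¹ᵁ U) (f.map.app U m)) : Pair.IsCart f := by
  refine isIso_of_isGen _ fun x => ?_
  obtain ⟨U, hxU, m, h1, h2⟩ := h x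
  refine ⟨f.base ⁻¹ᵁ U, hxU, _, h1.of_isCart (Q.isCart_pullHom f.base), ?_⟩
  have h3 : (Scheme.Modules.pullbackPushforwardAdjunction f.base).unit.app Q.sheaf ≫
      (Scheme.Modules.pushforward f.base).map
        (((Scheme.Modules.pullbackPushforwardAdjunction f.base).homEquiv _ _).symm f.map) =
      f.map := by
    refine ((Scheme.Modules.pullbackPushforwardAdjunction f.base).homEquiv_unit _ _ _).symm.trans ?_
    exact Equiv.apply_symm_apply _ _
  have h4 := congr(($h3).app U m)
  exact h4.symm ▸ h2

lemma existsUnique_rs {X : Scheme.{0}} (M : X.Modules) {ι : Type} (U : ι → X.Opens)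
    (sf : ∀ i, Γ(M, U i))
    (h : ∀ i j, rs M (inf_le_left : U i ⊓ U j ≤ U i) (sf i) =
      rs M (inf_le_right : U i ⊓ U j ≤ U j) (sf j)) :
    ∃! s : Γ(M, iSup U), ∀ i, rs M (le_iSup U i) s = sf i :=
  TopCat.Sheaf.existsUnique_gluing (X := X.toTopCat) ⟨M.presheaf, M.isSheaf⟩ U sf h

variable {X : Scheme.{0}} [X.Over SpecC] {L M E : X.Modules} {r : E ⟶ jets L}

/-! ### The line bundle given by an extension -/

/-- The sections of the line bundle given by an extension of the sheaf of one-jets. -/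
def jetLift (r : E ⟶ jets L) (W : X.Opens) : AddSubgroup (Γ(E, W) × Γ(L, W)) :=
  ((r.app W).hom.comp (AddMonoidHom.fst _ _)).eqLocus ((p₁Hom L W).comp (AddMonoidHom.snd _ _))

namespace jetLift

lemma r_fst {W : X.Opens} (y : jetLift r W) : r.app W y.1.1 = p₁Hom L W y.1.2 := y.2

lemma ext {W : X.Opens} {y z : jetLift r W} (h : y.1.1 = z.1.1) (h' : y.1.2 = z.1.2) : y = z :=
  Subtype.ext (Prod.ext h h')

/-- A pair `(e, l)` stands for `(d(t), t|_X)`, and the action expresses `d(a t) = a d(t) + [d,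
a](t)`. -/
instance (W : X.Opens) : SMul (CommLift r W) (jetLift r W) where
  smul x y := ⟨(x.fn • y.1.1 + x.op W le_rfl y.1.2, x.fn • y.1.2), by
    change r.app W (x.fn • y.1.1 + x.op W le_rfl y.1.2) = p₁Hom L W (x.fn • y.1.2)
    rw [map_add, Scheme.Modules.Hom.app_smul, r_fst, x.r_op, ro_self, add_sub_cancel]⟩

lemma smul_fst {W : X.Opens} (x : CommLift r W) (y : jetLift r W) :
    (x • y).1.1 = x.fn • y.1.1 + x.op W le_rfl y.1.2 := rfl

lemma smul_snd {W : X.Opens} (x : CommLift r W) (y : jetLift r W) :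
    (x • y).1.2 = x.fn • y.1.2 := rfl

lemma add_fst {W : X.Opens} (y z : jetLift r W) : (y + z).1.1 = y.1.1 + z.1.1 := rfl

lemma add_snd {W : X.Opens} (y z : jetLift r W) : (y + z).1.2 = y.1.2 + z.1.2 := rfl

instance (W : X.Opens) : Module (CommLift r W) (jetLift r W) where
  one_smul y := ext (by rw [smul_fst, CommLift.one_fn, CommLift.one_op, one_smul, add_zero])
    (by rw [smul_snd, CommLift.one_fn, one_smul])
  mul_smul x x' y := ext (by
      simp only [smul_fst, smul_snd, CommLift.mul_fn, CommLift.mul_op, x.op_smul, ro_self,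
        mul_smul, smul_add, add_assoc])
    (by simp only [smul_snd, CommLift.mul_fn, mul_smul])
  smul_zero x := ext (by
      change x.fn • (0 : Γ(E, W)) + x.op W le_rfl (0 : Γ(L, W)) = 0
      rw [smul_zero, map_zero, add_zero])
    (smul_zero (A := Γ(L, W)) x.fn)
  smul_add x y z := ext (by
      simp only [smul_fst, add_fst, add_snd, smul_add, map_add]
      abel)
    (by simp only [smul_snd, add_snd, smul_add])
  add_smul x x' y := ext (by
      simp only [smul_fst, add_fst, CommLift.add_fn, CommLift.add_op, add_smul]
      abel)
    (by simp only [smul_snd, add_snd, CommLift.add_fn, add_smul])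
  zero_smul y := ext (by
      change (0 : Γ(X, W)) • y.1.1 + 0 = 0
      rw [zero_smul, add_zero])
    (zero_smul Γ(X, W) y.1.2)

/-- Restriction to a smaller open subset. -/
def restrict {W W' : X.Opens} (h : W' ≤ W) : jetLift r W →+ jetLift r W' where
  toFun y := ⟨(rs E h y.1.1, rs L h y.1.2), by
    change r.app W' (rs E h y.1.1) = p₁Hom L W' (rs L h y.1.2)
    rw [app_rs, p₁Hom_rs, r_fst]⟩
  map_zero' := ext (map_zero (rs E h)) (map_zero (rs L h))
  map_add' _ _ := ext (map_add (rs E h) _ _) (map_add (rs L h) _ _)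

lemma restrict_smul {W W' : X.Opens} (h : W' ≤ W) (x : CommLift r W) (y : jetLift r W) :
    restrict h (x • y) = CommLift.restrict h x • restrict h y := ext (by
      change rs E h (x.fn • y.1.1 + x.op W le_rfl y.1.2) =
        ro h x.fn • rs E h y.1.1 + x.op W' _ (rs L h y.1.2)
      rw [map_add, rs_smul, ← x.op_rs])
    (rs_smul h _ _)

end jetLift

/-- The presheaf of sections of the line bundle given by an extension. -/
def jetLiftPresheaf (r : E ⟶ jets L) : X.toTopCat.Presheaf Ab.{0} where
  obj W := AddCommGrpCat.of (jetLift r W.unop)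
  map i := AddCommGrpCat.ofHom (jetLift.restrict (leOfHom i.unop))
  map_id _ := AddCommGrpCat.hom_ext (AddMonoidHom.ext fun y =>
    jetLift.ext (rs_self _ y.1.1) (rs_self _ y.1.2))
  map_comp _ _ := AddCommGrpCat.hom_ext (AddMonoidHom.ext fun y =>
    jetLift.ext (rs_rs _ _ y.1.1).symm (rs_rs _ _ y.1.2).symm)

lemma jetLiftPresheaf_isSheaf (r : E ⟶ jets L) : (jetLiftPresheaf r).IsSheaf := by
  rw [TopCat.Presheaf.isSheaf_iff_isSheafUniqueGluing]
  intro ι U sf hsf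
  change ∀ i, jetLift r (U i) at sf
  have hsf' : ∀ i j, jetLift.restrict (inf_le_left : U i ⊓ U j ≤ U i) (sf i) =
    jetLift.restrict (inf_le_right : U i ⊓ U j ≤ U j) (sf j) := hsf
  obtain ⟨e, he, he'⟩ := existsUnique_rs E U (fun i => (sf i).1.1)
    fun i j => congrArg (fun y : jetLift r (U i ⊓ U j) => y.1.1) (hsf' i j)
  obtain ⟨l, hl, hl'⟩ := existsUnique_rs L U (fun i => (sf i).1.2)
    fun i j => congrArg (fun y : jetLift r (U i ⊓ U j) => y.1.2) (hsf' i j)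
  have hel : r.app (iSup U) e = p₁Hom L (iSup U) l := rs_ext fun x hx => by
    obtain ⟨i, hi⟩ := Opens.mem_iSup.1 hx
    refine ⟨U i, le_iSup U i, hi, ?_⟩
    rw [← app_rs, ← p₁Hom_rs, he, hl, jetLift.r_fst]
  refine ⟨(⟨(e, l), hel⟩ : jetLift r (iSup U)), fun i => jetLift.ext (he i) (hl i),
    fun (s : jetLift r (iSup U)) hs => ?_⟩
  have hs' : ∀ i, jetLift.restrict (le_iSup U i) s = sf i := hs
  exact jetLift.ext (he' s.1.1 fun i => congrArg (fun y : jetLift r (U i) => y.1.1) (hs' i))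
    (hl' s.1.2 fun i => congrArg (fun y : jetLift r (U i) => y.1.2) (hs' i))

/-- A lift of the one-jet of a generator generates the module of lifts of one-jets. -/
lemma bijective_smul_jetLift {U : X.Opens} (y : jetLift r U) (hy : IsGen L y.1.2) {W : X.Opens}
    (h : W ≤ U) : Function.Bijective fun x : CommLift r W => x • jetLift.restrict h y := by
  have hl : IsGen L (jetLift.restrict h y).1.2 := hy.restrict h
  generalize jetLift.restrict h y = z at hl
  refine ⟨fun x x' hxx => ?_, fun z' => ?_⟩
  · have h2 : x.fn = x'.fn := by
      have := congrArg (fun z : jetLift r W => z.1.2) hxx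
      refine (hl W le_rfl).1 ?_
      change x.fn • rs L le_rfl z.1.2 = x'.fn • rs L le_rfl z.1.2
      rw [rs_self]
      exact this
    have h1 : x.op W le_rfl z.1.2 = x'.op W le_rfl z.1.2 := by
      have := congrArg (fun z : jetLift r W => z.1.1) hxx
      simpa only [jetLift.smul_fst, h2, add_right_inj] using this
    refine CommLift.ext' h2 fun V hV l => ?_
    rw [← hl.coeff_smul_gen hV l, x.op_smul, x'.op_smul, x.op_rs _ _ le_rfl hV, h1,
      x'.op_rs _ _ le_rfl hV]
  -- The components in `L` force the function `f`. What is left of the component in `E` prescribes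
  -- the value of the operator at the generator, which can be chosen freely among lifts of the
  -- commutator.
  · have h1 := hl.coeff_smul_gen le_rfl z'.1.2
    rw [rs_self] at h1
    set f := hl.coeff le_rfl z'.1.2
    refine ⟨CommLift.ofGen hl f (z'.1.1 - f • z.1.1) ?_, jetLift.ext ?_ h1⟩
    · rw [map_sub, Scheme.Modules.Hom.app_smul, jetLift.r_fst, jetLift.r_fst, h1]
    · change f • z.1.1 + hl.coeff le_rfl z.1.2 • rs E le_rfl (z'.1.1 - f • z.1.1) = z'.1.1
      rw [hl.coeff_eq (a := 1) le_rfl (by rw [one_smul, rs_self]), one_smul, rs_self,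
          add_sub_cancel]

variable {V : Type} [AddCommGroup V] [Module ℂ V] [Module ℂᵐᵒᵖ V] [IsCentralScalar ℂ V]
  {ι : Type} [Fintype ι] {b : Module.Basis ι ℂ V} {j : M ⟶ E} {w : j ≫ r = 0}

/-- The action of scalars on the thickening given by an extension. -/
def CommLift.scalar (F : Frame L M b) (w : j ≫ r = 0) (W : X.Opens) :
    TrivSqZeroExt ℂ V →+* CommLift r W where
  toFun a :=
    { fn := algebraMap ℂ _ a.fst
      op := fun U _ => (j.app U).hom.comp ((F.τ a.snd).app U).hom
      op_smul := fun U h f l => by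
        change j.app U ((F.τ a.snd).app U (f • l)) = f • j.app U ((F.τ a.snd).app U l)
        rw [Scheme.Modules.Hom.app_smul, Scheme.Modules.Hom.app_smul]
      op_rs := fun U U' h h' l => by
        change j.app U' ((F.τ a.snd).app U' (rs L h' l)) = rs E h' (j.app U ((F.τ a.snd).app U l))
        rw [app_rs, app_rs]
      r_op := fun U h l => by
        have h1 : ro h (algebraMap ℂ Γ(X, W) a.fst) = algebraMap ℂ Γ(X, U) a.fst :=
          map_algebraMap (homOfLE h) _
        have h2 : p₁Hom L U (algebraMap ℂ Γ(X, U) a.fst • l) =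
            algebraMap ℂ Γ(X, U) a.fst • p₁Hom L U l :=
          (isDiffOp_p₁ L U).const a.fst l
        rw [h1, h2, sub_self]
        exact congr(($w).app U _) }
  map_one' := CommLift.ext' (map_one _) fun U h l => by
    change j.app U ((F.τ 0).app U l) = 0
    rw [map_zero]
    exact map_zero (j.app U).hom
  map_zero' := CommLift.ext' (map_zero _) fun U h l => by
    change j.app U ((F.τ 0).app U l) = 0
    rw [map_zero]
    exact map_zero (j.app U).hom
  map_add' a a' := CommLift.ext' (map_add _ _ _) fun U h l => by
    change j.app U ((F.τ (a.snd + a'.snd)).app U l) =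
      j.app U ((F.τ a.snd).app U l) + j.app U ((F.τ a'.snd).app U l)
    rw [F.τ_add_app, map_add]
  map_mul' a a' := CommLift.ext' (map_mul _ _ _) fun U h l => by
    have h1 : ∀ c, ro h (algebraMap ℂ Γ(X, W) c) = algebraMap ℂ Γ(X, U) c :=
      map_algebraMap (homOfLE h)
    have h2 : (a * a').snd = a.fst • a'.snd + a'.fst • a.snd := by
      rw [TrivSqZeroExt.snd_mul, op_smul_eq_smul]
    change j.app U ((F.τ (a * a').snd).app U l) =
      ro h (algebraMap ℂ _ a.fst) • j.app U ((F.τ a'.snd).app U l) +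
      ro h (algebraMap ℂ _ a'.fst) • j.app U ((F.τ a.snd).app U l)
    rw [h2, F.τ_add_app, F.τ_smul_app, F.τ_smul_app, map_add, app_smul_complex, app_smul_complex,
      h1, h1]
    rfl

/-! ### The deformation given by an extension -/

section Realisation

variable {X : Scheme.{0}} [X.Over SpecC] {L M E : X.Modules} {r : E ⟶ jets L}
  {V : Type} [AddCommGroup V] [Module ℂ V] [Module ℂᵐᵒᵖ V] [IsCentralScalar ℂ V]
  {ι : Type} [Fintype ι] {b : Module.Basis ι ℂ V} {j : M ⟶ E} {w : j ≫ r = 0}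
  (F : Frame L M b) (hL : IsLineBundle L) (hS : (ShortComplex.mk j r w).ShortExact)

/-- The scalars of the thickening given by an extension. -/
def thickeningScalars : (thickening F hL hS).Scalars b where
  hom := CommLift.scalar F w ⊤
  pr_hom _ := rfl
  hom_inr v := CommLift.ext' (map_zero _) fun U h l => by
    change j.app U ((F.τ v).app U l) =
      j.app U (∑ k, (F.τ (b k)).app U (ro h (algebraMap ℂ Γ(X, ⊤) (b.repr v k)) • l))
    rw [F.τ_eq_sum]
    refine congrArg (j.app U) (Finset.sum_congr rfl fun k _ => ?_)
    have h1 : ro h (algebraMap ℂ Γ(X, ⊤) (b.repr v k)) = algebraMap ℂ Γ(X, U) (b.repr v k) :=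
      map_algebraMap (homOfLE h) _
    rw [h1]

lemma thickeningScalars_homOn (W : X.Opens) (a : TrivSqZeroExt ℂ V) :
    (thickeningScalars F hL hS).homOn W a = CommLift.scalar F w W a :=
  CommLift.ext' (map_algebraMap (homOfLE le_top) _) fun _ _ _ => rfl

variable (hT : ∀ x : X, ∃ W : X.Opens, IsAffineOpen W ∧ x ∈ W ∧
  Function.Surjective ((thickening F hL hS).pr W))

/-- The line bundle on the thickening given by an extension. -/
def thickeningModule : ((thickening F hL hS).scheme hT).Modules where
  val :=
    letI : ∀ U, Module (((thickening F hL hS).scheme hT).ringCatSheaf.obj.obj U)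
        ((jetLiftPresheaf r).obj U) := fun U =>
      inferInstanceAs (Module (CommLift r (show X.Opens from U.unop))
        (jetLift r (show X.Opens from U.unop)))
    PresheafOfModules.ofPresheaf (R := ((thickening F hL hS).scheme hT).ringCatSheaf.obj)
      (jetLiftPresheaf (X := X) r) (fun U U' i x y => jetLift.restrict_smul (r := r) (X := X)
        (W := (show X.Opens from U.unop)) (W' := (show X.Opens from U'.unop)) (leOfHom i.unop) x y)
  isSheaf := jetLiftPresheaf_isSheaf r

lemma isGen_thickeningModule {U : X.Opens} (y : jetLift r U) (hy : IsGen L y.1.2) :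
    IsGen (thickeningModule F hL hS hT) (U := U) y :=
  fun _ h => bijective_smul_jetLift y hy h

lemma exists_jetLift (hL : IsLineBundle L) (hS : (ShortComplex.mk j r w).ShortExact) (x : X) :
    ∃ U : X.Opens, x ∈ U ∧ ∃ y : jetLift r U, IsGen L y.1.2 := by
  obtain ⟨U, hxU, l, hl⟩ := hL.exists_isGen x
  have := hS.epi_g
  obtain ⟨U', h, hxU', e, he⟩ := exists_app_eq_of_epi r (p₁Hom L U l) hxU
  exact ⟨U', hxU', ⟨(e, rs L h l), he.trans (p₁Hom_rs h l).symm⟩, hl.restrict h⟩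

/-- The closed fibre of the deformation given by an extension. -/
def thickeningIncl : Pair.mk X L ⟶
    Pair.mk ((thickening F hL hS).scheme hT) (thickeningModule F hL hS hT) :=
  Pair.Hom.mk (P := Pair.mk X L)
    (Q := Pair.mk ((thickening F hL hS).scheme hT) (thickeningModule F hL hS hT))
    ((thickening F hL hS).incl hT)
    ⟨PresheafOfModules.homMk
      (M₁ := (thickeningModule F hL hS hT).val)
      (M₂ := ((Scheme.Modules.pushforward ((thickening F hL hS).incl hT)).obj L).val)
      { app := fun U => AddCommGrpCat.ofHom
          ((AddMonoidHom.snd _ _).comp (jetLift r U.unop).subtype)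
        naturality := fun _ _ _ => rfl }
      (fun _ _ _ => rfl)⟩

variable [FiniteDimensional ℂ V]

/-- The deformation given by an extension of the sheaf of one-jets. -/
def realisation : Deformation X L (infAlg V) where
  total := Pair.mk ((thickening F hL hS).scheme hT) (thickeningModule F hL hS hT)
  proj := (thickening F hL hS).toSpec hT (thickeningScalars F hL hS)
  flat := (thickening F hL hS).flat_toSpec hT _
  isLineBundle := isLineBundle_of_isGen fun x => by
    obtain ⟨U, hx, y, hy⟩ := exists_jetLift hL hS x
    exact ⟨U, hx, y, isGen_thickeningModule F hL hS hT y hy⟩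
  incl := thickeningIncl F hL hS hT
  isPullback := (thickening F hL hS).isPullback_incl hT _
  isCart := Pair.isCart_of_isGen _ fun x => by
    obtain ⟨U, hx, y, hy⟩ := exists_jetLift hL hS x
    exact ⟨U, hx, y, isGen_thickeningModule F hL hS hT y hy, hy⟩

lemma structHom_realisation (U : (realisation F hL hS hT).total.scheme.Opens)
    (a : TrivSqZeroExt ℂ V) : structHom (realisation F hL hS hT).proj U a =
      (show Γ((realisation F hL hS hT).total.scheme, U) from
        CommLift.scalar F w (show X.Opens from U) a) :=
  ((thickening F hL hS).structHom_toSpec hT _ U a).trans (thickeningScalars_homOn F hL hS U a)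

lemma algebraMap_realisation (U : (realisation F hL hS hT).total.scheme.Opens) (c : ℂ) :
    algebraMap ℂ Γ((realisation F hL hS hT).total.scheme, U) c =
      (show Γ((realisation F hL hS hT).total.scheme, U) from
        CommLift.scalar F w (show X.Opens from U) (TrivSqZeroExt.inl c)) :=
  (structHom_comp_specMap (realisation F hL hS hT).proj
    (CommRingCat.ofHom (algebraMap ℂ (infAlg V).carrier)) U c).trans
    (structHom_realisation F hL hS hT U (TrivSqZeroExt.inl c))

/-- The tautological differential operator on the deformation given by an extension. -/
def realisationOp : (realisation F hL hS hT).DOp E where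
  app U := (AddMonoidHom.fst _ _).comp (jetLift r (show X.Opens from U)).subtype
  app_rs _ _ := rfl
  isDiffOp U :=
    { const := fun c y => by
        let W : X.Opens := U
        let z : jetLift r W := y
        rw [algebraMap_realisation F hL hS hT U c]
        change (CommLift.scalar F w W (TrivSqZeroExt.inl c)).fn • z.1.1 +
          j.app W ((F.τ 0).app W z.1.2) =
          (CommLift.scalar F w W (TrivSqZeroExt.inl c)).fn • z.1.1
        rw [map_zero]
        exact (congrArg _ (map_zero (j.app W).hom)).trans (add_zero _)
      leibniz := fun a a' y => by
        let W : X.Opens := U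
        let z : jetLift r W := y
        let x : CommLift r W := a
        let x' : CommLift r W := a'
        change (x.fn * x'.fn) • z.1.1 + (x * x').op W le_rfl z.1.2 + (x.fn * x'.fn) • z.1.1 =
          x.fn • (x'.fn • z.1.1 + x'.op W le_rfl z.1.2) +
          x'.fn • (x.fn • z.1.1 + x.op W le_rfl z.1.2)
        rw [CommLift.mul_op, ro_self, ro_self, smul_add, smul_add, smul_smul, smul_smul,
          mul_comm x'.fn]
        abel }

/-- The extension attached to the deformation given by an extension. -/
def realisationComparison : (realisation F hL hS hT).Comparison F j r where
  d := realisationOp F hL hS hT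
  r_d U t := jetLift.r_fst (show jetLift r (show X.Opens from U) from t)
  d_vFun U v t := by
    let W : X.Opens := U
    let z : jetLift r W := t
    have h1 : (realisation F hL hS hT).vFun U v =
        (show Γ((realisation F hL hS hT).total.scheme, U) from
          CommLift.scalar F w W (TrivSqZeroExt.inr v)) :=
      structHom_realisation F hL hS hT U (TrivSqZeroExt.inr v)
    rw [h1]
    change algebraMap ℂ Γ(X, W) 0 • z.1.1 + j.app W ((F.τ v).app W z.1.2) = _
    rw [map_zero, zero_smul, zero_add]
    rfl

end Realisation

/-! ### Commutators with functions, and the morphism from the realisation -/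

namespace Deformation

variable {X : Scheme.{0}} [X.Over SpecC] {L N : X.Modules}
  {V : Type} [AddCommGroup V] [Module ℂ V] [Module ℂᵐᵒᵖ V] [IsCentralScalar ℂ V]
  [FiniteDimensional ℂ V] {D : Deformation X L (infAlg V)}

lemma ext_of_rl {A : ArtAlg} (D : Deformation X L A) {W : X.Opens} (l : Γ(L, W)) {n n' : Γ(N, W)}
    (h : ∀ (U : D.total.scheme.Opens) (hU : D.i ⁻¹ᵁ U ≤ W) (t : Γ(D.total.sheaf, U)),
      D.rl U t = rs L hU l → rs N hU n = rs N hU n') : n = n' := rs_ext fun x hx => by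
  obtain ⟨U, hU, hxU, t, ht⟩ := D.exists_rl_eq l hx
  exact ⟨_, hU, hxU, h U hU t ht⟩

lemma ext_of_io {A : ArtAlg} (D : Deformation X L A) {W : X.Opens} (f : Γ(X, W)) {n n' : Γ(N, W)}
    (h : ∀ (U : D.total.scheme.Opens) (hU : D.i ⁻¹ᵁ U ≤ W) (a : Γ(D.total.scheme, U)),
      D.io U a = ro hU f → rs N hU n = rs N hU n') : n = n' := rs_ext fun x hx => by
  obtain ⟨U, hU, hxU, t, ht⟩ := D.exists_io_eq f hx
  exact ⟨_, hU, hxU, h U hU t ht⟩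

namespace DOp

variable (Δ : D.DOp N) {U : D.total.scheme.Opens}

/-- The commutator of a differential operator with a function. -/
def comm (a : Γ(D.total.scheme, U)) {U' : D.total.scheme.Opens} (h : U' ≤ U) :
    Γ(D.total.sheaf, U') →+ Γ(N, D.i ⁻¹ᵁ U') :=
  (Δ.app U').comp (DistribSMul.toAddMonoidHom _ (ro h a)) -
    (DistribSMul.toAddMonoidHom _ (D.io U' (ro h a))).comp (Δ.app U')

lemma comm_apply (a : Γ(D.total.scheme, U)) {U' : D.total.scheme.Opens} (h : U' ≤ U)
    (t : Γ(D.total.sheaf, U')) :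
    Δ.comm a h t = Δ.app U' (ro h a • t) - D.io U' (ro h a) • Δ.app U' t := rfl

lemma comm_rs (a : Γ(D.total.scheme, U)) {U' U'' : D.total.scheme.Opens} (h : U' ≤ U)
    (h' : U'' ≤ U') (t : Γ(D.total.sheaf, U')) :
    Δ.comm a (h'.trans h) (rs _ h' t) = rs N (D.i.preimage_mono h') (Δ.comm a h t) := by
  rw [comm_apply, comm_apply, map_sub, rs_smul, ← Δ.app_rs h', ← Δ.app_rs h', rs_smul,
    ← D.io_ro h', ro_ro]

lemma comm_ro (a : Γ(D.total.scheme, U)) {U' U'' : D.total.scheme.Opens} (h : U' ≤ U)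
    (h' : U'' ≤ U') (t : Γ(D.total.sheaf, U'')) :
    Δ.comm (ro h a) h' t = Δ.comm a (h'.trans h) t := by
  rw [comm_apply, comm_apply, ro_ro]

/-- This is the Leibniz identity rearranged: for an operator of first order, the commutators with
functions are linear. -/
lemma comm_smul (a : Γ(D.total.scheme, U)) {U' : D.total.scheme.Opens} (h : U' ≤ U)
    (c : Γ(D.total.scheme, U')) (t : Γ(D.total.sheaf, U')) :
    Δ.comm a h (c • t) = D.io U' c • Δ.comm a h t := by
  rw [comm_apply, comm_apply, smul_sub, sub_eq_sub_iff_add_eq_add, smul_smul, smul_smul, ← map_mul,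
    mul_comm c, (Δ.isDiffOp U').leibniz, add_comm]

lemma comm_add (a a' : Γ(D.total.scheme, U)) {U' : D.total.scheme.Opens} (h : U' ≤ U)
    (t : Γ(D.total.sheaf, U')) : Δ.comm (a + a') h t = Δ.comm a h t + Δ.comm a' h t := by
  simp only [comm_apply, map_add, add_smul]
  abel

lemma comm_mul (a a' : Γ(D.total.scheme, U)) {U' : D.total.scheme.Opens} (h : U' ≤ U)
    (t : Γ(D.total.sheaf, U')) : Δ.comm (a * a') h t =
      D.io U' (ro h a) • Δ.comm a' h t + D.io U' (ro h a') • Δ.comm a h t := by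
  have h1 := (Δ.isDiffOp U').leibniz (ro h a) (ro h a') t
  rw [← eq_sub_iff_add_eq] at h1
  simp only [comm_apply, map_mul, smul_sub, h1, smul_smul, mul_comm (D.io U' (ro h a'))]
  abel

lemma comm_one {U' : D.total.scheme.Opens} (h : U' ≤ U) (t : Γ(D.total.sheaf, U')) :
    Δ.comm 1 h t = 0 := by
  rw [comm_apply, map_one, map_one, one_smul, one_smul, sub_self]

lemma comm_zero {U' : D.total.scheme.Opens} (h : U' ≤ U) (t : Γ(D.total.sheaf, U')) :
    Δ.comm 0 h t = 0 := by
  rw [comm_apply, map_zero, map_zero, zero_smul, zero_smul, map_zero, sub_self]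

/-- The commutator is linear with values in a module on `X`, where `V` acts by zero. So it kills `V
ℒ` and passes to `L`. -/
lemma comm_eq_of_rl_eq (a : Γ(D.total.scheme, U)) {U' : D.total.scheme.Opens} (h : U' ≤ U)
    {t t' : Γ(D.total.sheaf, U')} (ht : D.rl U' t = D.rl U' t') : Δ.comm a h t = Δ.comm a h t' := by
  rw [← sub_eq_zero, ← map_sub]
  have h0 : D.rl U' (t - t') = 0 := by rw [map_sub, ht, sub_self]
  refine rs_ext fun x hx => ?_
  obtain ⟨U'', hU, hxU, c, hc⟩ := D.exists_sum_eq_of_rl_eq_zero (Module.finBasis ℂ V) h0 hx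
  refine ⟨_, D.i.preimage_mono hU, hxU, ?_⟩
  rw [← Δ.comm_rs a h hU, hc, map_sum, map_zero]
  refine Finset.sum_eq_zero fun k _ => ?_
  rw [comm_smul, io_vFun, zero_smul]

lemma exists_comm (a : Γ(D.total.scheme, U)) {W : X.Opens} (h : W ≤ D.i ⁻¹ᵁ U) (l : Γ(L, W)) :
    ∃ n : Γ(N, W), ∀ (U' : D.total.scheme.Opens) (hU : D.i ⁻¹ᵁ U' ≤ W) (t : Γ(D.total.sheaf, U')),
      D.rl U' t = rs L hU l →
        rs N hU n = Δ.comm a (D.preimage_le_iff.1 (hU.trans h)) t := by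
  obtain ⟨n, hn⟩ := exists_rs (M := N) (U := W) (fun Z hZ n =>
      ∀ (U' : D.total.scheme.Opens) (hU : D.i ⁻¹ᵁ U' ≤ Z) (t : Γ(D.total.sheaf, U')),
        D.rl U' t = rs L (hU.trans hZ) l →
        rs N hU n = Δ.comm a (D.preimage_le_iff.1 (hU.trans (hZ.trans h))) t)
    (fun Z Z' hZ h n hn U' hU t ht => by rw [rs_rs, hn U' (hU.trans h) t ht])
    (fun Z hZ n n' hn hn' => D.ext_of_rl (rs L hZ l) fun U' hU t ht => by
      rw [rs_rs] at ht
      rw [hn U' hU t ht, hn' U' hU t ht])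
    (fun x hx => by
      obtain ⟨U₀, hU₀, hxU₀, t₀, ht₀⟩ := D.exists_rl_eq l hx
      refine ⟨_, hU₀, hxU₀, Δ.comm a (D.preimage_le_iff.1 (hU₀.trans h)) t₀, fun U' hU t ht => ?_⟩
      rw [← Δ.comm_rs _ _ (D.preimage_le_iff.1 hU)]
      refine Δ.comm_eq_of_rl_eq _ _ ?_
      rw [D.rl_rs (D.preimage_le_iff.1 hU), ht₀, rs_rs, ht])
  refine ⟨n, fun U' hU t ht => rs_ext fun x hx => ?_⟩
  obtain ⟨Z, hZ, hxZ, hn⟩ := hn x (hU hx)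
  obtain ⟨U₁, rfl⟩ := D.exists_preimage_eq Z
  have h1 : U' ⊓ U₁ ≤ U' := inf_le_left
  have h2 : U' ⊓ U₁ ≤ U₁ := inf_le_right
  refine ⟨_, D.i.preimage_mono h1, ⟨hx, hxZ⟩, ?_⟩
  have h3 := hn (U' ⊓ U₁) (D.i.preimage_mono h2) (rs _ h1 t) (by rw [D.rl_rs h1, ht, rs_rs])
  rw [rs_rs] at h3
  rw [rs_rs, h3, ← Δ.comm_rs _ _ h1]

/-- The value on `L` of the commutator of a differential operator with a function. -/
def commVal (a : Γ(D.total.scheme, U)) {W : X.Opens} (h : W ≤ D.i ⁻¹ᵁ U) (l : Γ(L, W)) : Γ(N, W) :=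
  (Δ.exists_comm a h l).choose

lemma rs_commVal (a : Γ(D.total.scheme, U)) {W : X.Opens} (h : W ≤ D.i ⁻¹ᵁ U) (l : Γ(L, W))
    {U' : D.total.scheme.Opens} (hU : D.i ⁻¹ᵁ U' ≤ W) (h' : U' ≤ U) {t : Γ(D.total.sheaf, U')}
    (ht : D.rl U' t = rs L hU l) : rs N hU (Δ.commVal a h l) = Δ.comm a h' t :=
  (Δ.exists_comm a h l).choose_spec U' hU t ht

lemma commVal_eq (a : Γ(D.total.scheme, U)) {W : X.Opens} (h : W ≤ D.i ⁻¹ᵁ U) (l : Γ(L, W))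
    {n : Γ(N, W)} (hn : ∀ (U' : D.total.scheme.Opens) (hU : D.i ⁻¹ᵁ U' ≤ W) (h' : U' ≤ U)
      (t : Γ(D.total.sheaf, U')), D.rl U' t = rs L hU l → rs N hU n = Δ.comm a h' t) :
    Δ.commVal a h l = n :=
  D.ext_of_rl l fun U' hU t ht => by
    have h' := D.preimage_le_iff.1 (hU.trans h)
    rw [Δ.rs_commVal a h l hU h' ht, hn U' hU h' t ht]

lemma commVal_add_right (a : Γ(D.total.scheme, U)) {W : X.Opens} (h : W ≤ D.i ⁻¹ᵁ U)
    (l l' : Γ(L, W)) : Δ.commVal a h (l + l') = Δ.commVal a h l + Δ.commVal a h l' := by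
  refine D.ext_of_rl l fun U' hU t ht => D.ext_of_rl (rs L hU l') fun U'' hU' t' ht' => ?_
  have h' := D.preimage_le_iff.1 (hU.trans h)
  have h'' := D.preimage_le_iff.1 hU'
  have h1 : D.rl U'' (rs _ h'' t) = rs L (hU'.trans hU) l := by rw [D.rl_rs h'', ht, rs_rs]
  rw [rs_rs] at ht'
  rw [rs_rs, rs_rs, map_add, Δ.rs_commVal a h l _ (h''.trans h') h1,
    Δ.rs_commVal a h l' _ (h''.trans h') ht', ← map_add]
  exact Δ.rs_commVal a h _ _ _ (by rw [map_add, map_add, h1, ht'])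

lemma commVal_smul (a : Γ(D.total.scheme, U)) {W : X.Opens} (h : W ≤ D.i ⁻¹ᵁ U)
    (f : Γ(X, W)) (l : Γ(L, W)) : Δ.commVal a h (f • l) = f • Δ.commVal a h l := by
  refine D.ext_of_io f fun U' hU c hc => D.ext_of_rl (rs L hU l) fun U'' hU' t ht => ?_
  have h' := D.preimage_le_iff.1 (hU.trans h)
  have h'' := D.preimage_le_iff.1 hU'
  have h1 : D.io U'' (ro h'' c) = ro (hU'.trans hU) f := by rw [D.io_ro h'', hc, ro_ro]
  rw [rs_rs] at ht
  rw [rs_rs, rs_rs, rs_smul, Δ.rs_commVal a h l _ (h''.trans h') ht, ← h1, ← comm_smul]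
  exact Δ.rs_commVal a h _ _ _ (by rw [rl_smul, rs_smul, h1, ht])

lemma commVal_rs (a : Γ(D.total.scheme, U)) {W W' : X.Opens} (h : W ≤ D.i ⁻¹ᵁ U) (h' : W' ≤ W)
    (l : Γ(L, W)) : Δ.commVal a (h'.trans h) (rs L h' l) = rs N h' (Δ.commVal a h l) :=
  Δ.commVal_eq _ _ _ fun U' hU hle t ht => by
    rw [rs_rs] at ht ⊢
    exact Δ.rs_commVal a h l _ hle ht

end DOp

variable {M E : X.Modules} {ι : Type} [Fintype ι] {b : Module.Basis ι ℂ V} {F : Frame L M b}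
  {j : M ⟶ E} {r : E ⟶ jets L} (C : D.Comparison F j r)

namespace Comparison

/-- The commutator of a comparison with a function. -/
def commFn {U : D.total.scheme.Opens} (a : Γ(D.total.scheme, U)) : CommLift r (D.i ⁻¹ᵁ U) where
  fn := D.io U a
  op W h := AddMonoidHom.mk' (C.d.commVal a h) (C.d.commVal_add_right a h)
  op_smul W h f l := C.d.commVal_smul a h f l
  op_rs W W' h h' l := C.d.commVal_rs a h h' l
  r_op W h l := D.ext_of_rl l fun U' hU t ht => by
    have h' := D.preimage_le_iff.1 (hU.trans h)
    rw [← app_rs, map_sub, ← p₁Hom_rs, rs_smul, rs_smul, ← p₁Hom_rs, ro_ro]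
    refine (congrArg (r.app _) (C.d.rs_commVal a h l hU h' ht)).trans ?_
    rw [C.d.comm_apply, map_sub, Scheme.Modules.Hom.app_smul, C.r_d, C.r_d, rl_smul, ht,
      D.io_ro h']

lemma rs_commFn_op {U : D.total.scheme.Opens} (a : Γ(D.total.scheme, U))
    {W : X.Opens} (h : W ≤ D.i ⁻¹ᵁ U) (l : Γ(L, W))
    {U' : D.total.scheme.Opens} (hU : D.i ⁻¹ᵁ U' ≤ W) (h' : U' ≤ U) {t : Γ(D.total.sheaf, U')}
    (ht : D.rl U' t = rs L hU l) :
    rs E hU ((C.commFn a).op W h l) = C.d.comm a h' t :=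
  C.d.rs_commVal a h l hU h' ht

lemma commFn_eq {U : D.total.scheme.Opens} {a : Γ(D.total.scheme, U)} {x : CommLift r (D.i ⁻¹ᵁ U)}
    (h : D.io U a = x.fn) (h' : ∀ (W : X.Opens) (hW : W ≤ D.i ⁻¹ᵁ U) (l : Γ(L, W))
      (U' : D.total.scheme.Opens) (hU : D.i ⁻¹ᵁ U' ≤ W) (hle : U' ≤ U) (t : Γ(D.total.sheaf, U')),
      D.rl U' t = rs L hU l → rs E hU (x.op W hW l) = C.d.comm a hle t) :
    C.commFn a = x :=
  CommLift.ext' h fun W hW l => C.d.commVal_eq a hW l (h' W hW l)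

/-- The functions on a deformation as liftings of commutators. -/
def commLift (U : D.total.scheme.Opens) : Γ(D.total.scheme, U) →+* CommLift r (D.i ⁻¹ᵁ U) where
  toFun a := C.commFn a
  map_one' := C.commFn_eq (map_one _) fun W h l U' hU h' t ht => by
    rw [C.d.comm_one, CommLift.one_op, map_zero]
  map_zero' := C.commFn_eq (map_zero _) fun W h l U' hU h' t ht => by
    rw [C.d.comm_zero, CommLift.zero_op, map_zero]
  map_add' a a' := C.commFn_eq (map_add _ _ _) fun W h l U' hU h' t ht => by
    rw [C.d.comm_add, CommLift.add_op, map_add, C.rs_commFn_op a h l hU h' ht,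
      C.rs_commFn_op a' h l hU h' ht]
  map_mul' a a' := C.commFn_eq (map_mul _ _ _) fun W h l U' hU h' t ht => by
    rw [C.d.comm_mul, CommLift.mul_op, map_add, rs_smul, rs_smul, C.rs_commFn_op a h l hU h' ht,
      C.rs_commFn_op a' h l hU h' ht, D.io_ro h', D.io_ro h', ro_ro, ro_ro]
    rfl

lemma commLift_ro {U U' : D.total.scheme.Opens} (h : U' ≤ U) (a : Γ(D.total.scheme, U)) :
    C.commLift U' (ro h a) = CommLift.restrict (D.i.preimage_mono h) (C.commLift U a) :=
  C.commFn_eq (D.io_ro h a) fun W hW l U'' hU h' t ht => by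
    rw [C.d.comm_ro]
    exact C.rs_commFn_op a _ l hU _ ht

/-- The sections of the line bundle of a deformation as lifts of one-jets. -/
def jetLift (U : D.total.scheme.Opens) :
    Γ(D.total.sheaf, U) →+ DefPair.jetLift r (D.i ⁻¹ᵁ U) where
  toFun t := ⟨(C.d.app U t, D.rl U t), C.r_d U t⟩
  map_zero' := jetLift.ext (map_zero (C.d.app U)) (map_zero (D.rl U))
  map_add' _ _ := jetLift.ext (map_add (C.d.app U) _ _) (map_add (D.rl U) _ _)

lemma jetLift_rs {U U' : D.total.scheme.Opens} (h : U' ≤ U) (t : Γ(D.total.sheaf, U)) :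
    C.jetLift U' (rs _ h t) = jetLift.restrict (D.i.preimage_mono h) (C.jetLift U t) :=
  jetLift.ext (C.d.app_rs h t) (D.rl_rs h t)

lemma jetLift_smul (U : D.total.scheme.Opens) (a : Γ(D.total.scheme, U))
    (t : Γ(D.total.sheaf, U)) : C.jetLift U (a • t) = C.commLift U a • C.jetLift U t :=
  jetLift.ext (by
    have h1 := C.rs_commFn_op a le_rfl (D.rl U t) le_rfl le_rfl (t := t) (rs_self _ _).symm
    rw [rs_self, C.d.comm_apply, ro_self, eq_sub_iff_add_eq'] at h1
    exact h1.symm)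
    (D.rl_smul U a t)

/-- The commutator of `d` with a constant is zero. The commutator with `v` is `t ↦ d(v t)`, since
`v` acts by zero on `E`, and the comparison prescribes this value. Hence `a ↦ (a|_X, [d, a])`
respects the structure over `ℂ[V]`. -/
lemma commLift_structHom {w : j ≫ r = 0} (U : D.total.scheme.Opens) (a : TrivSqZeroExt ℂ V) :
    C.commLift U (structHom D.proj U a) = CommLift.scalar F w (D.i ⁻¹ᵁ U) a :=
  C.commFn_eq (D.i_app_structHom U a) fun W hW l U' hU h' t ht => by
    have h1 : ro h' (structHom D.proj U a) =
        algebraMap ℂ Γ(D.total.scheme, U') a.fst + D.vFun U' a.snd := by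
      refine (ro_structHom D.proj h' a).trans ?_
      refine (congrArg (structHom D.proj U') a.inl_fst_add_inr_snd_eq.symm).trans ?_
      refine (map_add (structHom D.proj U') _ _).trans (congrArg (· + D.vFun U' a.snd) ?_)
      exact (structHom_comp_specMap D.proj
        (CommRingCat.ofHom (algebraMap ℂ (infAlg V).carrier)) U' a.fst).symm
    have h2 : rs E hU ((CommLift.scalar F w (D.i ⁻¹ᵁ U) a).op W hW l) =
        j.app _ ((F.τ a.snd).app _ (rs L hU l)) := by
      rw [app_rs, app_rs]
      rfl
    rw [h2, C.d.comm_apply, h1, add_smul, map_add, map_add, add_smul, (C.d.isDiffOp U').const,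
      C.d_vFun, io_vFun, zero_smul, add_zero, add_sub_cancel_left, ht]

end Comparison

end Deformation

namespace Deformation

variable {X : Scheme.{0}} [X.Over SpecC] {L M E : X.Modules}
  {V : Type} [AddCommGroup V] [Module ℂ V] [Module ℂᵐᵒᵖ V] [IsCentralScalar ℂ V]
  [FiniteDimensional ℂ V] {D : Deformation X L (infAlg V)}
  {ι : Type} [Fintype ι] {b : Module.Basis ι ℂ V} {F : Frame L M b}
  {j : M ⟶ E} {r : E ⟶ jets L} (C : D.Comparison F j r)
  {w : j ≫ r = 0} (hL : IsLineBundle L) (hS : (ShortComplex.mk j r w).ShortExact)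

namespace Comparison

/-- The morphism of ringed spaces from a thickening given by a comparison. -/
def ringedHom : (thickening F hL hS).toSheafedSpace.toPresheafedSpace ⟶
    D.total.scheme.toPresheafedSpace where
  base := D.i.base
  c :=
    { app := fun U => CommRingCat.ofHom (C.commLift U.unop)
      naturality := fun _ _ i => CommRingCat.hom_ext (RingHom.ext fun a =>
        C.commLift_ro (leOfHom i.unop) a) }

variable (hT : ∀ x : X, ∃ W : X.Opens, IsAffineOpen W ∧ x ∈ W ∧
  Function.Surjective ((thickening F hL hS).pr W))

/-- The morphism of schemes from a thickening given by a comparison. -/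
def schemeHom : (thickening F hL hS).scheme hT ⟶ D.total.scheme where
  toLRSHom' :=
    { toHom := C.ringedHom hL hS
      prop := fun x => ⟨fun s hs => by
        obtain ⟨U, hx, a, rfl⟩ := TopCat.Presheaf.exists_germ_eq D.total.scheme.presheaf s
        -- Locality can be checked on `X`: units of the thickening are detected there, and the
        -- composite with the projection is the local homomorphism of `D.i`.
        have h1 : (C.ringedHom hL hS).stalkMap x (D.total.scheme.presheaf.germ U (D.i x) hx a) =
            (thickening F hL hS).presheaf.germ (D.i ⁻¹ᵁ U) x hx (C.commLift U a) :=
          PresheafedSpace.stalkMap_germ_apply (C.ringedHom hL hS) U x hx a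
        have h2 := ((thickening F hL hS).isUnit_germ_iff (W := D.i ⁻¹ᵁ U) (C.commLift U a) hx).1
          (h1 ▸ hs)
        have h3 : D.i.stalkMap x (D.total.scheme.presheaf.germ U (D.i x) hx a) =
            X.presheaf.germ (D.i ⁻¹ᵁ U) x hx (D.io U a) :=
          Scheme.Hom.germ_stalkMap_apply D.i U x hx a
        have h4 : IsUnit (D.i.stalkMap x (D.total.scheme.presheaf.germ U (D.i x) hx a)) :=
          h3 ▸ h2
        exact (D.i.prop x).map_nonunit _ h4⟩ }

lemma incl_schemeHom : (thickening F hL hS).incl hT ≫ C.schemeHom hL hS hT = D.i :=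
  Scheme.Hom.ext' (LocallyRingedSpace.Hom.ext' (PresheafedSpace.ext _ _ rfl
    (NatTrans.ext (funext fun U => by
      refine CommRingCat.hom_ext (RingHom.ext fun a => ?_)
      exact ro_self (le_refl (D.i ⁻¹ᵁ U.unop)) (D.io U.unop a)))))

lemma schemeHom_proj : C.schemeHom hL hS hT ≫ D.proj = (realisation F hL hS hT).proj := by
  refine structHom_ext fun a => ?_
  refine (app_structHom (C.schemeHom hL hS hT) D.proj ⊤ a).symm.trans ?_
  refine Eq.trans ?_ (structHom_realisation F hL hS hT ⊤ a).symm
  exact C.commLift_structHom ⊤ a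

/-- The morphism from the realisation of an extension given by a comparison. -/
def realisationHom : (realisation F hL hS hT).total ⟶ D.total :=
  Pair.Hom.mk (P := (realisation F hL hS hT).total) (Q := D.total) (C.schemeHom hL hS hT)
    ⟨PresheafOfModules.homMk
      (M₁ := D.total.sheaf.val)
      (M₂ := ((Scheme.Modules.pushforward (C.schemeHom hL hS hT)).obj
        (thickeningModule F hL hS hT)).val)
      { app := fun U => AddCommGrpCat.ofHom (C.jetLift U.unop)
        naturality := fun _ _ i => AddCommGrpCat.hom_ext (AddMonoidHom.ext fun t =>
          C.jetLift_rs (leOfHom i.unop) t) }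
      (fun U a t => C.jetLift_smul U.unop a t)⟩

/-- The maps `a ↦ (a|_X, [d, a])` and `t ↦ (d(t), t|_X)` form a morphism from the realisation to `D`
over `ℂ[V]` and under `(X, L)`, and such a morphism is an isomorphism. -/
lemma isomorphic_realisation (C : D.Comparison F j r) : (realisation F hL hS hT).Isomorphic D := by
  refine isomorphic_of_hom (g := C.realisationHom hL hS hT) (C.schemeHom_proj hL hS hT) ?_
  refine Pair.Hom.ext' (C.incl_schemeHom hL hS hT) ?_
  ext U t
  exact rs_self (M := L) _ _

end Comparison

end Deformation

/-! ### The bijection between deformations and extension classes -/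

variable {X : Scheme.{0}} [X.Over SpecC] {L M : X.Modules}
  {V : Type} [AddCommGroup V] [Module ℂ V] [Module ℂᵐᵒᵖ V] [IsCentralScalar ℂ V]
  [FiniteDimensional ℂ V]
  {ι : Type} [Fintype ι] {b : Module.Basis ι ℂ V}

section Transport

variable {E E' : X.Modules} {j : M ⟶ E} {r : E ⟶ jets L} {j' : M ⟶ E'} {r' : E' ⟶ jets L}

/-- Comparisons can be transported along morphisms of extensions. -/
def Deformation.Comparison.map {F : Frame L M b} {D : Deformation X L (infAlg V)}
    (C : D.Comparison F j r) (f : E ⟶ E') (hj : j ≫ f = j') (hr : f ≫ r' = r) :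
    D.Comparison F j' r' where
  d := C.d.comp f
  r_d U t := (congr(($hr).app _ (C.d.app U t))).trans (C.r_d U t)
  d_vFun U v t := by
    rw [← hj, DOp.comp_app, C.d_vFun]
    rfl

end Transport

variable [LocallyOfFiniteType (X ↘ SpecC)]

/-- Every extension of the sheaf of one-jets comes from a deformation. -/
lemma exists_deformation_comparison (F : Frame L M b) (hL : IsLineBundle L) {E : X.Modules}
    {j : M ⟶ E} {r : E ⟶ jets L} {w : j ≫ r = 0} (hS : (ShortComplex.mk j r w).ShortExact) :
    ∃ D : Deformation X L (infAlg V), Nonempty (D.Comparison F j r) :=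
  ⟨_, ⟨realisationComparison F hL hS (thickeningScalars F hL hS).exists_surjective_pr⟩⟩

/-- Deformations with the same extension are isomorphic. -/
lemma Deformation.Comparison.isomorphic {F : Frame L M b} (hL : IsLineBundle L) {E : X.Modules}
    {j : M ⟶ E} {r : E ⟶ jets L} {w : j ≫ r = 0} (hS : (ShortComplex.mk j r w).ShortExact)
    {D D' : Deformation X L (infAlg V)} (C : D.Comparison F j r) (C' : D'.Comparison F j r) :
    D.Isomorphic D' :=
  have hT := (thickeningScalars F hL hS).exists_surjective_pr
  (isomorphic_realisation hL hS hT C).symm.trans (isomorphic_realisation hL hS hT C')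

variable [IsReduced X]

namespace Deformation

/-- The class of the extension attached to a deformation. -/
def extClass (F : Frame L M b) (D : Deformation X L (infAlg V)) : Abelian.Ext (jets L) M 1 :=
  (D.exists_comparison F).choose_spec.choose_spec.choose_spec.choose_spec.1.extClass

lemma exists_comparison_extClass (F : Frame L M b) (D : Deformation X L (infAlg V)) :
    ∃ (E : X.Modules) (j : M ⟶ E) (r : E ⟶ jets L) (w : j ≫ r = 0)
      (hS : (ShortComplex.mk j r w).ShortExact), Nonempty (D.Comparison F j r) ∧
        D.extClass F = hS.extClass :=
  ⟨_, _, _, _, (D.exists_comparison F).choose_spec.choose_spec.choose_spec.choose_spec.1,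
    (D.exists_comparison F).choose_spec.choose_spec.choose_spec.choose_spec.2, rfl⟩

/-- The class is defined through a chosen extension; by universality any other extension with a
comparison has the same class. -/
lemma Comparison.extClass_eq {F : Frame L M b} {D : Deformation X L (infAlg V)} {E : X.Modules}
    {j : M ⟶ E} {r : E ⟶ jets L} (C : D.Comparison F j r) {w : j ≫ r = 0}
    (hS : (ShortComplex.mk j r w).ShortExact) : D.extClass F = hS.extClass := by
  obtain ⟨_, _, _, _, hS', ⟨C'⟩, h⟩ := D.exists_comparison_extClass F
  rw [h]
  exact C'.extClass_eq_of_isomorphic C hS' hS (.refl D)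

lemma extClass_eq_of_isomorphic (F : Frame L M b) {D D' : Deformation X L (infAlg V)}
    (h : D.Isomorphic D') : D.extClass F = D'.extClass F := by
  obtain ⟨_, _, _, _, hS, ⟨C⟩, h1⟩ := D.exists_comparison_extClass F
  obtain ⟨_, _, _, _, hS', ⟨C'⟩, h1'⟩ := D'.exists_comparison_extClass F
  rw [h1, h1']
  exact C.extClass_eq_of_isomorphic C' hS hS' h

/-- Equal classes give a morphism of extensions, along which the first comparison is transported.
Both deformations then have a comparison with one extension and are isomorphic to its realisation.
-/
lemma isomorphic_of_extClass_eq (F : Frame L M b) (hL : IsLineBundle L)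
    {D D' : Deformation X L (infAlg V)} (h : D.extClass F = D'.extClass F) : D.Isomorphic D' := by
  obtain ⟨_, _, _, _, hS, ⟨C⟩, h1⟩ := D.exists_comparison_extClass F
  obtain ⟨_, _, _, _, hS', ⟨C'⟩, h1'⟩ := D'.exists_comparison_extClass F
  obtain ⟨f, hf, hf'⟩ := exists_hom_of_extClass_eq hS hS' (h1.symm.trans (h.trans h1'))
  exact (C.map f hf hf').isomorphic hL hS' C'

lemma exists_extClass_eq (F : Frame L M b) (hL : IsLineBundle L) (ξ : Abelian.Ext (jets L) M 1) :
    ∃ D : Deformation X L (infAlg V), D.extClass F = ξ := by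
  obtain ⟨E, j, r, w, hS, rfl⟩ := DefPair.exists_extClass_eq ξ
  obtain ⟨D, ⟨C⟩⟩ := exists_deformation_comparison F hL hS
  exact ⟨D, C.extClass_eq hS⟩

lemma extClass_of_isBaseChange {W : Type} [AddCommGroup W] [Module ℂ W] [Module ℂᵐᵒᵖ W]
    [IsCentralScalar ℂ W] [FiniteDimensional ℂ W] {ι' : Type} [Fintype ι']
    {b' : Module.Basis ι' ℂ W} {M' : X.Modules} (F : Frame L M b) (F' : Frame L M' b')
    {f : V →ₗ[ℂ] W} {D' : Deformation X L (infAlg W)} {D : Deformation X L (infAlg V)}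
    (h : IsBaseChange (infMap f) D' D) : D'.extClass F' =
      (D.extClass F).comp (Abelian.Ext.mk₀ (F.desc fun k => F'.τ (f (b k)))) (add_zero 1) := by
  obtain ⟨_, _, _, _, hS, ⟨C⟩, h1⟩ := D.exists_comparison_extClass F
  obtain ⟨_, _, _, _, hS', ⟨C'⟩, h1'⟩ := D'.exists_comparison_extClass F'
  obtain ⟨g, -, hp, hg⟩ := h
  rw [h1, h1']
  exact (C.extClass_comp C' hS hS' hp.w hg).symm

end Deformation

/-- The class of the extension attached to an isomorphism class of deformations. -/
def defClass (F : Frame L M b) (z : (defFunctor X L).obj (infAlg V)) :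
    Abelian.Ext (jets L) M 1 :=
  Quotient.lift (Deformation.extClass F)
    (fun _ _ h => Deformation.extClass_eq_of_isomorphic F h) z

lemma bijective_defClass (F : Frame L M b) (hL : IsLineBundle L) :
    Function.Bijective (defClass F) := by
  refine ⟨fun z z' h => ?_, fun ξ => ?_⟩
  · induction z using Quotient.inductionOn with | _ D =>
    induction z' using Quotient.inductionOn with | _ D' =>
    exact Quotient.sound (Deformation.isomorphic_of_extClass_eq F hL h)
  · obtain ⟨D, hD⟩ := Deformation.exists_extClass_eq F hL ξ
    exact ⟨Quotient.mk _ D, hD⟩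

/-- Naturality in `V`: base change along `f` acts on classes by push-out along `L ⊗ V → L ⊗ W`. The
compatibility with both vector space operations is a special case. -/
lemma defClass_map {W : Type} [AddCommGroup W] [Module ℂ W] [Module ℂᵐᵒᵖ W]
    [IsCentralScalar ℂ W] [FiniteDimensional ℂ W] {ι' : Type} [Fintype ι']
    {b' : Module.Basis ι' ℂ W} {M' : X.Modules} (F : Frame L M b) (F' : Frame L M' b')
    (f : V →ₗ[ℂ] W) (z : (defFunctor X L).obj (infAlg V)) :
    defClass F' ((defFunctor X L).map (infMap f) z) =
      (defClass F z).comp (Abelian.Ext.mk₀ (F.desc fun k => F'.τ (f (b k)))) (add_zero 1) := by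
  induction z using Quotient.inductionOn with | _ D =>
  exact Deformation.extClass_of_isBaseChange F F' (D.isBaseChange_baseChange _)

/-- The sequence (∗) has a comparison, so its class is the one attached to the deformation. -/
lemma defClass_eq_jetSequence (D : Deformation X L dualNumbers) :
    ∃ hS : D.jetSequence.ShortExact,
      defClass (Deformation.lineFrame L) (Quotient.mk (Deformation.setoid dualNumbers) D) =
        hS.extClass := by
  obtain ⟨w, hS⟩ := Deformation.shortExact_of_jetAt_vFun D.jetAt_vFun_eq_jetIncl
  exact ⟨hS, (Deformation.jetComparison D.jetAt_vFun_eq_jetIncl).extClass_eq hS⟩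

lemma bijective_ext_biprod {Y : Scheme.{0}} {P M N : Y.Modules} (n : ℕ) :
    Function.Bijective fun ξ : Abelian.Ext P (M ⊞ N) n =>
      (ξ.comp (Abelian.Ext.mk₀ biprod.fst) (add_zero n),
        ξ.comp (Abelian.Ext.mk₀ biprod.snd) (add_zero n)) := by
  have h : ∀ ξ : Abelian.Ext P (M ⊞ N) n,
      (ξ.comp (Abelian.Ext.mk₀ biprod.fst) (add_zero n)).comp
        (Abelian.Ext.mk₀ biprod.inl) (add_zero n) +
      (ξ.comp (Abelian.Ext.mk₀ biprod.snd) (add_zero n)).comp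
        (Abelian.Ext.mk₀ biprod.inr) (add_zero n) = ξ := fun ξ => by
    rw [Abelian.Ext.comp_assoc_of_third_deg_zero, Abelian.Ext.comp_assoc_of_third_deg_zero,
      Abelian.Ext.mk₀_comp_mk₀, Abelian.Ext.mk₀_comp_mk₀, ← Abelian.Ext.comp_add,
      ← Abelian.Ext.mk₀_add, biprod.total, Abelian.Ext.comp_mk₀_id]
  refine ⟨fun ξ ξ' hξ => ?_, fun ⟨x, y⟩ => ⟨x.comp (Abelian.Ext.mk₀ biprod.inl) (add_zero n) +
    y.comp (Abelian.Ext.mk₀ biprod.inr) (add_zero n), ?_⟩⟩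
  · obtain ⟨h1, h2⟩ := Prod.ext_iff.1 hξ
    rw [← h ξ, ← h ξ']
    exact congrArg₂ (fun x y => x.comp (Abelian.Ext.mk₀ biprod.inl) (add_zero n) +
      y.comp (Abelian.Ext.mk₀ biprod.inr) (add_zero n)) h1 h2
  · refine Prod.ext ?_ ?_ <;>
    simp [Abelian.Ext.add_comp]

/-! ### The vector space structure on the tangent space -/

variable {X : Scheme.{0}} [X.Over SpecC] {L : X.Modules}

/-- The sheaf `L ⊞ L` as a tensor product with the vector space `ℂ × ℂ`. -/
def biprodFrame (L : X.Modules) : Frame L (L ⊞ L)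
    ((Module.Basis.singleton Unit ℂ).prod (Module.Basis.singleton Unit ℂ)) where
  τ := LinearMap.coprod (LinearMap.toSpanSingleton ℂ (L ⟶ L ⊞ L) biprod.inl)
    (LinearMap.toSpanSingleton ℂ (L ⟶ L ⊞ L) biprod.inr)
  π := Sum.elim (fun _ => biprod.fst) (fun _ => biprod.snd)
  τ_π k := by cases k <;> simp
  τ_π_of_ne k l h := by
    cases k <;> cases l
    · exact (h rfl).elim
    · simp
    · simp
    · exact (h rfl).elim
  sum_π_τ := by simp [Fintype.sum_sum_type, biprod.total]

lemma lineFrame_τ (L : X.Modules) (c : ℂ) : (Deformation.lineFrame L).τ c = c • 𝟙 L := rfl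

lemma lineFrame_desc {N : X.Modules} (κ : Unit → (L ⟶ N)) :
    (Deformation.lineFrame L).desc κ = κ () := by
  simp [Frame.desc, Deformation.lineFrame]

lemma biprodFrame_desc {N : X.Modules} (κ : Unit ⊕ Unit → (L ⟶ N)) :
    (biprodFrame L).desc κ = biprod.desc (κ (.inl ())) (κ (.inr ())) := by
  apply biprod.hom_ext' <;> simp [Frame.desc, biprodFrame, Fintype.sum_sum_type]

variable [LocallyOfFiniteType (X ↘ SpecC)] [IsReduced X]

lemma defClass_map_smul (c : ℂ) (x : tangentSpace (defFunctor X L)) :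
    defClass (Deformation.lineFrame L)
        ((defFunctor X L).map (infMap (c • (LinearMap.id : ℂ →ₗ[ℂ] ℂ))) x) =
      c • defClass (Deformation.lineFrame L) x := by
  rw [defClass_map (Deformation.lineFrame L) (Deformation.lineFrame L), lineFrame_desc, lineFrame_τ,
    Abelian.Ext.smul_eq_comp_mk₀]
  congr 3
  simp

lemma defClass_map_fst (z : (defFunctor X L).obj (infAlg (ℂ × ℂ))) :
    defClass (Deformation.lineFrame L) ((defFunctor X L).map (infMap (LinearMap.fst ℂ ℂ ℂ)) z) =
      (defClass (biprodFrame L) z).comp (Abelian.Ext.mk₀ biprod.fst) (add_zero 1) := by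
  rw [defClass_map (biprodFrame L) (Deformation.lineFrame L), biprodFrame_desc]
  congr 2
  apply biprod.hom_ext' <;> simp [lineFrame_τ]

lemma defClass_map_snd (z : (defFunctor X L).obj (infAlg (ℂ × ℂ))) :
    defClass (Deformation.lineFrame L) ((defFunctor X L).map (infMap (LinearMap.snd ℂ ℂ ℂ)) z) =
      (defClass (biprodFrame L) z).comp (Abelian.Ext.mk₀ biprod.snd) (add_zero 1) := by
  rw [defClass_map (biprodFrame L) (Deformation.lineFrame L), biprodFrame_desc]
  congr 2
  apply biprod.hom_ext' <;> simp [lineFrame_τ]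

/-- The homomorphism `ε₁, ε₂ ↦ ε` induces on kernels the sum of the two projections `L ⊞ L ⟶ L`, and
composition in `Ext` is additive. -/
lemma defClass_map_add (z : (defFunctor X L).obj (infAlg (ℂ × ℂ))) :
    defClass (Deformation.lineFrame L)
      ((defFunctor X L).map (infMap (LinearMap.fst ℂ ℂ ℂ + LinearMap.snd ℂ ℂ ℂ)) z) =
      defClass (Deformation.lineFrame L) ((defFunctor X L).map (infMap (LinearMap.fst ℂ ℂ ℂ)) z) +
      defClass (Deformation.lineFrame L)
        ((defFunctor X L).map (infMap (LinearMap.snd ℂ ℂ ℂ)) z) := by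
  rw [defClass_map_fst, defClass_map_snd, defClass_map (biprodFrame L) (Deformation.lineFrame L),
    biprodFrame_desc, ← Abelian.Ext.comp_add, ← Abelian.Ext.mk₀_add]
  congr 2
  apply biprod.hom_ext' <;> simp [lineFrame_τ]

/-- Through `defClass` this becomes the decomposition of `Ext¹(𝒫¹(L), L ⊞ L)` as a product of two
copies of `Ext¹(𝒫¹(L), L)`. -/
lemma bijective_map_fst_snd (hL : IsLineBundle L) :
    Function.Bijective (fun z : (defFunctor X L).obj (infAlg (ℂ × ℂ)) =>
      ((defFunctor X L).map (infMap (LinearMap.fst ℂ ℂ ℂ)) z,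
        (defFunctor X L).map (infMap (LinearMap.snd ℂ ℂ ℂ)) z)) := by
  have h := bijective_defClass (Deformation.lineFrame L) hL
  refine ((h.prodMap h).of_comp_iff' _).1 ?_
  have h2 := (bijective_ext_biprod 1).comp (bijective_defClass (biprodFrame L) hL)
  refine (iff_of_eq (congrArg _ (funext fun z => ?_))).1 h2
  exact Prod.ext (defClass_map_fst z).symm (defClass_map_snd z).symm

/-! ### Connecting homomorphisms and the pairing -/

section Cohomology

variable {X : Scheme.{0}} {M N : X.Modules}

lemma toH0_app (f : M ⟶ N) (s : Γ(M, ⊤)) : toH0 (f.app ⊤ s) =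
    (toH0 s).comp (Abelian.Ext.mk₀ ((abSheaf X).map f)) (add_zero 0) :=
  (Sheaf.H.equiv₀_symm_naturality (Preorder.isTerminalTop X.Opens) ((abSheaf X).map f) s).symm

lemma toH0_add (s t : Γ(M, ⊤)) : toH0 (s + t) = toH0 s + toH0 t :=
  map_add (Sheaf.H.equiv₀ ((abSheaf X).obj M) (Preorder.isTerminalTop X.Opens)).symm s t

lemma toH0_injective : Function.Injective (toH0 (M := M)) :=
  (Sheaf.H.equiv₀ ((abSheaf X).obj M) (Preorder.isTerminalTop X.Opens)).symm.injective

lemma toH0_surjective : Function.Surjective (toH0 (M := M)) :=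
  (Sheaf.H.equiv₀ ((abSheaf X).obj M) (Preorder.isTerminalTop X.Opens)).symm.surjective

/-- This is exactness of the cohomology sequence at `H⁰`. It is the covariant `Ext` sequence of the
underlying abelian sheaves, with classes of degree `0` read as global sections. -/
lemma connecting_eq_zero_iff {S : ShortComplex X.Modules} (hS : S.ShortExact) (s : Γ(S.X₃, ⊤)) :
    connecting hS s = 0 ↔ ∃ e : Γ(S.X₂, ⊤), S.g.app ⊤ e = s := by
  constructor
  · intro h
    obtain ⟨x, hx⟩ := Abelian.Ext.covariant_sequence_exact₃ _ (hS.map_of_exact (abSheaf X))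
      (toH0 s) (zero_add 1) h
    obtain ⟨e, rfl⟩ := toH0_surjective x
    exact ⟨e, toH0_injective ((toH0_app S.g e).trans hx)⟩
  · rintro ⟨e, rfl⟩
    rw [connecting, toH0_app]
    refine (Abelian.Ext.comp_assoc_of_second_deg_zero (toH0 e) _ _ _).trans ?_
    have h := (hS.map_of_exact (abSheaf X)).comp_extClass
    refine (congrArg (fun y => Abelian.Ext.comp (toH0 e) y (zero_add 1)) h).trans ?_
    exact Abelian.Ext.comp_zero _ _ _ _ _

/-- The connecting homomorphism of an extension class. -/
def extConnecting (ξ : Abelian.Ext M N 1) (s : Γ(M, ⊤)) : H N 1 :=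
  (toH0 s).comp (ξ.mapExactFunctor (abSheaf X)) (zero_add 1)

lemma extConnecting_extClass {S : ShortComplex X.Modules} (hS : S.ShortExact) (s : Γ(S.X₃, ⊤)) :
    extConnecting hS.extClass s = connecting hS s := by
  rw [extConnecting, Abelian.Ext.mapExactFunctor_extClass]
  rfl

lemma extConnecting_add_left (ξ ξ' : Abelian.Ext M N 1) (s : Γ(M, ⊤)) :
    extConnecting (ξ + ξ') s = extConnecting ξ s + extConnecting ξ' s := by
  have h : (ξ + ξ').mapExactFunctor (abSheaf X) =
      ξ.mapExactFunctor (abSheaf X) + ξ'.mapExactFunctor (abSheaf X) :=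
    map_add ((abSheaf X).mapExtAddHom M N 1) ξ ξ'
  rw [extConnecting, h]
  exact Abelian.Ext.comp_add _ _ _ _

lemma extConnecting_add_right (ξ : Abelian.Ext M N 1) (s t : Γ(M, ⊤)) :
    extConnecting ξ (s + t) = extConnecting ξ s + extConnecting ξ t := by
  rw [extConnecting, toH0_add]
  exact Abelian.Ext.add_comp _ _ _ _

variable [X.Over SpecC]

lemma extConnecting_smul_left (c : ℂ) (ξ : Abelian.Ext M N 1) (s : Γ(M, ⊤)) :
    extConnecting (c • ξ) s = c • extConnecting ξ s := by
  have h : c • 𝟙 N = scalHom N c := Category.id_comp _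
  rw [Abelian.Ext.smul_eq_comp_mk₀, h, extConnecting, Abelian.Ext.mapExactFunctor_comp,
    Abelian.Ext.mapExactFunctor_mk₀, ← Abelian.Ext.comp_assoc_of_third_deg_zero]
  rfl

/-- In `Ext` the scalar `c` acts equally through the source and the target, which reduces the claim
to linearity in the class. -/
lemma extConnecting_smul_right (c : ℂ) (ξ : Abelian.Ext M N 1) (s : Γ(M, ⊤)) :
    extConnecting ξ (c • s) = c • extConnecting ξ s := by
  have h : c • 𝟙 M = scalHom M c := Category.id_comp _
  have h1 : (Abelian.Ext.mk₀ (scalHom M c)).comp ξ (zero_add 1) = c • ξ := by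
    rw [← h, Abelian.Ext.mk₀_smul, Abelian.Ext.smul_comp, Abelian.Ext.mk₀_id_comp]
  have h2 : toH0 (c • s) = (toH0 s).comp (Abelian.Ext.mk₀ ((abSheaf X).map (scalHom M c)))
      (add_zero 0) := toH0_app (scalHom M c) s
  rw [← extConnecting_smul_left, ← h1, extConnecting, extConnecting, h2,
    Abelian.Ext.mapExactFunctor_comp, Abelian.Ext.mapExactFunctor_mk₀,
    Abelian.Ext.comp_assoc_of_second_deg_zero]

/-- The pairing of extension classes with global sections. -/
def extPairing (L : X.Modules) : Abelian.Ext (jets L) L 1 ⊗[ℂ] Γ(L, ⊤) →ₗ[ℂ] H L 1 :=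
  TensorProduct.lift (LinearMap.mk₂ ℂ (fun ξ s => extConnecting ξ (p₁Hom L ⊤ s))
    (fun ξ ξ' s => extConnecting_add_left ξ ξ' _)
    (fun c ξ s => extConnecting_smul_left c ξ _)
    (fun ξ s t => by rw [map_add, extConnecting_add_right])
    (fun c ξ s => by
      have h : p₁Hom L ⊤ (c • s) = c • p₁Hom L ⊤ s := (isDiffOp_p₁ L ⊤).const c s
      rw [h, extConnecting_smul_right]))

lemma extPairing_extClass {L E : X.Modules} {j : L ⟶ E} {r : E ⟶ jets L} {w : j ≫ r = 0}
    (hS : (ShortComplex.mk j r w).ShortExact) (s : Γ(L, ⊤)) :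
    extPairing L (hS.extClass ⊗ₜ[ℂ] s) = connecting hS (p₁Hom L ⊤ s) :=
  extConnecting_extClass hS _

end Cohomology

variable {X : Scheme.{0}} [X.Over SpecC] {L : X.Modules}

/-- The obstruction to lifting a section to a deformation. -/
lemma exists_lift_iff {M E : X.Modules} {V : Type} [AddCommGroup V] [Module ℂ V]
    [Module ℂᵐᵒᵖ V] [IsCentralScalar ℂ V] [FiniteDimensional ℂ V] {ι : Type} [Fintype ι]
    {b : Module.Basis ι ℂ V} {F : Frame L M b} {D : Deformation X L (infAlg V)}
    {j : M ⟶ E} {r : E ⟶ jets L} (C : D.Comparison F j r) {w : j ≫ r = 0}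
    (hS : (ShortComplex.mk j r w).ShortExact) (s : Γ(L, ⊤)) :
    (∃ t : Γ(D.total.sheaf, ⊤), D.res.app ⊤ t = s) ↔ connecting hS (p₁Hom L ⊤ s) = 0 := by
  rw [connecting_eq_zero_iff]
  constructor
  · rintro ⟨t, rfl⟩
    exact ⟨C.d.app ⊤ t, C.r_d ⊤ t⟩
  -- A section of `ℒ` is the same as a pair `(e, s)` with `r(e) = p₁(s)`, so a global lift `e` of
  -- `p₁(s)` yields a section that restricts to `s`.
  · rintro ⟨e, he⟩
    obtain ⟨t, -, ht⟩ := C.exists_section hS (U := ⊤) e s he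
    exact ⟨t, ht⟩

end DefPair
end

open DefPair CategoryTheory AlgebraicGeometry Opposite TensorProduct

theorem theorem3p1 (X : Scheme.{0}) [X.Over SpecC] [IsReduced X]
    [LocallyOfFiniteType (X ↘ SpecC)] [QuasiCompact (X ↘ SpecC)]
    (L : X.Modules) (hL : IsLineBundle L) :
    ∃ Φ : tangentSpace (defFunctor X L) ≃ Abelian.Ext (jets L) L 1,
      -- the canonical identification
      (∀ D : Deformation X L dualNumbers,
        ∃ hS : D.jetSequence.ShortExact, Φ (Quotient.mk (Deformation.setoid dualNumbers) D) =
          hS.extClass) ∧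
      -- it respects the vector space structure of the tangent space
      (∀ (c : ℂ) (x : tangentSpace (defFunctor X L)),
        Φ ((defFunctor X L).map (infMap (c • (LinearMap.id : ℂ →ₗ[ℂ] ℂ))) x) = c • Φ x) ∧
      Function.Bijective (fun z : (defFunctor X L).obj (infAlg (ℂ × ℂ)) =>
        ((defFunctor X L).map (infMap (LinearMap.fst ℂ ℂ ℂ)) z,
          (defFunctor X L).map (infMap (LinearMap.snd ℂ ℂ ℂ)) z)) ∧
      (∀ z : (defFunctor X L).obj (infAlg (ℂ × ℂ)),
        Φ ((defFunctor X L).map (infMap (LinearMap.fst ℂ ℂ ℂ + LinearMap.snd ℂ ℂ ℂ)) z) =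
          Φ ((defFunctor X L).map (infMap (LinearMap.fst ℂ ℂ ℂ)) z) +
            Φ ((defFunctor X L).map (infMap (LinearMap.snd ℂ ℂ ℂ)) z)) ∧
      -- the pairing
      ∃ p : Abelian.Ext (jets L) L 1 ⊗[ℂ] Γ(L, ⊤) →ₗ[ℂ] H L 1,
        (∀ (E : X.Modules) (j : L ⟶ E) (r : E ⟶ jets L) (w : j ≫ r = 0)
          (hS : (CategoryTheory.ShortComplex.mk j r w).ShortExact) (s : Γ(L, ⊤)),
          p (hS.extClass ⊗ₜ[ℂ] s) = connecting hS (p₁Hom L ⊤ s)) ∧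
        (∀ (D : Deformation X L dualNumbers) (s : Γ(L, ⊤)),
          (∃ t : Γ(D.total.sheaf, ⊤), D.res.app ⊤ t = s) ↔
            p (Φ (Quotient.mk (Deformation.setoid dualNumbers) D) ⊗ₜ[ℂ] s) = 0) := by
  let Φ := Equiv.ofBijective _ (bijective_defClass (Deformation.lineFrame L) hL)
  have hΦ : ∀ D : Deformation X L dualNumbers, ∃ hS : D.jetSequence.ShortExact,
      Φ (Quotient.mk (Deformation.setoid dualNumbers) D) = hS.extClass := defClass_eq_jetSequence
  refine ⟨Φ, hΦ, defClass_map_smul, bijective_map_fst_snd hL, defClass_map_add, extPairing L,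
    fun E j r w hS s => extPairing_extClass hS s, fun D s => ?_⟩
  obtain ⟨hS, h⟩ := hΦ D
  rw [h]
  refine (exists_lift_iff (Deformation.jetComparison D.jetAt_vFun_eq_jetIncl) hS s).trans ?_
  exact iff_of_eq (congrArg (· = 0) (extPairing_extClass hS s).symm)
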